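/- Let $e_*,s_*\ge 0$ and $p=e_*+2s_*$. Use indices $1\le e\le e_*$ and $e_*<s\le e_*+s_*$, and write $e^*=e$, $s^*=s+s_*$, $(s+s_*)^*=s$. Let $0<\gamma_e<1/2$ and let $\gamma_s\in\mathbf C$ satisfy $\operatorname{Re}\gamma_s<1/2$, $\operatorname{Im}\gamma_s\ge 0$, $\gamma_s\ne 0$; put $c_e=\gamma_e$, $c_s=\gamma_s$, $c_{s+s_*}=1-\overline{\gamma_s}$. Let $Q\subset\mathbf C^{2p}$ be the product quadric (with no hyperbolic component) $z_{p+j}=(z_j+2c_j\overline{z_{j^*}})^2$, $1\le j\le p$. Let $M\subset \mathbf C^{2p}$ be a germ at $0$ of real analytic submanifold $$z_{p+j}=E_j(z',\bar z'),\quad E_j(z',\bar z')=(z_j+2c_j\overline{z_{j^*}})^2+O(|z'|^3),\quad 1\le j\le p,\quad z'=(z_1,\dots,z_p),$$ i.e. a higher order perturbation of $Q$. The complexification $\mathcal M\subset\mathbf C^{2p}\times\mathbf C^{2p}$ of $M$, given by $z''=E(z',w')$, $w''=\overline E(w',z')$, has coordinates $(z',w')$, carries the anti-holomorphic involution $\rho_0(z',w')=(\overline{w'},\overline{z'})$,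 and $\pi_1:\mathcal M\to\mathbf C^{2p}$ is the projection $(z,w)\mapsto z$. A deck transformation of $\pi_1$ is a germ of biholomorphism $F$ of $(\mathcal M,0)$ with $\pi_1\circ F=\pi_1$. Let $T_{1j}$ be the linear deck transformation of the quadric which changes only $w_j$, by $w_j'=-w_j-c_{j^*}^{-1}z_{j^*}$. The Moser–Webster involutions of $M$ are generators $\tau_{11},\dots,\tau_{1p}$ of the group of deck transformations of $\pi_1$ which are involutions, each fixing a smooth complex hypersurface, numbered so that $\tau_{1j}$ has linear part $T_{1j}$ at $0$. Put $$\sigma_j=\tau_{1j}\circ\tau_{2j},\qquad \tau_{2j}:=\rho_0\,\tau_{1j^*}\,\rho_0,\qquad 1\le j\le p.$$ Assume that $M$ has an abelian CR singularity at $0$, that is, $\pi_1$ has exactly $2^p$ deck transformations and $\sigma_1,\dots,\sigma_p$ commute pairwise. Let $\lambda_e>1$ be the root of $\gamma_e\lambda^2-\lambda+\gamma_e=0$, let $\lambda_s$ be the square root of $\mu_s=\overline{\gamma_s}^{\,-1}-1$ with $0\le\arg\lambda_s\le\pi/2$, and let $\lambda_{s+s_*}=\overline{\lambda_s}^{\,-1}$,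 $\mu_j=\lambda_j^2$. On $\mathbf C^{2p}$ with coordinates $(\xi,\eta)$ let $\rho$ be the involution $$(\xi_e,\eta_e)\mapsto(\bar\eta_e,\bar\xi_e),\quad (\xi_s,\eta_s,\xi_{s+s_*},\eta_{s+s_*})\mapsto(\bar\xi_{s+s_*},\bar\eta_{s+s_*},\bar\xi_s,\bar\eta_s).$$ **Theorem.** The Moser–Webster involutions exist, and there are linear coordinates $(\xi,\eta)$ in which $\rho_0$ becomes $\rho$ and each $T_{1j}$ becomes $\xi_j'=\lambda_j\eta_j$, $\eta_j'=\lambda_j^{-1}\xi_j$ (the other coordinates being fixed). In any such linear coordinates there is a germ of biholomorphism $\psi$ of $(\mathbf C^{2p},0)$ commuting with $\rho$, and there are germs at $0\in\mathbf C^p$ of holomorphic functions $M_i,\Lambda_{1i},\Lambda_{2i}$, with $M_i(0)=\mu_i$ and $\Lambda_{1i}(0)=\lambda_i$, such that, with $\xi\eta=(\xi_1\eta_1,\dots,\xi_p\eta_p)$, for all $1\le i\le p$ and $k=1,2$, $$\psi^{-1}\sigma_i\psi:\begin{cases}\xi_i'=M_i(\xi\eta)\xi_i\\ \eta_i'=M_i^{-1}(\xi\eta)\eta_i\\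 \xi_j'=\xi_j,\ \eta_j'=\eta_j,\ j\ne i,\end{cases}\qquad \psi^{-1}\tau_{ki}\psi:\begin{cases}\xi_i'=\Lambda_{ki}(\xi\eta)\eta_i\\ \eta_i'=\Lambda_{ki}^{-1}(\xi\eta)\xi_i\\ \xi_j'=\xi_j,\ \eta_j'=\eta_j,\ j\ne i.\end{cases}$$ Moreover $\Lambda_{2j}=\Lambda_{1j}^{-1}$ for all $j$, and $$\Lambda_{1e}=\overline{\Lambda_{1e}\circ\rho_z},\ 1\le e\le e_*;\qquad \Lambda_{1s}^{-1}=\overline{\Lambda_{1(s+s_*)}\circ\rho_z},\ e_*<s\le e_*+s_*,$$ where $\rho_z:\zeta_e\mapsto\bar\zeta_e,\ \zeta_s\mapsto\bar\zeta_{s+s_*},\ \zeta_{s+s_*}\mapsto\bar\zeta_s$. -/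

import Mathlib

open Filter Topology ComplexConjugate Asymptotics

noncomputable section

namespace AbelianCR

/-- The indices `1, …, p` with `p = e + 2 s`: first the `e` elliptic indices, then the `s` indices
`k` and the `s` indices `k + s_*` of the complex type. -/
abbrev Idx (e s : ℕ) : Type := Fin e ⊕ (Fin s ⊕ Fin s)

/-- `ℂ^p`. -/
abbrev Vec (e s : ℕ) : Type := Idx e s → ℂ

/-- `ℂ^{2p}`, whose points are written `(z', z'')`, `(z', w')` or `(ξ, η)`. -/
abbrev Dbl (e s : ℕ) : Type := Vec e s × Vec e s

variable {e s : ℕ}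

/-- The involution of the indices: elliptic indices are fixed, `k` and `k + s_*` are swapped. -/
def partner : Idx e s → Idx e s
  | .inl i => .inl i
  | .inr (.inl k) => .inr (.inr k)
  | .inr (.inr k) => .inr (.inl k)

/-- Componentwise complex conjugation. -/
def conjV (z : Vec e s) : Vec e s := fun i => conj (z i)

/-! ### The product quadric and its perturbations -/

/-- The coefficients `γ_e`, `γ_s`, `1 - conj γ_s`. -/
def coeff (γe : Fin e → ℝ) (γs : Fin s → ℂ) : Idx e s → ℂ
  | .inl i => (γe i : ℂ)
  | .inr (.inl k) => γs k
  | .inr (.inr k) => 1 - conj (γs k)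

/-- The complexified product quadric: `z_{p+i} = (z_i + 2 γ_i w_i)^2` for `i` elliptic, and
`z_{p+k} = (z_k + 2 γ_k w_{k+s_*})^2`, `z_{p+k+s_*} = (z_{k+s_*} + 2 (1 - conj γ_k) w_k)^2`
for the complex type. Here `w` stands for the conjugate of `z'`. -/
def quadric (γe : Fin e → ℝ) (γs : Fin s → ℂ) (x : Dbl e s) : Vec e s :=
  fun j => (x.1 j + 2 * coeff γe γs j * x.2 (partner j)) ^ 2

/-- Near `0` the set `M ⊆ ℂ^{2p}` is the real analytic submanifold `z'' = E(z', conj z')`, with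
`E(z', w')` a convergent power series, and it is a higher order perturbation of the product quadric
with invariants `γ`: `E` and the quadric differ by terms of order at least three. -/
structure IsPerturbation (γe : Fin e → ℝ) (γs : Fin s → ℂ) (M : Set (Dbl e s))
    (E : Dbl e s → Vec e s) : Prop where
  analytic : AnalyticAt ℂ E 0
  graph : ∀ᶠ z in 𝓝 (0 : Dbl e s), z ∈ M ↔ z.2 = E (z.1, conjV z.1)
  jet : (fun x => E x - quadric γe γs x) =O[𝓝 0] fun x => ‖x‖ ^ 3

/-! ### Deck transformations

The complexification `z'' = E(z', w')`, `w'' = conj E(w', z')` of `M` has `(z', w') ∈ ℂ^{2p}` as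
holomorphic coordinates; everything below is expressed in these coordinates. Germs at `0` are
represented by functions that are compared by `=ᶠ[𝓝 0]`. -/

/-- `F` is (a representative of) a germ of biholomorphism of `(ℂ^{2p}, 0)`. -/
structure IsBiholo (F : Dbl e s → Dbl e s) : Prop where
  analytic : AnalyticAt ℂ F 0
  map_zero : F 0 = 0
  invertible : (fderiv ℂ F 0).IsInvertible

/-- The projection `(z, w) ↦ z` restricted to the complexification. -/
def pi1 (E : Dbl e s → Vec e s) (x : Dbl e s) : Dbl e s := (x.1, E x)

/-- `F` is a germ of deck transformation of `pi1 E`. -/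
def IsDeck (E : Dbl e s → Vec e s) (F : Dbl e s → Dbl e s) : Prop :=
  IsBiholo F ∧ pi1 E ∘ F =ᶠ[𝓝 0] pi1 E

/-- The group of germs of deck transformations of `pi1 E` (as a set of germs). -/
def deckGerms (E : Dbl e s → Vec e s) : Set (Germ (𝓝 (0 : Dbl e s)) (Dbl e s)) :=
  {g | ∃ F : Dbl e s → Dbl e s, IsDeck E F ∧ g = (F : Germ (𝓝 (0 : Dbl e s)) (Dbl e s))}

/-- The anti-holomorphic involution `(z', w') ↦ (conj w', conj z')` of the complexification. -/
def rho0 (x : Dbl e s) : Dbl e s := (conjV x.2, conjV x.1)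

/-- The fixed points of `F` form a germ of smooth complex hypersurface at `0`. -/
def FixesHypersurface (F : Dbl e s → Dbl e s) : Prop :=
  ∃ h : Dbl e s → ℂ, AnalyticAt ℂ h 0 ∧ fderiv ℂ h 0 ≠ 0 ∧ ∀ᶠ x in 𝓝 0, F x = x ↔ h x = 0

/-- The deck transformation `T_{1j}` of the product quadric: it changes only the coordinate `w_j`,
by `w_j' = - w_j - c z_{j^*}` with `j^*` the partner of `j` and `c` equal to `γ_e⁻¹`,
`(1 - conj γ_s)⁻¹`, `γ_s⁻¹` in the three cases. -/
def quadricT (γe : Fin e → ℝ) (γs : Fin s → ℂ) (j : Idx e s) (x : Dbl e s) : Dbl e s :=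
  (x.1, Function.update x.2 j (-x.2 j - (coeff γe γs (partner j))⁻¹ * x.1 (partner j)))

/-- `τ` is the family `τ_{11}, …, τ_{1p}` of Moser-Webster involutions: generators of the group of
deck transformations of `pi1 E`, each of which is an involution that fixes a hypersurface,
numbered in such a way that `τ_{1j}` has linear part `T_{1j}`. -/
structure IsMoserWebster (γe : Fin e → ℝ) (γs : Fin s → ℂ) (E : Dbl e s → Vec e s)
    (τ : Idx e s → Dbl e s → Dbl e s) : Prop where
  deck : ∀ j, IsDeck E (τ j)
  involution : ∀ j, τ j ∘ τ j =ᶠ[𝓝 0] id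
  hypersurface : ∀ j, FixesHypersurface (τ j)
  generate : ∀ F, IsDeck E F →
    ∃ l : List (Idx e s), F =ᶠ[𝓝 0] (l.map τ).foldr (fun f g => f ∘ g) id
  linear_part : ∀ j, (fun x => τ j x - quadricT γe γs j x) =O[𝓝 0] fun x => ‖x‖ ^ 2

/-- `τ_{2j} = ρ_0 τ_{1j} ρ_0`. -/
def tau2 (τ : Idx e s → Dbl e s → Dbl e s) (j : Idx e s) : Dbl e s → Dbl e s :=
  rho0 ∘ τ j ∘ rho0

/-- `σ_j = τ_{1j} τ_{2j^*}`, that is `σ_e = τ_{1e} τ_{2e}`, `σ_s = τ_{1s} τ_{2(s+s_*)}` and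
`σ_{s+s_*} = τ_{1(s+s_*)} τ_{2s}`. -/
def sigma (τ : Idx e s → Dbl e s → Dbl e s) (j : Idx e s) : Dbl e s → Dbl e s :=
  τ j ∘ tau2 τ (partner j)

/-- The origin is an abelian CR singularity: there are `2^p` deck transformations, and
`σ_1, …, σ_p` commute pairwise. -/
def IsAbelianCRSingularity (γe : Fin e → ℝ) (γs : Fin s → ℂ) (E : Dbl e s → Vec e s) : Prop :=
  (deckGerms E).ncard = 2 ^ (e + 2 * s) ∧
    ∀ τ, IsMoserWebster γe γs E τ →
      ∀ i j, sigma τ i ∘ sigma τ j =ᶠ[𝓝 0] sigma τ j ∘ sigma τ i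

/-! ### Normal forms in the coordinates `(ξ, η)` -/

/-- The normal form of the anti-holomorphic involution:
`(ξ_e, η_e) ↦ (conj η_e, conj ξ_e)`, `(ξ_s, η_s) ↦ (conj ξ_{s+s_*}, conj η_{s+s_*})` and
`(ξ_{s+s_*}, η_{s+s_*}) ↦ (conj ξ_s, conj η_s)`. -/
def rho (x : Dbl e s) : Dbl e s :=
  (Sum.elim (fun i => conj (x.2 (.inl i))) (fun k => conj (x.1 (partner (.inr k)))),
   Sum.elim (fun i => conj (x.1 (.inl i))) (fun k => conj (x.2 (partner (.inr k)))))

/-- `ρ_z : ζ_e ↦ conj ζ_e`, `ζ_s ↦ conj ζ_{s+s_*}`, `ζ_{s+s_*} ↦ conj ζ_s`. -/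
def rhoz (ζ : Vec e s) : Vec e s := fun i => conj (ζ (partner i))

/-- `ξ_j' = m(ξη) ξ_j`, `η_j' = m(ξη)⁻¹ η_j`, the other coordinates being unchanged; here
`ξη = (ξ_1 η_1, …, ξ_p η_p)`. -/
def sigmaNF (m : Vec e s → ℂ) (j : Idx e s) (x : Dbl e s) : Dbl e s :=
  (Function.update x.1 j (m (x.1 * x.2) * x.1 j),
   Function.update x.2 j ((m (x.1 * x.2))⁻¹ * x.2 j))

/-- `ξ_j' = l(ξη) η_j`, `η_j' = l(ξη)⁻¹ ξ_j`, the other coordinates being unchanged. -/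
def tauNF (l : Vec e s → ℂ) (j : Idx e s) (x : Dbl e s) : Dbl e s :=
  (Function.update x.1 j (l (x.1 * x.2) * x.2 j),
   Function.update x.2 j ((l (x.1 * x.2))⁻¹ * x.1 j))

/-- `λ_e` is the root larger than `1` of `γ_e λ² - λ + γ_e = 0`, `λ_s` is the square root with
argument in `[0, π/2]` of `μ_s = (conj γ_s)⁻¹ - 1`, and `λ_{s+s_*} = (conj λ_s)⁻¹`. -/
def lam (γe : Fin e → ℝ) (γs : Fin s → ℂ) : Idx e s → ℂ
  | .inl i => (((1 + √(1 - 4 * γe i ^ 2)) / (2 * γe i) : ℝ) : ℂ)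
  | .inr (.inl k) => ((conj (γs k))⁻¹ - 1) ^ (1 / 2 : ℂ)
  | .inr (.inr k) => (conj (((conj (γs k))⁻¹ - 1) ^ (1 / 2 : ℂ)))⁻¹

/-- `(z', w') = L(ξ, η)` are linear coordinates in which `ρ_0` becomes `rho` and `T_{1j}` becomes
`ξ_j' = λ_j η_j`, `η_j' = λ_j⁻¹ ξ_j`. -/
def IsNormalizing (γe : Fin e → ℝ) (γs : Fin s → ℂ) (L : Dbl e s ≃L[ℂ] Dbl e s) : Prop :=
  (∀ x, L (rho x) = rho0 (L x)) ∧
    ∀ j x, L (tauNF (fun _ => lam γe γs j) j x) = quadricT γe γs j (L x)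

end AbelianCR

end

open Filter Topology ComplexConjugate AbelianCR

open Filter Topology ComplexConjugate Asymptotics
set_option autoImplicit false
set_option linter.unusedSectionVars false
noncomputable section
namespace AbelianCR

/-! ### The Banach algebra of absolutely convergent power series on the unit polydisc -/

section PowerSeries

open MvPowerSeries hiding coeff

/-! Deck transformations. A deck transformation preserves `E`, so its linear part preserves the
quadric, which is a vector of squares of the linear forms `ell`; hence it multiplies each form by a
sign. A germ of finite order tangent to the identity is the identity (`eq_one_of_pow_eq_one`), so
the signs determine the deck transformation. With 2^p of them every sign vector occurs, the group is
(±1)^p, the involutions exist (`exists_isMoserWebster`), and the τ_{1j} commute with one another, as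
do their conjugates under ρ_0.

One pair. In normalizing coordinates put a_i = τ_{1i}, b_i = ρ a_{i^*} ρ, s_i = a_i b_i. To first
order s_i multiplies ξ_i, η_i by λ_i^2, λ_i^{-2} and fixes everything else, and |λ_i| ≠ 1. Each pair
a_i, b_i can separately be put in a normal form whose multipliers are invariant under the rotation
(ξ_i, η_i) ↦ (tξ_i, t⁻¹η_i) (`exists_pair_normal_form`). Grade monomials by weight, the exponent of
ξ_i minus that of η_i. With μ = λ_i^2 and n near μ⁻¹, the conjugacy equation in weight k has the
divisor n^{-k} - μ or n^{-k} - 1. These stay away from zero except for k = 1, which fixes n, and k =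
0, respectively: there are no small divisors. Enough components are solved by a contraction
(`exists_fixed`); the remaining ones, including the resonant k = 0, hold automatically because s_i
is reversible (`reversible_remainder`, `remainder_eq_zero`).

The torus. By `hasWt_of_comp`, a biholomorphism intertwining two such normal forms commutes with the
rotation (`comm_rotG_of_intertwine`). So the rotation R_i seen through the normal form of s_i
commutes with everything that commutes with s_i. As the s_i commute, so do the R_i, and ρ carries
R_i to R_{i^*} or its inverse. Averaging linearizes all R_i at once, compatibly with ρ
(`exists_torus_coordinates`).

The multipliers. Now a_i and b_i exchange ξ_i and η_i up to multipliers u_i, v_i. Commutation of the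
a_i, of the b_i, and of the s_i with the torus makes u_i, v_i invariant under every rotation, so
they are functions of ξη (`multipliers_eq_comp_hm`). A scaling by the fourth root of u_i v_i yields
Λ_{1i}Λ_{2i} = 1, and conjugation by ρ gives the reality conditions (`exists_rescaling`,
`exists_normal_form`). -/

lemma summable_coeff_mul {J : Type*} [Fintype J] [DecidableEq J] {f g : MvPowerSeries J ℂ}
    (hf : Summable fun α => ‖MvPowerSeries.coeff α f‖) (hg : Summable fun α => ‖MvPowerSeries.coeff α g‖) :
    Summable fun α => ‖MvPowerSeries.coeff α (f * g)‖ := by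
  have h0 := hf.mul_norm hg
  simp only [norm_mul] at h0
  have h := summable_sum_mul_antidiagonal_of_summable_mul (f := fun α => ‖MvPowerSeries.coeff α f‖)
    (g := fun α => ‖MvPowerSeries.coeff α g‖) h0
  refine Summable.of_nonneg_of_le (fun _ => norm_nonneg _) (fun α => ?_) h
  rw [coeff_mul]
  exact (norm_sum_le _ _).trans (Finset.sum_le_sum fun x _ => norm_mul_le _ _)

lemma summable_coeff_add {J : Type*} {f g : MvPowerSeries J ℂ}
    (hf : Summable fun α => ‖MvPowerSeries.coeff α f‖) (hg : Summable fun α => ‖MvPowerSeries.coeff α g‖) :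
    Summable fun α => ‖MvPowerSeries.coeff α (f + g)‖ := by
  refine Summable.of_nonneg_of_le (fun _ => norm_nonneg _) (fun α => ?_) (hf.add hg)
  simpa using norm_add_le (MvPowerSeries.coeff α f) (MvPowerSeries.coeff α g)

/-- Power series in the variables `J` whose coefficients are absolutely summable. -/
def absSummable (J : Type*) [Fintype J] [DecidableEq J] : Subalgebra ℂ (MvPowerSeries J ℂ) where
  carrier := {f | Summable fun α => ‖MvPowerSeries.coeff α f‖}
  mul_mem' := fun hf hg => summable_coeff_mul hf hg
  add_mem' := fun hf hg => summable_coeff_add hf hg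
  algebraMap_mem' := by
    intro c
    refine summable_of_ne_finset_zero (s := {0}) fun α hα => ?_
    rw [Finset.mem_singleton] at hα
    simp [MvPowerSeries.algebraMap_apply, coeff_C, hα]

/-- The algebra of power series with absolutely summable coefficients. -/
def PS (J : Type*) [Fintype J] [DecidableEq J] : Type _ := absSummable J

variable {J : Type*} [Fintype J] [DecidableEq J]

namespace PS

instance : CommRing (PS J) := inferInstanceAs (CommRing (absSummable J))

instance : Algebra ℂ (PS J) := inferInstanceAs (Algebra ℂ (absSummable J))

lemma coe_mul (f g : PS J) : (f * g).1 = f.1 * g.1 := rfl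

lemma coe_add (f g : PS J) : (f + g).1 = f.1 + g.1 := rfl

lemma coe_neg (f : PS J) : (-f).1 = -f.1 := rfl

lemma coe_zero : (0 : PS J).1 = 0 := rfl

lemma coe_one : (1 : PS J).1 = 1 := rfl

lemma coe_smul (c : ℂ) (f : PS J) : (c • f).1 = c • f.1 := rfl

lemma ext_coeff {f g : PS J} (h : ∀ α, MvPowerSeries.coeff α f.1 = MvPowerSeries.coeff α g.1) :
    f = g := Subtype.ext (MvPowerSeries.ext h)

lemma summable_norm_coeff (f : PS J) : Summable fun α => ‖MvPowerSeries.coeff α f.1‖ := f.2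

instance : NormedAddCommGroup (PS J) := AddGroupNorm.toNormedAddCommGroup
  { toFun := fun f => ∑' α, ‖MvPowerSeries.coeff α f.1‖
    map_zero' := by simp [coe_zero]
    add_le' := fun f g => by
      rw [← f.summable_norm_coeff.tsum_add g.summable_norm_coeff]
      exact (f + g).summable_norm_coeff.tsum_le_tsum
        (fun α => by
          rw [coe_add, map_add]
          exact norm_add_le _ _)
        (f.summable_norm_coeff.add g.summable_norm_coeff)
    neg' := fun f => by simp [coe_neg]
    eq_zero_of_map_eq_zero' := fun f hf => by
      have h := (hasSum_zero_iff_of_nonneg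
        (fun α => norm_nonneg (MvPowerSeries.coeff α f.1))).1
        (hf ▸ f.summable_norm_coeff.hasSum)
      refine ext_coeff fun α => ?_
      simpa [coe_zero] using congrFun h α }

lemma norm_def (f : PS J) : ‖f‖ = ∑' α, ‖MvPowerSeries.coeff α f.1‖ := rfl

lemma norm_mul_le' (f g : PS J) : ‖f * g‖ ≤ ‖f‖ * ‖g‖ := by
  have h0 := f.summable_norm_coeff.mul_norm g.summable_norm_coeff
  simp only [norm_mul] at h0
  rw [norm_def, norm_def, norm_def,
    f.summable_norm_coeff.tsum_mul_tsum_eq_tsum_sum_antidiagonal g.summable_norm_coeff h0]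
  refine (f * g).summable_norm_coeff.tsum_le_tsum (fun α => ?_)
    (summable_sum_mul_antidiagonal_of_summable_mul (f := fun α => ‖MvPowerSeries.coeff α f.1‖)
    (g := fun α => ‖MvPowerSeries.coeff α g.1‖) h0)
  rw [coe_mul, coeff_mul]
  exact (norm_sum_le _ _).trans (Finset.sum_le_sum fun x _ => norm_mul_le _ _)

instance : NormedCommRing (PS J) :=
  { (inferInstance : CommRing (PS J)), (inferInstance : NormedAddCommGroup (PS J)) with
    norm_mul_le := norm_mul_le' }

instance : NormedAlgebra ℂ (PS J) :=
  { (inferInstance : Algebra ℂ (PS J)) with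
    norm_smul_le := fun c f => by
      rw [norm_def, norm_def, ← tsum_mul_left]
      refine le_of_eq (tsum_congr fun α => ?_)
      simp [coe_smul] }

lemma norm_coeff_le (f : PS J) (α : J →₀ ℕ) : ‖MvPowerSeries.coeff α f.1‖ ≤ ‖f‖ :=
  f.summable_norm_coeff.le_tsum α (fun _ _ => norm_nonneg _)

/-- The coefficients of a power series, as an element of `ℓ¹`. -/
def toLp : PS J ≃ₗᵢ[ℂ] lp (fun _ : J →₀ ℕ => ℂ) 1 where
  toFun f := ⟨fun α => MvPowerSeries.coeff α f.1, by
    show Memℓp _ _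
    rw [memℓp_gen_iff (by simp)]
    simp only [ENNReal.toReal_one, Real.rpow_one]
    exact f.summable_norm_coeff⟩
  invFun x := ⟨fun α => x.1 α, by
    have := (memℓp_gen_iff (by simp)).1 x.2
    simp only [ENNReal.toReal_one, Real.rpow_one] at this
    exact this⟩
  left_inv f := ext_coeff fun α => rfl
  right_inv x := by ext α; rfl
  map_add' f g := by ext α; rfl
  map_smul' c f := by ext α; rfl
  norm_map' f := by
    rw [lp.norm_eq_tsum_rpow (by simp)]
    simp only [ENNReal.toReal_one, Real.rpow_one, div_one]
    rfl

/-- Completeness of ℓ¹ is carried over; the contraction principle behind `exists_fixed` depends on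
it. -/
instance : CompleteSpace (PS J) :=
  (completeSpace_congr (e := (toLp (J := J)).toEquiv) (toLp (J := J)).isometry.isUniformEmbedding).2
    inferInstance

/-- The coefficient of the monomial `α`. -/
def cf (α : J →₀ ℕ) : PS J →L[ℂ] ℂ :=
  LinearMap.mkContinuous
    { toFun := fun f => MvPowerSeries.coeff α f.1, map_add' := fun f g => by simp [coe_add],
      map_smul' := fun c f => by simp [coe_smul] }
    1 (fun f => by simpa using norm_coeff_le f α)

lemma cf_apply (α : J →₀ ℕ) (f : PS J) : cf α f = MvPowerSeries.coeff α f.1 := rfl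

lemma ext_cf {f g : PS J} (h : ∀ α, cf α f = cf α g) : f = g := by
  exact ext_coeff h

lemma summable_cf (f : PS J) : Summable fun α => ‖cf α f‖ := f.2

lemma norm_eq_tsum (f : PS J) : ‖f‖ = ∑' α, ‖cf α f‖ := rfl

lemma cf_mul (α : J →₀ ℕ) (f g : PS J) :
    cf α (f * g) = ∑ x ∈ Finset.HasAntidiagonal.antidiagonal α, cf x.1 f * cf x.2 g := by
  simp only [cf_apply, coe_mul, coeff_mul]

/-- The monomial with exponent `α`. -/
def mon (α : J →₀ ℕ) : PS J := ⟨monomial α 1, by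
  refine summable_of_ne_finset_zero (s := {α}) fun β hβ => ?_
  rw [Finset.mem_singleton] at hβ
  simp [coeff_monomial, hβ]⟩

lemma coe_mon (α : J →₀ ℕ) : (mon α : PS J).1 = monomial α 1 := rfl

lemma cf_mon (α β : J →₀ ℕ) : cf α (mon β : PS J) = if α = β then 1 else 0 := by
  rw [cf_apply, coe_mon, coeff_monomial]

lemma mon_add (α β : J →₀ ℕ) : (mon (α + β) : PS J) = mon α * mon β :=
  Subtype.ext (by rw [coe_mul, coe_mon, coe_mon, coe_mon, monomial_mul_monomial, one_mul])

lemma mon_zero : (mon 0 : PS J) = 1 :=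
  Subtype.ext (by rw [coe_mon, coe_one, monomial_zero_one])

lemma norm_mon (α : J →₀ ℕ) : ‖(mon α : PS J)‖ = 1 := by
  rw [norm_eq_tsum, tsum_eq_single α]
  · simp [cf_mon]
  · intro β hβ; simp [cf_mon, hβ]

/-! #### Linear maps determined by the images of the monomials -/

variable {E : Type*} [NormedAddCommGroup E] [NormedSpace ℂ E] [CompleteSpace E]
  {E' : Type*} [NormedAddCommGroup E'] [NormedSpace ℂ E'] [CompleteSpace E']

/-- The linear map that sends the monomial `α` to `g α`. -/
def lift (g : (J →₀ ℕ) → E) (f : PS J) : E := ∑' α, cf α f • g α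

lemma summable_norm_lift {g : (J →₀ ℕ) → E} {C : ℝ} (hg : ∀ α, ‖g α‖ ≤ C) (f : PS J) :
    Summable fun α => ‖cf α f • g α‖ := by
  refine Summable.of_nonneg_of_le (fun _ => norm_nonneg _) (fun α => ?_) (f.summable_cf.mul_right C)
  rw [norm_smul]
  exact mul_le_mul_of_nonneg_left (hg α) (norm_nonneg _)

lemma hasSum_lift {g : (J →₀ ℕ) → E} {C : ℝ} (hg : ∀ α, ‖g α‖ ≤ C) (f : PS J) :
    HasSum (fun α => cf α f • g α) (lift g f) :=
  (summable_norm_lift hg f).of_norm.hasSum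

/-- If `f` has coefficients only where `‖g‖ ≤ C`, then `‖lift g f‖ ≤ C ‖f‖`. -/
lemma norm_lift_le' {g : (J →₀ ℕ) → E} {C : ℝ} (f : PS J)
    (hg : ∀ α, cf α f ≠ 0 → ‖g α‖ ≤ C) : ‖lift g f‖ ≤ C * ‖f‖ := by
  rw [norm_eq_tsum, ← tsum_mul_left]
  have h : ∀ α, ‖cf α f • g α‖ ≤ C * ‖cf α f‖ := fun α => by
    rcases eq_or_ne (cf α f) 0 with h | h
    · simp [h]
    · rw [norm_smul, mul_comm]
      exact mul_le_mul_of_nonneg_right (hg α h) (norm_nonneg _)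
  exact tsum_of_norm_bounded (f.summable_cf.mul_left C).hasSum h

lemma norm_lift_le {g : (J →₀ ℕ) → E} {C : ℝ} (hg : ∀ α, ‖g α‖ ≤ C) (f : PS J) :
    ‖lift g f‖ ≤ C * ‖f‖ := norm_lift_le' f fun α _ => hg α

lemma lift_add {g : (J →₀ ℕ) → E} {C : ℝ} (hg : ∀ α, ‖g α‖ ≤ C) (f f' : PS J) :
    lift g (f + f') = lift g f + lift g f' := by
  refine (((hasSum_lift hg f).add (hasSum_lift hg f')).congr_fun fun α => ?_).tsum_eq
  simp [add_smul]

lemma lift_smul {g : (J →₀ ℕ) → E} (c : ℂ) (f : PS J) : lift g (c • f) = c • lift g f := by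
  simp only [lift, map_smul, smul_assoc]
  exact tsum_const_smul'' c

lemma lift_sub {g : (J →₀ ℕ) → E} {C : ℝ} (hg : ∀ α, ‖g α‖ ≤ C) (f f' : PS J) :
    lift g (f - f') = lift g f - lift g f' := by
  rw [sub_eq_add_neg, lift_add hg, ← neg_one_smul ℂ, lift_smul, neg_one_smul, sub_eq_add_neg]

/-- `lift g` as a continuous linear map, for bounded `g`. -/
def liftL (g : (J →₀ ℕ) → E) {C : ℝ} (hg : ∀ α, ‖g α‖ ≤ C) : PS J →L[ℂ] E :=
  LinearMap.mkContinuous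
    { toFun := lift g, map_add' := lift_add hg, map_smul' := fun c f => lift_smul c f }
    C (norm_lift_le hg)

lemma lift_mon (g : (J →₀ ℕ) → E) (α : J →₀ ℕ) : lift g (mon α) = g α := by
  rw [lift, tsum_eq_single α]
  · simp [cf_mon]
  · intro β hβ; simp [cf_mon, hβ]

lemma map_lift {g : (J →₀ ℕ) → E} {C : ℝ} (hg : ∀ α, ‖g α‖ ≤ C) (φ : E →L[ℂ] E') (f : PS J) :
    φ (lift g f) = lift (fun α => φ (g α)) f := by
  rw [lift, φ.map_tsum (summable_norm_lift hg f).of_norm]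
  simp [lift]

lemma lift_congr {g g' : (J →₀ ℕ) → E} (f : PS J) (h : ∀ α, cf α f ≠ 0 → g α = g' α) :
    lift g f = lift g' f := by
  refine tsum_congr fun α => ?_
  rcases eq_or_ne (cf α f) 0 with h0 | h0
  · simp [h0]
  · rw [h α h0]

lemma lift_mul {B : Type*} [NormedCommRing B] [NormedAlgebra ℂ B] [CompleteSpace B]
    {g : (J →₀ ℕ) → B} {C : ℝ} (hg : ∀ α, ‖g α‖ ≤ C) (hadd : ∀ α β, g (α + β) = g α * g β)
    (f f' : PS J) : lift g (f * f') = lift g f * lift g f' := by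
  have h1 := (summable_norm_lift hg f)
  have h2 := (summable_norm_lift hg f')
  have h3 := summable_mul_of_summable_norm h1 h2
  rw [lift, lift, lift, h1.of_norm.tsum_mul_tsum_eq_tsum_sum_antidiagonal h2.of_norm h3]
  refine tsum_congr fun α => ?_
  rw [cf_mul, Finset.sum_smul]
  refine Finset.sum_congr rfl fun x hx => ?_
  rw [Finset.HasAntidiagonal.mem_antidiagonal] at hx
  rw [← hx, hadd, smul_mul_smul_comm]

/-- The value of the monomial `α` at a point of a commutative ring. -/
def pw {B : Type*} [CommMonoid B] (x : J → B) (α : J →₀ ℕ) : B := ∏ j, x j ^ α j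

lemma pw_add {B : Type*} [CommMonoid B] (x : J → B) (α β : J →₀ ℕ) :
    pw x (α + β) = pw x α * pw x β := by
  simp [pw, pow_add, Finset.prod_mul_distrib]

lemma pw_zero {B : Type*} [CommMonoid B] (x : J → B) : pw x 0 = 1 := by simp [pw]

lemma pw_mul {B : Type*} [CommMonoid B] (x y : J → B) (α : J →₀ ℕ) :
    pw (fun j => x j * y j) α = pw x α * pw y α := by
  simp [pw, mul_pow, Finset.prod_mul_distrib]

lemma map_pw {B B' : Type*} [CommMonoid B] [CommMonoid B'] (φ : B →* B') (x : J → B)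
    (α : J →₀ ℕ) : φ (pw x α) = pw (fun j => φ (x j)) α := by
  simp [pw]

lemma pw_smul (c : ℂ) (x : J → ℂ) (α : J →₀ ℕ) : pw (c • x) α = c ^ α.degree * pw x α := by
  simp [pw, mul_pow, Finset.prod_mul_distrib, Finset.prod_pow_eq_pow_sum, Finsupp.degree_eq_sum]

/-- The coordinate functions. -/
def X (j : J) : PS J := mon (Finsupp.single j 1)

lemma norm_X (j : J) : ‖(X j : PS J)‖ = 1 := norm_mon _

lemma pw_X (α : J →₀ ℕ) : pw (X : J → PS J) α = mon α := by
  have h : ∀ (j : J) (n : ℕ), (X j : PS J) ^ n = mon (Finsupp.single j n) := by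
    intro j n
    induction n with
    | zero => simp [mon_zero]
    | succ n ih => rw [pow_succ, ih, X, ← mon_add, ← Finsupp.single_add]
  have h2 : ∀ s : Finset J, ∏ j ∈ s, (mon (Finsupp.single j (α j)) : PS J)
      = mon (∑ j ∈ s, Finsupp.single j (α j)) := by
    intro s
    induction s using Finset.induction_on with
    | empty => simp [mon_zero]
    | insert a s ha ih => rw [Finset.prod_insert ha, Finset.sum_insert ha, ih, mon_add]
  simp only [pw, h, h2]
  rw [Finsupp.univ_sum_single]

lemma norm_pw_le {B : Type*} [NormedCommRing B] [NormOneClass B] {x : J → B} {K : ℝ}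
    (hx : ∀ j, ‖x j‖ ≤ K) (α : J →₀ ℕ) : ‖pw x α‖ ≤ K ^ α.degree := by
  refine (Finset.norm_prod_le _ _).trans ?_
  rw [Finsupp.degree_eq_sum, ← Finset.prod_pow_eq_pow_sum]
  refine Finset.prod_le_prod (fun _ _ => norm_nonneg _) fun j _ => ?_
  exact (norm_pow_le _ _).trans (pow_le_pow_left₀ (norm_nonneg _) (hx j) _)

lemma norm_pw_le_one {B : Type*} [NormedCommRing B] [NormOneClass B] {x : J → B}
    (hx : ∀ j, ‖x j‖ ≤ 1) (α : J →₀ ℕ) : ‖pw x α‖ ≤ 1 := by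
  simpa using norm_pw_le hx α

instance : NormOneClass (PS J) := ⟨by rw [← mon_zero, norm_mon]⟩

/-- Substitution of elements of a Banach algebra of norm at most one into a power series. -/
def sb {B : Type*} [NormedCommRing B] [NormedAlgebra ℂ B] (x : J → B) (f : PS J) : B :=
  ∑' α, cf α f • pw x α

section Substitution
variable {B : Type*} [NormedCommRing B] [NormOneClass B] [NormedAlgebra ℂ B] [CompleteSpace B]
  {x : J → B}

lemma sb_eq_lift (x : J → B) (f : PS J) : sb x f = lift (pw x) f := rfl

lemma sb_mul (hx : ∀ j, ‖x j‖ ≤ 1) (f f' : PS J) : sb x (f * f') = sb x f * sb x f' :=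
  lift_mul (norm_pw_le_one hx) (pw_add x) f f'

lemma sb_one : sb x (1 : PS J) = 1 := by
  rw [← mon_zero, sb_eq_lift, lift_mon, pw_zero]

lemma sb_X (j : J) : sb x (X j) = x j := by
  rw [sb_eq_lift, X, lift_mon, pw, Finset.prod_eq_single j]
  · simp
  · intro i _ hi; simp [hi.symm]
  · simp

/-- Substitution as an algebra homomorphism. -/
def subL (x : J → B) (hx : ∀ j, ‖x j‖ ≤ 1) : PS J →L[ℂ] B := liftL (pw x) (norm_pw_le_one hx)

lemma subL_apply (hx : ∀ j, ‖x j‖ ≤ 1) (f : PS J) : subL x hx f = sb x f := rfl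

lemma sb_pw (hx : ∀ j, ‖x j‖ ≤ 1) {K : Type*} [Fintype K] [DecidableEq K] (y : K → PS J)
    (α : K →₀ ℕ) : sb x (pw y α) = pw (fun j => sb x (y j)) α :=
  map_pw (B := PS J) (B' := B)
    { toFun := sb x, map_one' := sb_one, map_mul' := sb_mul hx } y α

lemma norm_sb_le (hx : ∀ j, ‖x j‖ ≤ 1) (f : PS J) : ‖sb x f‖ ≤ ‖f‖ := by
  rw [sb_eq_lift]; simpa using norm_lift_le (norm_pw_le_one hx) f

/-- Substitution is associative. -/
lemma sb_sb (hx : ∀ j, ‖x j‖ ≤ 1) {K : Type*} [Fintype K] [DecidableEq K] {y : K → PS J}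
    (hy : ∀ j, ‖y j‖ ≤ 1) (f : PS K) : sb x (sb y f) = sb (fun j => sb x (y j)) f := by
  rw [sb_eq_lift y, ← subL_apply hx, map_lift (norm_pw_le_one hy), sb_eq_lift]
  congr 1
  funext α
  rw [subL_apply, sb_pw hx]

end Substitution

end PS
end PowerSeries

namespace PS

variable {J : Type*} [Fintype J] [DecidableEq J]

/-! ### Analytic germs and their power series -/

/-- Listing the variables of a monomial with multiplicity exhibits it as the diagonal of a
multilinear map, as needed for a `FormalMultilinearSeries`. -/
lemma exists_word (n : ℕ) : ∀ α : J →₀ ℕ, α.degree = n →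
    ∃ w : Fin n → J, ∀ x : J → ℂ, ∏ i, x (w i) = pw x α := by
  induction n with
  | zero =>
    intro α hα
    rw [Finsupp.degree_eq_zero_iff] at hα
    exact ⟨Fin.elim0, fun x => by simp [hα, pw_zero]⟩
  | succ n ih =>
    intro α hα
    obtain ⟨j, hj⟩ : ∃ j, α j ≠ 0 := by
      by_contra! h
      have : α = 0 := Finsupp.ext h
      simp [this] at hα
    have hle : Finsupp.single j 1 ≤ α := by
      rw [Finsupp.single_le_iff]; omega
    obtain ⟨β, rfl⟩ := le_iff_exists_add.1 hle
    obtain ⟨w, hw⟩ := ih β (by simpa [Nat.add_comm 1] using hα)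
    refine ⟨Fin.cons j w, fun x => ?_⟩
    rw [Fin.prod_univ_succ, pw_add]
    have h1 : pw x (Finsupp.single j 1) = x j := by
      rw [pw, Finset.prod_eq_single j]
      · simp
      · intro i _ hi; simp [hi.symm]
      · simp
    simp [h1, hw]

/-- The exponents of total degree `n`. -/
def degSet (J : Type*) [Fintype J] [DecidableEq J] (n : ℕ) : Finset (J →₀ ℕ) :=
  Finset.finsuppAntidiag Finset.univ n

lemma mem_degSet {n : ℕ} {α : J →₀ ℕ} : α ∈ degSet J n ↔ α.degree = n := by
  simp [degSet, Finsupp.degree_eq_sum]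

/-- The homogeneous part of degree `d`, as a function. -/
def lead (f : PS J) (d : ℕ) (y : J → ℂ) : ℂ := ∑ α ∈ degSet J d, cf α f * pw y α

/-- A multilinear map whose restriction to the diagonal is the monomial `α`. -/
def monMultilinear (n : ℕ) (α : J →₀ ℕ) :
    ContinuousMultilinearMap ℂ (fun _ : Fin n => J → ℂ) ℂ :=
  if h : α.degree = n then
    (ContinuousMultilinearMap.mkPiAlgebraFin ℂ n ℂ).compContinuousLinearMap
      fun i => ContinuousLinearMap.proj ((exists_word n α h).choose i)
  else 0

lemma monMultilinear_apply {n : ℕ} {α : J →₀ ℕ} (h : α.degree = n) (x : J → ℂ) :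
    monMultilinear n α (fun _ => x) = pw x α := by
  rw [monMultilinear, dif_pos h, ← (exists_word n α h).choose_spec x]
  simp [List.prod_ofFn]

lemma norm_monMultilinear_le (n : ℕ) (α : J →₀ ℕ) : ‖monMultilinear n α‖ ≤ 1 := by
  rw [monMultilinear]
  split_ifs with h
  · refine (ContinuousMultilinearMap.norm_compContinuousLinearMap_le _ _).trans ?_
    rw [ContinuousMultilinearMap.norm_mkPiAlgebraFin, one_mul]
    refine Finset.prod_le_one (fun _ _ => norm_nonneg _) fun i _ => ?_
    refine ContinuousLinearMap.opNorm_le_bound _ zero_le_one fun x => ?_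
    rw [one_mul]
    exact norm_le_pi_norm x _
  · simp

/-- The formal multilinear series of a power series. -/
def toFML (f : PS J) : FormalMultilinearSeries ℂ (J → ℂ) ℂ := fun n =>
  ∑ α ∈ degSet J n, cf α f • monMultilinear n α

lemma toFML_apply (f : PS J) (n : ℕ) (x : J → ℂ) : (toFML f n fun _ => x) = lead f n x := by
  simp only [toFML, lead, sum_apply, smul_apply,
    smul_eq_mul]
  exact Finset.sum_congr rfl fun α hα => by rw [monMultilinear_apply (mem_degSet.1 hα)]

lemma norm_toFML_le (f : PS J) (n : ℕ) : ‖toFML f n‖ ≤ ‖f‖ := by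
  refine (norm_sum_le _ _).trans ?_
  refine le_trans (Finset.sum_le_sum fun α _ => ?_)
    (f.summable_cf.sum_le_tsum (degSet J n) fun _ _ => norm_nonneg _)
  rw [norm_smul]
  exact mul_le_of_le_one_right (norm_nonneg _) (norm_monMultilinear_le n α)

lemma norm_apply_le {x : J → ℂ} (hx : ‖x‖ ≤ 1) (j : J) : ‖x j‖ ≤ 1 :=
  (norm_le_pi_norm x j).trans hx

lemma hasSum_lead (f : PS J) {x : J → ℂ} (hx : ‖x‖ ≤ 1) :
    HasSum (fun n => lead f n x) (sb x f) := by
  have h := hasSum_lift (norm_pw_le_one (norm_apply_le hx)) f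
  have h2 := h.tsum_fiberwise (fun α => α.degree)
  refine h2.congr_fun fun n => ?_
  have h3 : (fun α : J →₀ ℕ => α.degree) ⁻¹' {n} = ↑(degSet J n) := by
    ext α; simp [mem_degSet]
  rw [h3, Finset.tsum_subtype' (degSet J n) (fun α => cf α f • pw x α)]
  simp [lead]

/-- The homogeneous terms are bounded by ‖f‖ uniformly in the degree, so the radius of convergence
is at least 1. -/
lemma hasFPowerSeriesOnBall_sb (f : PS J) :
    HasFPowerSeriesOnBall (fun x : J → ℂ => sb x f) (toFML f) 0 1 where
  r_le := by
    have := (toFML f).le_radius_of_bound ‖f‖ (r := 1) (fun n => by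
      simpa using norm_toFML_le f n)
    simpa using this
  r_pos := zero_lt_one
  hasSum := by
    intro y hy
    simp only [toFML_apply, zero_add]
    refine hasSum_lead f ?_
    have : ‖y‖ₑ < 1 := by simpa using hy
    rw [← ofReal_norm, ENNReal.ofReal_lt_one] at this
    exact this.le

/-- `f` is represented near `0` by the power series `F` in the variables `x / r`. -/
structure Rep (f : (J → ℂ) → ℂ) (r : ℝ) (F : PS J) : Prop where
  pos : 0 < r
  eq : ∀ x, ‖x‖ ≤ r → f x = sb ((r : ℂ)⁻¹ • x) F

lemma Rep.analyticAt {f : (J → ℂ) → ℂ} {r : ℝ} {F : PS J} (h : Rep f r F) : AnalyticAt ℂ f 0 := by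
  have h1 : AnalyticAt ℂ (fun x : J → ℂ => sb x F) 0 := (hasFPowerSeriesOnBall_sb F).analyticAt
  have h2 : AnalyticAt ℂ (fun x : J → ℂ => sb ((r : ℂ)⁻¹ • x) F) 0 := by
    have h3 : AnalyticAt ℂ (fun x : J → ℂ => (r : ℂ)⁻¹ • x) 0 :=
      ((r : ℂ)⁻¹ • ContinuousLinearMap.id ℂ (J → ℂ)).analyticAt 0
    exact AnalyticAt.comp (f := fun x : J → ℂ => (r : ℂ)⁻¹ • x) (by simpa using h1) h3
  refine h2.congr ?_
  filter_upwards [Metric.closedBall_mem_nhds (0 : J → ℂ) h.pos] with x hx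
  exact (h.eq x (by simpa using hx)).symm

lemma sb_smul_X {κ : ℂ} (hκ : ‖κ‖ ≤ 1) {x : J → ℂ} (hx : ‖x‖ ≤ 1) (F : PS J) :
    sb x (sb (fun j => κ • (X j : PS J)) F) = sb (κ • x) F := by
  rw [sb_sb (norm_apply_le hx) (fun j => by rw [norm_smul, norm_X, mul_one]; exact hκ)]
  congr 1
  funext j
  rw [sb_eq_lift, lift_smul, ← sb_eq_lift, sb_X]
  rfl

lemma cf_sb_smul_X {κ : ℂ} (hκ : ‖κ‖ ≤ 1) (F : PS J) (α : J →₀ ℕ) :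
    cf α (sb (fun j => κ • (X j : PS J)) F) = κ ^ α.degree * cf α F := by
  have hb : ∀ j : J, ‖κ • (X j : PS J)‖ ≤ 1 := fun j => by
    rw [norm_smul, norm_X, mul_one]; exact hκ
  have h : ∀ β : J →₀ ℕ, pw (fun j => κ • (X j : PS J)) β = κ ^ β.degree • mon β := by
    intro β
    simp only [Algebra.smul_def]
    rw [pw_mul, pw_X]
    congr 1
    simp [pw, Finset.prod_pow_eq_pow_sum, Finsupp.degree_eq_sum]
  rw [sb_eq_lift, map_lift (norm_pw_le_one hb), lift, tsum_eq_single α]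
  · rw [h, map_smul, cf_mon]; simp [mul_comm]
  · intro β hβ
    rw [h, map_smul, cf_mon, if_neg hβ.symm]; simp

lemma norm_smul_inv_le {r : ℝ} (hr : 0 < r) {x : J → ℂ} (hx : ‖x‖ ≤ r) :
    ‖(r : ℂ)⁻¹ • x‖ ≤ 1 := by
  rw [norm_smul, norm_inv, Complex.norm_real, Real.norm_of_nonneg hr.le, inv_mul_le_iff₀ hr]
  simpa using hx

/-- Shrinking the polydisc. -/
def shrink (κ : ℝ) (F : PS J) : PS J := sb (fun j => (κ : ℂ) • (X j : PS J)) F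

lemma Rep.shrink {f : (J → ℂ) → ℂ} {r r' : ℝ} {F : PS J} (h : Rep f r F) (h0 : 0 < r')
    (h1 : r' ≤ r) : Rep f r' (shrink (r' / r) F) := by
  refine ⟨h0, fun x hx => ?_⟩
  have hr := h.pos
  rw [h.eq x (hx.trans h1), PS.shrink, sb_smul_X _ (norm_smul_inv_le h0 hx)]
  · congr 1
    rw [smul_smul]
    congr 1
    have : (r' : ℂ) ≠ 0 := by exact_mod_cast h0.ne'
    push_cast
    field_simp
  · rw [Complex.norm_real, Real.norm_of_nonneg (by positivity)]
    exact (div_le_one hr).2 h1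

lemma cf_shrink {κ : ℝ} (h0 : 0 ≤ κ) (h1 : κ ≤ 1) (F : PS J) (α : J →₀ ℕ) :
    cf α (shrink κ F) = (κ : ℂ) ^ α.degree * cf α F :=
  cf_sb_smul_X (by rwa [Complex.norm_real, Real.norm_of_nonneg h0]) F α

/-- Each multilinear Taylor term is expanded over words in the standard basis. There are (card J)^n
words of length n, and rescaling the variables absorbs this count, leaving a geometric series of
ratio 1/2 in the Banach algebra. -/
theorem exists_rep {f : (J → ℂ) → ℂ} (hf : AnalyticAt ℂ f 0) : ∃ r F, Rep f r F := by
  obtain ⟨p, R, hp⟩ := hf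
  obtain ⟨ρ, hρ0, hρR⟩ := ENNReal.lt_iff_exists_nnreal_btwn.1 hp.r_pos
  have hρ0' : (0 : ℝ) < ρ := by exact_mod_cast hρ0
  obtain ⟨C, hC, hpC⟩ := p.norm_mul_pow_le_of_lt_radius (hρR.trans_le hp.r_le)
  -- Adding 1 gives 1 ≤ c even for empty `J`, so the new radius does not exceed ρ.
  set c : ℝ := Fintype.card J + 1 with hc
  have hc0 : 0 < c := by positivity
  set r : ℝ := ρ / (2 * c) with hr
  have hr0 : 0 < r := by positivity
  let term : ℕ → PS J := fun n => ∑ w : Fin n → J,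
    ((r : ℂ) ^ n * p n (fun i => Pi.single (w i) 1)) • ∏ i, (X (w i) : PS J)
  have hterm : ∀ n, ‖term n‖ ≤ C * (1 / 2) ^ n := by
    intro n
    have h1 : ∀ w : Fin n → J, ‖((r : ℂ) ^ n * p n (fun i => Pi.single (w i) 1)) •
        ∏ i, (X (w i) : PS J)‖ ≤ r ^ n * ‖p n‖ := by
      intro w
      rw [norm_smul, norm_mul, norm_pow, Complex.norm_real, Real.norm_of_nonneg hr0.le]
      have h2 : ‖p n (fun i => Pi.single (w i) (1 : ℂ))‖ ≤ ‖p n‖ := by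
        refine ((p n).le_opNorm _).trans ?_
        refine mul_le_of_le_one_right (norm_nonneg _)
          (Finset.prod_le_one (fun _ _ => norm_nonneg _) fun i _ => ?_)
        rw [Pi.norm_single]; simp
      have h3 : ‖∏ i, (X (w i) : PS J)‖ ≤ 1 :=
        (Finset.norm_prod_le _ _).trans (Finset.prod_le_one (fun _ _ => norm_nonneg _)
          fun i _ => (norm_X _).le)
      calc r ^ n * ‖p n (fun i => Pi.single (w i) (1 : ℂ))‖ * ‖∏ i, (X (w i) : PS J)‖
          ≤ r ^ n * ‖p n‖ * 1 := by gcongr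
        _ = _ := mul_one _
    calc ‖term n‖ ≤ ∑ w : Fin n → J, r ^ n * ‖p n‖ :=
          (norm_sum_le _ _).trans (Finset.sum_le_sum fun w _ => h1 w)
      _ = (Fintype.card J : ℝ) ^ n * (r ^ n * ‖p n‖) := by simp
      _ ≤ c ^ n * (r ^ n * ‖p n‖) := by gcongr; simp [hc]
      _ = (1 / 2) ^ n * (‖p n‖ * ρ ^ n) := by
          rw [hr, div_pow, mul_pow, one_div, inv_pow]; field_simp
      _ ≤ (1 / 2) ^ n * C := by gcongr; exact hpC n
      _ = _ := mul_comm _ _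
  have hsum : Summable term := by
    refine Summable.of_norm_bounded (g := fun n => C * (1 / 2 : ℝ) ^ n) ?_ hterm
    exact (summable_geometric_of_lt_one (by norm_num) (by norm_num)).mul_left C
  refine ⟨r, ∑' n, term n, hr0, fun x hx => ?_⟩
  have hx1 := norm_smul_inv_le hr0 hx
  rw [← subL_apply (norm_apply_le hx1), ContinuousLinearMap.map_tsum _ hsum]
  have hrr : r ≤ ρ := by
    rw [hr, div_le_iff₀ (by positivity)]
    have : (1 : ℝ) ≤ c := by simp [hc]
    nlinarith
  have hxball : x ∈ Metric.eball (0 : J → ℂ) R := by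
    have h5 : ‖x‖ₑ ≤ (ρ : ENNReal) := by
      rw [← ofReal_norm, ← ENNReal.ofReal_coe_nnreal]
      exact ENNReal.ofReal_le_ofReal (hx.trans hrr)
    simpa using h5.trans_lt hρR
  have hs := hp.hasSum hxball
  rw [zero_add] at hs
  rw [← hs.tsum_eq]
  refine tsum_congr fun n => ?_
  have hr0' : (r : ℂ) ≠ 0 := by exact_mod_cast hr0.ne'
  simp only [term]
  rw [map_sum]
  have hxs : (fun _ : Fin n => x) = fun _ : Fin n => ∑ j, x j • Pi.single j (1 : ℂ) := by
    funext i
    ext k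
    simp [Finset.sum_apply, Pi.single_apply]
  rw [hxs, ContinuousMultilinearMap.map_sum]
  refine Finset.sum_congr rfl fun w _ => ?_
  rw [ContinuousMultilinearMap.map_smul_univ, map_smul, subL_apply, smul_eq_mul, smul_eq_mul]
  have h6 : sb ((r : ℂ)⁻¹ • x) (∏ i, (X (w i) : PS J)) = ∏ i, ((r : ℂ)⁻¹ * x (w i)) := by
    let φ : PS J →* ℂ :=
      { toFun := sb ((r : ℂ)⁻¹ • x), map_one' := sb_one, map_mul' := sb_mul (norm_apply_le hx1) }
    refine (map_prod φ (fun i => (X (w i) : PS J)) Finset.univ).trans ?_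
    exact Finset.prod_congr rfl fun i _ => sb_X (w i)
  rw [h6, Finset.prod_mul_distrib]
  simp only [Finset.prod_const, Finset.card_univ, Fintype.card_fin]
  rw [inv_pow]
  field_simp

lemma exists_rep_le {f : (J → ℂ) → ℂ} (hf : AnalyticAt ℂ f 0) :
    ∃ r₀ > 0, ∀ r, 0 < r → r ≤ r₀ → ∃ F, Rep f r F := by
  obtain ⟨r, F, h⟩ := exists_rep hf
  exact ⟨r, h.pos, fun r' h0 h1 => ⟨_, h.shrink h0 h1⟩⟩

/-- Finitely many analytic germs are represented on a common polydisc. -/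
lemma exists_rep_family {K : Type*} [Finite K] {f : K → (J → ℂ) → ℂ}
    (hf : ∀ k, AnalyticAt ℂ (f k) 0) :
    ∃ r₀ > 0, ∀ r, 0 < r → r ≤ r₀ → ∃ F : K → PS J, ∀ k, Rep (f k) r (F k) := by
  cases nonempty_fintype K
  choose r₀ h0 h1 using fun k => exists_rep_le (hf k)
  by_cases hK : Nonempty K
  · refine ⟨Finset.univ.inf' Finset.univ_nonempty r₀, ?_, fun r hr hr' => ?_⟩
    · rw [gt_iff_lt, Finset.lt_inf'_iff]; exact fun k _ => h0 k
    · choose F hF using fun k => h1 k r hr (hr'.trans (Finset.inf'_le _ (Finset.mem_univ k)))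
      exact ⟨F, hF⟩
  · exact ⟨1, one_pos, fun r _ _ => ⟨fun k => (hK ⟨k⟩).elim, fun k => (hK ⟨k⟩).elim⟩⟩

/-- The leading term of a power series along a curve. -/
lemma tendsto_lead {F : PS J} {d : ℕ} (hF : ∀ α : J →₀ ℕ, α.degree < d → cf α F = 0)
    {γ : ℂ → J → ℂ} {y : J → ℂ} (hγ : Tendsto (fun t => t⁻¹ • γ t) (𝓝[≠] 0) (𝓝 y)) :
    Tendsto (fun t => (t ^ d)⁻¹ * sb (γ t) F) (𝓝[≠] 0) (𝓝 (lead F d y)) := by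
  set K : ℝ := ‖y‖ + 1 with hK
  have hK0 : 0 < K := by positivity
  have hlim : lead F d y = ∑' α : J →₀ ℕ, if α.degree = d then cf α F * pw y α else 0 := by
    rw [tsum_eq_sum (s := degSet J d)]
    · exact Finset.sum_congr rfl fun α hα => by rw [if_pos (mem_degSet.1 hα)]
    · intro α hα
      rw [mem_degSet] at hα
      rw [if_neg hα]
  have hfun : ∀ t, (t ^ d)⁻¹ * sb (γ t) F = ∑' α : J →₀ ℕ, (t ^ d)⁻¹ * (cf α F * pw (γ t) α) := by
    intro t
    rw [sb, tsum_mul_left]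
    rfl
  simp only [hfun, hlim]
  have hterm : ∀ (t : ℂ) (α : J →₀ ℕ), t ≠ 0 → d ≤ α.degree →
      (t ^ d)⁻¹ * (cf α F * pw (γ t) α)
        = t ^ (α.degree - d) * (cf α F * pw (t⁻¹ • γ t) α) := by
    intro t α ht hα
    rw [pw_smul, inv_pow]
    have h1 : t ^ α.degree = t ^ (α.degree - d) * t ^ d := by
      rw [← pow_add]; congr 1; omega
    rw [h1]
    field_simp
  refine tendsto_tsum_of_dominated_convergence (bound := fun α => ‖cf α F‖ * K ^ d)
    (F.summable_cf.mul_right _) (fun α => ?_) ?_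
  · rcases lt_trichotomy α.degree d with h | h | h
    · simp [hF α h, h.ne]
    · simp only [h, if_true]
      have hp : Tendsto (fun t => cf α F * pw (t⁻¹ • γ t) α) (𝓝[≠] 0) (𝓝 (cf α F * pw y α)) := by
        refine Tendsto.const_mul _ ?_
        have hc : Continuous fun x : J → ℂ => pw x α := by unfold pw; fun_prop
        exact (hc.tendsto y).comp hγ
      refine hp.congr' ?_
      filter_upwards [self_mem_nhdsWithin] with t ht
      rw [hterm t α ht h.ge, h]; simp
    · rw [if_neg h.ne']
      have hp : Tendsto (fun t => t ^ (α.degree - d) * (cf α F * pw (t⁻¹ • γ t) α)) (𝓝[≠] 0)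
          (𝓝 (0 * (cf α F * pw y α))) := by
        have hc : Continuous fun x : J → ℂ => pw x α := by unfold pw; fun_prop
        refine Tendsto.mul ?_ (((hc.tendsto y).comp hγ).const_mul _)
        have : Tendsto (fun t : ℂ => t ^ (α.degree - d)) (𝓝 0) (𝓝 (0 ^ (α.degree - d))) :=
          (continuous_pow _).tendsto 0
        rw [zero_pow (by omega)] at this
        exact this.mono_left nhdsWithin_le_nhds
      rw [zero_mul] at hp
      refine hp.congr' ?_
      filter_upwards [self_mem_nhdsWithin] with t ht
      rw [hterm t α ht h.le]
  -- Domination: once ‖t‖ K ≤ 1, a term of degree at least d, divided by t^d, is bounded by its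
  -- coefficient times K^d, independently of the degree.
  · have h1 : ∀ᶠ t in 𝓝[≠] (0 : ℂ), ‖t⁻¹ • γ t‖ ≤ K :=
      (hγ.norm.eventually (gt_mem_nhds (show ‖y‖ < K by simp [hK]))).mono fun t ht => ht.le
    have h2 : ∀ᶠ t in 𝓝[≠] (0 : ℂ), ‖t‖ * K ≤ 1 := by
      have : Tendsto (fun t : ℂ => ‖t‖ * K) (𝓝 0) (𝓝 (‖(0 : ℂ)‖ * K)) :=
        (continuous_norm.mul continuous_const).tendsto 0
      rw [norm_zero, zero_mul] at this
      exact ((this.mono_left nhdsWithin_le_nhds).eventually (gt_mem_nhds zero_lt_one)).mono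
        fun t ht => ht.le
    filter_upwards [h1, h2, self_mem_nhdsWithin] with t ht1 ht2 ht0 α
    rcases lt_or_ge α.degree d with h | h
    · simp [hF α h]
    · rw [hterm t α ht0 h, norm_mul, norm_mul, norm_pow]
      have h3 : ‖pw (t⁻¹ • γ t) α‖ ≤ K ^ α.degree :=
        norm_pw_le (fun j => (norm_le_pi_norm _ j).trans ht1) α
      calc ‖t‖ ^ (α.degree - d) * (‖cf α F‖ * ‖pw (t⁻¹ • γ t) α‖)
          ≤ ‖t‖ ^ (α.degree - d) * (‖cf α F‖ * K ^ α.degree) := by gcongr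
        _ = (‖t‖ * K) ^ (α.degree - d) * (‖cf α F‖ * K ^ d) := by
            rw [mul_pow]
            have : K ^ α.degree = K ^ (α.degree - d) * K ^ d := by
              rw [← pow_add]; congr 1; omega
            rw [this]; ring
        _ ≤ 1 * (‖cf α F‖ * K ^ d) := by
            gcongr
            exact pow_le_one₀ (by positivity) ht2
        _ = _ := one_mul _

/-- A polynomial over the infinite field ℂ is determined by its values; this turns identities
between leading forms into identities between coefficients. -/
lemma coeff_eq_zero_of_sum {c : (J →₀ ℕ) → ℂ} {d : ℕ}
    (h : ∀ y : J → ℂ, ∑ α ∈ degSet J d, c α * pw y α = 0) (α : J →₀ ℕ) (hα : α.degree = d) :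
    c α = 0 := by
  let P : MvPolynomial J ℂ := ∑ α ∈ degSet J d, MvPolynomial.monomial α (c α)
  have hP : P = 0 := by
    refine MvPolynomial.funext fun y => ?_
    rw [map_zero, ← h y, map_sum]
    refine Finset.sum_congr rfl fun β _ => ?_
    rw [MvPolynomial.eval_monomial, pw, Finsupp.prod_fintype _ _ (by simp)]
  have h2 : MvPolynomial.coeff α P = c α := by
    simp only [P, MvPolynomial.coeff_sum, MvPolynomial.coeff_monomial]
    rw [Finset.sum_ite_eq' , if_pos (mem_degSet.2 hα)]
  rw [← h2, hP, MvPolynomial.coeff_zero]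

/-- A power series vanishes if its lowest order terms vanish. -/
lemma eq_zero_of_lead {F : PS J}
    (h : ∀ d, (∀ α : J →₀ ℕ, α.degree < d → cf α F = 0) →
      ∀ α : J →₀ ℕ, α.degree = d → cf α F = 0) : F = 0 := by
  have h2 : ∀ d, ∀ α : J →₀ ℕ, α.degree < d → cf α F = 0 := by
    intro d
    induction d with
    | zero => intro α hα; omega
    | succ d ih =>
      intro α hα
      rcases Nat.lt_succ_iff_lt_or_eq.1 hα with h1 | h1
      · exact ih α h1
      · exact h d ih α h1
  refine ext_cf fun α => ?_
  rw [h2 _ α (Nat.lt_succ_self _), map_zero]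

lemma tendsto_smul_line (y : J → ℂ) (c : ℂ) :
    Tendsto (fun t : ℂ => t⁻¹ • (c • (t • y))) (𝓝[≠] 0) (𝓝 (c • y)) := by
  refine tendsto_const_nhds.congr' ?_
  filter_upwards [self_mem_nhdsWithin] with t ht
  rw [smul_comm c, smul_smul, inv_mul_cancel₀ ht, one_smul]

lemma tendsto_line (y : J → ℂ) : Tendsto (fun t : ℂ => t • y) (𝓝[≠] 0) (𝓝 0) := by
  have : Tendsto (fun t : ℂ => t • y) (𝓝 0) (𝓝 ((0 : ℂ) • y)) :=
    (continuous_id.smul continuous_const).tendsto 0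
  rw [zero_smul] at this
  exact this.mono_left nhdsWithin_le_nhds

/-- If F were nonzero, its lowest homogeneous part would be a limit of t^{-d} f along each line
through 0, hence zero. Uniqueness of representing series follows. -/
lemma Rep.eq_zero {f : (J → ℂ) → ℂ} {r : ℝ} {F : PS J} (h : Rep f r F)
    (hf : ∀ᶠ x in 𝓝 0, f x = 0) : F = 0 := by
  refine eq_zero_of_lead fun d hd => ?_
  refine coeff_eq_zero_of_sum fun y => ?_
  have h1 := tendsto_lead hd (tendsto_smul_line ((r : ℂ) • y) (r : ℂ)⁻¹)
  have hr : (r : ℂ) ≠ 0 := by exact_mod_cast h.pos.ne'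
  rw [smul_smul, inv_mul_cancel₀ hr, one_smul] at h1
  refine tendsto_nhds_unique h1 (tendsto_const_nhds.congr' ?_)
  have h2 := (tendsto_line ((r : ℂ) • y)).eventually hf
  have h3 := (tendsto_line ((r : ℂ) • y)).eventually (Metric.closedBall_mem_nhds _ h.pos)
  filter_upwards [h2, h3] with t ht1 ht2
  rw [← h.eq _ (by simpa using ht2), ht1, mul_zero]

lemma Rep.sub {f g : (J → ℂ) → ℂ} {r : ℝ} {F G : PS J} (hf : Rep f r F) (hg : Rep g r G) :
    Rep (fun x => f x - g x) r (F - G) := by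
  refine ⟨hf.pos, fun x hx => ?_⟩
  rw [hf.eq x hx, hg.eq x hx, sb_eq_lift, sb_eq_lift, sb_eq_lift,
    lift_sub (norm_pw_le_one (norm_apply_le (norm_smul_inv_le hf.pos hx)))]

lemma Rep.unique {f g : (J → ℂ) → ℂ} {r : ℝ} {F G : PS J} (hf : Rep f r F) (hg : Rep g r G)
    (h : f =ᶠ[𝓝 0] g) : F = G := by
  refine sub_eq_zero.1 ((hf.sub hg).eq_zero ?_)
  filter_upwards [h] with x hx
  rw [hx, sub_self]

end PS

/-! ### The group of germs at the origin of local homeomorphisms -/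

section Germs

variable (V : Type*) [NormedAddCommGroup V]

/-- The self-maps of `V` that tend to `0` at `0`. -/
def zeroEnd : Submonoid (Function.End V) where
  carrier := {f | Tendsto (f : V → V) (𝓝 0) (𝓝 0)}
  mul_mem' := fun hf hg => Tendsto.comp hf hg
  one_mem' := tendsto_id

/-- Equality of germs at `0`. -/
def germCon : Con (zeroEnd V) where
  r f g := (f.1 : V → V) =ᶠ[𝓝 0] g.1
  iseqv := ⟨fun _ => EventuallyEq.rfl, fun h => h.symm, fun h h' => h.trans h'⟩
  mul' := by
    intro w x y z h h'
    have h1 : (fun v => w.1 (y.1 v)) =ᶠ[𝓝 0] fun v => x.1 (y.1 v) := h.comp_tendsto y.2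
    have h2 : (fun v => x.1 (y.1 v)) =ᶠ[𝓝 0] fun v => x.1 (z.1 v) := h'.fun_comp x.1
    exact h1.trans h2

/-- The group of invertible germs at `0`. -/
abbrev GG := ((germCon V).Quotient)ˣ

variable {V}

/-- The function `f` represents the germ `g`. -/
def Rp (g : GG V) (f : V → V) : Prop :=
  ∃ hf : Tendsto f (𝓝 0) (𝓝 0), (g : (germCon V).Quotient) = ((⟨f, hf⟩ : zeroEnd V) : (germCon V).Quotient)

/-- The filter is the full neighbourhood filter, not the punctured one, so the constant sequence 0
may be inserted. -/
lemma eq_zero_of_tendsto {f : V → V} (hf : Tendsto f (𝓝 0) (𝓝 0)) : f 0 = 0 :=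
  tendsto_nhds_unique (tendsto_const_nhds (x := f 0) (f := (atTop : Filter ℕ)))
    (hf.comp (tendsto_const_nhds (x := (0 : V)) (f := (atTop : Filter ℕ))))

namespace Rp

variable {g g' : GG V} {f f' : V → V}

lemma tendsto (h : Rp g f) : Tendsto f (𝓝 0) (𝓝 0) := h.1

lemma map_zero (h : Rp g f) : f 0 = 0 := eq_zero_of_tendsto h.1

lemma eventuallyEq (h : Rp g f) (h' : Rp g f') : f =ᶠ[𝓝 0] f' := by
  obtain ⟨_, h1⟩ := h
  obtain ⟨_, h2⟩ := h'
  exact (Con.eq _).1 (h1.symm.trans h2)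

lemma ext (h : Rp g f) (h' : Rp g' f') (hff : f =ᶠ[𝓝 0] f') : g = g' := by
  obtain ⟨_, h1⟩ := h
  obtain ⟨_, h2⟩ := h'
  exact Units.ext (h1.trans (((Con.eq _).2 hff).trans h2.symm))

lemma congr (h : Rp g f) (hff : f =ᶠ[𝓝 0] f') : Rp g f' := by
  obtain ⟨hf, h1⟩ := h
  exact ⟨hf.congr' hff, h1.trans ((Con.eq _).2 hff)⟩

lemma mul (h : Rp g f) (h' : Rp g' f') : Rp (g * g') (fun x => f (f' x)) := by
  obtain ⟨hf, h1⟩ := h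
  obtain ⟨hf', h2⟩ := h'
  refine ⟨hf.comp hf', ?_⟩
  rw [Units.val_mul, h1, h2, ← Con.coe_mul]
  rfl

lemma one : Rp (1 : GG V) fun x => x := ⟨tendsto_id, rfl⟩

lemma mul_eq_one (h : Rp g f) (h' : Rp g' f') (hff : ∀ᶠ x in 𝓝 0, f (f' x) = x) : g * g' = 1 :=
  (h.mul h').ext one hff

end Rp

lemma exists_rp (g : GG V) : ∃ f, Rp g f := by
  obtain ⟨f, hf⟩ := Quotient.exists_rep (g : (germCon V).Quotient)
  exact ⟨f.1, f.2, hf.symm⟩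

lemma exists_unit {f f' : V → V} (hf : Tendsto f (𝓝 0) (𝓝 0)) (hf' : Tendsto f' (𝓝 0) (𝓝 0))
    (h : ∀ᶠ x in 𝓝 0, f (f' x) = x) (h' : ∀ᶠ x in 𝓝 0, f' (f x) = x) :
    ∃ g : GG V, Rp g f ∧ Rp g⁻¹ f' := by
  refine ⟨⟨((⟨f, hf⟩ : zeroEnd V) : (germCon V).Quotient), ((⟨f', hf'⟩ : zeroEnd V) : _), ?_, ?_⟩,
    ⟨hf, rfl⟩, ⟨hf', rfl⟩⟩
  · rw [← Con.coe_mul]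
    exact (Con.eq _).2 h
  · rw [← Con.coe_mul]
    exact (Con.eq _).2 h'

variable [NormedSpace ℂ V]

/-- The group of germs of biholomorphisms. -/
def Hol (V : Type*) [NormedAddCommGroup V] [NormedSpace ℂ V] : Subgroup (GG V) where
  carrier := {g | (∃ f, AnalyticAt ℂ f 0 ∧ Rp g f) ∧ ∃ f, AnalyticAt ℂ f 0 ∧ Rp g⁻¹ f}
  mul_mem' := by
    rintro g g' ⟨⟨f1, a1, r1⟩, f2, a2, r2⟩ ⟨⟨f3, a3, r3⟩, f4, a4, r4⟩
    refine ⟨⟨_, AnalyticAt.comp (by rwa [r3.map_zero]) a3, r1.mul r3⟩, ?_⟩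
    rw [mul_inv_rev]
    exact ⟨_, AnalyticAt.comp (by rwa [r2.map_zero]) a2, r4.mul r2⟩
  one_mem' := ⟨⟨_, analyticAt_id, Rp.one⟩, by rw [inv_one]; exact ⟨_, analyticAt_id, Rp.one⟩⟩
  inv_mem' := by
    rintro g ⟨h1, h2⟩
    exact ⟨h2, by rwa [inv_inv]⟩

/-- The linear part of a germ. -/
def D (g : GG V) : V →L[ℂ] V := fderiv ℂ (exists_rp g).choose 0

/-- Representatives agree near 0, so the choice made in `D` is immaterial. -/
lemma Rp.D_eq {g : GG V} {f : V → V} (h : Rp g f) : D g = fderiv ℂ f 0 :=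
  ((exists_rp g).choose_spec.eventuallyEq h).fderiv_eq

lemma Rp.analyticAt {g : GG V} {f : V → V} (h : Rp g f) (hg : g ∈ Hol V) : AnalyticAt ℂ f 0 := by
  obtain ⟨⟨f', a, r⟩, _⟩ := hg
  exact a.congr (r.eventuallyEq h)

lemma Rp.hasStrictFDerivAt {g : GG V} {f : V → V} (h : Rp g f) (hg : g ∈ Hol V) :
    HasStrictFDerivAt f (D g) 0 := by
  rw [h.D_eq]; exact (h.analyticAt hg).hasStrictFDerivAt

lemma Rp.hasFDerivAt {g : GG V} {f : V → V} (h : Rp g f) (hg : g ∈ Hol V) :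
    HasFDerivAt f (D g) 0 := (h.hasStrictFDerivAt hg).hasFDerivAt

lemma D_one : D (1 : GG V) = 1 := by
  rw [Rp.one.D_eq]; exact fderiv_fun_id

lemma D_mul {g g' : GG V} (hg : g ∈ Hol V) (hg' : g' ∈ Hol V) : D (g * g') = D g * D g' := by
  obtain ⟨f, h⟩ := exists_rp g
  obtain ⟨f', h'⟩ := exists_rp g'
  rw [(h.mul h').D_eq]
  refine HasFDerivAt.fderiv (HasFDerivAt.comp (g := f) 0 ?_ (h'.hasFDerivAt hg'))
  rw [h'.map_zero]
  exact h.hasFDerivAt hg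

lemma D_inv_mul {g : GG V} (hg : g ∈ Hol V) : D g⁻¹ * D g = 1 := by
  rw [← D_mul (inv_mem hg) hg, inv_mul_cancel, D_one]

lemma D_mul_inv {g : GG V} (hg : g ∈ Hol V) : D g * D g⁻¹ = 1 := by
  rw [← D_mul hg (inv_mem hg), mul_inv_cancel, D_one]

lemma D_pow {g : GG V} (hg : g ∈ Hol V) (n : ℕ) : D (g ^ n) = D g ^ n := by
  induction n with
  | zero => simp [D_one]
  | succ n ih => rw [pow_succ, pow_succ, D_mul (pow_mem hg n) hg, ih]

lemma isInvertible_D {g : GG V} (hg : g ∈ Hol V) : (D g).IsInvertible :=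
  ContinuousLinearMap.IsInvertible.of_inverse (D_mul_inv hg) (D_inv_mul hg)

lemma exists_analytic_rp {g : GG V} (hg : g ∈ Hol V) :
    ∃ f, AnalyticAt ℂ f 0 ∧ Rp g f ∧ HasFDerivAt f (D g) 0 := by
  obtain ⟨f, h⟩ := exists_rp g
  exact ⟨f, h.analyticAt hg, h, h.hasFDerivAt hg⟩

/-- Inverse function theorem for germs. -/
lemma exists_hol_of_invertible [CompleteSpace V] {f : V → V} (hf : AnalyticAt ℂ f 0) (h0 : f 0 = 0)
    (h : (fderiv ℂ f 0).IsInvertible) : ∃ g ∈ Hol V, Rp g f := by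
  obtain ⟨i, hi⟩ := h
  have hs : HasStrictFDerivAt f (i : V →L[ℂ] V) 0 := by rw [hi]; exact hf.hasStrictFDerivAt
  have hc : Tendsto f (𝓝 0) (𝓝 0) := by
    have := hf.continuousAt.tendsto
    rwa [h0] at this
  have hinv : AnalyticAt ℂ (hs.localInverse) (f 0) :=
    (hs.toOpenPartialHomeomorph f).analyticAt_symm' (hs.mem_toOpenPartialHomeomorph_source) hf hi.symm
  rw [h0] at hinv
  have h1 := hs.eventually_left_inverse
  have h2 := hs.eventually_right_inverse
  have h3 := hs.localInverse_tendsto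
  rw [h0] at h2 h3
  obtain ⟨g, hg, hg'⟩ := exists_unit hc h3 h2 h1
  exact ⟨g, ⟨⟨f, hf, hg⟩, _, hinv, hg'⟩, hg⟩

lemma exists_hol_of_hasFDerivAt [CompleteSpace V] {f : V → V} (hf : AnalyticAt ℂ f 0) (h0 : f 0 = 0)
    {A : V →L[ℂ] V} (hA : A.IsInvertible) (h : HasFDerivAt f A 0) : ∃ g ∈ Hol V, Rp g f ∧ D g = A := by
  obtain ⟨g, hg, hr⟩ := exists_hol_of_invertible hf h0 (by rwa [h.fderiv])
  exact ⟨g, hg, hr, by rw [hr.D_eq, h.fderiv]⟩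

/-- The germ of a linear isomorphism. -/
lemma exists_lin (e : V ≃L[ℂ] V) : ∃ g ∈ Hol V, Rp g e ∧ D g = e := by
  have h1 : Tendsto e (𝓝 0) (𝓝 0) := by
    have := e.continuous.tendsto 0
    rwa [map_zero] at this
  have h2 : Tendsto e.symm (𝓝 0) (𝓝 0) := by
    have := e.symm.continuous.tendsto 0
    rwa [map_zero] at this
  obtain ⟨g, hg, hg'⟩ := exists_unit h1 h2 (.of_forall fun x => by simp) (.of_forall fun x => by simp)
  refine ⟨g, ⟨⟨_, (e : V →L[ℂ] V).analyticAt 0, hg⟩, _, (e.symm : V →L[ℂ] V).analyticAt 0, hg'⟩, hg, ?_⟩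
  rw [hg.D_eq]
  exact (e : V →L[ℂ] V).hasFDerivAt.fderiv

/-- A germ of finite order tangent to the identity is the identity. -/
lemma eq_one_of_pow_eq_one [CompleteSpace V] {g : GG V} (hg : g ∈ Hol V) (hD : D g = 1) {n : ℕ}
    (hn : n ≠ 0) (h : g ^ n = 1) : g = 1 := by
  choose f ha hr hd using fun k : ℕ => exists_analytic_rp (pow_mem hg k)
  -- The sum φ = 1 + g + ... + g^{n-1} has derivative n·1, so it is invertible as a germ.
  have hd' : HasFDerivAt (fun x => ∑ k ∈ Finset.range n, f k x) ((n : ℂ) • (1 : V →L[ℂ] V)) 0 := by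
    have := HasFDerivAt.fun_sum (u := Finset.range n) fun k _ => hd k
    simp only [D_pow hg, hD, one_pow, Finset.sum_const, Finset.card_range] at this
    rwa [Nat.cast_smul_eq_nsmul]
  have ha' : AnalyticAt ℂ (fun x => ∑ k ∈ Finset.range n, f k x) 0 :=
    Finset.analyticAt_fun_sum _ fun k _ => ha k
  have hn' : (n : ℂ) ≠ 0 := by exact_mod_cast hn
  obtain ⟨φ, hφ, hφr, -⟩ := exists_hol_of_hasFDerivAt ha'
    (Finset.sum_eq_zero fun k _ => (hr k).map_zero)
    (ContinuousLinearMap.IsInvertible.of_inverse (g := (n : ℂ)⁻¹ • (1 : V →L[ℂ] V))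
      (by ext x; simp [smul_smul, hn']) (by ext x; simp [smul_smul, hn'])) hd'
  have hr1 : Rp g (f 1) := by simpa using hr 1
  have h1 : ∀ k, ∀ᶠ x in 𝓝 0, f k (f 1 x) = f (k + 1) x := fun k => by
    have := (hr k).mul hr1
    rw [← pow_succ] at this
    exact this.eventuallyEq (hr (k + 1))
  have hn0 : f n =ᶠ[𝓝 0] f 0 := by
    have h2 := hr n
    rw [h, ← pow_zero g] at h2
    exact h2.eventuallyEq (hr 0)
  -- Composing the sum with g shifts the exponents cyclically because g^n = 1; cancelling the
  -- invertible φ gives g = 1.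
  have h3 : φ * g = φ := by
    refine (hφr.mul hr1).ext hφr ?_
    have h4 : ∀ᶠ x in 𝓝 0, ∀ k ∈ Finset.range n, f k (f 1 x) = f (k + 1) x :=
      (Finset.eventually_all _).2 fun k _ => h1 k
    filter_upwards [h4, hn0] with x hx hx0
    rw [Finset.sum_congr rfl hx]
    have h5 := Finset.sum_range_succ' (fun k => f k x) n
    rw [Finset.sum_range_succ, hx0] at h5
    exact (add_right_cancel h5).symm
  exact mul_eq_left.1 h3

/-- An involutive germ is linearized by averaging. -/
lemma exists_linearize [CompleteSpace V] {a A : GG V} (ha : a ∈ Hol V) (h : a * a = 1)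
    {T : V →L[ℂ] V} (hAT : Rp A T) (hD : D a = T) :
    ∃ φ ∈ Hol V, D φ = 1 ∧ φ * a = A * φ := by
  have hTT : T * T = 1 := by rw [← hD, ← D_mul ha ha, h, D_one]
  have hTT' : ∀ x, T (T x) = x := fun x => congrArg (fun B : V →L[ℂ] V => B x) hTT
  obtain ⟨f, hf, hr, hd⟩ := exists_analytic_rp ha
  -- The conjugating germ is φ = (1 + T a)/2. Since a² = 1 and T² = 1, both φ a and T φ equal (a +
  -- T)/2.
  have h1 : HasFDerivAt (fun x => (1 / 2 : ℂ) • (x + T (f x))) (1 : V →L[ℂ] V) 0 := by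
    have h2 : HasFDerivAt (fun x => (1 / 2 : ℂ) • (x + T (f x))) _ 0 :=
      ((hasFDerivAt_id (𝕜 := ℂ) (0 : V)).add (T.hasFDerivAt.comp (0 : V) hd)).const_smul (1 / 2 : ℂ)
    refine h2.congr_fderiv ?_
    rw [hD]
    ext x
    have := hTT' x
    simp only [one_apply_eq_self, smul_apply, add_apply,
      ContinuousLinearMap.id_apply, ContinuousLinearMap.comp_apply, this]
    rw [← two_smul ℂ x, smul_smul]
    norm_num
  have h3 : AnalyticAt ℂ (fun x => (1 / 2 : ℂ) • (x + T (f x))) 0 :=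
    (analyticAt_id.add ((T.analyticAt _).comp hf)).const_smul
  obtain ⟨φ, hφ, hφr, hφD⟩ := exists_hol_of_hasFDerivAt h3 (by simp [hr.map_zero])
    (ContinuousLinearMap.IsInvertible.of_inverse (g := 1) rfl rfl) h1
  refine ⟨φ, hφ, hφD, (hφr.mul hr).ext (hAT.mul hφr) ?_⟩
  have h4 : ∀ᶠ x in 𝓝 0, f (f x) = x := by
    have := hr.mul hr
    rw [h] at this
    exact this.eventuallyEq Rp.one
  filter_upwards [h4] with x hx
  rw [hx, map_smul, map_add, hTT', add_comm]

end Germs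

/-! ### Weights with respect to a pair of variables -/

section Weights

open PS

variable {J : Type*} [Fintype J] [DecidableEq J]

/-- A point of the unit circle that is not a root of unity. -/
def t0 : ℂ := Complex.exp Complex.I

lemma norm_t0 : ‖t0‖ = 1 := by
  have := Complex.norm_exp_ofReal_mul_I 1
  simpa [t0] using this

lemma t0_ne_zero : t0 ≠ 0 := Complex.exp_ne_zero _

/-- exp(in) = 1 means n = 2πm, which contradicts the irrationality of π unless m = 0. One rotation
thus does the work of the whole circle: its powers separate all weights. -/
lemma t0_zpow_eq_one {n : ℤ} (h : t0 ^ n = 1) : n = 0 := by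
  rw [t0, ← Complex.exp_int_mul, Complex.exp_eq_one_iff] at h
  obtain ⟨m, hm⟩ := h
  by_contra hn
  have h1 : ((n : ℤ) : ℂ) = ((m * (2 * Real.pi) : ℝ) : ℂ) := by
    have := mul_right_cancel₀ Complex.I_ne_zero
      (show (n : ℂ) * Complex.I = (m * (2 * Real.pi)) * Complex.I by rw [hm]; ring)
    rw [this]; push_cast; ring
  have h2 : (n : ℝ) = m * (2 * Real.pi) := by exact_mod_cast h1
  have hm0 : m ≠ 0 := by
    rintro rfl
    simp at h2; exact hn h2
  have h3 : Real.pi = ((n / (2 * m) : ℚ) : ℝ) := by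
    have : (m : ℝ) ≠ 0 := by exact_mod_cast hm0
    push_cast
    rw [h2]; field_simp
  exact irrational_pi ⟨_, h3.symm⟩

lemma conj_t0 : conj t0 = t0⁻¹ := by
  rw [Complex.inv_def, Complex.normSq_eq_norm_sq, norm_t0]; simp

lemma t0_zpow_inj {m n : ℤ} (h : t0 ^ m = t0 ^ n) : m = n := by
  have : t0 ^ (m - n) = 1 := by
    rw [zpow_sub₀ t0_ne_zero, h, div_self (zpow_ne_zero _ t0_ne_zero)]
  have := t0_zpow_eq_one this
  omega

/-- The vector with entries `c` at `p`, `c⁻¹` at `q` and `1` elsewhere. -/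
def dv (p q : J) (c : ℂ) : J → ℂ := fun j => if j = p then c else if j = q then c⁻¹ else 1

/-- The weight of an exponent. -/
def wt (p q : J) (α : J →₀ ℕ) : ℤ := α p - α q

lemma wt_add (p q : J) (α β : J →₀ ℕ) : wt p q (α + β) = wt p q α + wt p q β := by
  simp [wt]; ring

lemma wt_zero (p q : J) : wt p q 0 = 0 := by simp [wt]

variable {p q : J}

lemma dv_left (c : ℂ) : dv p q c p = c := by simp [dv]

lemma dv_right (hpq : p ≠ q) (c : ℂ) : dv p q c q = c⁻¹ := by simp [dv, hpq.symm]

lemma dv_other {j : J} (hp : j ≠ p) (hq : j ≠ q) (c : ℂ) : dv p q c j = 1 := by simp [dv, hp, hq]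

lemma dv_swap (hpq : p ≠ q) (c : ℂ) : dv q p c⁻¹ = dv p q c := by
  funext j
  by_cases hp : j = p
  · subst hp; simp [dv, hpq]
  · by_cases hq : j = q
    · subst hq; simp [dv, hp]
    · simp [dv, hp, hq]

lemma dv_mul (c c' : ℂ) : dv p q (c * c') = dv p q c * dv p q c' := by
  funext j
  simp only [dv, Pi.mul_apply]
  split_ifs <;> simp [mul_comm]

lemma dv_one : dv p q 1 = 1 := by
  funext j
  simp [dv]

lemma pw_split {B : Type*} [CommMonoid B] (hpq : p ≠ q) (x : J → B) (α : J →₀ ℕ) :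
    pw x α = x p ^ α p * (x q ^ α q * ∏ j ∈ (Finset.univ.erase p).erase q, x j ^ α j) := by
  rw [pw, ← Finset.mul_prod_erase _ _ (Finset.mem_univ p),
    ← Finset.mul_prod_erase (Finset.univ.erase p) _ (Finset.mem_erase.2 ⟨hpq.symm, Finset.mem_univ q⟩)]

lemma pw_dv (hpq : p ≠ q) {c : ℂ} (hc : c ≠ 0) (α : J →₀ ℕ) : pw (dv p q c) α = c ^ wt p q α := by
  rw [pw_split hpq, dv_left, dv_right hpq, Finset.prod_eq_one, mul_one, wt, zpow_sub₀ hc, inv_pow,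
    zpow_natCast, zpow_natCast, div_eq_mul_inv]
  intro j hj
  simp only [Finset.mem_erase] at hj
  rw [dv_other hj.2.1 hj.1, one_pow]

lemma pw_dv_mul (hpq : p ≠ q) {c : ℂ} (hc : c ≠ 0) (x : J → ℂ) (α : J →₀ ℕ) :
    pw (dv p q c * x) α = c ^ wt p q α * pw x α := by
  rw [← pw_dv hpq hc, ← pw_mul]; rfl

lemma norm_dv_mul {c : ℂ} (hc : ‖c‖ = 1) (x : J → ℂ) : ‖dv p q c * x‖ = ‖x‖ := by
  have h : ∀ j, ‖dv p q c j‖ = 1 := by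
    intro j; simp only [dv]; split_ifs <;> simp [hc]
  have h1 : ∀ j, ‖(dv p q c * x) j‖ = ‖x j‖ := fun j => by
    rw [Pi.mul_apply, norm_mul, h, one_mul]
  simp only [Pi.norm_def]
  congr 2
  funext j
  exact NNReal.eq (h1 j)

/-- The rotation of the two variables by `t0` and its inverse. -/
def rot (p q : J) (x : J → ℂ) : J → ℂ := dv p q t0 * x

lemma norm_rot (x : J → ℂ) : ‖rot p q x‖ = ‖x‖ := norm_dv_mul norm_t0 x

lemma tendsto_rot : Tendsto (rot p q) (𝓝 0) (𝓝 0) := by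
  have : Continuous (rot p q) := by unfold rot; fun_prop
  simpa [rot] using this.tendsto 0

/-- `f` is an analytic germ of weight `k`. -/
structure HasWt (p q : J) (k : ℤ) (f : (J → ℂ) → ℂ) : Prop where
  an : AnalyticAt ℂ f 0
  rot : ∀ᶠ x in 𝓝 0, f (rot p q x) = t0 ^ k * f x

/-- All monomials of the power series have weight `k`. -/
def IsWt (p q : J) (k : ℤ) (F : PS J) : Prop := ∀ α, cf α F ≠ 0 → wt p q α = k

/-- The map that multiplies the coefficients by the bounded family `c`. -/
def scale (c : (J →₀ ℕ) → ℂ) (F : PS J) : PS J := lift (fun α => c α • mon α) F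

lemma norm_smul_mon_le {c : (J →₀ ℕ) → ℂ} {C : ℝ} (hc : ∀ α, ‖c α‖ ≤ C) (α : J →₀ ℕ) :
    ‖c α • (mon α : PS J)‖ ≤ C := by
  rw [norm_smul, norm_mon, mul_one]; exact hc α

lemma cf_scale {c : (J →₀ ℕ) → ℂ} {C : ℝ} (hc : ∀ α, ‖c α‖ ≤ C) (F : PS J) (α : J →₀ ℕ) :
    cf α (scale c F) = c α * cf α F := by
  rw [scale, map_lift (norm_smul_mon_le hc), lift, tsum_eq_single α]
  · simp [cf_mon, mul_comm]
  · intro β hβ; simp [cf_mon, hβ.symm]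

lemma sb_scale {c : (J →₀ ℕ) → ℂ} {C : ℝ} (hc : ∀ α, ‖c α‖ ≤ C) {x : J → ℂ} (hx : ‖x‖ ≤ 1)
    (F : PS J) : PS.sb x (scale c F) = lift (fun α => c α * pw x α) F := by
  rw [scale, ← subL_apply (norm_apply_le hx), map_lift (norm_smul_mon_le hc)]
  congr 1
  funext α
  rw [map_smul, subL_apply, sb_eq_lift, lift_mon, smul_eq_mul]

lemma norm_t0_zpow (n : ℤ) : ‖t0 ^ n‖ = 1 := by rw [norm_zpow, norm_t0, one_zpow]

lemma norm_t0_sub_le (m n : ℤ) : ‖t0 ^ m - t0 ^ n‖ ≤ 2 := by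
  refine (norm_sub_le _ _).trans ?_
  rw [norm_t0_zpow, norm_t0_zpow]; norm_num

lemma smul_dv_mul (r c : ℂ) (x : J → ℂ) : r • (dv p q c * x) = dv p q c * (r • x) := by
  rw [mul_smul_comm]

lemma sb_rot (hpq : p ≠ q) (x : J → ℂ) (F : PS J) :
    PS.sb (rot p q x) F = lift (fun α => t0 ^ wt p q α * pw x α) F := by
  rw [sb_eq_lift]; congr 1; funext α
  exact pw_dv_mul hpq t0_ne_zero x α

/-- The defect of equivariance multiplies each coefficient by t0^(weight) - t0^k, which vanishes
only in weight k. It links the analytic notion `HasWt` with the algebraic notion `IsWt`. -/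
lemma rep_rot_sub (hpq : p ≠ q) {f : (J → ℂ) → ℂ} {r : ℝ} {F : PS J} (h : Rep f r F) (k : ℤ) :
    Rep (fun x => f (rot p q x) - t0 ^ k * f x) r (scale (fun α => t0 ^ wt p q α - t0 ^ k) F) := by
  refine ⟨h.pos, fun x hx => ?_⟩
  have hx1 := norm_smul_inv_le h.pos hx
  rw [h.eq _ (by rwa [norm_rot]), h.eq x hx, sb_scale (fun α => norm_t0_sub_le _ _) hx1]
  have h1 : ((r : ℂ)⁻¹ • rot p q x) = rot p q ((r : ℂ)⁻¹ • x) := smul_dv_mul _ _ _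
  rw [h1, sb_rot hpq]
  have hb := norm_pw_le_one (norm_apply_le hx1)
  have hb2 : ∀ α : J →₀ ℕ, ‖t0 ^ wt p q α * pw ((r : ℂ)⁻¹ • x) α‖ ≤ 1 := fun α => by
    rw [norm_mul, norm_t0_zpow, one_mul]; exact hb α
  have e1 := hasSum_lift hb2 F
  have e2 := (hasSum_lift hb F).mul_left (t0 ^ k)
  rw [sb_eq_lift]
  refine ((e1.sub e2).congr_fun fun α => ?_).tsum_eq.symm
  simp only [smul_eq_mul]; ring

lemma HasWt.isWt (hpq : p ≠ q) {k : ℤ} {f : (J → ℂ) → ℂ} (hf : HasWt p q k f) {r : ℝ} {F : PS J}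
    (h : Rep f r F) : IsWt p q k F := by
  have h1 := (rep_rot_sub hpq h k).eq_zero (by
    filter_upwards [hf.rot] with x hx; rw [hx, sub_self])
  intro α hα
  have h2 := cf_scale (fun α => norm_t0_sub_le (wt p q α) k) F α
  rw [h1, map_zero, eq_comm, mul_eq_zero, or_iff_left hα, sub_eq_zero] at h2
  exact t0_zpow_inj h2

lemma IsWt.hasWt (hpq : p ≠ q) {k : ℤ} {f : (J → ℂ) → ℂ} {r : ℝ} {F : PS J} (hF : IsWt p q k F)
    (h : Rep f r F) : HasWt p q k f := by
  refine ⟨h.analyticAt, ?_⟩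
  have h1 := rep_rot_sub hpq h k
  have h2 : scale (fun α => t0 ^ wt p q α - t0 ^ k) F = 0 := by
    refine ext_cf fun α => ?_
    rw [cf_scale (fun α => norm_t0_sub_le _ _), map_zero]
    by_cases h0 : cf α F = 0
    · rw [h0, mul_zero]
    · rw [hF α h0, sub_self, zero_mul]
  filter_upwards [Metric.closedBall_mem_nhds (0 : J → ℂ) h.pos] with x hx
  have h3 := h1.eq x (by simpa using hx)
  rw [h2] at h3
  have h4 : PS.sb ((r : ℂ)⁻¹ • x) (0 : PS J) = 0 := by simp [PS.sb]
  rw [h4] at h3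
  exact sub_eq_zero.1 h3

lemma tendsto_slope {W : Type*} [NormedAddCommGroup W] [NormedSpace ℂ W] {s : (J → ℂ) → W}
    {S : (J → ℂ) →L[ℂ] W} (hs : HasFDerivAt s S 0) (h0 : s 0 = 0) (y : J → ℂ) :
    Tendsto (fun t : ℂ => t⁻¹ • s (t • y)) (𝓝[≠] 0) (𝓝 (S y)) := by
  have h1 : HasDerivAt (fun t : ℂ => t • y) ((1 : ℂ) • y) 0 := (hasDerivAt_id (0 : ℂ)).smul_const y
  have h2 : HasFDerivAt s S ((0 : ℂ) • y) := by rwa [zero_smul]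
  have h3 := h2.comp_hasDerivAt (0 : ℂ) h1
  rw [hasDerivAt_iff_tendsto_slope_zero] at h3
  simp only [zero_add, Function.comp_apply, zero_smul, h0, sub_zero, one_smul] at h3
  exact h3

lemma tendsto_line0 (y : J → ℂ) : Tendsto (fun t : ℂ => t • y) (𝓝[≠] 0) (𝓝 0) := tendsto_line y

lemma lead_dv_mul (hpq : p ≠ q) {μ : ℂ} (hμ : μ ≠ 0) (F : PS J) (d : ℕ) (y : J → ℂ) :
    lead F d (dv p q μ * y) = ∑ α ∈ degSet J d, (μ ^ wt p q α * cf α F) * pw y α := by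
  refine Finset.sum_congr rfl fun α _ => ?_
  rw [pw_dv_mul hpq hμ]; ring

/-- A germ that is multiplied by `c ∼ μ ^ k` under a map with hyperbolic linear part commuting with
the rotation has weight `k`. -/
theorem hasWt_of_comp (hpq : p ≠ q) {μ : ℂ} (hμ : μ ≠ 0) (hμ1 : ∀ n : ℤ, μ ^ n = 1 → n = 0) {k : ℤ}
    {f c : (J → ℂ) → ℂ} {s : (J → ℂ) → J → ℂ} {S : (J → ℂ) →L[ℂ] J → ℂ}
    (hf : AnalyticAt ℂ f 0) (hs : HasFDerivAt s S 0) (hS : ∀ y, S y = dv p q μ * y) (hs0 : s 0 = 0)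
    (hsr : ∀ᶠ x in 𝓝 0, s (rot p q x) = rot p q (s x)) (hc : ContinuousAt c 0)
    (hcr : ∀ᶠ x in 𝓝 0, c (rot p q x) = c x) (hc0 : c 0 = μ ^ k)
    (h : ∀ᶠ x in 𝓝 0, f (s x) = c x * f x) : HasWt p q k f := by
  refine ⟨hf, ?_⟩
  obtain ⟨r, F, hF⟩ := exists_rep hf
  have hG := rep_rot_sub hpq hF k
  set G := scale (fun α => t0 ^ wt p q α - t0 ^ k) F with hGdef
  set g : (J → ℂ) → ℂ := fun x => f (rot p q x) - t0 ^ k * f x with hg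
  have hcfG : ∀ α, cf α G = (t0 ^ wt p q α - t0 ^ k) * cf α F :=
    cf_scale (fun α => norm_t0_sub_le _ _) F
  -- The defect g of equivariance obeys the same functional equation as f, since s commutes with the
  -- rotation and c is invariant under it.
  have hgs : ∀ᶠ x in 𝓝 0, g (s x) = c x * g x := by
    filter_upwards [h, tendsto_rot.eventually h, hsr, hcr] with x h1 h2 h3 h4
    simp only [hg]
    rw [← h3, h2, h1, h4]; ring
  have hr : (r : ℂ) ≠ 0 := by exact_mod_cast hF.pos.ne'
  have hG0 : G = 0 := by
    refine eq_zero_of_lead fun d hd => ?_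
    -- To lowest order only the linear part of s and the value of c at 0 matter.
    have key : ∀ y : J → ℂ, lead G d (dv p q μ * y) = μ ^ k * lead G d y := by
      intro y
      have hl := tendsto_line0 ((r : ℂ) • y)
      have h1 : Tendsto (fun t : ℂ => (t ^ d)⁻¹ * g (s (t • (r : ℂ) • y))) (𝓝[≠] 0)
          (𝓝 (lead G d (dv p q μ * y))) := by
        have h2 : Tendsto (fun t : ℂ => t⁻¹ • ((r : ℂ)⁻¹ • s (t • (r : ℂ) • y))) (𝓝[≠] 0)
            (𝓝 (dv p q μ * y)) := by
          have h3 := (tendsto_slope hs hs0 ((r : ℂ) • y)).const_smul ((r : ℂ)⁻¹)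
          rw [map_smul, smul_smul, inv_mul_cancel₀ hr, one_smul, hS] at h3
          refine h3.congr fun t => ?_
          rw [smul_comm]
        refine (tendsto_lead hd h2).congr' ?_
        have h4 : Tendsto (fun t : ℂ => s (t • (r : ℂ) • y)) (𝓝[≠] 0) (𝓝 0) := by
          have := hs.continuousAt.tendsto
          rw [hs0] at this
          exact this.comp hl
        filter_upwards [h4.eventually (Metric.closedBall_mem_nhds _ hF.pos)] with t ht
        rw [hG.eq _ (by simpa using ht)]
      have h5 : Tendsto (fun t : ℂ => (t ^ d)⁻¹ * g (t • (r : ℂ) • y)) (𝓝[≠] 0)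
          (𝓝 (lead G d y)) := by
        have h2 := tendsto_smul_line ((r : ℂ) • y) ((r : ℂ)⁻¹)
        rw [smul_smul, inv_mul_cancel₀ hr, one_smul] at h2
        refine (tendsto_lead hd h2).congr' ?_
        filter_upwards [hl.eventually (Metric.closedBall_mem_nhds _ hF.pos)] with t ht
        rw [hG.eq _ (by simpa using ht)]
      have h6 : Tendsto (fun t : ℂ => c (t • (r : ℂ) • y)) (𝓝[≠] 0) (𝓝 (μ ^ k)) := by
        rw [← hc0]; exact hc.tendsto.comp hl
      refine tendsto_nhds_unique h1 ((h6.mul h5).congr' ?_)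
      filter_upwards [hl.eventually hgs] with t ht
      rw [ht]; ring
    have key2 := coeff_eq_zero_of_sum
      (c := fun α => (μ ^ wt p q α - μ ^ k) * cf α G) (d := d) (fun y => by
        have := key y
        rw [lead_dv_mul hpq hμ, lead, Finset.mul_sum, ← sub_eq_zero, ← Finset.sum_sub_distrib] at this
        rw [← this]
        exact Finset.sum_congr rfl fun α _ => by ring)
    intro α hα
    -- The functional equation leaves only weight k in the lowest part of g, whereas the
    -- construction of g removed exactly weight k.
    rcases mul_eq_zero.1 (key2 α hα) with h1 | h1
    · have h2 : wt p q α = k := by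
        have h3 : μ ^ (wt p q α - k) = 1 := by
          rw [zpow_sub₀ hμ, sub_eq_zero.1 h1, div_self (zpow_ne_zero _ hμ)]
        have := hμ1 _ h3
        omega
      rw [hcfG, h2, sub_self, zero_mul]
    · exact h1
  filter_upwards [Metric.closedBall_mem_nhds (0 : J → ℂ) hF.pos] with x hx
  have h3 := hG.eq x (by simpa using hx)
  rw [hG0] at h3
  have h4 : PS.sb ((r : ℂ)⁻¹ • x) (0 : PS J) = 0 := by simp [PS.sb]
  rw [h4] at h3
  exact sub_eq_zero.1 h3

/-- A germ of weight zero depends on the two variables only through their product. -/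
lemma HasWt.eq_of_prod_eq (hpq : p ≠ q) {f : (J → ℂ) → ℂ} (hf : HasWt p q 0 f) :
    ∃ ρ > 0, ∀ x y : J → ℂ, ‖x‖ ≤ ρ → ‖y‖ ≤ ρ → (∀ j, j ≠ p → j ≠ q → x j = y j) →
      x p * x q = y p * y q → f x = f y := by
  obtain ⟨r, F, hF⟩ := exists_rep hf.an
  refine ⟨r, hF.pos, fun x y hx hy hj hxy => ?_⟩
  rw [hF.eq x hx, hF.eq y hy, sb_eq_lift, sb_eq_lift]
  refine lift_congr _ fun α hα => ?_
  have h := hf.isWt hpq hF α hα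
  -- In weight zero the two exponents agree, so the monomial is a power of x_p x_q times the
  -- remaining variables.
  have h1 : α q = α p := by unfold wt at h; omega
  rw [pw_smul, pw_smul, pw_split hpq, pw_split hpq, h1, ← mul_assoc (x p ^ α p), ← mul_pow, hxy,
    ← mul_assoc (y p ^ α p), ← mul_pow]
  congr 2
  refine Finset.prod_congr rfl fun j hj' => ?_
  simp only [Finset.mem_erase] at hj'
  rw [hj j hj'.2.1 hj'.1]

/-- With this, invariance of a weight-zero germ under a map becomes an algebraic check on the
product of two coordinates, with no composition of series. -/
lemma HasWt.comp_eq (hpq : p ≠ q) {f : (J → ℂ) → ℂ} (hf : HasWt p q 0 f)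
    {s s' : (J → ℂ) → J → ℂ} (hs : Tendsto s (𝓝 0) (𝓝 0)) (hs' : Tendsto s' (𝓝 0) (𝓝 0))
    (hj : ∀ᶠ x in 𝓝 0, ∀ j, j ≠ p → j ≠ q → s x j = s' x j)
    (hp : ∀ᶠ x in 𝓝 0, s x p * s x q = s' x p * s' x q) : ∀ᶠ x in 𝓝 0, f (s x) = f (s' x) := by
  obtain ⟨ρ, hρ, h⟩ := hf.eq_of_prod_eq hpq
  filter_upwards [hs.eventually (Metric.closedBall_mem_nhds _ hρ),
    hs'.eventually (Metric.closedBall_mem_nhds _ hρ), hj, hp] with x h1 h2 h3 h4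
  exact h _ _ (by simpa using h1) (by simpa using h2) h3 h4

end Weights

/-! ### Germs that commute with a rotation -/

section Centralizer

open PS

variable {J : Type*} [Fintype J] [DecidableEq J]

/-! ### Graded power series -/

lemma IsWt.mul {p q : J} {k l : ℤ} {F G : PS J} (hF : IsWt p q k F) (hG : IsWt p q l G) :
    IsWt p q (k + l) (F * G) := by
  intro α hα
  rw [cf_mul] at hα
  obtain ⟨x, hx, hx0⟩ := Finset.exists_ne_zero_of_sum_ne_zero hα
  rw [Finset.HasAntidiagonal.mem_antidiagonal] at hx
  rw [← hx, wt_add, hF _ (left_ne_zero_of_mul hx0), hG _ (right_ne_zero_of_mul hx0)]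

lemma IsWt.one {p q : J} : IsWt p q 0 (1 : PS J) := by
  intro α hα
  rw [← mon_zero, cf_mon] at hα
  have : α = 0 := by by_contra h; simp [h] at hα
  rw [this, wt_zero]

lemma IsWt.mon {p q : J} (α : J →₀ ℕ) : IsWt p q (wt p q α) (mon α : PS J) := by
  intro β hβ
  rw [cf_mon] at hβ
  have : β = α := by by_contra h; simp [h] at hβ
  rw [this]

lemma IsWt.pow {p q : J} {k : ℤ} {F : PS J} (hF : IsWt p q k F) (n : ℕ) :
    IsWt p q (n * k) (F ^ n) := by
  induction n with
  | zero => simpa using IsWt.one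
  | succ n ih =>
    rw [pow_succ]
    convert ih.mul hF using 1
    push_cast; ring

lemma IsWt.prod {p q : J} {K : Type*} (s : Finset K) {k : K → ℤ} {F : K → PS J}
    (hF : ∀ i, IsWt p q (k i) (F i)) : IsWt p q (∑ i ∈ s, k i) (∏ i ∈ s, F i) := by
  classical
  induction s using Finset.induction_on with
  | empty => simpa using IsWt.one
  | insert a s ha ih => rw [Finset.prod_insert ha, Finset.sum_insert ha]; exact (hF a).mul ih

/-- The weight of a coordinate. -/
def wj (p q : J) (j : J) : ℤ := if j = p then 1 else if j = q then -1 else 0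

lemma wj_eq_wt {p q : J} (hpq : p ≠ q) (j : J) : wt p q (Finsupp.single j 1) = wj p q j := by
  by_cases hp : j = p
  · subst hp; simp [wt, wj, hpq]
  · by_cases hq : j = q
    · subst hq; simp [wt, wj, hp]
    · simp [wt, wj, hp, hq]

lemma dv_t0 {p q : J} (j : J) : dv p q t0 j = t0 ^ wj p q j := by
  simp only [dv, wj]
  split_ifs <;> simp

lemma sum_wj {p q : J} (hpq : p ≠ q) (α : J →₀ ℕ) : ∑ j, (α j : ℤ) * wj p q j = wt p q α := by
  have h : ∀ j, (α j : ℤ) * wj p q j = (if j = p then (α p : ℤ) else 0) - if j = q then (α q : ℤ) else 0 := by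
    intro j
    by_cases hp : j = p
    · subst hp; simp [wj, hpq]
    · by_cases hq : j = q
      · subst hq; simp [wj, hp]
      · simp [wj, hp, hq]
  simp [h, wt]

lemma IsWt.pw {p q : J} (hpq : p ≠ q) {Φ : J → PS J} (hΦ : ∀ j, IsWt p q (wj p q j) (Φ j))
    (α : J →₀ ℕ) : IsWt p q (wt p q α) (pw Φ α) := by
  rw [← sum_wj hpq]
  exact IsWt.prod _ fun j => (hΦ j).pow (α j)

/-- The projection to the weight `k`. -/
def proj (p q : J) (k : ℤ) : PS J → PS J := scale fun α => if wt p q α = k then 1 else 0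

lemma ite_norm_le (P : Prop) [Decidable P] : ‖(if P then 1 else 0 : ℂ)‖ ≤ 1 := by
  split_ifs <;> simp

lemma cf_proj (p q : J) (k : ℤ) (F : PS J) (α : J →₀ ℕ) :
    cf α (proj p q k F) = if wt p q α = k then cf α F else 0 := by
  rw [proj, cf_scale (C := 1) fun α => ite_norm_le _]; simp

lemma isWt_proj (p q : J) (k : ℤ) (F : PS J) : IsWt p q k (proj p q k F) := by
  intro α hα
  rw [cf_proj] at hα
  by_contra h
  simp [h] at hα

lemma proj_eq_self {p q : J} {k : ℤ} {F : PS J} (hF : IsWt p q k F) : proj p q k F = F := by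
  refine ext_cf fun α => ?_
  rw [cf_proj]
  split_ifs with h
  · rfl
  · by_contra h2
    exact h (hF α (Ne.symm h2))

lemma proj_eq_zero {p q : J} {k l : ℤ} {F : PS J} (hF : IsWt p q l F) (h : l ≠ k) :
    proj p q k F = 0 := by
  refine ext_cf fun α => ?_
  rw [cf_proj, map_zero]
  split_ifs with h1
  · by_contra h2
    exact h ((hF α h2).symm.trans h1)
  · rfl

lemma proj_smul (p q : J) (k : ℤ) (c : ℂ) (F : PS J) : proj p q k (c • F) = c • proj p q k F :=
  lift_smul c F

/-- The projection as a continuous linear map. -/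
def projL (p q : J) (k : ℤ) : PS J →L[ℂ] PS J :=
  liftL (fun α => (if wt p q α = k then 1 else 0 : ℂ) • mon α)
    (norm_smul_mon_le (C := 1) fun _ => ite_norm_le _)

lemma projL_apply (p q : J) (k : ℤ) (F : PS J) : projL p q k F = proj p q k F := rfl

/-- Substitution of an equivariant family commutes with the projection to a weight. -/
lemma proj_sb {p q : J} (hpq : p ≠ q) {Φ : J → PS J} (hΦ : ∀ j, IsWt p q (wj p q j) (Φ j))
    (hn : ∀ j, ‖Φ j‖ ≤ 1) (k : ℤ) (G : PS J) :
    proj p q k (sb Φ G) = sb Φ (proj p q k G) := by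
  rw [← projL_apply, sb_eq_lift, map_lift (norm_pw_le_one hn), ← subL_apply hn, proj, scale,
    map_lift (norm_smul_mon_le (C := 1) fun _ => ite_norm_le _)]
  congr 1
  funext α
  rw [map_smul, subL_apply, sb_eq_lift, lift_mon, projL_apply]
  split_ifs with h
  · rw [one_smul, proj_eq_self]
    rw [← h]; exact IsWt.pw hpq hΦ α
  · rw [zero_smul, proj_eq_zero (IsWt.pw hpq hΦ α) h]

lemma proj_shrink (p q : J) (k : ℤ) {κ : ℝ} (h0 : 0 ≤ κ) (h1 : κ ≤ 1) (F : PS J) :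
    proj p q k (shrink κ F) = shrink κ (proj p q k F) := by
  refine ext_cf fun α => ?_
  rw [cf_proj, cf_shrink h0 h1, cf_shrink h0 h1, cf_proj]
  split_ifs <;> simp

lemma sb_zero (F : PS J) : sb (0 : J → ℂ) F = cf 0 F := by
  rw [sb, tsum_eq_single 0]
  · simp [pw_zero]
  · intro α hα
    have : ∃ j, α j ≠ 0 := by
      by_contra! h; exact hα (Finsupp.ext h)
    obtain ⟨j, hj⟩ := this
    rw [pw, Finset.prod_eq_zero (Finset.mem_univ j) (by simp [hj]), smul_zero]

lemma PS.Rep.apply_zero {f : (J → ℂ) → ℂ} {r : ℝ} {F : PS J} (h : Rep f r F) : f 0 = cf 0 F := by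
  rw [h.eq 0 (by simpa using h.pos.le), smul_zero, sb_zero]

lemma norm_shrink_le {κ : ℝ} (h0 : 0 ≤ κ) (h1 : κ ≤ 1) {F : PS J} {d : ℕ}
    (hF : ∀ α : J →₀ ℕ, α.degree < d → cf α F = 0) : ‖shrink κ F‖ ≤ κ ^ d * ‖F‖ := by
  rw [norm_eq_tsum, norm_eq_tsum, ← tsum_mul_left]
  refine (shrink κ F).summable_cf.tsum_le_tsum (fun α => ?_) (F.summable_cf.mul_left _)
  rw [cf_shrink h0 h1, norm_mul, norm_pow, Complex.norm_real, Real.norm_of_nonneg h0]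
  rcases lt_or_ge α.degree d with h | h
  · simp [hF α h]
  · gcongr ?_ * _
    exact pow_le_pow_of_le_one h0 h1 h

/-- Germs vanishing at the origin are represented by small power series on small polydiscs. -/
lemma exists_small_rep {K : Type*} [Finite K] {f : K → (J → ℂ) → ℂ}
    (hf : ∀ k, AnalyticAt ℂ (f k) 0) (h0 : ∀ k, f k 0 = 0) {ε : ℝ} (hε : 0 < ε) :
    ∃ r₀ > 0, ∀ r, 0 < r → r ≤ r₀ → ∃ Φ : K → PS J, ∀ k, Rep (f k) r (Φ k) ∧ ‖Φ k‖ ≤ ε := by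
  cases nonempty_fintype K
  obtain ⟨r₁, hr₁, h⟩ := exists_rep_family hf
  obtain ⟨F, hF⟩ := h r₁ hr₁ le_rfl
  set C : ℝ := ∑ k, ‖F k‖ + 1 with hC
  have hC0 : 0 < C := by positivity
  have hFC : ∀ k, ‖F k‖ ≤ C := fun k =>
    (Finset.single_le_sum (f := fun k => ‖F k‖) (fun _ _ => norm_nonneg _) (Finset.mem_univ k)).trans
      (by simp [hC])
  refine ⟨min r₁ (r₁ * (ε / C)), by positivity, fun r hr hr' => ?_⟩
  have hr1 : r ≤ r₁ := hr'.trans (min_le_left _ _)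
  have hr2 : r ≤ r₁ * (ε / C) := hr'.trans (min_le_right _ _)
  refine ⟨fun k => shrink (r / r₁) (F k), fun k => ⟨(hF k).shrink hr hr1, ?_⟩⟩
  refine (norm_shrink_le (d := 1) (by positivity) ((div_le_one hr₁).2 hr1) fun α hα => ?_).trans ?_
  · have : α = 0 := by
      rw [← Finsupp.degree_eq_zero_iff]; omega
    rw [this, ← (hF k).apply_zero, h0]
  · rw [pow_one]
    calc r / r₁ * ‖F k‖ ≤ (ε / C) * C := by
          refine mul_le_mul ?_ (hFC k) (norm_nonneg _) (by positivity)
          rw [div_le_iff₀ hr₁, mul_comm]; exact hr2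
      _ = ε := by field_simp

/-- `G` is a series in x / r, so the inner components are divided by r; the bound ‖Φ j‖ ≤ 1 keeps
the inner map inside the polydisc of `G`. -/
lemma PS.Rep.comp {g : (J → ℂ) → ℂ} {r r' : ℝ} {G : PS J} {f : (J → ℂ) → J → ℂ} {Φ : J → PS J}
    (hg : Rep g r G) (hf : ∀ j, Rep (fun x => (r : ℂ)⁻¹ * f x j) r' (Φ j)) (hΦ : ∀ j, ‖Φ j‖ ≤ 1)
    (hr' : 0 < r') : Rep (fun x => g (f x)) r' (sb Φ G) := by
  refine ⟨hr', fun x hx => ?_⟩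
  have hx1 := norm_apply_le (norm_smul_inv_le hr' hx)
  have hr : (r : ℂ) ≠ 0 := by exact_mod_cast hg.pos.ne'
  have h1 : (r : ℂ)⁻¹ • f x = fun j => sb ((r' : ℂ)⁻¹ • x) (Φ j) := by
    funext j
    rw [← (hf j).eq x hx]; rfl
  have h2 : ‖f x‖ ≤ r := by
    refine (pi_norm_le_iff_of_nonneg hg.pos.le).2 fun j => ?_
    have h3 : ‖(r : ℂ)⁻¹ * f x j‖ ≤ 1 := by
      rw [(hf j).eq x hx]; exact (norm_sb_le hx1 _).trans (hΦ j)
    rw [norm_mul, norm_inv, Complex.norm_real, Real.norm_of_nonneg hg.pos.le,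
      inv_mul_le_iff₀ hg.pos, mul_one] at h3
    exact h3
  rw [hg.eq _ h2, h1, sb_sb hx1 hΦ]

lemma lead_one {f : (J → ℂ) → ℂ} {r : ℝ} {F : PS J} (h : Rep f r F) (h0 : f 0 = 0)
    {A : (J → ℂ) →L[ℂ] ℂ} (hA : HasFDerivAt f A 0) (y : J → ℂ) : lead F 1 y = r * A y := by
  have hr : (r : ℂ) ≠ 0 := by exact_mod_cast h.pos.ne'
  have h1 := tendsto_slope hA h0 ((r : ℂ) • y)
  rw [map_smul, smul_eq_mul] at h1
  have h2 := tendsto_smul_line ((r : ℂ) • y) ((r : ℂ)⁻¹)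
  rw [smul_smul, inv_mul_cancel₀ hr, one_smul] at h2
  refine tendsto_nhds_unique (tendsto_lead (d := 1) (F := F) (fun α hα => ?_) h2) (h1.congr' ?_)
  · have : α = 0 := by
      rw [← Finsupp.degree_eq_zero_iff]; omega
    rw [this, ← h.apply_zero, h0]
  · filter_upwards [(tendsto_line0 ((r : ℂ) • y)).eventually (Metric.closedBall_mem_nhds _ h.pos)]
      with t ht
    rw [h.eq _ (by simpa using ht), pow_one, smul_eq_mul]

/-! ### Linear germs and the rotation -/

/-- The germ of a linear isomorphism. -/
def linG {V : Type*} [NormedAddCommGroup V] [NormedSpace ℂ V] (e : V ≃L[ℂ] V) : GG V :=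
  (exists_lin e).choose

section LinG
variable {V : Type*} [NormedAddCommGroup V] [NormedSpace ℂ V] (e : V ≃L[ℂ] V)

lemma linG_mem : linG e ∈ Hol V := (exists_lin e).choose_spec.1

lemma linG_rp : Rp (linG e) e := (exists_lin e).choose_spec.2.1

end LinG

/-- Multiplication by the vector `dv p q c`. -/
def dvE (p q : J) (c : ℂ) (hc : c ≠ 0) : (J → ℂ) ≃L[ℂ] (J → ℂ) :=
  ContinuousLinearEquiv.equivOfInverse (ContinuousLinearMap.mul ℂ (J → ℂ) (dv p q c))
    (ContinuousLinearMap.mul ℂ (J → ℂ) (dv p q c⁻¹))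
    (fun x => by
      rw [ContinuousLinearMap.mul_apply', ContinuousLinearMap.mul_apply', ← mul_assoc, ← dv_mul,
        inv_mul_cancel₀ hc, dv_one, one_mul])
    (fun x => by
      rw [ContinuousLinearMap.mul_apply', ContinuousLinearMap.mul_apply', ← mul_assoc, ← dv_mul,
        mul_inv_cancel₀ hc, dv_one, one_mul])

/-- The germ of the rotation. -/
def rotG (p q : J) : GG (J → ℂ) := linG (dvE p q t0 t0_ne_zero)

lemma rotG_mem (p q : J) : rotG p q ∈ Hol (J → ℂ) := linG_mem _

lemma rotG_rp (p q : J) : Rp (rotG p q) (rot p q) := linG_rp (dvE p q t0 t0_ne_zero)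

/-- The rotation is diagonal with entries t0 ^ `wj`, so commutation with it decouples into one
weight condition per component. -/
lemma comm_rotG_iff {p q : J} {F : GG (J → ℂ)} {f : (J → ℂ) → J → ℂ} (hF : F ∈ Hol (J → ℂ))
    (hr : Rp F f) : F * rotG p q = rotG p q * F ↔ ∀ j, HasWt p q (wj p q j) fun x => f x j := by
  have ha := analyticAt_pi_iff.1 (hr.analyticAt hF)
  constructor
  · intro h j
    have h1 := (hr.mul (rotG_rp p q)).eventuallyEq (h ▸ (rotG_rp p q).mul hr)
    refine ⟨ha j, ?_⟩
    filter_upwards [h1] with x hx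
    rw [hx, rot, Pi.mul_apply, dv_t0]
  · intro h
    refine (hr.mul (rotG_rp p q)).ext ((rotG_rp p q).mul hr) ?_
    filter_upwards [eventually_all.2 fun j => (h j).rot] with x hx
    funext j
    rw [hx, rot, Pi.mul_apply, dv_t0]

/-- `x_p` and `x_q` are multiplied by `c` and `c⁻¹`. -/
def sF (p q : J) (c : (J → ℂ) → ℂ) (x : J → ℂ) : J → ℂ := dv p q (c x) * x

lemma analyticAt_dv {p q : J} {c : (J → ℂ) → ℂ} (hc : AnalyticAt ℂ c 0) (hc0 : c 0 ≠ 0) :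
    AnalyticAt ℂ (fun x => dv p q (c x)) 0 := by
  refine analyticAt_pi_iff.2 fun j => ?_
  simp only [dv]
  split_ifs
  · exact hc
  · exact hc.inv hc0
  · exact analyticAt_const

lemma hasFDerivAt_mul_lin {m : (J → ℂ) → J → ℂ} (hm : AnalyticAt ℂ m 0) (B : (J → ℂ) →L[ℂ] J → ℂ) :
    HasFDerivAt (fun x => m x * B x) (ContinuousLinearMap.mul ℂ (J → ℂ) (m 0) ∘L B) 0 := by
  refine (hm.differentiableAt.hasFDerivAt.mul (B.hasFDerivAt (x := 0))).congr_fderiv ?_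
  ext x j
  simp

lemma analyticAt_mul_lin {m : (J → ℂ) → J → ℂ} (hm : AnalyticAt ℂ m 0)
    (B : (J → ℂ) →L[ℂ] J → ℂ) : AnalyticAt ℂ (fun x => m x * B x) 0 := hm.mul (B.analyticAt 0)

lemma sF_apply_left {p q : J} (c : (J → ℂ) → ℂ) (x : J → ℂ) : sF p q c x p = c x * x p := by
  simp [sF, dv_left]

lemma sF_apply_right {p q : J} (hpq : p ≠ q) (c : (J → ℂ) → ℂ) (x : J → ℂ) :
    sF p q c x q = (c x)⁻¹ * x q := by
  simp [sF, dv_right hpq]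

lemma sF_apply_other {p q j : J} (hp : j ≠ p) (hq : j ≠ q) (c : (J → ℂ) → ℂ) (x : J → ℂ) :
    sF p q c x j = x j := by
  simp [sF, dv_other hp hq]

lemma hasFDerivAt_sF {p q : J} {c : (J → ℂ) → ℂ} (hc : AnalyticAt ℂ c 0) (hc0 : c 0 ≠ 0) :
    HasFDerivAt (sF p q c) (ContinuousLinearMap.mul ℂ (J → ℂ) (dv p q (c 0))) 0 :=
  hasFDerivAt_mul_lin (analyticAt_dv hc hc0) (ContinuousLinearMap.id ℂ _)

/-- The factors c and c⁻¹ cancel in the product x_p x_q. -/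
lemma HasWt.comp_sF {p q : J} (hpq : p ≠ q) {f c : (J → ℂ) → ℂ} (hf : HasWt p q 0 f)
    (hc : AnalyticAt ℂ c 0) (hc0 : c 0 ≠ 0) : ∀ᶠ x in 𝓝 0, f (sF p q c x) = f x := by
  have h1 : Tendsto (sF p q c) (𝓝 0) (𝓝 0) := by
    have := (hasFDerivAt_sF (p := p) (q := q) hc hc0).continuousAt.tendsto
    simpa [sF] using this
  refine hf.comp_eq hpq (s' := fun x => x) h1 tendsto_id
    (.of_forall fun x j hp hq => sF_apply_other hp hq c x) ?_
  filter_upwards [hc.continuousAt.eventually_ne hc0] with x hx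
  rw [sF_apply_left, sF_apply_right hpq]
  field_simp

lemma sF_rot {p q : J} {c : (J → ℂ) → ℂ} (hc : HasWt p q 0 c) :
    ∀ᶠ x in 𝓝 0, sF p q c (rot p q x) = rot p q (sF p q c x) := by
  filter_upwards [hc.rot] with x hx
  rw [zpow_zero, one_mul] at hx
  rw [sF, hx, rot, sF, rot, mul_left_comm]

lemma hasWt_one {p q : J} : HasWt p q 0 fun _ : J → ℂ => (1 : ℂ) :=
  ⟨analyticAt_const, .of_forall fun x => by simp⟩

/-- A biholomorphism that intertwines two hyperbolic normal forms commutes with the rotation. -/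
theorem comm_rotG_of_intertwine {p q : J} (hpq : p ≠ q) {μ : ℂ} (hμ : μ ≠ 0)
    (hμ1 : ∀ n : ℤ, μ ^ n = 1 → n = 0) {c c' : (J → ℂ) → ℂ} (hc : HasWt p q 0 c)
    (hc' : HasWt p q 0 c') (h0 : c 0 = μ) (h0' : c' 0 = μ) {K S S' : GG (J → ℂ)}
    (hK : K ∈ Hol (J → ℂ)) (hS : Rp S (sF p q c)) (hS' : Rp S' (sF p q c'))
    (h : K * S = S' * K) : K * rotG p q = rotG p q * K := by
  obtain ⟨k, hk⟩ := exists_rp K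
  rw [comm_rotG_iff hK hk]
  have ha := analyticAt_pi_iff.1 (hk.analyticAt hK)
  have hint : ∀ᶠ x in 𝓝 0, k (sF p q c x) = sF p q c' (k x) :=
    (hk.mul hS).eventuallyEq (h ▸ hS'.mul hk)
  have hd := hasFDerivAt_sF (p := p) (q := q) hc.an (by rwa [h0])
  have hdS : ∀ y, (ContinuousLinearMap.mul ℂ (J → ℂ) (dv p q (c 0))) y = dv p q μ * y := fun y => by
    rw [h0]; rfl
  have hs0 : sF p q c 0 = 0 := by simp [sF]
  have key : ∀ (m : ℤ) (f e : (J → ℂ) → ℂ), AnalyticAt ℂ f 0 → HasWt p q 0 e → e 0 = μ ^ m →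
      (∀ᶠ x in 𝓝 0, f (sF p q c x) = e x * f x) → HasWt p q m f := fun m f e hf he he0 hfe =>
    hasWt_of_comp hpq hμ hμ1 hf hd hdS hs0 (sF_rot hc) he.an.continuousAt
      (by filter_upwards [he.rot] with x hx; simpa using hx) he0 hfe
  have hcan : AnalyticAt ℂ (fun x => c' (k x)) 0 :=
    AnalyticAt.comp (g := c') (by rw [hk.map_zero]; exact hc'.an) (hk.analyticAt hK)
  -- c' is invariant under the second normal form, hence c' ∘ k is invariant under the first. This
  -- makes it an admissible multiplier in the equations for the components p and q of k.
  have he : HasWt p q 0 fun x => c' (k x) := by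
    refine key 0 _ (fun _ => 1) hcan hasWt_one (by simp) ?_
    filter_upwards [hint, hk.tendsto.eventually (hc'.comp_sF hpq hc'.an (by rwa [h0']))]
      with x h1 h2
    rw [h1, h2, one_mul]
  have he0 : c' (k 0) = μ := by rw [hk.map_zero, h0']
  intro j
  by_cases hp : j = p
  · subst hp
    rw [show wj j q j = 1 by simp [wj]]
    refine key 1 _ _ (ha j) he (by rw [he0, zpow_one]) ?_
    filter_upwards [hint] with x h1
    rw [h1, sF_apply_left]
  · by_cases hq : j = q
    · subst hq
      rw [show wj p j j = -1 by simp [wj, hp]]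
      refine key (-1) _ (fun x => (c' (k x))⁻¹) (ha j) ⟨hcan.inv (by rwa [he0]), ?_⟩
        (by rw [he0, zpow_neg_one]) ?_
      · filter_upwards [he.rot] with x h1
        rw [h1]; simp
      · filter_upwards [hint] with x h1
        rw [h1, sF_apply_right hpq]
    · rw [show wj p q j = 0 by simp [wj, hp, hq]]
      refine key 0 _ (fun _ => 1) (ha j) hasWt_one (by simp) ?_
      filter_upwards [hint] with x h1
      rw [h1, sF_apply_other hp hq, one_mul]

/-! ### Averaging over the rotations -/

/-- The equivariant part of a germ tangent to the identity is again tangent to the identity, and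
inherits intertwining relations with germs that commute with the rotation. -/
theorem exists_equivariant_part {p q : J} (hpq : p ≠ q) {G : GG (J → ℂ)} (hG : G ∈ Hol (J → ℂ))
    (hD : D G = 1) : ∃ G' ∈ Hol (J → ℂ), D G' = 1 ∧ G' * rotG p q = rotG p q * G' ∧
      ∀ (F Δ : GG (J → ℂ)) (v : J → ℂ), F ∈ Hol (J → ℂ) → F * rotG p q = rotG p q * F →
        Rp Δ (fun x => v * x) → G * F = Δ * G → G' * F = Δ * G' := by
  obtain ⟨g, hg⟩ := exists_rp G
  have ha := analyticAt_pi_iff.1 (hg.analyticAt hG)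
  obtain ⟨r, hr, h⟩ := exists_rep_family ha
  obtain ⟨A, hA⟩ := h r hr le_rfl
  have hr0 : (r : ℂ) ≠ 0 := by exact_mod_cast hr.ne'
  have hd := hasFDerivAt_pi'.1 (hg.hasFDerivAt hG)
  rw [hD] at hd
  -- Averaging over the circle is done algebraically: component j keeps only the monomials of the
  -- weight of x_j.
  set B : J → PS J := fun j => proj p q (wj p q j) (A j) with hB
  set g' : (J → ℂ) → J → ℂ := fun x j => sb ((r : ℂ)⁻¹ • x) (B j) with hg'
  have hrep : ∀ j, Rep (fun x => g' x j) r (B j) := fun j => ⟨hr, fun x _ => rfl⟩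
  have ha' : AnalyticAt ℂ g' 0 := analyticAt_pi_iff.2 fun j => (hrep j).analyticAt
  have hA0 : ∀ j, cf 0 (A j) = 0 := fun j => by
    rw [← (hA j).apply_zero, hg.map_zero]; rfl
  have h00 : ∀ j, g' 0 j = 0 := fun j => by
    rw [(hrep j).apply_zero, hB, cf_proj, hA0]; simp
  have hcf : ∀ j, ∀ α : J →₀ ℕ, α.degree = 1 → cf α (A j) = if α = Finsupp.single j 1 then (r : ℂ) else 0 := by
    intro j α hα
    rw [← sub_eq_zero]
    refine coeff_eq_zero_of_sum (c := fun α => cf α (A j) - if α = Finsupp.single j 1 then (r : ℂ) else 0)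
      (d := 1) (fun y => ?_) α hα
    have h1 := lead_one (hA j) (by rw [hg.map_zero]; rfl) (hd j) y
    simp only [sub_mul, Finset.sum_sub_distrib]
    rw [← lead, h1, sub_eq_zero]
    simp only [ite_mul, zero_mul]
    rw [Finset.sum_ite_eq', if_pos (mem_degSet.2 (by simp))]
    congr 1
    rw [pw, Finset.prod_eq_single j]
    · simp
    · intro i _ hi; simp [hi.symm]
    · simp
  -- The linear part of component j is x_j, which already has the retained weight, so the projection
  -- leaves it unchanged.
  have hd' : HasFDerivAt g' (1 : (J → ℂ) →L[ℂ] J → ℂ) 0 := by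
    refine hasFDerivAt_pi'.2 fun j => ?_
    refine ((hrep j).analyticAt.differentiableAt.hasFDerivAt).congr_fderiv ?_
    ext1 y
    have h1 := lead_one (hrep j) (h00 j) ((hrep j).analyticAt.differentiableAt.hasFDerivAt) y
    have h2 := lead_one (hA j) (by rw [hg.map_zero]; rfl) (hd j) y
    have h3 : lead (B j) 1 y = lead (A j) 1 y := by
      refine Finset.sum_congr rfl fun α hα => ?_
      rw [hB, cf_proj, hcf j α (mem_degSet.1 hα)]
      by_cases h4 : α = Finsupp.single j 1
      · rw [h4, wj_eq_wt hpq, if_pos rfl]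
      · simp [h4]
    rw [h3, h2] at h1
    exact (mul_left_cancel₀ hr0 h1).symm
  obtain ⟨G', hG', hgr', hD'⟩ := exists_hol_of_hasFDerivAt ha' (funext h00)
    (ContinuousLinearMap.IsInvertible.of_inverse (g := 1) rfl rfl) hd'
  refine ⟨G', hG', hD', ?_, ?_⟩
  · rw [comm_rotG_iff hG' hgr']
    exact fun j => (isWt_proj _ _ _ _).hasWt hpq (hrep j)
  · intro F Δ v hF hFR hΔ hGF
    obtain ⟨f, hf⟩ := exists_rp F
    have hwt := (comm_rotG_iff hF hf).1 hFR
    have hfa := analyticAt_pi_iff.1 (hf.analyticAt hF)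
    obtain ⟨r₁, hr₁, h1⟩ := exists_small_rep (f := fun j x => (r : ℂ)⁻¹ * f x j)
      (fun j => analyticAt_const.mul (hfa j)) (fun j => by rw [hf.map_zero]; simp) one_pos
    set r' := min r₁ r with hr'
    have hr'0 : 0 < r' := lt_min hr₁ hr
    obtain ⟨Φ, hΦ⟩ := h1 r' hr'0 (min_le_left _ _)
    have hΦwt : ∀ j, IsWt p q (wj p q j) (Φ j) := by
      intro j
      refine HasWt.isWt hpq ⟨analyticAt_const.mul (hfa j), ?_⟩ (hΦ j).1
      filter_upwards [(hwt j).rot] with x hx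
      simp only [Pi.mul_apply]; rw [hx]; ring
    have hκ0 : 0 ≤ r' / r := by positivity
    have hκ1 : r' / r ≤ 1 := (div_le_one hr).2 (min_le_right _ _)
    have hsmulrep : ∀ (f : (J → ℂ) → ℂ) (F : PS J) (c : ℂ), Rep f r' F →
        Rep (fun x => c * f x) r' (c • F) := fun f F c hf => ⟨hf.pos, fun x hx => by
      rw [hf.eq x hx, sb_eq_lift, sb_eq_lift, lift_smul, smul_eq_mul]⟩
    have key : ∀ j, sb Φ (A j) = v j • shrink (r' / r) (A j) := by
      intro j
      refine ((hA j).comp (fun i => (hΦ i).1) (fun i => (hΦ i).2) hr'0).unique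
        (hsmulrep _ _ (v j) ((hA j).shrink hr'0 (min_le_right _ _))) ?_
      filter_upwards [(hg.mul hf).eventuallyEq (hGF ▸ hΔ.mul hg)] with x hx
      rw [hx]; rfl
    -- Substitution of the equivariant F and multiplication by the diagonal Δ both respect weights,
    -- so the relation for G can be projected to a single weight.
    have key2 : ∀ j, sb Φ (B j) = v j • shrink (r' / r) (B j) := by
      intro j
      rw [hB, ← proj_sb hpq hΦwt (fun i => (hΦ i).2), key, proj_smul, proj_shrink _ _ _ hκ0 hκ1]
    refine (hgr'.mul hf).ext (hΔ.mul hgr') ?_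
    filter_upwards [Metric.closedBall_mem_nhds (0 : J → ℂ) hr'0] with x hx
    have hx' : ‖x‖ ≤ r' := by simpa using hx
    funext j
    rw [((hrep j).comp (fun i => (hΦ i).1) (fun i => (hΦ i).2) hr'0).eq x hx', key2,
      ← (hsmulrep _ _ (v j) ((hrep j).shrink hr'0 (min_le_right _ _))).eq x hx']
    rfl

end Centralizer

/-! ### The equations of a normalizing map and their solution by contraction -/

section FixedPoint
open PS
variable {J : Type*} [Fintype J] [DecidableEq J]

/-- The coefficients of degree less than `d` vanish. -/
def Ord (d : ℕ) (F : PS J) : Prop := ∀ α : J →₀ ℕ, α.degree < d → cf α F = 0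

/-- All monomials of `F` have weight in `A`. -/
def Wts (p q : J) (A : Set ℤ) (F : PS J) : Prop := ∀ α, cf α F ≠ 0 → wt p q α ∈ A

lemma Ord.add {d : ℕ} {F G : PS J} (hF : Ord d F) (hG : Ord d G) : Ord d (F + G) :=
  fun α hα => by rw [map_add, hF α hα, hG α hα, add_zero]

lemma Ord.sub {d : ℕ} {F G : PS J} (hF : Ord d F) (hG : Ord d G) : Ord d (F - G) :=
  fun α hα => by rw [map_sub, hF α hα, hG α hα, sub_zero]

lemma Ord.smul {d : ℕ} {F : PS J} (c : ℂ) (hF : Ord d F) : Ord d (c • F) :=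
  fun α hα => by rw [map_smul, hF α hα, smul_zero]

lemma Ord.zero {d : ℕ} : Ord d (0 : PS J) := fun _ _ => map_zero _

lemma Ord.mono {d d' : ℕ} (h : d' ≤ d) {F : PS J} (hF : Ord d F) : Ord d' F :=
  fun α hα => hF α (hα.trans_le h)

lemma Ord.mul {d d' : ℕ} {F G : PS J} (hF : Ord d F) (hG : Ord d' G) : Ord (d + d') (F * G) := by
  intro α hα
  rw [cf_mul]
  refine Finset.sum_eq_zero fun x hx => ?_
  rw [Finset.HasAntidiagonal.mem_antidiagonal] at hx
  have h : x.1.degree + x.2.degree = α.degree := by rw [← hx, map_add]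
  by_cases h1 : x.1.degree < d
  · rw [hF _ h1, zero_mul]
  · rw [hG _ (by omega), mul_zero]

lemma Ord.nil {F : PS J} : Ord 0 F := fun _ h => absurd h (Nat.not_lt_zero _)

lemma Ord.mul_left {d : ℕ} {F G : PS J} (hG : Ord d G) : Ord d (F * G) := by
  simpa using Ord.nil.mul hG

lemma Ord.mon {d : ℕ} {α : J →₀ ℕ} (h : d ≤ α.degree) : Ord d (mon α : PS J) := by
  intro β hβ
  rw [cf_mon, if_neg]
  rintro rfl
  omega

lemma Ord.pow {F : PS J} (hF : Ord 1 F) (n : ℕ) : Ord n (F ^ n) := by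
  induction n with
  | zero => exact .nil
  | succ n ih => rw [pow_succ]; exact ih.mul hF

lemma Ord.pw {Φ : J → PS J} (hΦ : ∀ j, Ord 1 (Φ j)) (α : J →₀ ℕ) : Ord α.degree (pw Φ α) := by
  have : ∀ s : Finset J, Ord (∑ j ∈ s, α j) (∏ j ∈ s, Φ j ^ α j) := by
    intro s
    induction s using Finset.induction_on with
    | empty => exact .nil
    | insert i s hi ih =>
      rw [Finset.sum_insert hi, Finset.prod_insert hi]
      exact ((hΦ i).pow _).mul ih
  have h := this Finset.univ
  rwa [← Finsupp.degree_eq_sum] at h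

lemma lift_zero_fun {W : Type*} [NormedAddCommGroup W] [NormedSpace ℂ W] (F : PS J) :
    lift (fun _ => (0 : W)) F = 0 := by
  simp [lift]

lemma Ord.lift {d : ℕ} {g : (J →₀ ℕ) → PS J} {C : ℝ} (hg : ∀ α, ‖g α‖ ≤ C) {F : PS J}
    (h : ∀ α, cf α F ≠ 0 → Ord d (g α)) : Ord d (lift g F) := by
  intro β hβ
  rw [map_lift hg, lift_congr F (g' := fun _ => 0) fun α hα => h α hα β hβ, lift_zero_fun]

lemma Wts.lift {p q : J} {A : Set ℤ} {g : (J →₀ ℕ) → PS J} {C : ℝ} (hg : ∀ α, ‖g α‖ ≤ C)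
    {F : PS J} (h : ∀ α, cf α F ≠ 0 → Wts p q A (g α)) : Wts p q A (lift g F) := by
  intro β hβ
  by_contra hA
  refine hβ ?_
  rw [map_lift hg, lift_congr F (g' := fun _ => 0) fun α hα => ?_, lift_zero_fun]
  by_contra h0
  exact hA (h α hα β h0)

lemma IsWt.wts {p q : J} {k : ℤ} {A : Set ℤ} {F : PS J} (hF : IsWt p q k F) (hk : k ∈ A) :
    Wts p q A F := fun α hα => by rwa [hF α hα]

lemma Wts.add {p q : J} {A : Set ℤ} {F G : PS J} (hF : Wts p q A F) (hG : Wts p q A G) :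
    Wts p q A (F + G) := by
  intro α hα
  by_contra h
  refine hα ?_
  rw [map_add, not_not.1 fun h0 => h (hF α h0), not_not.1 fun h0 => h (hG α h0), add_zero]

lemma Wts.sub {p q : J} {A : Set ℤ} {F G : PS J} (hF : Wts p q A F) (hG : Wts p q A G) :
    Wts p q A (F - G) := by
  intro α hα
  by_contra h
  refine hα ?_
  rw [map_sub, not_not.1 fun h0 => h (hF α h0), not_not.1 fun h0 => h (hG α h0), sub_zero]

open Classical in
/-- The part of a power series with weights in `A`. -/
def cut (p q : J) (A : Set ℤ) : PS J → PS J := scale fun α => if wt p q α ∈ A then 1 else 0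

open Classical in
lemma cf_cut (p q : J) (A : Set ℤ) (F : PS J) (α : J →₀ ℕ) :
    cf α (cut p q A F) = if wt p q α ∈ A then cf α F else 0 := by
  rw [cut, cf_scale (C := 1) fun α => ite_norm_le _]
  split_ifs <;> simp

lemma wts_cut (p q : J) (A : Set ℤ) (F : PS J) : Wts p q A (cut p q A F) := by
  classical
  intro α hα
  rw [cf_cut] at hα
  by_contra h
  exact hα (if_neg h)

lemma cut_add (p q : J) (A : Set ℤ) (F G : PS J) :
    cut p q A (F + G) = cut p q A F + cut p q A G := by
  classical
  refine ext_cf fun α => ?_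
  rw [map_add, cf_cut, cf_cut, cf_cut]; split_ifs <;> simp

lemma cut_sub (p q : J) (A : Set ℤ) (F G : PS J) :
    cut p q A (F - G) = cut p q A F - cut p q A G := by
  classical
  refine ext_cf fun α => ?_
  rw [map_sub, cf_cut, cf_cut, cf_cut]; split_ifs <;> simp

lemma cut_smul (p q : J) (A : Set ℤ) (c : ℂ) (F : PS J) :
    cut p q A (c • F) = c • cut p q A F := by
  classical
  refine ext_cf fun α => ?_
  rw [map_smul, cf_cut, cf_cut]; split_ifs <;> simp

lemma Ord.cut {p q : J} {A : Set ℤ} {d : ℕ} {F : PS J} (hF : Ord d F) : Ord d (cut p q A F) := by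
  classical
  intro α hα
  rw [cf_cut, hF α hα, ite_self]

lemma norm_cut_add_le {p q : J} {A B : Set ℤ} (h : Disjoint A B) (F : PS J) :
    ‖cut p q A F‖ + ‖cut p q B F‖ ≤ ‖F‖ := by
  classical
  rw [norm_eq_tsum, norm_eq_tsum, norm_eq_tsum, ← (summable_cf _).tsum_add (summable_cf _)]
  refine ((summable_cf _).add (summable_cf _)).tsum_le_tsum (fun α => ?_) (summable_cf _)
  rw [cf_cut, cf_cut]
  by_cases h1 : wt p q α ∈ A
  · rw [if_pos h1, if_neg (Set.disjoint_left.1 h h1), norm_zero, add_zero]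
  · rw [if_neg h1, norm_zero, zero_add]
    split_ifs
    · rfl
    · rw [norm_zero]; exact norm_nonneg _

lemma norm_cut_le (p q : J) (A : Set ℤ) (F : PS J) : ‖cut p q A F‖ ≤ ‖F‖ :=
  (le_add_of_nonneg_right (norm_nonneg _)).trans (norm_cut_add_le (disjoint_compl_right (a := A)) F)

lemma cut_add_cut {p q : J} {A B : Set ℤ} (h : Disjoint A B) (F : PS J) (hF : Wts p q (A ∪ B) F) :
    cut p q A F + cut p q B F = F := by
  classical
  refine ext_cf fun α => ?_
  rw [map_add, cf_cut, cf_cut]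
  by_cases h0 : cf α F = 0
  · simp [h0]
  by_cases h1 : wt p q α ∈ A
  · rw [if_pos h1, if_neg (Set.disjoint_left.1 h h1), add_zero]
  · rw [if_neg h1, zero_add, if_pos ((hF α h0).resolve_left h1)]

/-- Multiply the part of weight `k` by `N ^ |k|`. -/
def wp (p q : J) (N : PS J) (F : PS J) : PS J :=
  lift (fun α => N ^ (wt p q α).natAbs * mon α) F

lemma norm_wp_aux {N : PS J} {ν : ℝ} (hN : ‖N‖ ≤ ν) (n : ℕ) (α : J →₀ ℕ) :
    ‖N ^ n * mon α‖ ≤ ν ^ n := by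
  refine (norm_mul_le _ _).trans ?_
  rw [norm_mon, mul_one]
  exact (norm_pow_le _ _).trans (by gcongr)

lemma wp_bdd (p q : J) {N : PS J} (hN : ‖N‖ ≤ 1) (α : J →₀ ℕ) :
    ‖N ^ (wt p q α).natAbs * (mon α : PS J)‖ ≤ 1 :=
  (norm_wp_aux hN _ _).trans (by simp)

lemma norm_wp_le {p q : J} {N : PS J} {ν : ℝ} (hN : ‖N‖ ≤ ν) (hν : ν ≤ 1) {d : ℕ} {F : PS J}
    {A : Set ℤ} (hF : Wts p q A F) (hA : ∀ k ∈ A, d ≤ k.natAbs) : ‖wp p q N F‖ ≤ ν ^ d * ‖F‖ :=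
  norm_lift_le' F fun α hα => (norm_wp_aux hN _ _).trans
    (pow_le_pow_of_le_one ((norm_nonneg _).trans hN) hν (hA _ (hF α hα)))

lemma wp_sub {p q : J} {N : PS J} (hN : ‖N‖ ≤ 1) (F G : PS J) :
    wp p q N (F - G) = wp p q N F - wp p q N G := lift_sub (wp_bdd p q hN) F G

/-- The factor is a geometric sum bounded independently of the exponent; this makes `wp` Lipschitz
in N although arbitrarily large powers of N occur. -/
lemma norm_pow_sub_pow_le {B : Type*} [NormedCommRing B] [NormOneClass B] {x y : B} {ν : ℝ}
    (hx : ‖x‖ ≤ ν) (hy : ‖y‖ ≤ ν) (hν : ν < 1) (n : ℕ) :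
    ‖x ^ n - y ^ n‖ ≤ (1 - ν)⁻¹ * ‖x - y‖ := by
  have hν0 : 0 ≤ ν := (norm_nonneg _).trans hx
  have key : ∀ n : ℕ, ‖x ^ n - y ^ n‖ ≤ (∑ i ∈ Finset.range n, ν ^ i) * ‖x - y‖ := by
    intro n
    induction n with
    | zero => simp
    | succ n ih =>
      have e : x ^ (n + 1) - y ^ (n + 1) = x * (x ^ n - y ^ n) + (x - y) * y ^ n := by ring
      rw [e, Finset.sum_range_succ']
      calc _ ≤ ‖x‖ * ‖x ^ n - y ^ n‖ + ‖x - y‖ * ‖y ^ n‖ :=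
            (norm_add_le _ _).trans (add_le_add (norm_mul_le _ _) (norm_mul_le _ _))
        _ ≤ ν * ((∑ i ∈ Finset.range n, ν ^ i) * ‖x - y‖) + ‖x - y‖ * 1 := by
            gcongr
            exact (norm_pow_le _ _).trans (pow_le_one₀ (norm_nonneg _) (hy.trans hν.le))
        _ = _ := by rw [add_mul, ← mul_assoc, Finset.mul_sum]; simp [pow_succ, mul_comm]
  refine (key n).trans (mul_le_mul_of_nonneg_right ?_ (norm_nonneg _))
  rw [← tsum_geometric_of_lt_one hν0 hν]
  exact (summable_geometric_of_lt_one hν0 hν).sum_le_tsum _ fun i _ => by positivity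

lemma norm_wp_sub_le {p q : J} {N N' : PS J} {ν : ℝ} (hN : ‖N‖ ≤ ν) (hN' : ‖N'‖ ≤ ν) (hν : ν < 1)
    (F : PS J) : ‖wp p q N F - wp p q N' F‖ ≤ (1 - ν)⁻¹ * ‖N - N'‖ * ‖F‖ := by
  have e : wp p q N F - wp p q N' F =
      lift (fun α => N ^ (wt p q α).natAbs * mon α - N' ^ (wt p q α).natAbs * mon α) F := by
    have h1 := hasSum_lift (wp_bdd p q (hN.trans hν.le)) F
    have h2 := hasSum_lift (wp_bdd p q (hN'.trans hν.le)) F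
    have h3 := h1.sub h2
    simp only [← smul_sub] at h3
    exact h3.tsum_eq.symm
  rw [e]
  refine norm_lift_le (fun α => ?_) F
  rw [← sub_mul]
  refine (norm_mul_le _ _).trans ?_
  rw [norm_mon, mul_one]
  exact norm_pow_sub_pow_le hN hN' hν _

lemma Ord.wp {p q : J} {N : PS J} (hN : ‖N‖ ≤ 1) {d : ℕ} {F : PS J} (hF : Ord d F) :
    Ord d (wp p q N F) :=
  Ord.lift (wp_bdd p q hN) fun α hα => (Ord.mon (by
    by_contra h
    exact hα (hF α (not_le.1 h)))).mul_left

lemma Wts.wp {p q : J} {N : PS J} (hN : ‖N‖ ≤ 1) (hN0 : IsWt p q 0 N) {A : Set ℤ} {F : PS J}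
    (hF : Wts p q A F) : Wts p q A (wp p q N F) := by
  refine Wts.lift (wp_bdd p q hN) fun α hα => ?_
  have h := (hN0.pow (wt p q α).natAbs).mul (IsWt.mon (p := p) (q := q) α)
  exact h.wts (by simpa using hF α hα)

/-- `F / x_p` on the part of weight one. -/
def dvd (p q : J) (F : PS J) : PS J :=
  lift (fun α => if wt p q α = 1 then mon (α - Finsupp.single p 1) else 0) F

lemma dvd_bdd (p q : J) (α : J →₀ ℕ) :
    ‖(if wt p q α = 1 then mon (α - Finsupp.single p 1) else 0 : PS J)‖ ≤ 1 := by
  split_ifs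
  · rw [norm_mon]
  · simp

lemma norm_dvd_le (p q : J) (F : PS J) : ‖dvd p q F‖ ≤ ‖F‖ :=
  (norm_lift_le (dvd_bdd p q) F).trans_eq (one_mul _)

lemma dvd_sub (p q : J) (F G : PS J) : dvd p q (F - G) = dvd p q F - dvd p q G :=
  lift_sub (dvd_bdd p q) F G

lemma Ord.dvd {p q : J} {d : ℕ} {F : PS J} (hF : Ord (d + 1) F) : Ord d (dvd p q F) := by
  refine Ord.lift (dvd_bdd p q) fun α hα => ?_
  split_ifs with h
  · refine Ord.mon ?_
    have h1 : d + 1 ≤ α.degree := by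
      by_contra h
      exact hα (hF α (not_le.1 h))
    have h2 : Finsupp.single p 1 ≤ α := by
      rw [Finsupp.single_le_iff]
      have : (α p : ℤ) - α q = 1 := h
      omega
    have h3 : (α - Finsupp.single p 1).degree + 1 = α.degree := by
      conv_rhs => rw [← tsub_add_cancel_of_le h2, map_add, Finsupp.degree_single]
    omega
  · exact .zero

/-- In weight one the exponent of x_p is positive, so the truncated subtraction in `dvd` is a
genuine division. -/
lemma X_mul_dvd (p q : J) (F : PS J) : X p * dvd p q F = cut p q {1} F := by
  classical
  have h := map_lift (dvd_bdd p q) (ContinuousLinearMap.mul ℂ (PS J) (X p)) F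
  refine h.trans ?_
  refine lift_congr F fun α _ => ?_
  simp only [ContinuousLinearMap.mul_apply', Set.mem_singleton_iff]
  split_ifs with h
  · have h2 : Finsupp.single p 1 ≤ α := by
      rw [Finsupp.single_le_iff]
      have : (α p : ℤ) - α q = 1 := h
      omega
    rw [X, ← mon_add, add_tsub_cancel_of_le h2, one_smul]
  · simp

/-- Exchange the variables `x_p` and `x_q`. -/
def Sw (p q : J) (F : PS J) : PS J := sb (fun j => X (Equiv.swap p q j)) F

lemma Sw_sub (p q : J) (F G : PS J) : Sw p q (F - G) = Sw p q F - Sw p q G :=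
  lift_sub (norm_pw_le_one fun _ => (norm_X _).le) F G

lemma norm_Sw_le (p q : J) (F : PS J) : ‖Sw p q F‖ ≤ ‖F‖ := norm_sb_le (fun _ => (norm_X _).le) F

lemma sb_Sw (p q : J) {x : J → ℂ} (hx : ‖x‖ ≤ 1) (F : PS J) :
    sb x (Sw p q F) = sb (x ∘ Equiv.swap p q) F := by
  rw [Sw, sb_sb (norm_apply_le hx) fun _ => (norm_X _).le]
  simp only [sb_X]; rfl

lemma Ord.X (j : J) : Ord 1 (X j : PS J) := Ord.mon (by simp)

lemma Ord.Sw {p q : J} {d : ℕ} {F : PS J} (hF : Ord d F) : Ord d (Sw p q F) :=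
  Ord.lift (norm_pw_le_one fun _ => (norm_X _).le) fun α hα =>
    (Ord.pw (fun _ => Ord.X _) α).mono (by
      by_contra h
      exact hα (hF α (not_le.1 h)))

lemma X_isWt {p q : J} (hpq : p ≠ q) (j : J) : IsWt p q (wj p q j) (X j : PS J) := by
  rw [← wj_eq_wt hpq]; exact IsWt.mon _

lemma wj_swap {p q : J} (hpq : p ≠ q) (j : J) : wj p q (Equiv.swap p q j) = -wj p q j := by
  unfold wj
  rcases eq_or_ne j p with rfl | h1
  · simp [hpq.symm]
  rcases eq_or_ne j q with rfl | h2
  · simp [hpq.symm]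
  · simp [Equiv.swap_apply_of_ne_of_ne h1 h2, h1, h2]

lemma Wts.Sw {p q : J} (hpq : p ≠ q) {A : Set ℤ} {F : PS J} (hF : Wts p q (-A) F) :
    Wts p q A (Sw p q F) := by
  refine Wts.lift (norm_pw_le_one fun _ => (norm_X _).le) fun α hα => ?_
  have h := IsWt.prod (p := p) (q := q) Finset.univ
    (fun j => (X_isWt hpq (Equiv.swap p q j)).pow (α j))
  refine h.wts ?_
  have e : ∑ j, (α j : ℤ) * wj p q (Equiv.swap p q j) = -wt p q α := by
    rw [← sum_wj hpq, ← Finset.sum_neg_distrib]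
    exact Finset.sum_congr rfl fun j _ => by rw [wj_swap hpq]; ring
  rw [e]
  exact hF α hα

/-- The candidates for a normalizing map; they commute with the exchange of `x_p` and `x_q`. -/
def nf (p q : J) (Y : J → PS J) (j : J) : PS J := X j + Y j + Sw p q (Y (Equiv.swap p q j))

lemma norm_nf_le {p q : J} {Y : J → PS J} {η : ℝ} (hY : ∀ j, ‖Y j‖ ≤ η) (hη : η ≤ 1 / 2) (j : J) :
    ‖nf p q Y j‖ ≤ 2 := by
  have h1 := norm_add₃_le (a := X j) (b := Y j) (c := Sw p q (Y (Equiv.swap p q j)))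
  have h2 := (norm_Sw_le p q (Y (Equiv.swap p q j))).trans (hY _)
  have h3 := hY j
  rw [norm_X] at h1
  unfold nf
  linarith

lemma norm_nf_sub_le {p q : J} (Y Y' : J → PS J) : ‖nf p q Y - nf p q Y'‖ ≤ 2 * ‖Y - Y'‖ := by
  refine (pi_norm_le_iff_of_nonneg (by positivity)).2 fun j => ?_
  have e : (nf p q Y - nf p q Y') j = (Y - Y') j + Sw p q ((Y - Y') (Equiv.swap p q j)) := by
    simp only [nf, Pi.sub_apply, Sw_sub]; abel
  rw [e, two_mul]
  exact (norm_add_le _ _).trans (add_le_add (norm_le_pi_norm _ _)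
    ((norm_Sw_le _ _ _).trans (norm_le_pi_norm _ _)))

lemma Ord.nf {p q : J} {Y : J → PS J} (hY : ∀ j, Ord 2 (Y j)) (j : J) : Ord 1 (nf p q Y j) :=
  ((Ord.X j).add ((hY j).mono (by norm_num))).add ((hY _).Sw.mono (by norm_num))

/-- The equation for the component `x_p` of a normalizing map. -/
def eqP (p q : J) (μ : ℂ) (N Y H : PS J) : PS J :=
  wp p q N (cut p q (Set.Ici 2) (μ • Y + H)) +
    μ⁻¹ • (wp p q N (cut p q (Set.Iic 0) Y) - cut p q (Set.Iic 0) H)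

/-- The equation for the components other than `x_p` and `x_q`. -/
def eqZ (p q : J) (N Y H : PS J) : PS J := wp p q N (cut p q (Set.Ici 1) (Y + H))

/-- The equation for the multiplier. -/
def eqN (p q : J) (μ : ℂ) (N H : PS J) : PS J := μ⁻¹ • (1 - proj p q 0 (N * dvd p q H))

/-- In weight k the conjugacy equation reads (n^{-k} - μ) Y_k = H_k. Solving for the dominant term
gives the factors μ n^k when k ≥ 2 and μ⁻¹ n^{-k} when k ≤ 0, both bounded by κ. Weight one is left
out of Y: it determines n. Since the weight ranges are disjoint, the norms add and no constant is
lost. -/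
lemma norm_eqP_le {p q : J} {μ : ℂ} {N : PS J} {ν κ : ℝ} (hN : ‖N‖ ≤ ν) (hν : ν ≤ 1)
    (hμ : 1 < ‖μ‖) (h1 : ‖μ‖ * ν ^ 2 ≤ κ) (h2 : ‖μ‖⁻¹ ≤ κ) (Y H : PS J) :
    ‖eqP p q μ N Y H‖ ≤ κ * ‖Y‖ + ‖H‖ := by
  have hd : Disjoint (Set.Ici (2 : ℤ)) (Set.Iic 0) := by
    rw [Set.disjoint_left]; intro k hk hk'; simp at hk hk'; omega
  have hY := norm_cut_add_le (p := p) (q := q) hd Y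
  have hH := norm_cut_add_le (p := p) (q := q) hd H
  have hν0 : 0 ≤ ν := (norm_nonneg _).trans hN
  have hν2 : ν ^ 2 ≤ 1 := pow_le_one₀ hν0 hν
  have hm : ‖μ‖⁻¹ ≤ 1 := inv_le_one_of_one_le₀ hμ.le
  have e1 : ‖wp p q N (cut p q (Set.Ici 2) (μ • Y + H))‖ ≤
      ν ^ 2 * (‖μ‖ * ‖cut p q (Set.Ici 2) Y‖ + ‖cut p q (Set.Ici 2) H‖) := by
    refine (norm_wp_le hN hν (wts_cut p q _ _) (d := 2) fun k hk => ?_).trans ?_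
    · simp at hk; omega
    · gcongr
      rw [cut_add, cut_smul]
      exact (norm_add_le _ _).trans (by rw [norm_smul])
  have e2 : ‖wp p q N (cut p q (Set.Iic 0) Y)‖ ≤ ‖cut p q (Set.Iic 0) Y‖ := by
    simpa using norm_wp_le hN hν (wts_cut p q (Set.Iic 0) Y) (d := 0) fun k hk => by simp
  have e3 : ‖eqP p q μ N Y H‖ ≤ ‖wp p q N (cut p q (Set.Ici 2) (μ • Y + H))‖ +
      ‖μ‖⁻¹ * (‖wp p q N (cut p q (Set.Iic 0) Y)‖ + ‖cut p q (Set.Iic 0) H‖) := by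
    refine (norm_add_le _ _).trans ?_
    rw [norm_smul, norm_inv]
    gcongr
    exact norm_sub_le _ _
  have a1 := norm_nonneg (cut p q (Set.Ici 2) Y)
  have a2 := norm_nonneg (cut p q (Set.Iic 0) Y)
  have a3 := norm_nonneg (cut p q (Set.Ici 2) H)
  have a4 := norm_nonneg (cut p q (Set.Iic 0) H)
  have hκ : 0 ≤ κ := le_trans (by positivity) h2
  calc _ ≤ ν ^ 2 * (‖μ‖ * ‖cut p q (Set.Ici 2) Y‖ + ‖cut p q (Set.Ici 2) H‖) +
      ‖μ‖⁻¹ * (‖cut p q (Set.Iic 0) Y‖ + ‖cut p q (Set.Iic 0) H‖) := by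
        refine e3.trans (add_le_add e1 ?_); gcongr
    _ = (‖μ‖ * ν ^ 2) * ‖cut p q (Set.Ici 2) Y‖ + ν ^ 2 * ‖cut p q (Set.Ici 2) H‖ +
      (‖μ‖⁻¹ * ‖cut p q (Set.Iic 0) Y‖ + ‖μ‖⁻¹ * ‖cut p q (Set.Iic 0) H‖) := by ring
    _ ≤ κ * ‖cut p q (Set.Ici 2) Y‖ + 1 * ‖cut p q (Set.Ici 2) H‖ +
      (κ * ‖cut p q (Set.Iic 0) Y‖ + 1 * ‖cut p q (Set.Iic 0) H‖) := by gcongr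
    _ = κ * (‖cut p q (Set.Ici 2) Y‖ + ‖cut p q (Set.Iic 0) Y‖) +
      (‖cut p q (Set.Ici 2) H‖ + ‖cut p q (Set.Iic 0) H‖) := by ring
    _ ≤ _ := by gcongr

lemma norm_eqP_sub_le {p q : J} {μ : ℂ} {N N' : PS J} {ν : ℝ} (hN : ‖N‖ ≤ ν) (hN' : ‖N'‖ ≤ ν)
    (hν : ν < 1) (hμ : 1 < ‖μ‖) (Y H : PS J) : ‖eqP p q μ N Y H - eqP p q μ N' Y H‖ ≤
      (1 - ν)⁻¹ * ‖N - N'‖ * ((‖μ‖ + 1) * ‖Y‖ + ‖H‖) := by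
  have hm : ‖μ‖⁻¹ ≤ 1 := inv_le_one_of_one_le₀ hμ.le
  have e : eqP p q μ N Y H - eqP p q μ N' Y H =
      (wp p q N (cut p q (Set.Ici 2) (μ • Y + H)) - wp p q N' (cut p q (Set.Ici 2) (μ • Y + H))) +
      μ⁻¹ • (wp p q N (cut p q (Set.Iic 0) Y) - wp p q N' (cut p q (Set.Iic 0) Y)) := by
    simp only [eqP, smul_sub]; abel
  have h1 := norm_wp_sub_le (p := p) (q := q) hN hN' hν (cut p q (Set.Ici 2) (μ • Y + H))
  have h2 := norm_wp_sub_le (p := p) (q := q) hN hN' hν (cut p q (Set.Iic 0) Y)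
  have h3 : ‖cut p q (Set.Ici 2) (μ • Y + H)‖ ≤ ‖μ‖ * ‖Y‖ + ‖H‖ :=
    (norm_cut_le _ _ _ _).trans ((norm_add_le _ _).trans (by rw [norm_smul]))
  have hν0 : 0 < 1 - ν := by linarith
  rw [e]
  refine (norm_add_le _ _).trans ?_
  rw [norm_smul, norm_inv]
  calc _ ≤ (1 - ν)⁻¹ * ‖N - N'‖ * (‖μ‖ * ‖Y‖ + ‖H‖) + 1 * ((1 - ν)⁻¹ * ‖N - N'‖ * ‖Y‖) := by
        refine add_le_add (h1.trans (by gcongr)) ?_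
        refine mul_le_mul hm (h2.trans ?_) (norm_nonneg _) zero_le_one
        gcongr
        exact norm_cut_le _ _ _ _
    _ = _ := by ring

lemma eqP_sub {p q : J} {μ : ℂ} {N : PS J} (hN : ‖N‖ ≤ 1) (Y Y' H H' : PS J) :
    eqP p q μ N Y H - eqP p q μ N Y' H' = eqP p q μ N (Y - Y') (H - H') := by
  have e : μ • (Y - Y') + (H - H') = (μ • Y + H) - (μ • Y' + H') := by rw [smul_sub]; abel
  unfold eqP
  rw [e]
  simp only [cut_sub (F := μ • Y + H), cut_sub (F := Y), cut_sub (F := H), wp_sub hN, smul_sub]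
  abel

/-- Here the weight-k equation is (n^{-k} - 1) Y_k = H_k, imposed only for k ≥ 1 and solved as Y_k =
n^k (Y_k + H_k); at least one factor n is present. -/
lemma norm_eqZ_le {p q : J} {N : PS J} {ν : ℝ} (hN : ‖N‖ ≤ ν) (hν : ν ≤ 1) (Y H : PS J) :
    ‖eqZ p q N Y H‖ ≤ ν * (‖Y‖ + ‖H‖) := by
  refine (norm_wp_le hN hν (wts_cut p q _ _) (d := 1) fun k hk => ?_).trans ?_
  · simp at hk; omega
  · rw [pow_one]
    have := (norm_nonneg _).trans hN
    gcongr
    exact (norm_cut_le _ _ _ _).trans (norm_add_le _ _)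

lemma norm_eqZ_sub_le {p q : J} {N N' : PS J} {ν : ℝ} (hN : ‖N‖ ≤ ν) (hN' : ‖N'‖ ≤ ν)
    (hν : ν < 1) (Y H : PS J) : ‖eqZ p q N Y H - eqZ p q N' Y H‖ ≤
      (1 - ν)⁻¹ * ‖N - N'‖ * (‖Y‖ + ‖H‖) := by
  have hν0 : 0 < 1 - ν := by linarith
  refine (norm_wp_sub_le hN hN' hν _).trans ?_
  gcongr
  exact (norm_cut_le _ _ _ _).trans (norm_add_le _ _)

lemma eqZ_sub {p q : J} {N : PS J} (hN : ‖N‖ ≤ 1) (Y Y' H H' : PS J) :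
    eqZ p q N Y H - eqZ p q N Y' H' = eqZ p q N (Y - Y') (H - H') := by
  have e : (Y - Y') + (H - H') = (Y + H) - (Y' + H') := by abel
  simp only [eqZ, e, cut_sub, wp_sub hN]

lemma norm_proj_le (p q : J) (k : ℤ) (F : PS J) : ‖proj p q k F‖ ≤ ‖F‖ :=
  (norm_lift_le (norm_smul_mon_le (C := 1) fun _ => ite_norm_le _) F).trans_eq (one_mul _)

lemma proj_sub (p q : J) (k : ℤ) (F G : PS J) :
    proj p q k (F - G) = proj p q k F - proj p q k G := map_sub (projL p q k) F G

lemma norm_eqN_sub_le {p q : J} {μ : ℂ} (hμ : 1 < ‖μ‖) (N N' H H' : PS J) :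
    ‖eqN p q μ N H - eqN p q μ N' H'‖ ≤ ‖N - N'‖ * ‖H'‖ + ‖N‖ * ‖H - H'‖ := by
  have hm : ‖μ‖⁻¹ ≤ 1 := inv_le_one_of_one_le₀ hμ.le
  have e : eqN p q μ N H - eqN p q μ N' H' = -(μ⁻¹ • proj p q 0 ((N - N') * dvd p q H' +
      N * dvd p q (H - H'))) := by
    have : (N - N') * dvd p q H' + N * dvd p q (H - H') = N * dvd p q H - N' * dvd p q H' := by
      rw [dvd_sub]; ring
    rw [this, eqN, eqN, ← smul_sub, proj_sub, ← smul_neg]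
    congr 1; abel
  rw [e, norm_neg, norm_smul, norm_inv]
  calc _ ≤ 1 * ‖(N - N') * dvd p q H' + N * dvd p q (H - H')‖ :=
        mul_le_mul hm (norm_proj_le _ _ _ _) (norm_nonneg _) zero_le_one
    _ ≤ ‖N - N'‖ * ‖dvd p q H'‖ + ‖N‖ * ‖dvd p q (H - H')‖ := by
        rw [one_mul]
        exact (norm_add_le _ _).trans (add_le_add (norm_mul_le _ _) (norm_mul_le _ _))
    _ ≤ _ := by gcongr <;> exact norm_dvd_le _ _ _

lemma norm_eqN_sub_one_le {p q : J} {μ : ℂ} (hμ : 1 < ‖μ‖) (N H : PS J) :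
    ‖eqN p q μ N H - μ⁻¹ • 1‖ ≤ ‖N‖ * ‖H‖ := by
  have e : eqN p q μ N 0 = μ⁻¹ • (1 : PS J) := by
    simp [eqN, dvd, lift, proj, scale]
  simpa [e] using norm_eqN_sub_le (p := p) (q := q) hμ N N H 0

lemma isClosed_Ord (d : ℕ) : IsClosed {F : PS J | Ord d F} := by
  have : {F : PS J | Ord d F} = ⋂ (α : J →₀ ℕ) (_ : α.degree < d), {F | cf α F = 0} := by
    ext F; simp [Ord]
  rw [this]
  exact isClosed_iInter fun α => isClosed_iInter fun _ =>
    isClosed_eq (cf α).continuous continuous_const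

lemma Ord.eqP {p q : J} {μ : ℂ} {N Y H : PS J} (hN : ‖N‖ ≤ 1) {d : ℕ} (hY : Ord d Y)
    (hH : Ord d H) : Ord d (eqP p q μ N Y H) :=
  (Ord.wp hN ((hY.smul μ).add hH).cut).add (((Ord.wp hN hY.cut).sub hH.cut).smul _)

lemma Ord.eqZ {p q : J} {N Y H : PS J} (hN : ‖N‖ ≤ 1) {d : ℕ} (hY : Ord d Y)
    (hH : Ord d H) : Ord d (eqZ p q N Y H) := Ord.wp hN (hY.add hH).cut

/-- Solution of the equations for a normalizing map by the contraction principle. -/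
theorem exists_fixed {p q : J} {μ : ℂ} (hμ : 1 < ‖μ‖) : ∃ δ > 0,
    ∀ h : (J → PS J) → J → PS J,
      (∀ ψ, (∀ j, ‖ψ j‖ ≤ 2) → (∀ j, Ord 1 (ψ j)) → ∀ j, ‖h ψ j‖ ≤ δ ∧ Ord 2 (h ψ j)) →
      (∀ ψ ψ', (∀ j, ‖ψ j‖ ≤ 2) → (∀ j, ‖ψ' j‖ ≤ 2) → ∀ j, ‖h ψ j - h ψ' j‖ ≤ δ * ‖ψ - ψ'‖) →
      ∃ (N : PS J) (Y : J → PS J), ‖N‖ ≤ 1 ∧ (∀ j, ‖Y j‖ ≤ 1 / 2) ∧ (∀ j, Ord 2 (Y j)) ∧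
        N = eqN p q μ N (h (nf p q Y) p) ∧ Y p = eqP p q μ N (Y p) (h (nf p q Y) p) ∧
        (p ≠ q → Y q = 0) ∧
        ∀ j, j ≠ p → j ≠ q → Y j = eqZ p q N (Y j) (h (nf p q Y) j) := by
  set m := ‖μ‖ with hm
  have hm0 : 0 < m := by linarith
  -- ν bounds ‖N‖. It exceeds |μ|⁻¹, leaving room for a ball around the constant μ⁻¹, and stays
  -- below |μ|^(-1/2), so that |μ| ν² < 1.
  obtain ⟨ν, hν1, hν2⟩ := exists_between (show m⁻¹ < (√m)⁻¹ by
    rw [inv_lt_inv₀ hm0 (Real.sqrt_pos.2 hm0), Real.sqrt_lt' hm0]; nlinarith)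
  have hν0 : 0 < ν := lt_trans (by positivity) hν1
  have hν3 : m * ν ^ 2 < 1 := by
    have h1 : ν ^ 2 < ((√m)⁻¹) ^ 2 := by gcongr
    rw [inv_pow, Real.sq_sqrt hm0.le] at h1
    calc m * ν ^ 2 < m * m⁻¹ := by gcongr
      _ = 1 := mul_inv_cancel₀ hm0.ne'
  have hν4 : ν < 1 := by nlinarith
  set κ := max (m * ν ^ 2) ν with hκ
  have hκ1 : κ < 1 := max_lt hν3 hν4
  have hκ0 : 0 < κ := hν0.trans_le (le_max_right _ _)
  set C := (1 - ν)⁻¹ with hC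
  have hC1 : 1 ≤ C := by
    rw [hC]; exact (one_le_inv₀ (by linarith)).2 (by linarith)
  -- η is the radius of the ball. The three bounds keep ‖N‖ ≤ ν, keep `nf` of norm at most 2, and
  -- make the dependence on N cost at most (1 - κ)/4.
  obtain ⟨η, hη0, hη1⟩ : ∃ η > 0, η ≤ min (ν - m⁻¹) (min (1 / 2) ((1 - κ) / (4 * C * (m + 1)))) :=
    ⟨_, lt_min (by linarith) (lt_min (by norm_num) (div_pos (by linarith) (by positivity))), le_rfl⟩
  have hη2 : η ≤ ν - m⁻¹ := hη1.trans (min_le_left _ _)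
  have hη3 : η ≤ 1 / 2 := hη1.trans ((min_le_right _ _).trans (min_le_left _ _))
  have hη4 : C * (m + 1) * η ≤ (1 - κ) / 4 := by
    have := hη1.trans ((min_le_right _ _).trans (min_le_right _ _))
    rw [le_div_iff₀ (by positivity)] at this
    linarith
  -- The first bound makes the iteration preserve the ball, as κη + δ ≤ η; the second limits the
  -- contribution of h to the Lipschitz constant to (1 - κ)/4.
  obtain ⟨δ, hδ0, hδ1⟩ : ∃ δ > 0, δ ≤ min ((1 - κ) * η) ((1 - κ) / (4 * (2 + C))) :=
    ⟨_, lt_min (mul_pos (by linarith) hη0) (div_pos (by linarith) (by positivity)), le_rfl⟩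
  have hδ2 : δ ≤ (1 - κ) * η := hδ1.trans (min_le_left _ _)
  have hδ3 : (2 + C) * δ ≤ (1 - κ) / 4 := by
    have := hδ1.trans (min_le_right _ _)
    rw [le_div_iff₀ (by positivity)] at this
    linarith
  refine ⟨δ, hδ0, fun h hb hl => ?_⟩
  -- Component q is not solved for: by the symmetry built into `nf` it is already provided by
  -- component p.
  let T : PS J × (J → PS J) → PS J × (J → PS J) := fun x =>
    (eqN p q μ x.1 (h (nf p q x.2) p), fun j =>
      if j = p then eqP p q μ x.1 (x.2 j) (h (nf p q x.2) j) else
      if j = q then 0 else eqZ p q x.1 (x.2 j) (h (nf p q x.2) j))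
  let s : Set (PS J × (J → PS J)) :=
    {x | ‖x.1 - μ⁻¹ • 1‖ ≤ η ∧ (∀ j, ‖x.2 j‖ ≤ η) ∧ ∀ j, Ord 2 (x.2 j)}
  have hsc : IsComplete s := by
    refine IsClosed.isComplete ?_
    have c1 : IsClosed {x : PS J × (J → PS J) | ‖x.1 - μ⁻¹ • 1‖ ≤ η} :=
      isClosed_le (by fun_prop) continuous_const
    have c2 : IsClosed {x : PS J × (J → PS J) | ∀ j, ‖x.2 j‖ ≤ η} := by
      simp only [Set.ofPred_forall]
      exact isClosed_iInter fun j => isClosed_le (by fun_prop) continuous_const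
    have c3 : IsClosed {x : PS J × (J → PS J) | ∀ j, Ord 2 (x.2 j)} := by
      simp only [Set.ofPred_forall]
      exact isClosed_iInter fun j => (isClosed_Ord (J := J) 2).preimage
        (f := fun x : PS J × (J → PS J) => x.2 j) (by fun_prop)
    exact c1.inter (c2.inter c3)
  have hsN : ∀ x ∈ s, ‖x.1‖ ≤ ν := fun x hx => by
    have h1 := norm_add_le (x.1 - μ⁻¹ • 1) (μ⁻¹ • (1 : PS J))
    rw [sub_add_cancel, norm_smul, norm_inv, norm_one, mul_one] at h1
    linarith [hx.1]
  have hsb : ∀ x ∈ s, ∀ j, ‖h (nf p q x.2) j‖ ≤ δ ∧ Ord 2 (h (nf p q x.2) j) := fun x hx j =>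
    hb _ (norm_nf_le hx.2.1 hη3) (Ord.nf hx.2.2) j
  have hmaps : Set.MapsTo T s s := by
    intro x hx
    have hN := hsN x hx
    refine ⟨?_, fun j => ?_, fun j => ?_⟩
    · refine (norm_eqN_sub_one_le hμ _ _).trans ?_
      have := (hsb x hx p).1
      calc _ ≤ 1 * δ := mul_le_mul (hN.trans hν4.le) this (norm_nonneg _) zero_le_one
        _ ≤ η := by nlinarith
    · have hH := (hsb x hx j).1
      have hY := hx.2.1 j
      simp only [T]
      split_ifs with h1 h2
      · refine (norm_eqP_le hN hν4.le hμ (le_max_left _ _) (hν1.le.trans (le_max_right _ _))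
          _ _).trans ?_
        rw [← hκ]; nlinarith
      · simpa using hη0.le
      · refine (norm_eqZ_le hN hν4.le _ _).trans ?_
        have : ν ≤ κ := le_max_right _ _
        calc _ ≤ ν * (η + δ) := by gcongr
          _ ≤ κ * η + δ := by nlinarith
          _ ≤ η := by nlinarith
    · have hO := (hsb x hx j).2
      simp only [T]
      split_ifs with h1 h2
      · exact (hx.2.2 j).eqP (hN.trans hν4.le) hO
      · exact .zero
      · exact (hx.2.2 j).eqZ (hN.trans hν4.le) hO
  -- Two errors of (1 - κ)/4 are added to κ.
  set K : ℝ := (1 + κ) / 2 with hK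
  have hK0 : 0 ≤ K := by rw [hK]; positivity
  have hcon : ContractingWith K.toNNReal (hmaps.restrict T s s) := by
    refine ⟨?_, LipschitzWith.of_dist_le_mul fun x y => ?_⟩
    · rw [Real.toNNReal_lt_one]; linarith
    rw [Real.coe_toNNReal _ hK0]
    change dist (T x.1) (T y.1) ≤ K * dist x.1 y.1
    obtain ⟨x, hx⟩ := x
    obtain ⟨y, hy⟩ := y
    simp only
    have hNx := hsN x hx
    have hNy := hsN y hy
    have hd0 : 0 ≤ dist x y := dist_nonneg
    have hd1 : ‖x.1 - y.1‖ ≤ dist x y := by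
      rw [← dist_eq_norm, Prod.dist_eq]; exact le_max_left _ _
    have hd2 : ‖x.2 - y.2‖ ≤ dist x y := by
      rw [← dist_eq_norm, Prod.dist_eq]; exact le_max_right _ _
    have hdY : ∀ j, ‖x.2 j - y.2 j‖ ≤ dist x y := fun j => (norm_le_pi_norm (x.2 - y.2) j).trans hd2
    have hdH : ∀ j, ‖h (nf p q x.2) j - h (nf p q y.2) j‖ ≤ 2 * δ * dist x y := fun j => by
      refine (hl _ _ (norm_nf_le hx.2.1 hη3) (norm_nf_le hy.2.1 hη3) j).trans ?_
      have := norm_nf_sub_le (p := p) (q := q) x.2 y.2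
      calc _ ≤ δ * (2 * dist x y) := by gcongr; linarith
        _ = _ := by ring
    have hfin : κ * dist x y + 2 * δ * dist x y + C * dist x y * ((m + 1) * η + δ) ≤
        K * dist x y := by
      have : κ + 2 * δ + C * ((m + 1) * η + δ) ≤ K := by rw [hK]; linarith
      calc _ = (κ + 2 * δ + C * ((m + 1) * η + δ)) * dist x y := by ring
        _ ≤ _ := by gcongr
    rw [Prod.dist_eq]
    refine max_le ?_ ((dist_pi_le_iff (by positivity)).2 fun j => ?_)
    · rw [dist_eq_norm]
      refine (norm_eqN_sub_le hμ _ _ _ _).trans ?_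
      calc _ ≤ dist x y * δ + 1 * (2 * δ * dist x y) := by
            refine add_le_add (mul_le_mul hd1 (hsb y hy p).1 (norm_nonneg _) hd0)
              (mul_le_mul (hNx.trans hν4.le) (hdH p) (norm_nonneg _) zero_le_one)
        _ = 3 * δ * dist x y := by ring
        _ ≤ K * dist x y := by
            have : 3 * δ ≤ K := by rw [hK]; nlinarith
            gcongr
    · have hH := (hsb y hy j).1
      have hY := hy.2.1 j
      rw [dist_eq_norm]
      simp only [T]
      split_ifs with h1 h2
      · rw [← sub_add_sub_cancel _ (eqP p q μ x.1 (y.2 j) (h (nf p q y.2) j)),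
          eqP_sub (hNx.trans hν4.le)]
        refine le_trans ((norm_add_le _ _).trans (add_le_add
          (norm_eqP_le hNx hν4.le hμ (le_max_left _ _) (hν1.le.trans (le_max_right _ _)) _ _)
          (norm_eqP_sub_le hNx hNy hν4 hμ _ _))) (le_trans ?_ hfin)
        rw [← hκ, ← hC, ← hm]
        have := hdY j
        have := hdH j
        gcongr
      · simpa using by positivity
      · rw [← sub_add_sub_cancel _ (eqZ p q x.1 (y.2 j) (h (nf p q y.2) j)),
          eqZ_sub (hNx.trans hν4.le)]
        refine le_trans ((norm_add_le _ _).trans (add_le_add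
          (norm_eqZ_le hNx hν4.le _ _) (norm_eqZ_sub_le hNx hNy hν4 _ _))) (le_trans ?_ hfin)
        rw [← hC]
        have a1 := hdY j
        have a2 := hdH j
        have a3 : ν ≤ κ := le_max_right _ _
        have a4 : ν * (‖x.2 j - y.2 j‖ + ‖h (nf p q x.2) j - h (nf p q y.2) j‖) ≤
            κ * dist x y + 2 * δ * dist x y := by
          calc _ ≤ ν * (dist x y + 2 * δ * dist x y) := by gcongr
            _ = ν * dist x y + ν * (2 * δ * dist x y) := by ring
            _ ≤ κ * dist x y + 1 * (2 * δ * dist x y) := by gcongr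
            _ = _ := by ring
        refine add_le_add a4 ?_
        gcongr
        nlinarith
  have hx0 : (μ⁻¹ • (1 : PS J), (0 : J → PS J)) ∈ s :=
    ⟨by simpa using hη0.le, fun j => by simpa using hη0.le, fun j => Ord.zero⟩
  obtain ⟨y, hys, hy, -⟩ := ContractingWith.exists_fixedPoint' hsc hmaps hcon hx0 (edist_ne_top _ _)
  have hy' : T y = y := hy
  have hy2 : ∀ j, (T y).2 j = y.2 j := fun j => by rw [hy']
  refine ⟨y.1, y.2, (hsN y hys).trans hν4.le, fun j => (hys.2.1 j).trans hη3, hys.2.2, ?_, ?_, ?_, ?_⟩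
  · exact (congrArg Prod.fst hy').symm
  · have := (hy2 p).symm
    simpa [T] using this
  · intro hpq
    have := (hy2 q).symm
    simpa [T, hpq.symm] using this
  · intro j h1 h2
    have := (hy2 j).symm
    simpa [T, h1, h2] using this

end FixedPoint

/-! ### From the fixed point to the conjugacy equation -/

section Normalization
open PS
variable {J : Type*} [Fintype J] [DecidableEq J] {p q : J}

/-! ### Evaluation of the equations -/

/-- One factor is changed at a time. On the polydisc of radius 1/2 the number of factors is beaten
by the decay 2^{-degree}, so substitution is Lipschitz with a uniform constant. -/
lemma norm_pw_sub_pw_le {B : Type*} [NormedCommRing B] [NormOneClass B] {x y : J → B} {Δ : ℝ}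
    (hx : ∀ j, ‖x j‖ ≤ 1 / 2) (hy : ∀ j, ‖y j‖ ≤ 1 / 2) (hxy : ∀ j, ‖x j - y j‖ ≤ Δ)
    (α : J →₀ ℕ) : ‖pw x α - pw y α‖ ≤ α.degree * (1 / 2) ^ α.degree * (2 * Δ) := by
  have hadd : ∀ α β : J →₀ ℕ,
      ‖pw x α - pw y α‖ ≤ α.degree * (1 / 2) ^ α.degree * (2 * Δ) →
      ‖pw x β - pw y β‖ ≤ β.degree * (1 / 2) ^ β.degree * (2 * Δ) →
      ‖pw x (α + β) - pw y (α + β)‖ ≤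
        (α + β).degree * (1 / 2) ^ (α + β).degree * (2 * Δ) := by
    intro α β hα hβ
    have e : pw x (α + β) - pw y (α + β) =
        pw x α * (pw x β - pw y β) + (pw x α - pw y α) * pw y β := by
      rw [pw_add, pw_add]; ring
    have h1 := norm_pw_le hx α
    have h2 := norm_pw_le hy β
    rw [e]
    calc _ ≤ ‖pw x α‖ * ‖pw x β - pw y β‖ + ‖pw x α - pw y α‖ * ‖pw y β‖ :=
          (norm_add_le _ _).trans (add_le_add (norm_mul_le _ _) (norm_mul_le _ _))
      _ ≤ (1 / 2) ^ α.degree * (β.degree * (1 / 2) ^ β.degree * (2 * Δ)) +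
          α.degree * (1 / 2) ^ α.degree * (2 * Δ) * (1 / 2) ^ β.degree := by
            gcongr
            exact (norm_nonneg _).trans hα
      _ = _ := by rw [map_add]; push_cast; ring
  have hsing : ∀ (j : J) (n : ℕ), ‖pw x (Finsupp.single j n) - pw y (Finsupp.single j n)‖ ≤
      (Finsupp.single j n).degree * (1 / 2) ^ (Finsupp.single j n).degree * (2 * Δ) := by
    intro j n
    induction n with
    | zero => simp [pw_zero]
    | succ n ih =>
      rw [Finsupp.single_add]
      refine hadd _ _ ih ?_
      have : ∀ z : J → B, pw z (Finsupp.single j 1) = z j := fun z => by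
        rw [pw, Finset.prod_eq_single j] <;> simp +contextual
      rw [this, this]
      refine (hxy j).trans (le_of_eq ?_)
      rw [Finsupp.degree_single]; norm_num; ring
  induction α using Finsupp.induction_linear with
  | zero => simp [pw_zero]
  | add α β hα hβ => exact hadd α β hα hβ
  | single j n => exact hsing j n

lemma nat_mul_half_pow_le (n : ℕ) : (n : ℝ) * (1 / 2) ^ n ≤ 1 := by
  rw [one_div, inv_pow, ← div_eq_mul_inv, div_le_one (by positivity)]
  exact_mod_cast n.lt_two_pow_self.le

lemma norm_sb_sub_le {B : Type*} [NormedCommRing B] [NormOneClass B] [NormedAlgebra ℂ B]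
    [CompleteSpace B] {x y : J → B} {Δ : ℝ}
    (hx : ∀ j, ‖x j‖ ≤ 1 / 2) (hy : ∀ j, ‖y j‖ ≤ 1 / 2) (hxy : ∀ j, ‖x j - y j‖ ≤ Δ)
    (hΔ : 0 ≤ Δ) (F : PS J) : ‖sb x F - sb y F‖ ≤ 2 * Δ * ‖F‖ := by
  have e : sb x F - sb y F = lift (fun α => pw x α - pw y α) F := by
    have h1 := hasSum_lift (norm_pw_le_one fun j => (hx j).trans (by norm_num)) F
    have h2 := hasSum_lift (norm_pw_le_one fun j => (hy j).trans (by norm_num)) F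
    have h3 := h1.sub h2
    simp only [← smul_sub] at h3
    exact h3.tsum_eq.symm
  rw [e]
  refine norm_lift_le (fun α => (norm_pw_sub_pw_le hx hy hxy α).trans ?_) F
  calc _ ≤ 1 * (2 * Δ) := by gcongr; exact nat_mul_half_pow_le _
    _ = _ := one_mul _

lemma Ord.sb {Φ : J → PS J} {d : ℕ} (hn : ∀ j, ‖Φ j‖ ≤ 1) (hΦ : ∀ j, Ord 1 (Φ j)) {F : PS J}
    (hF : Ord d F) : Ord d (sb Φ F) :=
  Ord.lift (norm_pw_le_one hn) fun α hα => (Ord.pw hΦ α).mono (by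
    by_contra h
    exact hα (hF α (not_le.1 h)))

lemma sb_wp {N F : PS J} {x : J → ℂ} (hN : ‖N‖ ≤ 1) (hx : ‖x‖ ≤ 1) :
    sb x (wp p q N F) = lift (fun α => sb x N ^ (wt p q α).natAbs * pw x α) F := by
  have hx' := norm_apply_le hx
  have h := map_lift (wp_bdd p q hN) (subL x hx') F
  refine h.trans (lift_congr F fun α _ => ?_)
  rw [subL_apply, sb_mul hx', ← pw_X α, sb_pw hx', ← subL_apply hx', ← subL_apply hx']
  simp only [subL_apply, sb_X]
  congr 1
  exact map_pow ({ toFun := PS.sb x, map_one' := sb_one, map_mul' := sb_mul hx' } : PS J →* ℂ) N _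

/-- `dv p q n` multiplies a monomial of weight k by n^k. Hence the factor n^|k| in `wp` amounts to
composing with `dv p q n` or its inverse, according to the sign of the weights. -/
lemma sb_wp_nonneg (hpq : p ≠ q) {N F : PS J} {x : J → ℂ} (hN : ‖N‖ ≤ 1) (hx : ‖x‖ ≤ 1)
    (h0 : sb x N ≠ 0) (hF : Wts p q (Set.Ici 0) F) :
    sb x (wp p q N F) = sb (dv p q (sb x N) * x) F := by
  rw [sb_wp hN hx]
  refine lift_congr F fun α hα => ?_
  rw [pw_dv_mul hpq h0, ← zpow_natCast, Int.natAbs_of_nonneg (hF α hα)]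

lemma sb_wp_nonpos (hpq : p ≠ q) {N F : PS J} {x : J → ℂ} (hN : ‖N‖ ≤ 1) (hx : ‖x‖ ≤ 1)
    (h0 : sb x N ≠ 0) (hF : Wts p q (Set.Iic 0) F) :
    sb x (wp p q N F) = sb (dv p q (sb x N)⁻¹ * x) F := by
  rw [sb_wp hN hx]
  refine lift_congr F fun α hα => ?_
  have : wt p q α ≤ 0 := hF α hα
  rw [pw_dv_mul hpq (inv_ne_zero h0), inv_zpow', ← zpow_natCast, Int.ofNat_natAbs_of_nonpos this]

lemma sb_add {x : J → ℂ} (hx : ‖x‖ ≤ 1) (F G : PS J) : sb x (F + G) = sb x F + sb x G :=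
  lift_add (norm_pw_le_one (norm_apply_le hx)) F G

lemma sb_sub {x : J → ℂ} (hx : ‖x‖ ≤ 1) (F G : PS J) : sb x (F - G) = sb x F - sb x G :=
  lift_sub (norm_pw_le_one (norm_apply_le hx)) F G

lemma sb_smul (c : ℂ) (x : J → ℂ) (F : PS J) : sb x (c • F) = c * sb x F := lift_smul c F

lemma isWt_dvd (hpq : p ≠ q) (F : PS J) : IsWt p q 0 (dvd p q F) := by
  have h : Wts p q {0} (dvd p q F) := by
    refine Wts.lift (dvd_bdd p q) fun α _ => ?_
    split_ifs with h
    · refine (IsWt.mon _).wts ?_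
      have h1 : (α p : ℤ) - α q = 1 := h
      have h2 : 1 ≤ α p := by omega
      simp only [wt, Finsupp.tsub_apply, Finsupp.single_eq_same, Finsupp.single_apply, if_neg hpq,
        Set.mem_singleton_iff]
      omega
    · intro β hβ; simp at hβ
  exact h

lemma cut_self {A : Set ℤ} {F : PS J} (hF : Wts p q A F) : cut p q A F = F := by
  classical
  refine ext_cf fun α => ?_
  rw [cf_cut]
  split_ifs with h
  · rfl
  · by_contra h0
    exact h (hF α (Ne.symm h0))

lemma cut_disj {A B : Set ℤ} (h : Disjoint A B) {F : PS J} (hF : Wts p q A F) :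
    cut p q B F = 0 := by
  classical
  refine ext_cf fun α => ?_
  rw [cf_cut, map_zero]
  split_ifs with h1
  · by_contra h0
    exact Set.disjoint_left.1 h (hF α h0) h1
  · rfl

lemma Wts.mono {A B : Set ℤ} (h : A ⊆ B) {F : PS J} (hF : Wts p q A F) : Wts p q B F :=
  fun α hα => h (hF α hα)

lemma disj_two : Disjoint (Set.Ici (2 : ℤ)) (Set.Iic 0) := by
  rw [Set.disjoint_left]; intro k hk hk'; simp at hk hk'; omega

lemma disj_one : Disjoint (Set.Ici (1 : ℤ)) (Set.Iic 0) := by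
  rw [Set.disjoint_left]; intro k hk hk'; simp at hk hk'; omega

/-- The component `x_p` of the conjugacy equation. -/
lemma eqP_eval (hpq : p ≠ q) {μ : ℂ} (hμ : μ ≠ 0) {N Y H : PS J} (hN : ‖N‖ ≤ 1)
    (hN0 : IsWt p q 0 N)
    (hNe : N = eqN p q μ N H) (hY : Y = eqP p q μ N Y H) {x y : J → ℂ} (hx : ‖x‖ ≤ 1)
    (hy : ‖y‖ ≤ 1) (h0 : sb y N ≠ 0) (hxy : x = dv p q (sb y N)⁻¹ * y) (hNx : sb x N = sb y N) :
    sb x (X p + Y) = μ * sb y (X p + Y) + sb y H := by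
  set n := sb y N with hn
  have hyx : y = dv p q n * x := by
    rw [hxy, ← mul_assoc, ← dv_mul, mul_inv_cancel₀ h0, dv_one, one_mul]
  set A := wp p q N (cut p q (Set.Ici 2) (μ • Y + H)) with hA
  set B := μ⁻¹ • (wp p q N (cut p q (Set.Iic 0) Y) - cut p q (Set.Iic 0) H) with hB
  have hYAB : Y = A + B := hY
  have hAw : Wts p q (Set.Ici 2) A := Wts.wp hN hN0 (wts_cut p q _ _)
  have hBw : Wts p q (Set.Iic 0) B := by
    have h1 : Wts p q (Set.Iic 0) (wp p q N (cut p q (Set.Iic 0) Y) - cut p q (Set.Iic 0) H) :=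
      (Wts.wp hN hN0 (wts_cut p q _ _)).sub (wts_cut p q _ _)
    intro α hα
    rw [hB, map_smul] at hα
    exact h1 α (right_ne_zero_of_smul hα)
  -- The two summands of the equation live in disjoint ranges of weights, so they are the
  -- corresponding parts of Y.
  have hcA : cut p q (Set.Ici 2) Y = A := by
    rw [hYAB, cut_add, cut_self hAw, cut_disj disj_two.symm hBw, add_zero]
  have hcB : cut p q (Set.Iic 0) Y = B := by
    rw [hYAB, cut_add, cut_self hBw, cut_disj disj_two hAw, zero_add]
  have eA : sb x A = μ * sb y A + sb y (cut p q (Set.Ici 2) H) := by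
    conv_lhs => rw [hA]
    rw [sb_wp_nonneg hpq hN hx (by rw [hNx]; exact h0) ((wts_cut p q _ _).mono (by
      intro k hk; simp at hk ⊢; omega)), hNx, ← hyx, cut_add, cut_smul, hcA, sb_add hy, sb_smul]
  have eB : μ * sb y B = sb x B - sb y (cut p q (Set.Iic 0) H) := by
    conv_lhs => rw [hB]
    rw [sb_smul, ← mul_assoc, mul_inv_cancel₀ hμ, one_mul, sb_sub hy, hcB,
      sb_wp_nonpos hpq hN hy h0 hBw, ← hxy]
  have eH : sb y H = sb y (cut p q (Set.Ici 2) H) + sb y (cut p q {1} H) +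
      sb y (cut p q (Set.Iic 0) H) := by
    rw [← sb_add hy, ← sb_add hy]
    congr 1
    classical
    refine ext_cf fun α => ?_
    simp only [map_add, cf_cut, Set.mem_Ici, Set.mem_Iic, Set.mem_singleton_iff]
    rcases lt_trichotomy (wt p q α) 1 with h | h | h
    · rw [if_neg (by omega), if_neg (by omega), if_pos (by omega)]; ring
    · rw [if_neg (by omega), if_pos (by omega), if_neg (by omega)]; ring
    · rw [if_pos (by omega), if_neg (by omega), if_neg (by omega)]; ring
  have e1 : sb y (cut p q {1} H) = y p * sb y (dvd p q H) := by
    rw [← X_mul_dvd, sb_mul (norm_apply_le hy), sb_X]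
  -- The weight-one part: n⁻¹ = μ + H_1 / y_p. The projection in `eqN` has no effect here because N
  -- and the quotient have weight zero.
  have eN : n * μ = 1 - n * sb y (dvd p q H) := by
    have h1 : N = μ⁻¹ • (1 - N * dvd p q H) := by
      conv_lhs => rw [hNe, eqN, proj_eq_self (by simpa using hN0.mul (isWt_dvd hpq H))]
    have h2 := congrArg (sb y) h1
    rw [sb_smul, sb_sub hy, sb_one, sb_mul (norm_apply_le hy), ← hn] at h2
    conv_lhs => rw [h2]
    field_simp
  have exp : x p = n⁻¹ * y p := by rw [hxy, Pi.mul_apply, dv_left]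
  have eX : x p = y p * (μ + sb y (dvd p q H)) := by
    rw [exp]; field_simp; linear_combination (y p) * (-eN)
  rw [sb_add hx, sb_add hy, sb_X, sb_X, hYAB, sb_add hx, sb_add hy, eA, eH, e1, eX]
  linear_combination eB * (-1)

/-- The components other than `x_p` and `x_q` of the conjugacy equation hold up to a series with
nonpositive weights. -/
lemma eqZ_eval (hpq : p ≠ q) {N Y H : PS J} (hN : ‖N‖ ≤ 1) (hN0 : IsWt p q 0 N)
    (hY : Y = eqZ p q N Y H) {j : J} (hp : j ≠ p) (hq : j ≠ q) :
    ∃ F, Wts p q (Set.Iic 0) F ∧ ∀ x y : J → ℂ, ‖x‖ ≤ 1 → ‖y‖ ≤ 1 → sb y N ≠ 0 →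
      x = dv p q (sb y N)⁻¹ * y → sb x N = sb y N →
      sb y (X j + Y + Sw p q Y) + sb y H - sb x (X j + Y + Sw p q Y) = sb y F := by
  have hYw : Wts p q (Set.Ici 1) Y := by
    rw [hY]; exact Wts.wp hN hN0 (wts_cut p q _ _)
  have hSw : Wts p q (Set.Iic 0) (Sw p q Y) := Wts.Sw hpq (hYw.mono (by
    intro k hk; simp at hk ⊢; omega))
  -- The weights k ≥ 1 cancel by the equation. What is left is the nonpositive part of H and the
  -- failure of the swapped part of the map to be invariant.
  refine ⟨Sw p q Y + cut p q (Set.Iic 0) H - wp p q N (Sw p q Y),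
    (hSw.add (wts_cut p q _ _)).sub (Wts.wp hN hN0 hSw), fun x y hx hy h0 hxy hNx => ?_⟩
  set n := sb y N with hn
  have hyx : y = dv p q n * x := by
    rw [hxy, ← mul_assoc, ← dv_mul, mul_inv_cancel₀ h0, dv_one, one_mul]
  have e1 : sb x Y = sb y Y + sb y (cut p q (Set.Ici 1) H) := by
    conv_lhs => rw [hY, eqZ]
    rw [sb_wp_nonneg hpq hN hx (by rw [hNx]; exact h0) ((wts_cut p q _ _).mono (by
      intro k hk; simp at hk ⊢; omega)), hNx, ← hyx, cut_add, cut_self hYw, sb_add hy]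
  have e2 : sb y (wp p q N (Sw p q Y)) = sb x (Sw p q Y) := by
    rw [sb_wp_nonpos hpq hN hy h0 hSw, ← hxy]
  have eH : sb y H = sb y (cut p q (Set.Ici 1) H) + sb y (cut p q (Set.Iic 0) H) := by
    rw [← sb_add hy, cut_add_cut disj_one]
    intro α _
    rcases le_total (wt p q α) 0 with h | h
    · exact Or.inr h
    · by_cases h1 : wt p q α = 0
      · exact Or.inr h1.le
      · left; simp; omega
  have ex : x j = y j := by rw [hxy, Pi.mul_apply, dv_other hp hq, one_mul]
  simp only [sb_add hx, sb_add hy, sb_sub hy, sb_X]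
  rw [e1, e2, eH, ex]; ring

/-- A homogeneous part with nonpositive weights that is antisymmetric under a hyperbolic reflection
vanishes. -/
lemma lead_eq_zero_of_antisymm (hpq : p ≠ q) {μ : ℂ} (hμ : μ ≠ 0) {F : PS J}
    (hF : Wts p q (Set.Iic 0) F) {d : ℕ}
    (h : ∀ y : J → ℂ, lead F d ((dv p q μ * y) ∘ Equiv.swap p q) + lead F d y = 0)
    (α : J →₀ ℕ) (hα : α.degree = d) : cf α F = 0 := by
  set σ : Equiv.Perm J := Equiv.swap p q with hσ
  have hσσ : ∀ β : J →₀ ℕ, (β.equivMapDomain σ).equivMapDomain σ = β := fun β => by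
    ext j; simp [Finsupp.equivMapDomain_apply, hσ]
  have hdeg : ∀ β : J →₀ ℕ, (β.equivMapDomain σ).degree = β.degree := fun β => by
    rw [Finsupp.degree_eq_sum, Finsupp.degree_eq_sum]
    simp only [Finsupp.equivMapDomain_apply]
    exact Equiv.sum_comp σ.symm β
  have hpw : ∀ (β : J →₀ ℕ) (z : J → ℂ), pw (z ∘ σ) β = pw z (β.equivMapDomain σ) := by
    intro β z
    simp only [pw, Finsupp.equivMapDomain_apply, Function.comp]
    rw [← Equiv.prod_comp σ (fun j => z j ^ β (σ.symm j))]
    simp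
  have hwt : ∀ β : J →₀ ℕ, wt p q (β.equivMapDomain σ) = -wt p q β := fun β => by
    simp [wt, Finsupp.equivMapDomain_apply, hσ]
  -- Exchanging x_p and x_q permutes the monomials of degree d and reverses their weights.
  have key : ∀ y : J → ℂ, ∑ β ∈ degSet J d,
      (cf (β.equivMapDomain σ) F * μ ^ wt p q β + cf β F) * pw y β = 0 := by
    intro y
    rw [← h y]
    simp only [add_mul, Finset.sum_add_distrib]
    congr 1
    refine Finset.sum_nbij' (fun β => β.equivMapDomain σ) (fun β => β.equivMapDomain σ)
      (fun β hβ => ?_) (fun β hβ => ?_) (fun β _ => hσσ β) (fun β _ => hσσ β) fun β _ => ?_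
    · rw [mem_degSet] at hβ ⊢; rw [hdeg, hβ]
    · rw [mem_degSet] at hβ ⊢; rw [hdeg, hβ]
    · rw [hpw, hσσ, pw_dv_mul hpq hμ]; ring
  have hc := coeff_eq_zero_of_sum key α hα
  have hpos : ∀ β : J →₀ ℕ, 0 < wt p q β → cf β F = 0 := fun β hβ => by
    by_contra h0
    exact absurd (hF β h0) (not_le.2 hβ)
  -- A negative weight is paired with a positive one, whose coefficient is zero by assumption. A
  -- weight-zero monomial is its own mirror image, so twice its coefficient is zero.
  rcases lt_trichotomy (wt p q α) 0 with h1 | h1 | h1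
  · rw [hpos (α.equivMapDomain σ) (by rw [hwt]; omega)] at hc
    simpa using hc
  · have e : α.equivMapDomain σ = α := by
      ext j
      have h2 : α p = α q := by
        have : (α p : ℤ) - α q = 0 := h1
        omega
      rw [Finsupp.equivMapDomain_apply, hσ, Equiv.symm_swap]
      rcases eq_or_ne j p with rfl | h3
      · simp [h2]
      rcases eq_or_ne j q with rfl | h4
      · simp [h2]
      · rw [Equiv.swap_apply_of_ne_of_ne h3 h4]
    rw [e, h1, zpow_zero, mul_one] at hc
    linear_combination hc / 2
  · exact hpos α h1

end Normalization

/-! ### Reversibility and the normal form in scaled coordinates -/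

section Scaled
open PS
variable {J : Type*} [Fintype J] [DecidableEq J] {p q : J}

lemma rep_sb (F : PS J) : Rep (fun x => sb x F) 1 F := ⟨one_pos, fun x _ => by simp⟩

lemma analyticAt_sb (F : PS J) : AnalyticAt ℂ (fun x : J → ℂ => sb x F) 0 := (rep_sb F).analyticAt

lemma hasFDerivAt_sb_of_ord {F : PS J} (hF : Ord 2 F) :
    HasFDerivAt (fun x : J → ℂ => sb x F) (0 : (J → ℂ) →L[ℂ] ℂ) 0 := by
  have h := (analyticAt_sb F).differentiableAt.hasFDerivAt
  have h0 : sb (0 : J → ℂ) F = 0 := by rw [sb_zero]; exact hF 0 (by simp)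
  suffices e : fderiv ℂ (fun x : J → ℂ => sb x F) 0 = 0 by rwa [e] at h
  ext1 y
  have := lead_one (rep_sb F) h0 h y
  rw [Complex.ofReal_one, one_mul] at this
  rw [← this, lead]
  refine Finset.sum_eq_zero fun α hα => ?_
  rw [mem_degSet] at hα
  rw [hF α (by omega), zero_mul]

lemma hasFDerivAt_sb_nf {Y : J → PS J} (hY : ∀ j, Ord 2 (Y j)) :
    HasFDerivAt (fun (x : J → ℂ) j => sb x (nf p q Y j)) (1 : (J → ℂ) →L[ℂ] J → ℂ) 0 := by
  refine hasFDerivAt_pi'.2 fun j => ?_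
  have h1 : HasFDerivAt (fun x : J → ℂ => x j) (ContinuousLinearMap.proj (R := ℂ) (φ := fun _ : J => ℂ) j) 0 :=
    (ContinuousLinearMap.proj (R := ℂ) (φ := fun _ : J => ℂ) j).hasFDerivAt
  have h2 := h1.add ((hasFDerivAt_sb_of_ord (hY j)).add
    (hasFDerivAt_sb_of_ord ((hY (Equiv.swap p q j)).Sw (p := p) (q := q))))
  rw [add_zero, add_zero] at h2
  refine h2.congr_of_eventuallyEq ?_
  filter_upwards [Metric.ball_mem_nhds (0 : J → ℂ) one_pos] with x hx
  have hx1 : ‖x‖ ≤ 1 := (mem_ball_zero_iff.1 hx).le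
  rw [nf, sb_add hx1, sb_add hx1, sb_X, add_assoc]
  rfl

lemma sb_nf_swap {Y : J → PS J} {x : J → ℂ} (hx : ‖x‖ ≤ 1) (j : J) :
    sb (x ∘ Equiv.swap p q) (nf p q Y j) = sb x (nf p q Y (Equiv.swap p q j)) := by
  have hx2 : ‖x ∘ Equiv.swap p q‖ ≤ 1 :=
    (pi_norm_le_iff_of_nonneg zero_le_one).2 fun i => norm_apply_le hx _
  have e : (x ∘ Equiv.swap p q) ∘ Equiv.swap p q = x := by
    funext i; simp
  simp only [nf, sb_add hx, sb_add hx2, sb_Sw p q hx, sb_Sw p q hx2, sb_X, e, Function.comp,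
    Equiv.swap_apply_self]
  ring

/-- The remainder of a conjugacy equation between reversible maps satisfies a linear equation up to
higher order terms. -/
lemma reversible_remainder {V : Type*} [NormedAddCommGroup V] [NormedSpace ℂ V]
    {s P T E : V → V} {S σ : V →L[ℂ] V} (hs : HasStrictFDerivAt s S 0)
    (hP : Tendsto P (𝓝 0) (𝓝 0)) (hT : Tendsto T (𝓝 0) (𝓝 0)) (hE : Tendsto E (𝓝 0) (𝓝 0))
    (hsr : ∀ᶠ y in 𝓝 0, σ (s (σ (s y))) = y)
    (hTr : ∀ᶠ y in 𝓝 0, T (σ (T y)) = σ y) (hPσ : ∀ᶠ y in 𝓝 0, P (σ y) = σ (P y))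
    (hσ : ∀ y, σ (σ y) = y)
    (hEq : ∀ᶠ y in 𝓝 0, s (P y) = P (T y) + E y) :
    (fun y => E (σ (T y)) + S (σ (E y))) =o[𝓝 0] fun y => σ (E y) := by
  have hσ0 : Tendsto σ (𝓝 0) (𝓝 0) := by simpa using σ.continuous.tendsto 0
  have hσT : Tendsto (fun y => σ (T y)) (𝓝 0) (𝓝 0) := hσ0.comp hT
  have h1 := hs.isLittleO
  -- Strict differentiability is needed because s is compared at two points that both move, rather
  -- than at a point and 0.
  have hlim : Tendsto (fun y => (P (σ (T y)) + σ (E y), P (σ (T y)))) (𝓝 0) (𝓝 ((0 : V), (0 : V))) := by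
    have a := hP.comp hσT
    have b := a.add (hσ0.comp hE)
    rw [add_zero] at b
    exact b.prodMk_nhds a
  have h2 := (h1.comp_tendsto hlim).neg_left
  refine (h2.congr' ?_ ?_)
  · filter_upwards [hEq, hσT.eventually hEq, hP.eventually hsr, hTr, hPσ, hT.eventually hPσ]
      with y e1 e2 e3 e4 e5 e6
    -- Reversibility says s σ s = σ. Applied at P y, with s (P y) = P (T y) + E y, it evaluates s at
    -- the shifted point; the equation at σ (T y) evaluates it at the unshifted one.
    have e7 : s (P (σ (T y)) + σ (E y)) = σ (P y) := by
      rw [e6, ← map_add, ← e1, ← hσ (s (σ (s (P y)))), e3]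
    simp only [Function.comp, add_sub_cancel_left]
    rw [e7, e2, e4, e5]
    abel
  · filter_upwards with y
    simp

lemma tendsto_lead_line {f : (J → ℂ) → ℂ} {r : ℝ} {F : PS J} (hf : Rep f r F) {d : ℕ}
    (hF : Ord d F) {γ : ℂ → J → ℂ} (hγ0 : Tendsto γ (𝓝[≠] 0) (𝓝 0)) {y : J → ℂ}
    (hγ : Tendsto (fun t => t⁻¹ • γ t) (𝓝[≠] 0) (𝓝 y)) :
    Tendsto (fun t => (t ^ d)⁻¹ * f (γ t)) (𝓝[≠] 0) (𝓝 (lead F d ((r : ℂ)⁻¹ • y))) := by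
  have h1 : Tendsto (fun t : ℂ => t⁻¹ • ((r : ℂ)⁻¹ • γ t)) (𝓝[≠] 0) (𝓝 ((r : ℂ)⁻¹ • y)) := by
    refine (hγ.const_smul ((r : ℂ)⁻¹)).congr fun t => ?_
    rw [smul_comm]
  refine (tendsto_lead hF h1).congr' ?_
  filter_upwards [hγ0.eventually (Metric.ball_mem_nhds (0 : J → ℂ) hf.pos)] with t ht
  rw [hf.eq _ (mem_ball_zero_iff.1 ht).le]

/-- Exchange of two coordinates as a linear map. -/
def swL (p q : J) : (J → ℂ) →L[ℂ] J → ℂ :=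
  ContinuousLinearMap.pi fun j => ContinuousLinearMap.proj (R := ℂ) (φ := fun _ : J => ℂ) (Equiv.swap p q j)

lemma swL_apply (x : J → ℂ) : swL p q x = x ∘ Equiv.swap p q := rfl

lemma swL_swL (x : J → ℂ) : swL p q (swL p q x) = x := by
  funext i; simp [swL_apply]

lemma swL_dv_mul (hpq : p ≠ q) (c : ℂ) (x : J → ℂ) :
    swL p q (dv p q c * x) = dv p q c⁻¹ * swL p q x := by
  funext j
  simp only [swL_apply, Function.comp, Pi.mul_apply]
  congr 1
  rcases eq_or_ne j p with rfl | h1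
  · rw [Equiv.swap_apply_left, dv_right hpq, dv_left]
  rcases eq_or_ne j q with rfl | h2
  · rw [Equiv.swap_apply_right, dv_right hpq, dv_left, inv_inv]
  · rw [Equiv.swap_apply_of_ne_of_ne h1 h2, dv_other h1 h2, dv_other h1 h2]

/-- The remainder vanishes if its component `x_p` does and the other components have only
nonpositive weights. -/
lemma remainder_eq_zero (hpq : p ≠ q) {μ : ℂ} (hμ : μ ≠ 0) {T E : (J → ℂ) → J → ℂ}
    (hE : ∀ j, AnalyticAt ℂ (fun y => E y j) 0) (hT : HasFDerivAt T
      (ContinuousLinearMap.mul ℂ (J → ℂ) (dv p q μ)) 0) (hT0 : T 0 = 0)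
    (hlo : (fun y => E (swL p q (T y)) + dv p q μ * swL p q (E y)) =o[𝓝 0]
      fun y => swL p q (E y))
    (hEp : ∀ᶠ y in 𝓝 0, E y p = 0)
    (hEz : ∀ j, j ≠ p → j ≠ q → ∃ F, Wts p q (Set.Iic 0) F ∧ ∀ᶠ y in 𝓝 0, E y j = sb y F) :
    ∀ᶠ y in 𝓝 0, E y = 0 := by
  obtain ⟨r₀, hr₀, hr⟩ := exists_rep_family hE
  set r := min r₀ 1 with hrdef
  have hr1 : r ≤ 1 := min_le_right _ _
  have hr0 : 0 < r := lt_min hr₀ one_pos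
  have hrC : (r : ℂ) ≠ 0 := by exact_mod_cast hr0.ne'
  obtain ⟨F, hF⟩ := hr r hr0 (min_le_left _ _)
  have hFp : F p = 0 := (hF p).eq_zero hEp
  have hFz : ∀ j, j ≠ p → j ≠ q → Wts p q (Set.Iic 0) (F j) := by
    intro j h1 h2
    obtain ⟨G, hG, hG2⟩ := hEz j h1 h2
    have e := (hF j).unique ((rep_sb G).shrink hr0 hr1) hG2
    intro α hα
    rw [e, cf_shrink (by rw [div_one]; exact hr0.le) (by rwa [div_one])] at hα
    exact hG α (right_ne_zero_of_mul hα)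
  -- All components are handled in the same degree at once, since the reversibility relation couples
  -- component j to its mirror component.
  have step : ∀ d, (∀ j, Ord d (F j)) → ∀ j, ∀ α : J →₀ ℕ, α.degree = d → cf α (F j) = 0 := by
    intro d hd
    have hσT : HasFDerivAt (fun y => swL p q (T y))
        (swL p q ∘L ContinuousLinearMap.mul ℂ (J → ℂ) (dv p q μ)) 0 :=
      (swL p q).hasFDerivAt.comp (0 : J → ℂ) hT
    have hlim1 : ∀ y : J → ℂ, Tendsto (fun t : ℂ => (t ^ d)⁻¹ • E (t • y)) (𝓝[≠] 0)
        (𝓝 fun j => lead (F j) d ((r : ℂ)⁻¹ • y)) := fun y => by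
      refine tendsto_pi_nhds.2 fun j => ?_
      have h := tendsto_smul_line y 1
      simp only [one_smul] at h
      exact tendsto_lead_line (hF j) (hd j) (tendsto_line y) h
    have hlim2 : ∀ y : J → ℂ, Tendsto (fun t : ℂ => (t ^ d)⁻¹ • E (swL p q (T (t • y)))) (𝓝[≠] 0)
        (𝓝 fun j => lead (F j) d ((r : ℂ)⁻¹ • swL p q (dv p q μ * y))) := fun y => by
      refine tendsto_pi_nhds.2 fun j => ?_
      refine tendsto_lead_line (hF j) (hd j) ?_ (tendsto_slope hσT (by simp [hT0]) y)
      have h := hσT.continuousAt.tendsto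
      rw [hT0, map_zero] at h
      exact h.comp (tendsto_line y)
    -- Divided by t^d along a line, the o-term in `hlo` tends to zero and a linear identity between
    -- leading forms remains.
    have hsum : ∀ (y : J → ℂ) (j : J), lead (F j) d ((r : ℂ)⁻¹ • swL p q (dv p q μ * y)) +
        dv p q μ j * lead (F (Equiv.swap p q j)) d ((r : ℂ)⁻¹ • y) = 0 := by
      intro y j
      have h1 := (hlim2 y).add ((tendsto_const_nhds (x := dv p q μ)).mul
        (((swL p q).continuous.tendsto _).comp (hlim1 y)))
      have h2 := ((swL p q).continuous.tendsto _).comp (hlim1 y)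
      have h3 := hlo.comp_tendsto (tendsto_line y)
      have h4 : (fun t : ℂ => (t ^ d)⁻¹ • (E (swL p q (T (t • y))) +
          dv p q μ * swL p q (E (t • y)))) =o[𝓝[≠] 0]
          fun t => (t ^ d)⁻¹ • swL p q (E (t • y)) :=
        (isBigO_refl (fun t : ℂ => (t ^ d)⁻¹) _).smul_isLittleO h3
      have h5 : (fun t : ℂ => (t ^ d)⁻¹ • swL p q (E (t • y))) =O[𝓝[≠] 0] fun _ => (1 : ℝ) := by
        refine Tendsto.isBigO_one ℝ (h2.congr fun t => ?_)
        simp only [Function.comp, map_smul]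
      have h6 := (isLittleO_one_iff ℝ).1 (h4.trans_isBigO h5)
      have h7 := tendsto_nhds_unique h6 (h1.congr fun t => by
        simp only [Function.comp, map_smul, smul_add, mul_smul_comm])
      have h8 := congrFun h7.symm j
      simpa [swL_apply] using h8
    -- Row p of the identity expresses the leading part of component q through that of component p,
    -- which is zero.
    have hq : ∀ α : J →₀ ℕ, α.degree = d → cf α (F q) = 0 := by
      refine fun α hα => coeff_eq_zero_of_sum (d := d) (fun y => ?_) α hα
      have h := hsum ((r : ℂ) • y) p
      rw [hFp, dv_left, Equiv.swap_apply_left, smul_smul, inv_mul_cancel₀ hrC, one_smul] at h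
      have h0 : lead (0 : PS J) d ((r : ℂ)⁻¹ • swL p q (dv p q μ * (r : ℂ) • y)) = 0 := by
        simp [lead]
      rw [h0, zero_add] at h
      exact (mul_eq_zero.1 h).resolve_left hμ
    intro j
    rcases eq_or_ne j p with rfl | h1
    · intro α _; rw [hFp, map_zero]
    rcases eq_or_ne j q with rfl | h2
    · exact hq
    refine lead_eq_zero_of_antisymm hpq hμ (hFz j h1 h2) fun y => ?_
    have h := hsum ((r : ℂ) • y) j
    rw [dv_other h1 h2, Equiv.swap_apply_of_ne_of_ne h1 h2, smul_smul, inv_mul_cancel₀ hrC,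
      one_smul, one_mul, mul_smul_comm, map_smul, smul_smul, inv_mul_cancel₀ hrC, one_smul] at h
    exact h
  have hord : ∀ d, ∀ j, Ord d (F j) := by
    intro d
    induction d with
    | zero => exact fun j => Ord.nil
    | succ d ih =>
      intro j α hα
      rcases Nat.lt_succ_iff_lt_or_eq.1 hα with h | h
      · exact ih j α h
      · exact step d ih j α h
  have hF0 : ∀ j, F j = 0 := fun j => ext_cf fun α => by
    rw [map_zero]; exact hord (α.degree + 1) j α (Nat.lt_succ_self _)
  filter_upwards [Metric.ball_mem_nhds (0 : J → ℂ) hr0] with y hy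
  funext j
  rw [(hF j).eq y (mem_ball_zero_iff.1 hy).le, hF0, Pi.zero_apply]
  simp [sb]

/-- Simultaneous normal form of a reversible map and the exchange of two coordinates, in scaled
coordinates. -/
theorem exists_normalizing_scaled (hpq : p ≠ q) {μ : ℂ} (hμ : 1 < ‖μ‖) : ∃ δ > 0,
    ∀ (s : (J → ℂ) → J → ℂ) (H : J → PS J), (∀ j, ‖H j‖ ≤ δ) → (∀ j, Ord 2 (H j)) →
      (∀ j, Rep (fun y => s y j - dv p q μ j * y j) 4 (H j)) →
      HasStrictFDerivAt s (ContinuousLinearMap.mul ℂ (J → ℂ) (dv p q μ)) 0 →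
      (∀ᶠ y in 𝓝 0, swL p q (s (swL p q (s y))) = y) →
      ∃ (P : (J → ℂ) → J → ℂ) (n : (J → ℂ) → ℂ), AnalyticAt ℂ P 0 ∧ P 0 = 0 ∧
        HasFDerivAt P (1 : (J → ℂ) →L[ℂ] J → ℂ) 0 ∧ (∀ᶠ y in 𝓝 0, P (swL p q y) = swL p q (P y)) ∧ HasWt p q 0 n ∧
        n 0 = μ⁻¹ ∧ ∀ᶠ y in 𝓝 0, s (P y) = P (sF p q (fun y => (n y)⁻¹) y) := by
  obtain ⟨δ, hδ, key⟩ := exists_fixed (J := J) (p := p) (q := q) hμ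
  have hμ0 : μ ≠ 0 := norm_pos_iff.1 (by linarith)
  refine ⟨δ, hδ, fun s H hH hHo hHr hs hsr => ?_⟩
  have hq4 : ∀ Φ : J → PS J, (∀ j, ‖Φ j‖ ≤ 2) → ∀ j, ‖(4 : ℂ)⁻¹ • Φ j‖ ≤ 1 / 2 := fun Φ hΦ j => by
    rw [norm_smul, norm_inv, Complex.norm_ofNat]
    linarith [hΦ j]
  have hq1 : ∀ Φ : J → PS J, (∀ j, ‖Φ j‖ ≤ 2) → ∀ j, ‖(4 : ℂ)⁻¹ • Φ j‖ ≤ 1 := fun Φ hΦ j =>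
    (hq4 Φ hΦ j).trans (by norm_num)
  -- `H` represents the nonlinear part on radius 4 and candidates have norm at most 2, so the
  -- substituted series have norm at most 1/2, where `norm_sb_sub_le` applies.
  set h : (J → PS J) → J → PS J := fun Φ j => sb (fun i => (4 : ℂ)⁻¹ • Φ i) (H j) with hh
  obtain ⟨N, Y, hN, hY, hYo, hNe, hYp, hYq, hYz⟩ := key h
    (fun Φ hΦ hΦo j => ⟨(norm_sb_le (hq1 Φ hΦ) _).trans (hH j),
      Ord.sb (hq1 Φ hΦ) (fun i => (hΦo i).smul _) (hHo j)⟩)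
    (fun Φ Φ' hΦ hΦ' j => by
      have h1 := norm_sb_sub_le (Δ := 4⁻¹ * ‖Φ - Φ'‖) (hq4 Φ hΦ) (hq4 Φ' hΦ') (fun i => by
        rw [← smul_sub, norm_smul, norm_inv, Complex.norm_ofNat]
        gcongr
        exact norm_le_pi_norm (Φ - Φ') i) (by positivity) (H j)
      refine h1.trans ?_
      have := hH j
      calc _ ≤ 2 * (4⁻¹ * ‖Φ - Φ'‖) * δ := by gcongr
        _ ≤ _ := by nlinarith [mul_nonneg hδ.le (norm_nonneg (Φ - Φ'))])
  set Φ := nf p q Y with hΦ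
  have hΦ2 : ∀ j, ‖Φ j‖ ≤ 2 := norm_nf_le hY le_rfl
  have hN0 : IsWt p q 0 N := by
    have h1 := isWt_proj p q 0 (N * dvd p q (h Φ p))
    intro α hα
    rw [hNe, eqN, map_smul, map_sub] at hα
    have h2 := right_ne_zero_of_smul hα
    by_contra h3
    refine h2 ?_
    have e1 : cf α (1 : PS J) = 0 := by
      by_contra h4; exact h3 (IsWt.one α h4)
    have e2 : cf α (proj p q 0 (N * dvd p q (h Φ p))) = 0 := by
      by_contra h4; exact h3 (h1 α h4)
    rw [e1, e2, sub_zero]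
  have hNc : cf 0 N = μ⁻¹ := by
    have h1 : Ord 1 (N * dvd p q (h Φ p)) := (Ord.dvd (Ord.sb (hq1 Φ hΦ2)
      (fun i => (Ord.nf hYo i).smul _) (hHo p))).mul_left
    rw [hNe, eqN, map_smul, map_sub, cf_proj, h1 0 (by simp), ite_self, ← mon_zero, cf_mon]
    simp
  set n : (J → ℂ) → ℂ := fun y => sb y N with hn
  have hnw : HasWt p q 0 n := hN0.hasWt hpq (rep_sb N)
  have hn0 : n 0 = μ⁻¹ := by rw [← hNc, hn]; exact sb_zero N
  have hn0' : n 0 ≠ 0 := by rw [hn0]; exact inv_ne_zero hμ0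
  have hni : AnalyticAt ℂ (fun y => (n y)⁻¹) 0 := hnw.an.inv hn0'
  have hni0 : (n 0)⁻¹ ≠ 0 := inv_ne_zero hn0'
  set T : (J → ℂ) → J → ℂ := sF p q fun y => (n y)⁻¹ with hT
  have hT0 : T 0 = 0 := by simp [hT, sF]
  have hTd : HasFDerivAt T (ContinuousLinearMap.mul ℂ (J → ℂ) (dv p q μ)) 0 := by
    have := hasFDerivAt_sF (p := p) (q := q) hni hni0
    rwa [hn0, inv_inv] at this
  have hTt : Tendsto T (𝓝 0) (𝓝 0) := by simpa [hT0] using hTd.continuousAt.tendsto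
  set P : (J → ℂ) → J → ℂ := fun y j => sb y (Φ j) with hP
  have hPa : AnalyticAt ℂ P 0 := analyticAt_pi_iff.2 fun j => analyticAt_sb (Φ j)
  have hP0 : P 0 = 0 := by
    funext j
    have : sb (0 : J → ℂ) (Φ j) = 0 := by rw [sb_zero]; exact Ord.nf hYo j 0 (by simp)
    exact this
  have hPt : Tendsto P (𝓝 0) (𝓝 0) := by simpa [hP0] using hPa.continuousAt.tendsto
  have hball : ∀ᶠ y : J → ℂ in 𝓝 0, ‖y‖ ≤ 1 := by
    filter_upwards [Metric.ball_mem_nhds (0 : J → ℂ) one_pos] with y hy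
    exact (mem_ball_zero_iff.1 hy).le
  have hPσ : ∀ᶠ y in 𝓝 0, P (swL p q y) = swL p q (P y) := by
    filter_upwards [hball] with y hy
    funext j
    exact sb_nf_swap hy j
  have hTcond : ∀ᶠ y in 𝓝 0, ‖y‖ ≤ 1 ∧ ‖T y‖ ≤ 1 ∧ n y ≠ 0 ∧ n (T y) = n y := by
    filter_upwards [hball, hTt.eventually hball, hnw.an.continuousAt.eventually_ne hn0',
      hnw.comp_sF hpq hni hni0] with y h1 h2 h3 h4 using ⟨h1, h2, h3, h4⟩
  have hsP : ∀ y : J → ℂ, ‖y‖ ≤ 1 → ∀ j, s (P y) j = dv p q μ j * P y j + sb y (h Φ j) := by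
    intro y hy j
    have h1 : ‖P y‖ ≤ 4 := by
      refine (pi_norm_le_iff_of_nonneg (by norm_num)).2 fun i => ?_
      exact (norm_sb_le (norm_apply_le hy) _).trans ((hΦ2 i).trans (by norm_num))
    have h2 := (hHr j).eq (P y) h1
    have h3 : sb y (h Φ j) = sb (((4 : ℝ) : ℂ)⁻¹ • P y) (H j) := by
      rw [hh, sb_sb (norm_apply_le hy) (hq1 Φ hΦ2)]
      congr 1
      funext i
      rw [sb_smul]; simp [hP]
    rw [h3, ← h2]; ring
  -- Only part of the conjugacy equation was imposed on the fixed point; E measures the rest.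
  set E : (J → ℂ) → J → ℂ := fun y => s (P y) - P (T y) with hE
  have hsa : ∀ j, AnalyticAt ℂ (fun y => s y j) 0 := fun j => by
    have h1 := (hHr j).analyticAt.add ((analyticAt_const (v := dv p q μ j)).mul
      ((ContinuousLinearMap.proj (R := ℂ) (φ := fun _ : J => ℂ) j).analyticAt 0))
    refine h1.congr (.of_forall fun y => ?_)
    simp
  have hTa : AnalyticAt ℂ T 0 := (analyticAt_dv hni hni0).mul analyticAt_id
  have hEa : AnalyticAt ℂ E 0 :=
    (AnalyticAt.comp (g := s) (by rw [hP0]; exact analyticAt_pi_iff.2 hsa) hPa).sub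
      (AnalyticAt.comp (g := P) (by rw [hT0]; exact hPa) hTa)
  have hs0 : s 0 = 0 := by
    funext j
    have h1 := (hHr j).apply_zero
    rw [hHo j 0 (by simp)] at h1
    simpa using h1
  have hE0 : E 0 = 0 := by simp [hE, hP0, hT0, hs0]
  -- The model map is reversible for the same exchange, because its multiplier depends on y_p, y_q
  -- only through their product.
  have hTr : ∀ᶠ y in 𝓝 0, T (swL p q (T y)) = swL p q y := by
    have hσt : Tendsto (swL p q) (𝓝 0) (𝓝 (0 : J → ℂ)) := by
      simpa using (swL p q).continuous.tendsto (0 : J → ℂ)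
    have h1 := hnw.comp_eq hpq (s := fun y => swL p q (T y)) (s' := T) (hσt.comp hTt) hTt
      (.of_forall fun y j h1 h2 => by simp [swL_apply, Equiv.swap_apply_of_ne_of_ne h1 h2])
      (.of_forall fun y => by simp [swL_apply, mul_comm])
    filter_upwards [h1, hTcond] with y e1 e2
    have e3 : n (swL p q (T y)) = n y := e1.trans e2.2.2.2
    rw [hT, sF, ← hT]
    simp only [e3]
    rw [hT, sF, swL_dv_mul hpq, inv_inv, ← mul_assoc, ← dv_mul, inv_mul_cancel₀ e2.2.2.1, dv_one,
      one_mul]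
  have hlo := reversible_remainder (E := E) hs hPt hTt
    (by simpa [hE0] using hEa.continuousAt.tendsto) hsr hTr hPσ swL_swL
    (.of_forall fun y => by simp [hE])
  have hfin := remainder_eq_zero hpq hμ0 (T := T) (E := E) (analyticAt_pi_iff.1 hEa) hTd hT0 hlo
    (by
      filter_upwards [hTcond] with y hy
      have h1 := eqP_eval hpq hμ0 hN hN0 hNe hYp hy.2.1 hy.1 hy.2.2.1 rfl hy.2.2.2
      have h2 : Φ p = X p + Y p := by
        rw [hΦ, nf, Equiv.swap_apply_left, hYq hpq]
        simp [Sw, sb]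
      have h3 : E y p = s (P y) p - P (T y) p := rfl
      rw [h3, hsP y hy.1, dv_left]
      simp only [hP, h2]
      rw [h1]; ring)
    (fun j h1 h2 => by
      obtain ⟨F, hF, hF2⟩ := eqZ_eval hpq hN hN0 (hYz j h1 h2) h1 h2
      refine ⟨F, hF, ?_⟩
      filter_upwards [hTcond] with y hy
      have h3 : E y j = s (P y) j - P (T y) j := rfl
      rw [← hF2 (T y) y hy.2.1 hy.1 hy.2.2.1 rfl hy.2.2.2, h3, hsP y hy.1,
        dv_other h1 h2, one_mul]
      simp only [hP, hΦ, nf, Equiv.swap_apply_of_ne_of_ne h1 h2])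
  refine ⟨P, n, hPa, hP0, hasFDerivAt_sb_nf hYo, hPσ, hnw, hn0, ?_⟩
  filter_upwards [hfin] with y hy
  exact sub_eq_zero.1 hy

end Scaled

/-! ### Normal form of a pair of involutions -/

section Pair
open PS
variable {J : Type*} [Fintype J] [DecidableEq J] {p q : J}

/-- The exchange of two coordinates as a linear isomorphism. -/
def swE (p q : J) : (J → ℂ) ≃L[ℂ] (J → ℂ) :=
  ContinuousLinearEquiv.equivOfInverse (swL p q) (swL p q) swL_swL swL_swL

/-- The map `x_p ↦ u x_q`, `x_q ↦ u⁻¹ x_p`. -/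
def tauF (p q : J) (u : (J → ℂ) → ℂ) (x : J → ℂ) : J → ℂ := dv p q (u x) * swL p q x

lemma tauF_left (u : (J → ℂ) → ℂ) (x : J → ℂ) : tauF p q u x p = u x * x q := by
  simp [tauF, dv_left, swL_apply]

lemma tauF_right (hpq : p ≠ q) (u : (J → ℂ) → ℂ) (x : J → ℂ) :
    tauF p q u x q = (u x)⁻¹ * x p := by
  simp [tauF, dv_right hpq, swL_apply]

lemma tauF_other {j : J} (hp : j ≠ p) (hq : j ≠ q) (u : (J → ℂ) → ℂ) (x : J → ℂ) :
    tauF p q u x j = x j := by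
  simp [tauF, dv_other hp hq, swL_apply, Equiv.swap_apply_of_ne_of_ne hp hq]

lemma swL_comm (p q : J) : swL p q = swL q p := by
  ext x j
  simp [swL_apply, Equiv.swap_comm]

lemma tauF_swap (hpq : p ≠ q) (u : (J → ℂ) → ℂ) (x : J → ℂ) :
    tauF q p (fun x => (u x)⁻¹) x = tauF p q u x := by
  rw [tauF, tauF, swL_comm, dv_swap hpq]

/-- The linear map `x_p ↦ c x_q`, `x_q ↦ c⁻¹ x_p`. -/
def tauL (p q : J) (c : ℂ) : (J → ℂ) →L[ℂ] J → ℂ :=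
  ContinuousLinearMap.mul ℂ (J → ℂ) (dv p q c) ∘L swL p q

lemma tauL_apply (c : ℂ) (x : J → ℂ) : tauL p q c x = dv p q c * swL p q x := rfl

lemma tauL_swap (hpq : p ≠ q) (c : ℂ) : tauL q p c⁻¹ = tauL p q c := by
  ext1 x
  rw [tauL_apply, tauL_apply, swL_comm, dv_swap hpq]

lemma HasWt.swap (hpq : p ≠ q) {f : (J → ℂ) → ℂ} (hf : HasWt q p 0 f) : HasWt p q 0 f := by
  refine ⟨hf.an, ?_⟩
  filter_upwards [tendsto_rot.eventually hf.rot] with x hx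
  have e : AbelianCR.rot q p (AbelianCR.rot p q x) = x := by
    rw [AbelianCR.rot, AbelianCR.rot, ← mul_assoc, ← dv_swap hpq.symm, ← dv_mul, inv_mul_cancel₀ t0_ne_zero, dv_one,
      one_mul]
  rw [e] at hx
  simpa using hx.symm

/-- The scaling by `ε` composed with `x_p ↦ c x_p`, `x_q ↦ c⁻¹ x_q`. -/
def scE (p q : J) {c ε : ℂ} (hc : c ≠ 0) (hε : ε ≠ 0) : (J → ℂ) ≃L[ℂ] (J → ℂ) :=
  ContinuousLinearEquiv.equivOfInverse (ε • (dvE p q c hc : (J → ℂ) →L[ℂ] J → ℂ))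
    (ε⁻¹ • ((dvE p q c hc).symm : (J → ℂ) →L[ℂ] J → ℂ))
    (fun x => by simp [smul_smul, hε]) (fun x => by simp [smul_smul, hε])

lemma scE_apply {c ε : ℂ} (hc : c ≠ 0) (hε : ε ≠ 0) (x : J → ℂ) :
    scE p q hc hε x = ε • (dv p q c * x) := rfl

lemma scE_symm_apply {c ε : ℂ} (hc : c ≠ 0) (hε : ε ≠ 0) (x : J → ℂ) :
    (scE p q hc hε).symm x = ε⁻¹ • (dv p q c⁻¹ * x) := rfl

lemma linG_inv_rp {V : Type*} [NormedAddCommGroup V] [NormedSpace ℂ V] (e : V ≃L[ℂ] V) :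
    Rp (linG e)⁻¹ e.symm := by
  have h : linG e * linG e.symm = 1 :=
    Rp.mul_eq_one (linG_rp e) (linG_rp e.symm) (.of_forall fun x => e.apply_symm_apply x)
  rw [inv_eq_of_mul_eq_one_right h]
  exact linG_rp _

lemma D_conj {V : Type*} [NormedAddCommGroup V] [NormedSpace ℂ V] {g h : GG V} (hg : g ∈ Hol V)
    (hh : h ∈ Hol V) (hDh : D h = 1) : D (g * h * g⁻¹) = 1 := by
  rw [D_mul ((Hol V).mul_mem hg hh) ((Hol V).inv_mem hg), D_mul hg hh, hDh, mul_one, D_mul_inv hg]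

lemma analyticAt_comp_zero {V W U : Type*} [NormedAddCommGroup V] [NormedSpace ℂ V]
    [NormedAddCommGroup W] [NormedSpace ℂ W] [NormedAddCommGroup U] [NormedSpace ℂ U]
    {g : W → U} {f : V → W} (hg : AnalyticAt ℂ g 0) (hf : AnalyticAt ℂ f 0) (h0 : f 0 = 0) :
    AnalyticAt ℂ (fun x => g (f x)) 0 :=
  AnalyticAt.comp (g := g) (by rwa [h0]) hf

lemma ord_two_of_hasFDerivAt {f : (J → ℂ) → ℂ} {r : ℝ} {F : PS J} (h : Rep f r F) (h0 : f 0 = 0)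
    (hf : HasFDerivAt f (0 : (J → ℂ) →L[ℂ] ℂ) 0) : Ord 2 F := by
  intro α hα
  rcases Nat.lt_succ_iff_lt_or_eq.1 hα with h1 | h1
  · have : α = 0 := by rw [← Finsupp.degree_eq_zero_iff]; omega
    rw [this, ← h.apply_zero, h0]
  · exact coeff_eq_zero_of_sum (d := 1) (c := fun α => cf α F)
      (fun y => by simpa [lead] using lead_one h h0 hf y) α h1

/-- Scaling makes the nonlinear part of a germ small. -/
lemma exists_scaled_rep {f : (J → ℂ) → J → ℂ} {A : (J → ℂ) →L[ℂ] J → ℂ} (hf : AnalyticAt ℂ f 0)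
    (h0 : f 0 = 0) (hA : HasFDerivAt f A 0) {δ : ℝ} (hδ : 0 < δ) :
    ∃ (ε : ℝ) (H : J → PS J), 0 < ε ∧ (∀ j, ‖H j‖ ≤ δ) ∧ (∀ j, Ord 2 (H j)) ∧
      ∀ j, Rep (fun y => ((ε : ℂ)⁻¹ • f ((ε : ℂ) • y)) j - A y j) 4 (H j) := by
  have hg : ∀ j, AnalyticAt ℂ (fun y => f y j - A y j) 0 := fun j =>
    (analyticAt_pi_iff.1 hf j).sub (analyticAt_pi_iff.1 (A.analyticAt 0) j)
  obtain ⟨r, hr, hR⟩ := exists_rep_family hg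
  obtain ⟨G, hG⟩ := hR r hr le_rfl
  have hGo : ∀ j, Ord 2 (G j) := fun j => by
    refine ord_two_of_hasFDerivAt (hG j) (by simp [h0]) ?_
    have h1 := (hasFDerivAt_pi'.1 hA j).sub (hasFDerivAt_pi'.1 (A.hasFDerivAt (x := 0)) j)
    rw [sub_self] at h1
    exact h1
  set C := ∑ j, ‖G j‖ + 1 with hC
  have hC0 : 0 < C := by positivity
  have hGC : ∀ j, ‖G j‖ ≤ C := fun j =>
    (Finset.single_le_sum (f := fun j => ‖G j‖) (fun _ _ => norm_nonneg _)
      (Finset.mem_univ j)).trans (by simp [hC])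
  -- A remainder of order two gains (4ε/r)² when restricted to radius 4ε, and rescaling the values
  -- costs ε⁻¹. The net size 16 ε C / r² must be at most δ, with 4ε ≤ r for convergence.
  obtain ⟨ε, hε0, hε⟩ : ∃ ε > 0, ε ≤ min (r / 4) (δ * r ^ 2 / (16 * C)) :=
    ⟨_, lt_min (by positivity) (by positivity), le_rfl⟩
  have hε1 : 4 * ε ≤ r := by linarith [hε.trans (min_le_left _ _)]
  have hε2 : ε * (16 * C) ≤ δ * r ^ 2 := by
    have := hε.trans (min_le_right _ _)
    rwa [le_div_iff₀ (by positivity)] at this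
  have hεC : (ε : ℂ) ≠ 0 := by exact_mod_cast hε0.ne'
  refine ⟨ε, fun j => (ε : ℂ)⁻¹ • shrink (4 * ε / r) (G j), hε0, fun j => ?_, fun j => ?_,
    fun j => ?_⟩
  · have h1 := norm_shrink_le (κ := 4 * ε / r) (by positivity) ((div_le_one hr).2 hε1) (hGo j)
    rw [norm_smul, norm_inv, Complex.norm_real, Real.norm_of_nonneg hε0.le]
    calc _ ≤ ε⁻¹ * ((4 * ε / r) ^ 2 * C) := by
          gcongr
          exact h1.trans (by gcongr; exact hGC j)
      _ = ε * (16 * C) / r ^ 2 := by field_simp; ring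
      _ ≤ δ := by rw [div_le_iff₀ (by positivity)]; exact hε2
  · refine Ord.smul _ fun α hα => ?_
    rw [cf_shrink (by positivity) ((div_le_one hr).2 hε1), hGo j α hα, mul_zero]
  · have h1 := (hG j).shrink (r' := 4 * ε) (by positivity) hε1
    refine ⟨by norm_num, fun y hy => ?_⟩
    have h2 := h1.eq ((ε : ℂ) • y) (by
      rw [norm_smul, Complex.norm_real, Real.norm_of_nonneg hε0.le]
      calc ε * ‖y‖ ≤ ε * 4 := by gcongr
        _ = _ := mul_comm _ _)
    have e : (((4 * ε : ℝ) : ℂ)⁻¹ • (ε : ℂ) • y) = ((4 : ℝ) : ℂ)⁻¹ • y := by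
      rw [smul_smul]; congr 1; push_cast; field_simp
    rw [e] at h2
    rw [sb_smul, ← h2, map_smul]
    simp only [Pi.smul_apply, smul_eq_mul]
    field_simp

lemma hasFDerivAt_unique_strict {V : Type*} [NormedAddCommGroup V] [NormedSpace ℂ V]
    [CompleteSpace V] {f : V → V} {A : V →L[ℂ] V} (hf : AnalyticAt ℂ f 0) (h : HasFDerivAt f A 0) :
    HasStrictFDerivAt f A 0 := by
  have := hf.hasStrictFDerivAt
  rwa [h.fderiv] at this

lemma tauL_tauL (hpq : p ≠ q) (c c' : ℂ) (x : J → ℂ) :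
    tauL p q c (tauL p q c' x) = dv p q (c * c'⁻¹) * x := by
  rw [tauL_apply, tauL_apply, swL_dv_mul hpq, swL_swL, ← mul_assoc, dv_mul]

lemma isInvertible_tauL (hpq : p ≠ q) {c : ℂ} (hc : c ≠ 0) : (tauL p q c).IsInvertible := by
  have h : ∀ x, tauL p q c (tauL p q c x) = x := fun x => by
    rw [tauL_tauL hpq, mul_inv_cancel₀ hc, dv_one, one_mul]
  exact ⟨ContinuousLinearEquiv.equivOfInverse (tauL p q c) (tauL p q c) h h, by ext; rfl⟩

lemma exists_tau_germ (hpq : p ≠ q) {u : (J → ℂ) → ℂ} (hu : AnalyticAt ℂ u 0) (h0 : u 0 ≠ 0) :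
    ∃ g ∈ Hol (J → ℂ), Rp g (tauF p q u) ∧ D g = tauL p q (u 0) := by
  have hm := analyticAt_dv (p := p) (q := q) hu h0
  exact exists_hol_of_hasFDerivAt (analyticAt_mul_lin hm (swL p q)) (by simp)
    (isInvertible_tauL hpq h0) (hasFDerivAt_mul_lin hm (swL p q))

lemma D_inv_eq_one {V : Type*} [NormedAddCommGroup V] [NormedSpace ℂ V] {g : GG V}
    (hg : g ∈ Hol V) (h : D g = 1) : D g⁻¹ = 1 := by
  have := D_inv_mul hg
  rwa [h, mul_one] at this

/-- Simultaneous normal form of two involutions, first case. -/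
theorem exists_pair_normal_form_aux (hpq : p ≠ q) {l : ℂ} (hl : 1 < ‖l‖) {a b : GG (J → ℂ)}
    (ha : a ∈ Hol (J → ℂ)) (hb : b ∈ Hol (J → ℂ)) (haa : a * a = 1) (hbb : b * b = 1)
    (hDa : D a = tauL p q l) (hDb : D b = tauL p q l⁻¹) :
    ∃ ψ ∈ Hol (J → ℂ), D ψ = 1 ∧ ∃ v, HasWt p q 0 v ∧ v 0 = l⁻¹ ∧
      Rp (ψ⁻¹ * a * ψ) (tauF p q fun _ => l) ∧ Rp (ψ⁻¹ * b * ψ) (tauF p q v) := by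
  have hl0 : l ≠ 0 := norm_pos_iff.1 (by linarith)
  -- The scaling x_p ↦ c x_p, x_q ↦ c⁻¹ x_q turns the linear involution with multiplier l into the
  -- plain exchange of coordinates.
  obtain ⟨c, hc⟩ : ∃ c : ℂ, c ^ 2 = l := IsAlgClosed.exists_pow_nat_eq l (by norm_num)
  have hc0 : c ≠ 0 := by rintro rfl; exact hl0 (by rw [← hc]; norm_num)
  have hμ : 1 < ‖l ^ 2‖ := by rw [norm_pow]; nlinarith
  obtain ⟨δ, hδ, key⟩ := exists_normalizing_scaled hpq hμ
  set A : GG (J → ℂ) := linG ((swE p q).trans (dvE p q l hl0)) with hA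
  have hAT : Rp A (tauL p q l) := linG_rp _
  obtain ⟨φ, hφ, hDφ, hφa⟩ := exists_linearize ha haa hAT hDa
  have hφ' := (Hol (J → ℂ)).inv_mem hφ
  have hab := (Hol (J → ℂ)).mul_mem ha hb
  have hs1 : φ * (a * b) * φ⁻¹ ∈ Hol (J → ℂ) :=
    (Hol (J → ℂ)).mul_mem ((Hol (J → ℂ)).mul_mem hφ hab) hφ'
  obtain ⟨f, hfa, hfr, hfd⟩ := exists_analytic_rp hs1
  have hDs : ∀ x, D (φ * (a * b) * φ⁻¹) x = dv p q (l ^ 2) * x := fun x => by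
    rw [D_mul ((Hol (J → ℂ)).mul_mem hφ hab) hφ', D_mul hφ hab, D_mul ha hb, hDφ,
      D_inv_eq_one hφ hDφ, one_mul, mul_one, hDa, hDb]
    exact (tauL_tauL hpq _ _ _).trans (by rw [inv_inv, sq])
  set f0 : (J → ℂ) → J → ℂ := fun y => dv p q c⁻¹ * f (dv p q c * y) with hf0
  have hf00 : f 0 = 0 := hfr.map_zero
  have hf0a : AnalyticAt ℂ f0 0 := by
    have h1 : AnalyticAt ℂ (fun y : J → ℂ => dv p q c * y) 0 :=
      (ContinuousLinearMap.mul ℂ (J → ℂ) (dv p q c)).analyticAt 0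
    exact analyticAt_const.mul (analyticAt_comp_zero hfa h1 (mul_zero _))
  have hf0d : HasFDerivAt f0 (ContinuousLinearMap.mul ℂ (J → ℂ) (dv p q (l ^ 2))) 0 := by
    have h1 : HasFDerivAt (fun y : J → ℂ => dv p q c * y)
        (ContinuousLinearMap.mul ℂ (J → ℂ) (dv p q c)) 0 :=
      (ContinuousLinearMap.mul ℂ (J → ℂ) (dv p q c)).hasFDerivAt
    have h2 := HasFDerivAt.comp (g := f) (f := fun y : J → ℂ => dv p q c * y) (0 : J → ℂ)
      (by rw [mul_zero]; exact hfd) h1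
    have h3 := (ContinuousLinearMap.mul ℂ (J → ℂ) (dv p q c⁻¹)).hasFDerivAt.comp (0 : J → ℂ) h2
    refine h3.congr_fderiv ?_
    ext1 y
    simp only [ContinuousLinearMap.comp_apply, ContinuousLinearMap.mul_apply', hDs]
    rw [← mul_assoc, ← mul_assoc, ← dv_mul, ← dv_mul]
    congr 2
    field_simp
  obtain ⟨ε, H, hε, hH, hHo, hHr⟩ := exists_scaled_rep hf0a (by simp [hf0, hf00]) hf0d hδ
  have hεC : (ε : ℂ) ≠ 0 := by exact_mod_cast hε.ne'
  set s : (J → ℂ) → J → ℂ := fun y => (ε : ℂ)⁻¹ • f0 ((ε : ℂ) • y) with hs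
  -- After linearizing a by φ, one linear change both makes a the exchange S and shrinks the
  -- nonlinear part of the composition below δ.
  set K : GG (J → ℂ) := linG (scE p q hc0 hεC) with hK
  have hKr : Rp K (scE p q hc0 hεC) := linG_rp _
  have hKr' : Rp K⁻¹ (scE p q hc0 hεC).symm := linG_inv_rp _
  have hKh : K ∈ Hol (J → ℂ) := linG_mem _
  have hKh' := (Hol (J → ℂ)).inv_mem hKh
  set S : GG (J → ℂ) := linG (swE p q) with hS
  have hSr : Rp S (swL p q) := linG_rp _
  have hSS : S * S = 1 := hSr.mul_eq_one hSr (.of_forall swL_swL)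
  have hKA : K⁻¹ * A * K = S := by
    refine ((hKr'.mul hAT).mul hKr).ext hSr (.of_forall fun x => ?_)
    simp only [scE_apply, scE_symm_apply, tauL_apply]
    rw [map_smul, swL_dv_mul hpq, ← hc]
    simp only [mul_smul_comm, smul_smul, inv_mul_cancel₀ hεC, one_smul, ← mul_assoc, ← dv_mul]
    rw [show c⁻¹ * c ^ 2 * c⁻¹ = 1 by field_simp, dv_one, one_mul]
  have hφA : φ * a * φ⁻¹ = A := by rw [hφa, mul_inv_cancel_right]
  set b' := K⁻¹ * (φ * b * φ⁻¹) * K with hb'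
  have hb'b' : b' * b' = 1 := by
    calc b' * b' = K⁻¹ * φ * (b * b) * φ⁻¹ * K := by rw [hb']; group
      _ = 1 := by rw [hbb]; group
  have hs2 : Rp (S * b') s := by
    have e : S * b' = K⁻¹ * (φ * (a * b) * φ⁻¹) * K := by
      rw [← hKA, ← hφA, hb']; group
    rw [e]
    refine ((hKr'.mul hfr).mul hKr).congr (.of_forall fun x => ?_)
    simp only [scE_apply, scE_symm_apply, hs, hf0]
    rw [mul_smul_comm]
  -- As s represents S b', the composition S s S s reduces to b' b' = 1.
  have hsr : ∀ᶠ y in 𝓝 0, swL p q (s (swL p q (s y))) = y := by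
    refine (hSr.mul (hs2.mul (hSr.mul hs2))).eventuallyEq (f' := fun y => y) ?_
    have : S * (S * b' * (S * (S * b'))) = 1 := by
      generalize b' = z at hb'b'
      rw [mul_assoc S z, ← mul_assoc S S z, hSS, one_mul, hb'b', mul_one, hSS]
    rw [this]
    exact Rp.one
  have hsa : AnalyticAt ℂ s 0 :=
    (analyticAt_comp_zero hf0a (((ε : ℂ) • ContinuousLinearMap.id ℂ (J → ℂ)).analyticAt 0)
      (by simp)).const_smul (c := (ε : ℂ)⁻¹)
  have hsd : HasFDerivAt s (ContinuousLinearMap.mul ℂ (J → ℂ) (dv p q (l ^ 2))) 0 := by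
    have h1 : HasFDerivAt (fun y : J → ℂ => (ε : ℂ) • y)
        ((ε : ℂ) • ContinuousLinearMap.id ℂ (J → ℂ)) 0 :=
      ((ε : ℂ) • ContinuousLinearMap.id ℂ (J → ℂ)).hasFDerivAt
    have h2 := (HasFDerivAt.comp (g := f0) (f := fun y : J → ℂ => (ε : ℂ) • y) (0 : J → ℂ)
      (by rw [smul_zero]; exact hf0d) h1).const_smul (ε : ℂ)⁻¹
    refine h2.congr_fderiv ?_
    ext1 y
    change (ε : ℂ)⁻¹ • (dv p q (l ^ 2) * ((ε : ℂ) • y)) = dv p q (l ^ 2) * y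
    rw [mul_smul_comm, smul_smul, inv_mul_cancel₀ hεC, one_smul]
  obtain ⟨P, n, hPa, hP0, hPd, hPσ, hnw, hn0, hPs⟩ := key s H hH hHo hHr
    (hasFDerivAt_unique_strict hsa hsd) hsr
  obtain ⟨Ψ, hΨ, hΨr, hDΨ⟩ := exists_hol_of_hasFDerivAt hPa hP0
    (A := 1) ⟨ContinuousLinearEquiv.refl ℂ _, rfl⟩ hPd
  have hn0' : n 0 ≠ 0 := by rw [hn0]; exact inv_ne_zero (pow_ne_zero _ hl0)
  obtain ⟨B, hB, hBr, -⟩ := exists_tau_germ hpq hnw.an hn0'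
  -- Since Ψ commutes with S, normalizing the composition leaves the already linear involution
  -- untouched, and b' is normalized along with it.
  have hSΨ : S * Ψ = Ψ * S := by
    refine (hSr.mul hΨr).ext (hΨr.mul hSr) ?_
    filter_upwards [hPσ] with x hx using hx.symm
  have hT0 : Tendsto (sF p q fun y => (n y)⁻¹) (𝓝 0) (𝓝 (0 : J → ℂ)) := by
    have h1 : AnalyticAt ℂ (fun y => (n y)⁻¹) 0 := hnw.an.inv hn0'
    have h2 := (hasFDerivAt_sF (p := p) (q := q) h1 (inv_ne_zero hn0')).continuousAt.tendsto
    simpa [sF] using h2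
  have hbΨ : b' * Ψ = Ψ * B := by
    have e : b' * Ψ = S * (S * b') * Ψ := by rw [← mul_assoc, hSS, one_mul]
    rw [e]
    refine ((hSr.mul hs2).mul hΨr).ext (hΨr.mul hBr) ?_
    filter_upwards [hPs, hT0.eventually hPσ] with x h1 h2
    rw [h1, ← h2, sF, swL_dv_mul hpq, inv_inv, tauF]
  -- Undoing K multiplies the multiplier n of the second involution by c² = l; its value at 0 is
  -- then l · l^{-2} = l⁻¹.
  refine ⟨φ⁻¹ * (K * Ψ * K⁻¹), (Hol (J → ℂ)).mul_mem hφ'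
    ((Hol (J → ℂ)).mul_mem ((Hol (J → ℂ)).mul_mem hKh hΨ) hKh'), ?_,
    fun x => l * n ((scE p q hc0 hεC).symm x), ⟨?_, ?_⟩, ?_, ?_, ?_⟩
  · rw [D_mul hφ' ((Hol (J → ℂ)).mul_mem ((Hol (J → ℂ)).mul_mem hKh hΨ) hKh'),
      D_inv_eq_one hφ hDφ, D_conj hKh hΨ hDΨ, one_mul]
  · exact analyticAt_const.mul (analyticAt_comp_zero hnw.an
      ((scE p q hc0 hεC).symm.analyticAt 0) (map_zero _))
  · have ht : Tendsto (scE p q hc0 hεC).symm (𝓝 0) (𝓝 0) := hKr'.tendsto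
    filter_upwards [ht.eventually hnw.rot] with x hx
    have e : (scE p q hc0 hεC).symm (rot p q x) = rot p q ((scE p q hc0 hεC).symm x) := by
      simp only [scE_symm_apply, rot, mul_smul_comm, mul_left_comm]
    rw [e, hx, zpow_zero, one_mul, one_mul]
  · change l * n ((scE p q hc0 hεC).symm 0) = _
    rw [map_zero, hn0]; field_simp
  · have e : (φ⁻¹ * (K * Ψ * K⁻¹))⁻¹ * a * (φ⁻¹ * (K * Ψ * K⁻¹)) =
        K * (Ψ⁻¹ * (K⁻¹ * (φ * a * φ⁻¹) * K) * Ψ) * K⁻¹ := by group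
    rw [e, hφA, hKA, mul_assoc Ψ⁻¹, hSΨ, inv_mul_cancel_left, ← hKA]
    have e2 : K * (K⁻¹ * A * K) * K⁻¹ = A := by group
    rw [e2]
    exact hAT
  · have e : (φ⁻¹ * (K * Ψ * K⁻¹))⁻¹ * b * (φ⁻¹ * (K * Ψ * K⁻¹)) =
        K * (Ψ⁻¹ * b' * Ψ) * K⁻¹ := by rw [hb']; group
    rw [e, mul_assoc Ψ⁻¹, hbΨ, inv_mul_cancel_left]
    refine ((hKr.mul hBr).mul hKr').congr (.of_forall fun x => ?_)
    simp only [tauF]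
    generalize n ((scE p q hc0 hεC).symm x) = k
    simp only [scE_apply, scE_symm_apply]
    rw [map_smul, swL_dv_mul hpq, inv_inv, ← hc]
    simp only [mul_smul_comm, smul_smul, mul_inv_cancel₀ hεC, one_smul, ← mul_assoc, ← dv_mul]
    congr 2
    ring

/-- Simultaneous normal form of two involutions whose composition has a hyperbolic linear part. -/
theorem exists_pair_normal_form (hpq : p ≠ q) {l : ℂ} (hl0 : l ≠ 0) (hl : ‖l‖ ≠ 1)
    {a b : GG (J → ℂ)}
    (ha : a ∈ Hol (J → ℂ)) (hb : b ∈ Hol (J → ℂ)) (haa : a * a = 1) (hbb : b * b = 1)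
    (hDa : D a = tauL p q l) (hDb : D b = tauL p q l⁻¹) :
    ∃ ψ ∈ Hol (J → ℂ), D ψ = 1 ∧ ∃ v, HasWt p q 0 v ∧ v 0 = l⁻¹ ∧
      Rp (ψ⁻¹ * a * ψ) (tauF p q fun _ => l) ∧ Rp (ψ⁻¹ * b * ψ) (tauF p q v) := by
  -- If |l| < 1, exchanging the roles of p and q replaces l by l⁻¹.
  rcases lt_or_gt_of_ne hl with h | h
  · have h1 : 1 < ‖l⁻¹‖ := by
      rw [norm_inv]; exact (one_lt_inv₀ (norm_pos_iff.2 hl0)).2 h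
    obtain ⟨ψ, hψ, hD, v, hv, hv0, h2, h3⟩ := exists_pair_normal_form_aux hpq.symm h1 ha hb haa hbb
      (by rw [hDa, tauL_swap hpq]) (by rw [hDb, ← tauL_swap hpq])
    have hv0' : v 0 ≠ 0 := by rw [hv0, inv_inv]; exact hl0
    refine ⟨ψ, hψ, hD, fun x => (v x)⁻¹, ⟨(hv.swap hpq).an.inv hv0', ?_⟩, by simp [hv0], ?_, ?_⟩
    · filter_upwards [(hv.swap hpq).rot] with x hx
      rw [hx, zpow_zero, one_mul, one_mul]
    · refine h2.congr (.of_forall fun x => ?_)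
      exact tauF_swap hpq (fun _ => l) x
    · refine h3.congr (.of_forall fun x => ?_)
      rw [← tauF_swap hpq.symm]
  · exact exists_pair_normal_form_aux hpq h ha hb haa hbb hDa hDb

end Pair

section Equivariant
open PS
variable {J : Type*} [Fintype J] [DecidableEq J] {p q : J}

/-! ### Maps of definite weight -/

lemma HasWt.swap_neg (hpq : p ≠ q) {k : ℤ} {f : (J → ℂ) → ℂ} (hf : HasWt p q (-k) f) :
    HasWt q p k f := by
  refine ⟨hf.an, ?_⟩
  have ht : Tendsto (AbelianCR.rot q p) (𝓝 0) (𝓝 (0 : J → ℂ)) := tendsto_rot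
  filter_upwards [ht.eventually hf.rot] with x hx
  have e : AbelianCR.rot p q (AbelianCR.rot q p x) = x := by
    rw [AbelianCR.rot, AbelianCR.rot, ← mul_assoc, ← dv_swap hpq, ← dv_mul,
      inv_mul_cancel₀ t0_ne_zero, dv_one, one_mul]
  rw [e, zpow_neg] at hx
  rw [hx, ← mul_assoc, mul_inv_cancel₀ (zpow_ne_zero _ t0_ne_zero), one_mul]

lemma HasWt.inv {f : (J → ℂ) → ℂ} (hf : HasWt p q 0 f) (h0 : f 0 ≠ 0) :
    HasWt p q 0 fun x => (f x)⁻¹ := by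
  refine ⟨hf.an.inv h0, ?_⟩
  filter_upwards [hf.rot] with x hx
  rw [hx, zpow_zero, one_mul, one_mul]

lemma HasWt.mul {k l : ℤ} {f g : (J → ℂ) → ℂ} (hf : HasWt p q k f) (hg : HasWt p q l g) :
    HasWt p q (k + l) fun x => f x * g x := by
  refine ⟨hf.an.mul hg.an, ?_⟩
  filter_upwards [hf.rot, hg.rot] with x h1 h2
  rw [h1, h2, zpow_add₀ t0_ne_zero]; ring

lemma hasWt_const {c : ℂ} : HasWt p q 0 fun _ : J → ℂ => c :=
  ⟨analyticAt_const, .of_forall fun x => by simp⟩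

/-- A germ of weight one is divisible by `x_p`. -/
lemma HasWt.exists_eq_mul (hpq : p ≠ q) {f : (J → ℂ) → ℂ} (hf : HasWt p q 1 f)
    {A : (J → ℂ) →L[ℂ] ℂ} (hA : HasFDerivAt f A 0) :
    ∃ g, HasWt p q 0 g ∧ g 0 = A (Pi.single p 1) ∧ ∀ᶠ x in 𝓝 0, f x = g x * x p := by
  obtain ⟨r, F, hF⟩ := exists_rep hf.an
  have hw : IsWt p q 1 F := hf.isWt hpq hF
  have hX : X p * dvd p q F = F := by
    rw [X_mul_dvd, cut_self]
    exact hw.wts rfl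
  have hr := hF.pos
  have hb : ∀ᶠ x : J → ℂ in 𝓝 0, ‖x‖ ≤ r := by
    filter_upwards [Metric.ball_mem_nhds (0 : J → ℂ) hr] with x hx
    exact (mem_ball_zero_iff.1 hx).le
  set g : (J → ℂ) → ℂ := fun x => sb ((r : ℂ)⁻¹ • x) ((r : ℂ)⁻¹ • dvd p q F) with hg
  have hgr : Rep g r ((r : ℂ)⁻¹ • dvd p q F) := ⟨hr, fun x _ => rfl⟩
  have hgw : IsWt p q 0 ((r : ℂ)⁻¹ • dvd p q F) := fun α hα => by
    rw [map_smul] at hα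
    exact isWt_dvd hpq F α (right_ne_zero_of_smul hα)
  have hfg : ∀ᶠ x in 𝓝 0, f x = g x * x p := by
    filter_upwards [hb] with x hx
    have hx' := norm_smul_inv_le hr hx
    rw [hF.eq x hx, ← hX, sb_mul (norm_apply_le hx'), sb_X, hg]
    simp only [sb_smul, Pi.smul_apply, smul_eq_mul]
    ring
  have hga : HasWt p q 0 g := hgw.hasWt hpq hgr
  have hf0 : f 0 = 0 := by
    have := hfg.self_of_nhds
    simpa using this
  refine ⟨g, hga, ?_, hfg⟩
  have h1 := tendsto_slope hA hf0 (Pi.single p 1)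
  have hl := tendsto_line (J := J) (Pi.single p 1)
  have h2 : Tendsto (fun t : ℂ => g (t • Pi.single p 1)) (𝓝[≠] 0) (𝓝 (g 0)) :=
    hga.an.continuousAt.tendsto.comp hl
  refine tendsto_nhds_unique h2 (h1.congr' ?_)
  filter_upwards [hl.eventually hfg, self_mem_nhdsWithin] with t h3 h4
  have ht : t ≠ 0 := h4
  rw [h3]
  simp only [Pi.smul_apply, Pi.single_eq_same, smul_eq_mul]
  field_simp

lemma comm_inv {G : Type*} [Group G] {a b : G} (h : a * b = b * a) : a⁻¹ * b = b * a⁻¹ := by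
  rw [inv_mul_eq_iff_eq_mul, ← mul_assoc, h, mul_inv_cancel_right]

/-- Conjugation of an involution by an equivariant germ. -/
theorem exists_conj_tau (hpq : p ≠ q) {G T : GG (J → ℂ)} (hG : G ∈ Hol (J → ℂ)) (hD : D G = 1)
    (hR : G * rotG p q = rotG p q * G) {w : (J → ℂ) → ℂ} (hw : HasWt p q 0 w) (hw0 : w 0 ≠ 0)
    (hT : Rp T (tauF p q w)) :
    ∃ u, HasWt p q 0 u ∧ u 0 = w 0 ∧ Rp (G * T * G⁻¹) (tauF p q u) := by
  obtain ⟨g, hga, hgr, hgd⟩ := exists_analytic_rp hG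
  obtain ⟨g', hga', hgr', -⟩ := exists_analytic_rp ((Hol (J → ℂ)).inv_mem hG)
  have hg0 := hgr.map_zero
  have hg0' := hgr'.map_zero
  have hwt := (comm_rotG_iff hG hgr).1 hR
  have hwt' := (comm_rotG_iff ((Hol (J → ℂ)).inv_mem hG) hgr').1 (comm_inv hR)
  have hTt := hT.tendsto
  rw [hD] at hgd
  have hgdj := fun j => hasFDerivAt_pi'.1 hgd j
  -- An equivariant germ has components A x_p and B x_q with A, B of weight zero, and A(0) = B(0) =
  -- 1 because G is tangent to the identity.
  obtain ⟨A, hA, hA0, hgA⟩ := (show HasWt p q 1 fun x => g x p by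
    simpa [wj] using hwt p).exists_eq_mul hpq (hgdj p)
  obtain ⟨B, hB, hB0, hgB⟩ := (HasWt.swap_neg hpq (k := 1) (f := fun x => g x q) (by
    simpa [wj, hpq.symm] using hwt q)).exists_eq_mul hpq.symm (hgdj q)
  have hB' := hB.swap hpq
  have hA1 : A 0 = 1 := by simp [hA0]
  have hB1 : B 0 = 1 := by simp [hB0]
  -- Conjugation trades the factor B on x_q for the factor A on x_p, so the multiplier w becomes w A
  -- / B, still to be expressed in the new coordinates through G⁻¹.
  set m : (J → ℂ) → ℂ := fun x => w x * (A x * (B x)⁻¹) with hm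
  have hmw : HasWt p q 0 m := hw.mul (hA.mul (hB'.inv (by rw [hB1]; exact one_ne_zero)))
  have hinv : ∀ {f : (J → ℂ) → ℂ}, HasWt p q 0 f → ∀ᶠ x in 𝓝 0, f (tauF p q w x) = f x := by
    intro f hf
    refine hf.comp_eq hpq hTt tendsto_id
      (.of_forall fun x j h1 h2 => tauF_other h1 h2 w x) ?_
    filter_upwards [hw.an.continuousAt.eventually_ne hw0] with x hx
    rw [tauF_left, tauF_right hpq]
    field_simp
  have key : ∀ᶠ x in 𝓝 0, g (tauF p q w x) = dv p q (m x) * swL p q (g x) := by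
    have hz : ∀ᶠ x in 𝓝 0, ∀ j, j ≠ p → j ≠ q → g (tauF p q w x) j = g x j := by
      refine eventually_all.2 fun j => ?_
      by_cases h1 : j = p
      · exact .of_forall fun x h => absurd h1 h
      by_cases h2 : j = q
      · exact .of_forall fun x _ h => absurd h2 h
      have := hinv (f := fun x => g x j) (by simpa [wj, h1, h2] using hwt j)
      filter_upwards [this] with x hx _ _ using hx
    have hAne := hA.an.continuousAt.eventually_ne (by rw [hA1]; exact one_ne_zero)
    have hBne := hB.an.continuousAt.eventually_ne (by rw [hB1]; exact one_ne_zero)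
    filter_upwards [hz, hgA, hgB, hTt.eventually hgA, hTt.eventually hgB, hinv hA, hinv hB',
      hAne, hBne, hw.an.continuousAt.eventually_ne hw0] with x e1 e2 e3 e4 e5 e6 e7 e8 e9 e10
    funext j
    rw [Pi.mul_apply, swL_apply, Function.comp]
    rcases eq_or_ne j p with rfl | h1
    · rw [Equiv.swap_apply_left, dv_left, e4, e6, e3, tauF_left, hm]
      field_simp
    rcases eq_or_ne j q with rfl | h2
    · rw [Equiv.swap_apply_right, dv_right hpq, e5, e7, e2, tauF_right hpq, hm]
      field_simp
    · rw [Equiv.swap_apply_of_ne_of_ne h1 h2, dv_other h1 h2, e1 j h1 h2, one_mul]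
  refine ⟨fun x => m (g' x), ⟨analyticAt_comp_zero hmw.an hga' hg0', ?_⟩, ?_, ?_⟩
  · have h1 := (hgr'.mul (rotG_rp p q)).eventuallyEq
      (comm_inv hR ▸ (rotG_rp p q).mul hgr')
    filter_upwards [h1, hgr'.tendsto.eventually hmw.rot] with x h2 h3
    rw [h2, h3]
  · simp [hm, hg0', hA1, hB1]
  · refine ((hgr.mul hT).mul hgr').congr ?_
    have h1 := (hgr.mul hgr').eventuallyEq (f' := fun x => x) (by
      rw [mul_inv_cancel]; exact Rp.one)
    filter_upwards [hgr'.tendsto.eventually key, h1] with x h2 h3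
    rw [h2, h3, tauF]

/-- Evaluation of `τ_u τ_v`. -/
lemma rp_tau_mul_tau (hpq : p ≠ q) {S T : GG (J → ℂ)} {u v : (J → ℂ) → ℂ} (hu : HasWt p q 0 u)
    (hv : HasWt p q 0 v) (hv0 : v 0 ≠ 0) (hS : Rp S (tauF p q u)) (hT : Rp T (tauF p q v)) :
    Rp (S * T) (sF p q fun x => u x * (v x)⁻¹) := by
  refine (hS.mul hT).congr ?_
  have h1 : ∀ᶠ x in 𝓝 0, u (tauF p q v x) = u x := by
    refine hu.comp_eq hpq hT.tendsto tendsto_id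
      (.of_forall fun x j h1 h2 => tauF_other h1 h2 v x) ?_
    filter_upwards [hv.an.continuousAt.eventually_ne hv0] with x hx
    rw [tauF_left, tauF_right hpq]
    field_simp
  filter_upwards [h1] with x hx
  rw [tauF, hx, tauF, swL_dv_mul hpq, swL_swL, ← mul_assoc, ← dv_mul, sF]

end Equivariant

/-! ### Conjugation of germs by an antiholomorphic involution -/

section Real
open PS
variable {J : Type*} [Fintype J] [DecidableEq J]

/-- The series with conjugate coefficients. -/
def conjS (F : PS J) : PS J := ⟨MvPowerSeries.map (starRingEnd ℂ) F.1, by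
  change Summable fun α => ‖MvPowerSeries.coeff α (MvPowerSeries.map (starRingEnd ℂ) F.1)‖
  simpa using summable_norm_coeff F⟩

lemma cf_conjS (F : PS J) (α : J →₀ ℕ) : cf α (conjS F) = conj (cf α F) := by
  change MvPowerSeries.coeff α (MvPowerSeries.map (starRingEnd ℂ) F.1) = _
  rw [MvPowerSeries.coeff_map]
  rfl

lemma conj_sb (F : PS J) (x : J → ℂ) : conj (sb x F) = sb (fun j => conj (x j)) (conjS F) := by
  rw [sb, sb, Complex.conj_tsum]
  refine tsum_congr fun α => ?_
  simp [cf_conjS, pw]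

/-- The conjugation of the coordinates combined with a permutation. -/
def conjR (π : J → J) (x : J → ℂ) : J → ℂ := fun j => conj (x (π j))

lemma norm_conjR_le (π : J → J) (x : J → ℂ) : ‖conjR π x‖ ≤ ‖x‖ :=
  (pi_norm_le_iff_of_nonneg (norm_nonneg _)).2 fun j => by
    rw [conjR, RCLike.norm_conj]; exact norm_le_pi_norm x _

lemma conjR_sub (π : J → J) (x y : J → ℂ) : conjR π (x - y) = conjR π x - conjR π y := by
  funext j; simp [conjR]

lemma conjR_zero (π : J → J) : conjR π (0 : J → ℂ) = 0 := by
  funext j; simp [conjR]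

lemma conjR_mul (π : J → J) (x y : J → ℂ) : conjR π (x * y) = conjR π x * conjR π y := by
  funext j; simp [conjR]

lemma conjR_conjR {π : J → J} (hπ : ∀ j, π (π j) = j) (x : J → ℂ) : conjR π (conjR π x) = x := by
  funext j; simp [conjR, hπ]

lemma continuous_conjR (π : J → J) : Continuous (conjR π : (J → ℂ) → J → ℂ) :=
  continuous_pi fun j => Complex.continuous_conj.comp (continuous_apply (π j))

lemma tendsto_conjR (π : J → J) : Tendsto (conjR π) (𝓝 0) (𝓝 (0 : J → ℂ)) := by
  simpa [conjR_zero] using (continuous_conjR π).tendsto 0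

/-- Conjugating an analytic function gives an analytic function. -/
lemma analyticAt_conj_conjR {f : (J → ℂ) → ℂ} (hf : AnalyticAt ℂ f 0) (π : J → J) :
    AnalyticAt ℂ (fun x => conj (f (conjR π x))) 0 := by
  obtain ⟨r, F, hF⟩ := exists_rep hf
  have hr := hF.pos
  have h1 : AnalyticAt ℂ (fun x : J → ℂ => sb ((r : ℂ)⁻¹ • x) (conjS F)) 0 :=
    (⟨hr, fun x _ => rfl⟩ : Rep _ r (conjS F)).analyticAt
  have h2 : AnalyticAt ℂ (fun x : J → ℂ => fun j => x (π j)) 0 :=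
    (ContinuousLinearMap.pi fun j => ContinuousLinearMap.proj (R := ℂ) (φ := fun _ : J => ℂ)
      (π j)).analyticAt 0
  refine (analyticAt_comp_zero h1 h2 rfl).congr ?_
  filter_upwards [Metric.ball_mem_nhds (0 : J → ℂ) hr] with x hx
  rw [hF.eq _ ((norm_conjR_le π x).trans (mem_ball_zero_iff.1 hx).le), conj_sb]
  congr 1
  funext j
  simp [conjR]

/-- The germ of the conjugation. -/
lemma exists_conjG {π : J → J} (hπ : ∀ j, π (π j) = j) :
    ∃ ρ : GG (J → ℂ), Rp ρ (conjR π) ∧ ρ * ρ = 1 := by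
  obtain ⟨ρ, h, -⟩ := exists_unit (tendsto_conjR π) (tendsto_conjR π)
    (.of_forall (conjR_conjR hπ)) (.of_forall (conjR_conjR hπ))
  exact ⟨ρ, h, h.mul_eq_one h (.of_forall (conjR_conjR hπ))⟩

lemma analyticAt_conj_map {f : (J → ℂ) → J → ℂ} (hf : AnalyticAt ℂ f 0) (π : J → J) :
    AnalyticAt ℂ (fun x => conjR π (f (conjR π x))) 0 :=
  analyticAt_pi_iff.2 fun j => analyticAt_conj_conjR (analyticAt_pi_iff.1 hf (π j)) π

lemma conj_mem_Hol {π : J → J} {ρ g : GG (J → ℂ)} (hρ : Rp ρ (conjR π)) (hρρ : ρ * ρ = 1)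
    (hg : g ∈ Hol (J → ℂ)) : ρ * g * ρ ∈ Hol (J → ℂ) := by
  obtain ⟨f, hf, hfr, -⟩ := exists_analytic_rp hg
  obtain ⟨f', hf', hfr', -⟩ := exists_analytic_rp ((Hol (J → ℂ)).inv_mem hg)
  refine ⟨⟨_, analyticAt_conj_map hf π, (hρ.mul hfr).mul hρ⟩, _, analyticAt_conj_map hf' π, ?_⟩
  have e : (ρ * g * ρ)⁻¹ = ρ * g⁻¹ * ρ := by
    rw [mul_inv_rev, mul_inv_rev, inv_eq_of_mul_eq_one_right hρρ, mul_assoc]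
  rw [e]
  exact (hρ.mul hfr').mul hρ

/-- Conjugation is not complex differentiable, so the complex chain rule is unavailable; the
o-estimate is transported instead, using that `conjR` does not increase norms. -/
lemma D_conj_conjR {π : J → J} {ρ g : GG (J → ℂ)} (hρ : Rp ρ (conjR π))
    (hg : g ∈ Hol (J → ℂ)) {A : (J → ℂ) →L[ℂ] J → ℂ}
    (hA : ∀ x, A x = conjR π (D g (conjR π x))) : D (ρ * g * ρ) = A := by
  obtain ⟨f, hf, hfr, hfd⟩ := exists_analytic_rp hg
  have h : HasFDerivAt (fun x => conjR π (f (conjR π x))) A 0 := by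
    rw [hasFDerivAt_iff_isLittleO_nhds_zero] at hfd ⊢
    have h1 := hfd.comp_tendsto (tendsto_conjR π)
    have h2 : (fun x => conjR π (f (0 + conjR π x) - f 0 - D g (conjR π x))) =o[𝓝 0]
        fun x : J → ℂ => x := by
      refine IsBigO.trans_isLittleO (g := fun x => f (0 + conjR π x) - f 0 - D g (conjR π x))
        (.of_bound 1 (.of_forall fun x => by rw [one_mul]; exact norm_conjR_le _ _)) ?_
      exact h1.trans_isBigO
        (.of_bound 1 (.of_forall fun x => by rw [one_mul]; exact norm_conjR_le _ _))
    refine h2.congr_left fun x => ?_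
    simp only [zero_add, conjR_sub, hA, conjR_zero]
  rw [((hρ.mul hfr).mul hρ).D_eq, h.fderiv]

end Real

/-! ### Rotations, the real structure and simultaneous linearization -/

section Torus
open PS

/-- An involution of the indices together with the indices whose coordinates `ξ`, `η` are exchanged
by the associated conjugation. -/
structure RealData (I : Type*) where
  star : I → I
  star_star : ∀ i, star (star i) = i
  fl : I → Bool
  fl_star : ∀ i, fl (star i) = fl i

variable {I : Type*} [Fintype I] [DecidableEq I]

/-- The permutation of the coordinates `ξ`, `η` given by the data of a real structure. -/
def RealData.perm (r : RealData I) : I ⊕ I → I ⊕ I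
  | .inl i => if r.fl i then .inr (r.star i) else .inl (r.star i)
  | .inr i => if r.fl i then .inl (r.star i) else .inr (r.star i)

lemma RealData.perm_perm (r : RealData I) (j : I ⊕ I) : r.perm (r.perm j) = j := by
  rcases j with i | i <;> cases h : r.fl i <;> simp [perm, h, r.fl_star, r.star_star]

/-- Conjugation, followed by inversion if `b` holds. -/
def cj (b : Bool) (c : ℂ) : ℂ := if b then (conj c)⁻¹ else conj c

lemma cj_mul (b : Bool) (c c' : ℂ) : cj b (c * c') = cj b c * cj b c' := by
  cases b <;> simp [cj, mul_comm]

lemma cj_inv (b : Bool) (c : ℂ) : cj b c⁻¹ = (cj b c)⁻¹ := by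
  cases b <;> simp [cj]

lemma cj_cj (b : Bool) (c : ℂ) : cj b (cj b c) = c := by
  cases b <;> simp [cj]

lemma cj_t0 (b : Bool) : cj b t0 = if b then t0 else t0⁻¹ := by
  cases b <;> simp [cj, conj_t0]

lemma cj_pow (b : Bool) (c : ℂ) (n : ℕ) : cj b (c ^ n) = cj b c ^ n := by
  cases b <;> simp [cj]

lemma hpq (i : I) : (Sum.inl i : I ⊕ I) ≠ Sum.inr i := Sum.inl_ne_inr

/-- When the real structure exchanges ξ and η, the conjugate of c reappears at η instead of ξ, which
inverts the parameter; `cj` records both cases. -/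
lemma conjR_dv (r : RealData I) (i : I) (c : ℂ) :
    conjR r.perm (dv (Sum.inl i) (Sum.inr i) c) =
      dv (Sum.inl (r.star i)) (Sum.inr (r.star i)) (cj (r.fl i) c) := by
  funext j
  have hs : ∀ k, r.star k = i ↔ k = r.star i := fun k =>
    ⟨fun h => by rw [← h, r.star_star], fun h => by rw [h, r.star_star]⟩
  have hf : ∀ k, k = r.star i → r.fl k = r.fl i := fun k h => by rw [h, r.fl_star]
  rcases j with k | k <;> by_cases h : k = r.star i
  · have := hf k h
    cases h2 : r.fl i <;> simp [conjR, RealData.perm, dv, cj, h, r.fl_star, r.star_star, h2]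
  · cases h2 : r.fl k <;> simp [conjR, RealData.perm, dv, h, h2, hs]
  · have := hf k h
    cases h2 : r.fl i <;> simp [conjR, RealData.perm, dv, cj, h, r.fl_star, r.star_star, h2]
  · cases h2 : r.fl k <;> simp [conjR, RealData.perm, dv, h, h2, hs]

lemma perm_swap (r : RealData I) (i : I) (j : I ⊕ I) :
    Equiv.swap (Sum.inl i) (Sum.inr i) (r.perm j) =
      r.perm (Equiv.swap (Sum.inl (r.star i)) (Sum.inr (r.star i)) j) := by
  have hs : ∀ k, r.star k = i ↔ k = r.star i := fun k =>
    ⟨fun h => by rw [← h, r.star_star], fun h => by rw [h, r.star_star]⟩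
  rcases j with k | k <;> by_cases h : k = r.star i <;> cases h2 : r.fl i <;>
    cases h3 : r.fl k <;>
    simp_all [RealData.perm, Equiv.swap_apply_def, r.fl_star, r.star_star]

lemma conjR_swL (r : RealData I) (i : I) (x : I ⊕ I → ℂ) :
    conjR r.perm (swL (Sum.inl i) (Sum.inr i) x) =
      swL (Sum.inl (r.star i)) (Sum.inr (r.star i)) (conjR r.perm x) := by
  funext j
  simp only [conjR, swL_apply, Function.comp, perm_swap]

lemma conjR_tauF (r : RealData I) (i : I) (u : (I ⊕ I → ℂ) → ℂ) (x : I ⊕ I → ℂ) :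
    conjR r.perm (tauF (Sum.inl i) (Sum.inr i) u (conjR r.perm x)) =
      tauF (Sum.inl (r.star i)) (Sum.inr (r.star i))
        (fun y => cj (r.fl i) (u (conjR r.perm y))) x := by
  rw [tauF, conjR_mul, conjR_dv, conjR_swL, conjR_conjR r.perm_perm, tauF]

lemma conjR_sF (r : RealData I) (i : I) (u : (I ⊕ I → ℂ) → ℂ) (x : I ⊕ I → ℂ) :
    conjR r.perm (sF (Sum.inl i) (Sum.inr i) u (conjR r.perm x)) =
      sF (Sum.inl (r.star i)) (Sum.inr (r.star i))
        (fun y => cj (r.fl i) (u (conjR r.perm y))) x := by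
  rw [sF, conjR_mul, conjR_dv, conjR_conjR r.perm_perm, sF]

lemma conjR_rot (r : RealData I) (i : I) (x : I ⊕ I → ℂ) :
    conjR r.perm (rot (Sum.inl i) (Sum.inr i) x) =
      dv (Sum.inl (r.star i)) (Sum.inr (r.star i)) (cj (r.fl i) t0) * conjR r.perm x := by
  rw [rot, conjR_mul, conjR_dv]

/-- Conjugation preserves weight zero. -/
lemma HasWt.cj_conjR (r : RealData I) {i : I} {f : (I ⊕ I → ℂ) → ℂ}
    (hf : HasWt (Sum.inl i) (Sum.inr i) 0 f) (h0 : f 0 ≠ 0) :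
    HasWt (Sum.inl (r.star i)) (Sum.inr (r.star i)) 0
      fun y => cj (r.fl i) (f (conjR r.perm y)) := by
  have hc : HasWt (Sum.inl (r.star i)) (Sum.inr (r.star i)) 0
      fun y => conj (f (conjR r.perm y)) := by
    refine ⟨analyticAt_conj_conjR hf.an _, ?_⟩
    have ht := tendsto_conjR r.perm
    have hrot : ∀ᶠ y in 𝓝 0, f (dv (Sum.inl i) (Sum.inr i) (cj (r.fl i) t0) * y) = f y := by
      cases h : r.fl i
      · have e : Tendsto (fun y : I ⊕ I → ℂ => dv (Sum.inl i) (Sum.inr i) t0⁻¹ * y) (𝓝 0) (𝓝 0) := by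
          have : Continuous fun y : I ⊕ I → ℂ => dv (Sum.inl i) (Sum.inr i) t0⁻¹ * y := by fun_prop
          simpa using this.tendsto 0
        filter_upwards [e.eventually hf.rot] with y hy
        rw [AbelianCR.rot, ← mul_assoc, ← dv_mul, mul_inv_cancel₀ t0_ne_zero, dv_one, one_mul,
          zpow_zero, one_mul] at hy
        rw [cj_t0, if_neg (by simp), hy]
      · filter_upwards [hf.rot] with y hy
        rw [cj_t0, if_pos rfl]
        simpa [AbelianCR.rot] using hy
    filter_upwards [ht.eventually hrot] with y hy
    have e := conjR_rot r (r.star i) y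
    rw [r.star_star, r.fl_star] at e
    rw [e, hy]; simp
  cases h : r.fl i
  · simpa [cj, h] using hc
  · simpa [cj, h] using hc.inv (by simpa [conjR_zero] using h0)

lemma zpow_eq_one_of_norm_ne_one {c : ℂ} (h : ‖c‖ ≠ 1) (n : ℤ) (hn : c ^ n = 1) :
    n = 0 := by
  have h1 : ‖c‖ ^ n = 1 := by rw [← norm_zpow, hn, norm_one]
  rcases (zpow_eq_one_iff_right₀ (norm_nonneg c) h).1 h1 with h2
  exact h2

/-- The multiplier is invariant under the map with the inverse multiplier, so the factors cancel and
that map is the inverse. -/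
lemma HasWt.sF_inv {J : Type*} [Fintype J] [DecidableEq J] {p q : J} (hpq : p ≠ q)
    {c : (J → ℂ) → ℂ} (hc : HasWt p q 0 c) (h0 : c 0 ≠ 0)
    {S : GG (J → ℂ)} (hS : Rp S (sF p q c)) : Rp S⁻¹ (sF p q fun x => (c x)⁻¹) := by
  have hi := hc.inv h0
  have hd := (hasFDerivAt_sF (p := p) (q := q) hi.an (inv_ne_zero h0)).continuousAt.tendsto
  have ht : Tendsto (sF p q fun x => (c x)⁻¹) (𝓝 0) (𝓝 0) := by simpa [sF] using hd
  obtain ⟨f, hf⟩ := exists_rp S⁻¹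
  have h1 := (hf.mul hS).eventuallyEq (f' := fun x => x) (by rw [inv_mul_cancel]; exact Rp.one)
  refine hf.congr ?_
  filter_upwards [ht.eventually h1, hc.comp_sF hpq hi.an (inv_ne_zero h0),
    hc.an.continuousAt.eventually_ne h0] with x h2 h3 h4
  have e : sF p q c (sF p q (fun x => (c x)⁻¹) x) = x := by
    rw [sF, h3, sF, ← mul_assoc, ← dv_mul, mul_inv_cancel₀ h4, dv_one, one_mul]
  rw [e] at h2
  exact h2

/-- The rotation of the `i`-th pair of coordinates. -/
abbrev Rt (i : I) : GG (I ⊕ I → ℂ) := rotG (Sum.inl i) (Sum.inr i)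

/-- `g` or `g⁻¹`. -/
def pf {G : Type*} [Group G] (b : Bool) (g : G) : G := if b then g else g⁻¹

lemma conj_Rt (r : RealData I) {ρ : GG (I ⊕ I → ℂ)} (hρ : Rp ρ (conjR r.perm)) (i : I) :
    ρ * Rt i * ρ = pf (r.fl i) (Rt (r.star i)) := by
  have h1 := (hρ.mul (rotG_rp (Sum.inl i) (Sum.inr i))).mul hρ
  cases h : r.fl i
  · refine h1.ext (linG_inv_rp _) (.of_forall fun x => ?_)
    beta_reduce
    rw [conjR_rot, conjR_conjR r.perm_perm, cj_t0, h]
    rfl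
  · refine h1.ext (rotG_rp _ _) (.of_forall fun x => ?_)
    beta_reduce
    rw [conjR_rot, conjR_conjR r.perm_perm, cj_t0, h]
    rfl

/-- Simultaneous linearization of commuting rotations. -/
lemma exists_common_linearization (ψ R : I → GG (I ⊕ I → ℂ)) (hψ : ∀ i, ψ i ∈ Hol _)
    (hD : ∀ i, D (ψ i) = 1) (hR : ∀ i, R i = ψ i * Rt i * (ψ i)⁻¹)
    (hcomm : ∀ i j, R i * R j = R j * R i) (s : Finset I) :
    ∃ χ ∈ Hol (I ⊕ I → ℂ), D χ = 1 ∧ ∀ j ∈ s, χ * R j = Rt j * χ := by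
  induction s using Finset.induction_on with
  | empty => exact ⟨1, one_mem _, D_one, by simp⟩
  | insert i s _ ih =>
    obtain ⟨χ, hχ, hDχ, hj⟩ := ih
    -- The germ χ ψ_i is averaged over the i-th rotation. The relations already won for j survive,
    -- since R_j read in the coordinates ψ_i commutes with that rotation and `Rt j` is diagonal.
    obtain ⟨G', hG', hDG', hGR, hF⟩ := exists_equivariant_part (hpq i)
      ((Hol _).mul_mem hχ (hψ i)) (by rw [D_mul hχ (hψ i), hDχ, hD, one_mul])
    have hψ' := (Hol _).inv_mem (hψ i)
    refine ⟨G' * (ψ i)⁻¹, (Hol _).mul_mem hG' hψ', ?_, fun j hjs => ?_⟩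
    · rw [D_mul hG' hψ', hDG', D_inv_eq_one (hψ i) (hD i), one_mul]
    have hRH : ∀ k, R k ∈ Hol (I ⊕ I → ℂ) := fun k => by
      rw [hR]
      exact (Hol _).mul_mem ((Hol _).mul_mem (hψ k) (rotG_mem _ _)) ((Hol _).inv_mem (hψ k))
    rcases Finset.mem_insert.1 hjs with rfl | hjs
    · rw [hR j, ← mul_assoc, ← mul_assoc, inv_mul_cancel_right, hGR, mul_assoc]
    · have h1 : (ψ i)⁻¹ * R j * ψ i * Rt i = Rt i * ((ψ i)⁻¹ * R j * ψ i) := by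
        have h2 := hcomm j i
        rw [hR i] at h2
        calc (ψ i)⁻¹ * R j * ψ i * Rt i = (ψ i)⁻¹ * (R j * (ψ i * Rt i * (ψ i)⁻¹)) * ψ i := by group
          _ = _ := by rw [h2]; group
      have h3 := hF ((ψ i)⁻¹ * R j * ψ i) (Rt j) (dv (Sum.inl j) (Sum.inr j) t0)
        ((Hol _).mul_mem ((Hol _).mul_mem hψ' (hRH j)) (hψ i)) h1 (rotG_rp _ _) (by
          rw [← mul_assoc, ← mul_assoc, mul_inv_cancel_right, hj j hjs, mul_assoc])
      calc G' * (ψ i)⁻¹ * R j = G' * ((ψ i)⁻¹ * R j * ψ i) * (ψ i)⁻¹ := by group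
        _ = _ := by rw [h3, mul_assoc]

/-- Averaging makes a linearization of rotations compatible with the real structure. -/
lemma exists_real_linearization (r : RealData I) {ρ : GG (I ⊕ I → ℂ)} (hρ : Rp ρ (conjR r.perm))
    (hρρ : ρ * ρ = 1) {R : I → GG (I ⊕ I → ℂ)} (hRρ : ∀ i, ρ * R i * ρ = pf (r.fl i) (R (r.star i)))
    {χ : GG (I ⊕ I → ℂ)} (hχ : χ ∈ Hol _) (hD : D χ = 1) (hR : ∀ j, χ * R j = Rt j * χ) :
    ∃ χ' ∈ Hol (I ⊕ I → ℂ), D χ' = 1 ∧ χ' * ρ = ρ * χ' ∧ ∀ j, χ' * R j = Rt j * χ' := by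
  obtain ⟨f, hf, hfr, hfd⟩ := exists_analytic_rp hχ
  have hχρ := conj_mem_Hol hρ hρρ hχ
  have hDρ : D (ρ * χ * ρ) = 1 := D_conj_conjR hρ hχ fun x => by
    rw [hD]; simp [conjR_conjR r.perm_perm]
  have hfr' := (hρ.mul hfr).mul hρ
  have hfd' := hfr'.hasFDerivAt hχρ
  rw [hDρ] at hfd'
  rw [hD] at hfd
  -- ρ acts on R_j and on `Rt j` by the same rule, so the conjugate of χ is another linearization.
  have hR' : ∀ j, ρ * χ * ρ * R j = Rt j * (ρ * χ * ρ) := by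
    intro j
    have h1 : R j = ρ * pf (r.fl j) (R (r.star j)) * ρ := by
      rw [← hRρ, ← mul_assoc, ← mul_assoc, hρρ, one_mul, mul_assoc, hρρ, mul_one]
    have h2 : Rt j = ρ * pf (r.fl j) (Rt (r.star j)) * ρ := by
      rw [← conj_Rt r hρ, ← mul_assoc, ← mul_assoc, hρρ, one_mul, mul_assoc, hρρ, mul_one]
    have h3 : χ * pf (r.fl j) (R (r.star j)) = pf (r.fl j) (Rt (r.star j)) * χ := by
      cases r.fl j
      · simp only [pf, Bool.false_eq_true, if_false]
        rw [eq_inv_mul_iff_mul_eq, ← mul_assoc, ← hR, mul_inv_cancel_right]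
      · exact hR _
    calc ρ * χ * ρ * R j = ρ * χ * (ρ * ρ) * pf (r.fl j) (R (r.star j)) * ρ := by
          conv_lhs => rw [h1]
          group
      _ = ρ * (χ * pf (r.fl j) (R (r.star j))) * ρ := by rw [hρρ]; group
      _ = ρ * pf (r.fl j) (Rt (r.star j)) * (ρ * ρ) * χ * ρ := by rw [h3, hρρ]; group
      _ = _ := by conv_rhs => rw [h2]
                  group
  -- The rotations are linear on the target side, so the mean of two linearizations is again one;
  -- this mean commutes with ρ and is tangent to the identity.
  set g : (I ⊕ I → ℂ) → I ⊕ I → ℂ := fun x =>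
    (2 : ℂ)⁻¹ • (f x + conjR r.perm (f (conjR r.perm x))) with hg
  have hga : AnalyticAt ℂ g 0 :=
    (hf.add (analyticAt_conj_map hf r.perm)).const_smul (c := (2 : ℂ)⁻¹)
  have hgd : HasFDerivAt g (1 : (I ⊕ I → ℂ) →L[ℂ] I ⊕ I → ℂ) 0 := by
    refine ((hfd.add hfd').const_smul (2 : ℂ)⁻¹).congr_fderiv ?_
    ext x j
    simp
    ring
  have hg0 : g 0 = 0 := by simp [hg, conjR_zero, hfr.map_zero]
  obtain ⟨χ', hχ', hgr, hDχ⟩ := exists_hol_of_hasFDerivAt hga hg0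
    (A := 1) ⟨ContinuousLinearEquiv.refl ℂ _, rfl⟩ hgd
  refine ⟨χ', hχ', hDχ, (hgr.mul hρ).ext (hρ.mul hgr) (.of_forall fun x => ?_), fun j => ?_⟩
  · funext k
    simp only [hg, conjR_conjR r.perm_perm]
    simp only [conjR, Pi.smul_apply, Pi.add_apply, r.perm_perm, smul_eq_mul, map_mul, map_add,
      map_inv₀, map_ofNat, Complex.conj_conj]
    rw [add_comm]
  · obtain ⟨k, hk⟩ := exists_rp (R j)
    refine (hgr.mul hk).ext ((rotG_rp _ _).mul hgr) ?_
    have e1 := (hfr.mul hk).eventuallyEq (hR j ▸ (rotG_rp _ _).mul hfr)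
    have e2 := (hfr'.mul hk).eventuallyEq (hR' j ▸ (rotG_rp _ _).mul hfr')
    filter_upwards [e1, e2] with x h1 h2
    simp only [hg]
    rw [h1, h2, rot, rot, rot, mul_smul_comm, mul_add]

end Torus

/-! ### The common torus of symmetries -/

section TorusMain
open PS
variable {I : Type*} [Fintype I] [DecidableEq I]

/-- Commuting reversible maps with hyperbolic linear parts admit a common torus of symmetries, which
can be linearized compatibly with the real structure. -/
theorem exists_torus_coordinates (r : RealData I) {ρ : GG (I ⊕ I → ℂ)} (hρ : Rp ρ (conjR r.perm))
    (hρρ : ρ * ρ = 1) {l : I → ℂ} (hl0 : ∀ i, l i ≠ 0) (hl1 : ∀ i, ‖l i‖ ≠ 1)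
    (hlr : ∀ i, cj (r.fl i) (l (r.star i)) = (l i)⁻¹) {a : I → GG (I ⊕ I → ℂ)}
    (ha : ∀ i, a i ∈ Hol _) (haa : ∀ i, a i * a i = 1)
    (hDa : ∀ i, D (a i) = tauL (Sum.inl i) (Sum.inr i) (l i))
    (hcomm : ∀ i j, a i * (ρ * a (r.star i) * ρ) * (a j * (ρ * a (r.star j) * ρ)) =
      a j * (ρ * a (r.star j) * ρ) * (a i * (ρ * a (r.star i) * ρ))) :
    ∃ χ ∈ Hol (I ⊕ I → ℂ), χ * ρ = ρ * χ ∧ ∀ i,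
      (∃ u, HasWt (Sum.inl i) (Sum.inr i) 0 u ∧ u 0 = l i ∧
        Rp (χ * a i * χ⁻¹) (tauF (Sum.inl i) (Sum.inr i) u)) ∧
      (∃ v, HasWt (Sum.inl i) (Sum.inr i) 0 v ∧ v 0 = (l i)⁻¹ ∧
        Rp (χ * (ρ * a (r.star i) * ρ) * χ⁻¹) (tauF (Sum.inl i) (Sum.inr i) v)) ∧
      ∀ j, χ * (a i * (ρ * a (r.star i) * ρ)) * χ⁻¹ * Rt j =
        Rt j * (χ * (a i * (ρ * a (r.star i) * ρ)) * χ⁻¹) := by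
  set b : I → GG (I ⊕ I → ℂ) := fun i => ρ * a (r.star i) * ρ with hb
  have hbH : ∀ i, b i ∈ Hol _ := fun i => conj_mem_Hol hρ hρρ (ha _)
  have hbb : ∀ i, b i * b i = 1 := fun i => by
    calc b i * b i = ρ * a (r.star i) * (ρ * ρ) * a (r.star i) * ρ := by rw [hb]; group
      _ = ρ * (a (r.star i) * a (r.star i)) * ρ := by rw [hρρ]; group
      _ = 1 := by rw [haa, mul_one, hρρ]
  have hDb : ∀ i, D (b i) = tauL (Sum.inl i) (Sum.inr i) (l i)⁻¹ := fun i =>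
    D_conj_conjR hρ (ha _) fun x => by
      rw [hDa, tauL_apply, tauL_apply, conjR_mul, conjR_dv, conjR_swL, conjR_conjR r.perm_perm,
        r.star_star, r.fl_star, hlr]
  choose ψ hψ hDψ v hv hv0 hra hrb using fun i =>
    exists_pair_normal_form (hpq i) (hl0 i) (hl1 i) (ha i) (hbH i) (haa i) (hbb i) (hDa i) (hDb i)
  set s : I → GG (I ⊕ I → ℂ) := fun i => a i * b i with hs
  have hsH : ∀ i, s i ∈ Hol _ := fun i => (Hol _).mul_mem (ha i) (hbH i)
  have hcs : ∀ i j, s i * s j = s j * s i := hcomm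
  set S : I → GG (I ⊕ I → ℂ) := fun i => (ψ i)⁻¹ * a i * ψ i * ((ψ i)⁻¹ * b i * ψ i) with hS
  have hSs : ∀ i, S i = (ψ i)⁻¹ * s i * ψ i := fun i => by rw [hS, hs]; group
  have hvne : ∀ i, v i 0 ≠ 0 := fun i => by rw [hv0]; exact inv_ne_zero (hl0 i)
  set c : I → (I ⊕ I → ℂ) → ℂ := fun i x => l i * (v i x)⁻¹ with hc
  have hcw : ∀ i, HasWt (Sum.inl i) (Sum.inr i) 0 (c i) := fun i =>
    hasWt_const.mul ((hv i).inv (hvne i))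
  have hc0 : ∀ i, c i 0 = l i ^ 2 := fun i => by simp only [hc, hv0, inv_inv, sq]
  have hSr : ∀ i, Rp (S i) (sF (Sum.inl i) (Sum.inr i) (c i)) := fun i =>
    rp_tau_mul_tau (hpq i) hasWt_const (hv i) (hvne i) (hra i) (hrb i)
  have hμ0 : ∀ i, l i ^ 2 ≠ 0 := fun i => pow_ne_zero _ (hl0 i)
  have hμ1 : ∀ i, ‖l i ^ 2‖ ≠ 1 := fun i => by
    rw [norm_pow]
    exact fun h => hl1 i ((pow_eq_one_iff_of_nonneg (norm_nonneg _) two_ne_zero).1 h)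
  have hμ1' : ∀ i, ‖(l i ^ 2)⁻¹‖ ≠ 1 := fun i => by
    rw [norm_inv]; exact fun h => hμ1 i (inv_eq_one.1 h)
  -- The ψ_i need not be compatible with one another; only the rotations they define are, and only
  -- these enter the simultaneous linearization.
  set R : I → GG (I ⊕ I → ℂ) := fun i => ψ i * Rt i * (ψ i)⁻¹ with hR
  have hRH : ∀ i, R i ∈ Hol _ := fun i =>
    (Hol _).mul_mem ((Hol _).mul_mem (hψ i) (rotG_mem _ _)) ((Hol _).inv_mem (hψ i))
  -- Read through ψ_i, K intertwines a hyperbolic normal form with itself, so it respects the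
  -- rotation.
  have hKR : ∀ i, ∀ K ∈ Hol (I ⊕ I → ℂ), K * s i = s i * K → K * R i = R i * K := by
    intro i K hK hKs
    have h1 : (ψ i)⁻¹ * K * ψ i * S i = S i * ((ψ i)⁻¹ * K * ψ i) := by
      rw [hSs]
      calc _ = (ψ i)⁻¹ * (K * s i) * ψ i := by group
        _ = _ := by rw [hKs]; group
    have h2 := comm_rotG_of_intertwine (hpq i) (hμ0 i)
      (zpow_eq_one_of_norm_ne_one (hμ1 i)) (hcw i) (hcw i) (hc0 i) (hc0 i)
      ((Hol _).mul_mem ((Hol _).mul_mem ((Hol _).inv_mem (hψ i)) hK) (hψ i)) (hSr i) (hSr i) h1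
    calc K * R i = ψ i * ((ψ i)⁻¹ * K * ψ i * Rt i) * (ψ i)⁻¹ := by rw [hR]; group
      _ = _ := by rw [h2, hR]; group
  have hsR : ∀ i j, s i * R j = R j * s i := fun i j => hKR j _ (hsH i) (hcs i j)
  -- The centralizer argument is used twice: s_j commutes with R_i, and therefore R_i commutes with
  -- R_j.
  have hRR : ∀ i j, R i * R j = R j * R i := fun i j => hKR j _ (hRH i) (hsR j i).symm
  have hRρ : ∀ i, ρ * R i * ρ = pf (r.fl i) (R (r.star i)) := by
    intro i
    set k := r.star i with hk
    -- ρ exchanges a_i with b_k and b_i with a_k, so the conjugate of a_i b_i is b_k a_k.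
    have hρs : ρ * s i * ρ = (s k)⁻¹ := by
      refine eq_inv_of_mul_eq_one_left ?_
      have e1 : b k = ρ * a i * ρ := by rw [hb]; simp only [hk, r.star_star]
      calc ρ * s i * ρ * s k = ρ * a i * ρ * a k * (ρ * ρ) * a k * (ρ * a i * ρ) := by
            rw [hs, hb]; simp only [hk, r.star_star]; group
        _ = ρ * a i * ρ * (a k * a k) * (ρ * a i * ρ) := by rw [hρρ]; group
        _ = b k * b k := by rw [haa, e1]; group
        _ = 1 := hbb k
    have hKH : (ψ k)⁻¹ * (ρ * ψ i * ρ) ∈ Hol (I ⊕ I → ℂ) :=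
      (Hol _).mul_mem ((Hol _).inv_mem (hψ k)) (conj_mem_Hol hρ hρρ (hψ i))
    have hint : (ψ k)⁻¹ * (ρ * ψ i * ρ) * (ρ * S i * ρ) = (S k)⁻¹ * ((ψ k)⁻¹ * (ρ * ψ i * ρ)) := by
      rw [hSs, hSs]
      calc _ = (ψ k)⁻¹ * ρ * ψ i * (ρ * ρ) * (ψ i)⁻¹ * s i * ψ i * ρ := by group
        _ = (ψ k)⁻¹ * (ρ * s i * 1) * ψ i * ρ := by rw [hρρ]; group
        _ = (ψ k)⁻¹ * (ρ * s i * (ρ * ρ)) * ψ i * ρ := by rw [hρρ]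
        _ = (ψ k)⁻¹ * (ρ * s i * ρ) * ρ * ψ i * ρ := by group
        _ = _ := by rw [hρs]; group
    have hci : c i 0 ≠ 0 := by rw [hc0]; exact hμ0 i
    have hck : c k 0 ≠ 0 := by rw [hc0]; exact hμ0 k
    have hval : cj (r.fl i) (c i (conjR r.perm 0)) = (l k ^ 2)⁻¹ := by
      have h1 := hlr k
      rw [hk, r.star_star, r.fl_star] at h1
      rw [conjR_zero, hc0, cj_pow, h1, inv_pow]
    -- The germ ψ_k⁻¹ (ρ ψ_i ρ) intertwines ρ S_i ρ with S_k⁻¹, two normal forms with the same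
    -- multiplier at 0.
    have hKR := comm_rotG_of_intertwine (hpq k) (inv_ne_zero (hμ0 k))
      (zpow_eq_one_of_norm_ne_one (hμ1' k)) ((hcw i).cj_conjR r hci) ((hcw k).inv hck) hval
      (by rw [hc0]) hKH (((hρ.mul (hSr i)).mul hρ).congr (.of_forall fun x => conjR_sF r i _ x))
      ((hcw k).sF_inv (hpq k) hck (hSr k)) hint
    have hKpf : (ψ k)⁻¹ * (ρ * ψ i * ρ) * pf (r.fl i) (Rt k) =
        pf (r.fl i) (Rt k) * ((ψ k)⁻¹ * (ρ * ψ i * ρ)) := by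
      cases r.fl i
      · exact (comm_inv hKR.symm).symm
      · exact hKR
    have hpfψ : pf (r.fl i) (R k) = ψ k * pf (r.fl i) (Rt k) * (ψ k)⁻¹ := by
      cases r.fl i
      · simp only [pf, Bool.false_eq_true, if_false, hR]; group
      · rfl
    calc ρ * R i * ρ = ρ * ψ i * 1 * Rt i * 1 * (ψ i)⁻¹ * ρ := by rw [hR]; group
      _ = ρ * ψ i * (ρ * ρ) * Rt i * (ρ * ρ) * (ψ i)⁻¹ * ρ := by rw [hρρ]
      _ = (ρ * ψ i * ρ) * (ρ * Rt i * ρ) * (ρ * (ψ i)⁻¹ * ρ) := by group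
      _ = ψ k * ((ψ k)⁻¹ * (ρ * ψ i * ρ) * pf (r.fl i) (Rt k)) * (ρ * (ψ i)⁻¹ * ρ) := by
          rw [conj_Rt r hρ, ← hk]; group
      _ = ψ k * pf (r.fl i) (Rt k) * (ψ k)⁻¹ * (ρ * ψ i * (ρ * ρ) * (ψ i)⁻¹ * ρ) := by
          rw [hKpf]; group
      _ = _ := by rw [hρρ, mul_one, mul_inv_cancel_right, hρρ, mul_one, hpfψ]
  obtain ⟨χ₀, hχ₀, hDχ₀, hχ₀R⟩ := exists_common_linearization ψ R hψ hDψ (fun _ => rfl) hRR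
    Finset.univ
  obtain ⟨χ, hχ, hDχ, hχρ, hχR⟩ := exists_real_linearization r hρ hρρ hRρ hχ₀ hDχ₀
    fun j => hχ₀R j (Finset.mem_univ j)
  refine ⟨χ, hχ, hχρ, fun i => ?_⟩
  -- The passage from the i-th normal form to the common coordinates respects the i-th rotation, so
  -- `exists_conj_tau` keeps the shape of both involutions.
  have hG : χ * ψ i * Rt i = Rt i * (χ * ψ i) := by
    have h1 := hχR i
    calc χ * ψ i * Rt i = χ * R i * ψ i := by rw [hR]; group
      _ = _ := by rw [h1]; group
  have hGH := (Hol _).mul_mem hχ (hψ i)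
  have hGD : D (χ * ψ i) = 1 := by rw [D_mul hχ (hψ i), hDχ, hDψ, one_mul]
  refine ⟨?_, ?_, fun j => ?_⟩
  · obtain ⟨u, hu, hu0, hur⟩ := exists_conj_tau (hpq i) hGH hGD hG hasWt_const (hl0 i) (hra i)
    refine ⟨u, hu, hu0, ?_⟩
    have e : χ * ψ i * ((ψ i)⁻¹ * a i * ψ i) * (χ * ψ i)⁻¹ = χ * a i * χ⁻¹ := by group
    rwa [e] at hur
  · obtain ⟨u, hu, hu0, hur⟩ := exists_conj_tau (hpq i) hGH hGD hG (hv i) (hvne i) (hrb i)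
    refine ⟨u, hu, hu0.trans (hv0 i), ?_⟩
    have e : χ * ψ i * ((ψ i)⁻¹ * b i * ψ i) * (χ * ψ i)⁻¹ = χ * b i * χ⁻¹ := by group
    rwa [e] at hur
  · have h1 := hχR j
    have h2 : Rt j = χ * R j * χ⁻¹ := by rw [h1, mul_inv_cancel_right]
    have h3 := hsR i j
    calc χ * s i * χ⁻¹ * Rt j = χ * (s i * R j) * χ⁻¹ := by rw [h2]; group
      _ = Rt j * (χ * s i * χ⁻¹) := by rw [h3, h2]; group

end TorusMain

section NormalForm
open PS

/-! ### Functions of the products `ξ_i η_i` -/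

/-- A coordinate function is not a zero divisor. -/
lemma eventually_eq_zero_of_coord_mul {J : Type*} [Fintype J] [DecidableEq J] {f : (J → ℂ) → ℂ}
    (hf : AnalyticAt ℂ f 0) (k : J) (h : ∀ᶠ x in 𝓝 0, x k * f x = 0) : ∀ᶠ x in 𝓝 0, f x = 0 := by
  filter_upwards [hf.eventually_analyticAt, h.eventually_nhds] with x hx hx0
  by_cases hk : x k = 0
  · have hγ : Tendsto (fun t : ℂ => x + t • (Pi.single k 1 : J → ℂ)) (𝓝[≠] 0) (𝓝 x) := by
      have : Continuous fun t : ℂ => x + t • (Pi.single k 1 : J → ℂ) := by fun_prop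
      have h1 := this.tendsto 0
      simp only [zero_smul, add_zero] at h1
      exact h1.mono_left nhdsWithin_le_nhds
    have h1 := hx.continuousAt.tendsto.comp hγ
    refine tendsto_nhds_unique h1 (tendsto_const_nhds.congr' ?_)
    filter_upwards [hγ.eventually hx0, self_mem_nhdsWithin] with t h2 h3
    have h4 : (x + t • (Pi.single k 1 : J → ℂ)) k = t := by simp [hk]
    rw [h4] at h2
    exact ((mul_eq_zero.1 h2).resolve_left h3).symm
  · exact (mul_eq_zero.1 hx0.self_of_nhds).resolve_left hk

lemma HasWt.comp_tauF {J : Type*} [Fintype J] [DecidableEq J] {p q : J} (hpq : p ≠ q)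
    {f w : (J → ℂ) → ℂ} (hf : HasWt p q 0 f) (hw : ContinuousAt w 0) (hw0 : w 0 ≠ 0)
    (hT : Tendsto (tauF p q w) (𝓝 0) (𝓝 0)) : ∀ᶠ x in 𝓝 0, f (tauF p q w x) = f x := by
  refine hf.comp_eq hpq hT tendsto_id
    (.of_forall fun x j h1 h2 => tauF_other h1 h2 w x) ?_
  filter_upwards [hw.eventually_ne hw0] with x hx
  rw [tauF_left, tauF_right hpq]
  field_simp

variable {I : Type*} [Fintype I] [DecidableEq I]

/-- The products `ξ_i η_i`. -/
def hm (x : I ⊕ I → ℂ) (i : I) : ℂ := x (Sum.inl i) * x (Sum.inr i)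

/-- A point with prescribed products. -/
def sect (ε : ℂ) (ζ : I → ℂ) : I ⊕ I → ℂ := Sum.elim (fun i => ε⁻¹ * ζ i) fun _ => ε

lemma hm_sect {ε : ℂ} (hε : ε ≠ 0) (ζ : I → ℂ) : hm (sect ε ζ) = ζ := by
  funext i
  simp only [hm, sect, Sum.elim_inl, Sum.elim_inr]
  field_simp

lemma norm_sect_le {ε : ℝ} (hε : 0 < ε) {ζ : I → ℂ} (hζ : ‖ζ‖ ≤ ε ^ 2) : ‖sect (ε : ℂ) ζ‖ ≤ ε := by
  refine (pi_norm_le_iff_of_nonneg hε.le).2 fun j => ?_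
  rcases j with i | i
  · simp only [sect, Sum.elim_inl, norm_mul, norm_inv, Complex.norm_real, Real.norm_of_nonneg hε.le]
    rw [inv_mul_le_iff₀ hε, ← sq]
    exact (norm_le_pi_norm ζ i).trans hζ
  · simp [sect, abs_of_pos hε]

lemma continuous_hm : Continuous (hm : (I ⊕ I → ℂ) → I → ℂ) :=
  continuous_pi fun _ => (continuous_apply _).mul (continuous_apply _)

lemma analyticAt_hm (x : I ⊕ I → ℂ) : AnalyticAt ℂ hm x :=
  analyticAt_pi_iff.2 fun i =>
    ((ContinuousLinearMap.proj (R := ℂ) (φ := fun _ : I ⊕ I => ℂ) (Sum.inl i)).analyticAt x).mul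
      ((ContinuousLinearMap.proj (R := ℂ) (φ := fun _ : I ⊕ I => ℂ) (Sum.inr i)).analyticAt x)

lemma hm_zero : hm (0 : I ⊕ I → ℂ) = 0 := by funext i; simp [hm]

lemma tendsto_hm : Tendsto hm (𝓝 (0 : I ⊕ I → ℂ)) (𝓝 0) := by
  simpa [hm_zero] using (continuous_hm (I := I)).tendsto 0

/-- Every small vector is the value of `hm` at a small point, namely at `sect`; this brings
identities from the (ξ, η)-space down to the product variables. -/
lemma eventually_of_hm {P : (I → ℂ) → Prop} (h : ∀ᶠ x in 𝓝 (0 : I ⊕ I → ℂ), P (hm x)) :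
    ∀ᶠ ζ in 𝓝 0, P ζ := by
  obtain ⟨ε, hε, h⟩ := Metric.eventually_nhds_iff_ball.1 h
  have hε2 : 0 < ε / 2 := by positivity
  have hC : ((ε / 2 : ℝ) : ℂ) ≠ 0 := by exact_mod_cast hε2.ne'
  filter_upwards [Metric.ball_mem_nhds (0 : I → ℂ) (show 0 < (ε / 2) ^ 2 by positivity)] with ζ hζ
  have h1 := norm_sect_le hε2 (mem_ball_zero_iff.1 hζ).le
  have h2 := h (sect ((ε / 2 : ℝ) : ℂ) ζ) (mem_ball_zero_iff.2 (by linarith))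
  rwa [hm_sect hC] at h2

lemma hm_dv_mul {i : I} {c : ℂ} (hc : c ≠ 0) (x : I ⊕ I → ℂ) :
    hm (dv (Sum.inl i) (Sum.inr i) c * x) = hm x := by
  funext k
  simp only [hm, Pi.mul_apply]
  rcases eq_or_ne k i with rfl | h
  · rw [dv_left, dv_right (hpq k)]; field_simp
  · rw [dv_other (by simpa using h) (by simp), dv_other (by simp) (by simpa using h), one_mul,
      one_mul]

lemma hm_swL {i : I} (x : I ⊕ I → ℂ) : hm (swL (Sum.inl i) (Sum.inr i) x) = hm x := by
  funext k
  simp only [hm, swL_apply, Function.comp]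
  rcases eq_or_ne k i with rfl | h
  · rw [Equiv.swap_apply_left, Equiv.swap_apply_right, mul_comm]
  · rw [Equiv.swap_apply_of_ne_of_ne (by simpa using h) (by simp),
      Equiv.swap_apply_of_ne_of_ne (by simp) (by simpa using h)]

lemma hm_tauF {i : I} {w : (I ⊕ I → ℂ) → ℂ} {x : I ⊕ I → ℂ} (h : w x ≠ 0) :
    hm (tauF (Sum.inl i) (Sum.inr i) w x) = hm x := by
  rw [tauF, hm_dv_mul h, hm_swL]

lemma hasWt_comp_hm {f : (I → ℂ) → ℂ} (hf : AnalyticAt ℂ f 0) (i : I) :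
    HasWt (Sum.inl i) (Sum.inr i) 0 fun x => f (hm x) :=
  ⟨analyticAt_comp_zero hf (analyticAt_hm 0) hm_zero, .of_forall fun x => by
    rw [rot, hm_dv_mul t0_ne_zero, zpow_zero, one_mul]⟩

/-- A germ of weight zero for all pairs of coordinates is a function of the products `ξ_i η_i`. -/
theorem exists_eq_comp_hm {f : (I ⊕ I → ℂ) → ℂ} (hf : ∀ i, HasWt (Sum.inl i) (Sum.inr i) 0 f)
    (ha : AnalyticAt ℂ f 0) :
    ∃ g : (I → ℂ) → ℂ, AnalyticAt ℂ g 0 ∧ ∀ᶠ x in 𝓝 0, f x = g (hm x) := by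
  choose R hR0 hR using fun i => (hf i).eq_of_prod_eq (hpq i)
  obtain ⟨δ, hδ, hδa⟩ := Metric.eventually_nhds_iff_ball.1 ha.eventually_analyticAt
  obtain ⟨ε, hε, hεδ, hεR⟩ : ∃ ε > 0, ε < δ ∧ ∀ i, ε ≤ R i := by
    have h1 : ∀ᶠ ε : ℝ in 𝓝[>] 0, ε < δ ∧ ∀ i, ε ≤ R i :=
      ((eventually_lt_nhds hδ).and (eventually_all.2 fun i => eventually_le_nhds (hR0 i))).filter_mono
        nhdsWithin_le_nhds
    obtain ⟨ε, h2, h3⟩ := (h1.and self_mem_nhdsWithin).exists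
    exact ⟨ε, h3, h2.1, h2.2⟩
  have hC : (ε : ℂ) ≠ 0 := by exact_mod_cast hε.ne'
  have chain : ∀ x y : I ⊕ I → ℂ, ‖x‖ ≤ ε → ‖y‖ ≤ ε → hm x = hm y → f x = f y := by
    intro x y hx hy hxy
    -- The pairs are exchanged one at a time; each exchange keeps the product of its pair, so weight
    -- zero for that pair suffices. Norms stay bounded by ε throughout.
    set z : Finset I → I ⊕ I → ℂ := fun s j => if Sum.elim id id j ∈ s then y j else x j with hz
    have hzn : ∀ s, ‖z s‖ ≤ ε := fun s => (pi_norm_le_iff_of_nonneg hε.le).2 fun j => by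
      simp only [hz]
      split_ifs
      · exact (norm_le_pi_norm y j).trans hy
      · exact (norm_le_pi_norm x j).trans hx
    have h1 : ∀ s, f (z s) = f x := by
      intro s
      induction s using Finset.induction_on with
      | empty => simp [hz]
      | insert i s hi ih =>
        rw [← ih]
        refine hR i _ _ ((hzn _).trans (hεR i)) ((hzn _).trans (hεR i)) (fun j h1 h2 => ?_) ?_
        · have : Sum.elim id id j ≠ i := by
            rcases j with k | k
            · simpa using h1
            · simpa using h2
          simp [hz, this]
        · have := congrFun hxy i
          simp only [hm] at this
          simp [hz, hi, this]
    rw [← h1 Finset.univ]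
    simp [hz]
  have hsect : ∀ ζ : I → ℂ, AnalyticAt ℂ (sect (ε : ℂ)) ζ := fun ζ =>
    analyticAt_pi_iff.2 fun j => by
      rcases j with i | i
      · exact analyticAt_const.mul
          ((ContinuousLinearMap.proj (R := ℂ) (φ := fun _ : I => ℂ) i).analyticAt ζ)
      · exact analyticAt_const
  -- On the fibre over ζ the point with all η_i = ε is a holomorphic choice, and f does not depend
  -- on the choice.
  refine ⟨fun ζ => f (sect ε ζ), AnalyticAt.comp (g := f) (hδa _ ?_) (hsect 0), ?_⟩
  · rw [mem_ball_zero_iff]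
    exact (norm_sect_le hε (by rw [norm_zero]; positivity)).trans_lt hεδ
  · filter_upwards [Metric.ball_mem_nhds (0 : I ⊕ I → ℂ) hε,
      tendsto_hm.eventually (Metric.ball_mem_nhds (0 : I → ℂ) (show 0 < ε ^ 2 by positivity))]
      with x h1 h2
    exact chain _ _ (mem_ball_zero_iff.1 h1).le (norm_sect_le hε (mem_ball_zero_iff.1 h2).le)
      (hm_sect hC _).symm

/-- The multiplier of an involution is invariant under commuting germs that fix its coordinates. -/
lemma tau_multiplier_invariant {i : I} {A B : GG (I ⊕ I → ℂ)} {u : (I ⊕ I → ℂ) → ℂ}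
    {g : (I ⊕ I → ℂ) → I ⊕ I → ℂ} (hu : AnalyticAt ℂ u 0)
    (hA : Rp A (tauF (Sum.inl i) (Sum.inr i) u)) (hB : Rp B g) (hBH : B ∈ Hol (I ⊕ I → ℂ))
    (hgp : ∀ x, g x (Sum.inl i) = x (Sum.inl i)) (hgq : ∀ x, g x (Sum.inr i) = x (Sum.inr i))
    (h : A * B = B * A) : ∀ᶠ x in 𝓝 0, u (g x) = u x := by
  have h1 := (hA.mul hB).eventuallyEq (h ▸ hB.mul hA)
  have ha : AnalyticAt ℂ (fun x => u (g x) - u x) 0 :=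
    (analyticAt_comp_zero hu (hB.analyticAt hBH) hB.map_zero).sub hu
  have h2 := eventually_eq_zero_of_coord_mul ha (Sum.inr i) (by
    filter_upwards [h1] with x hx
    have h3 := congrFun hx (Sum.inl i)
    rw [tauF_left, hgp, tauF_left, hgq] at h3
    linear_combination h3)
  filter_upwards [h2] with x hx using sub_eq_zero.1 hx

lemma sF_multiplier_invariant {i : I} {A B : GG (I ⊕ I → ℂ)} {u : (I ⊕ I → ℂ) → ℂ}
    {g : (I ⊕ I → ℂ) → I ⊕ I → ℂ} (hu : AnalyticAt ℂ u 0)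
    (hA : Rp A (sF (Sum.inl i) (Sum.inr i) u)) (hB : Rp B g) (hBH : B ∈ Hol (I ⊕ I → ℂ))
    (hgp : ∀ x, g x (Sum.inl i) = x (Sum.inl i))
    (h : A * B = B * A) : ∀ᶠ x in 𝓝 0, u (g x) = u x := by
  have h1 := (hA.mul hB).eventuallyEq (h ▸ hB.mul hA)
  have ha : AnalyticAt ℂ (fun x => u (g x) - u x) 0 :=
    (analyticAt_comp_zero hu (hB.analyticAt hBH) hB.map_zero).sub hu
  have h2 := eventually_eq_zero_of_coord_mul ha (Sum.inl i) (by
    filter_upwards [h1] with x hx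
    have h3 := congrFun hx (Sum.inl i)
    rw [sF_apply_left, hgp, hgp, sF_apply_left] at h3
    linear_combination h3)
  filter_upwards [h2] with x hx using sub_eq_zero.1 hx

/-- Commuting pairs of involutions in normal form have multipliers that depend only on the products
`ξ_i η_i`. -/
theorem multipliers_eq_comp_hm {l : I → ℂ} (hl0 : ∀ i, l i ≠ 0) (hl1 : ∀ i, ‖l i‖ ≠ 1)
    {a b : I → GG (I ⊕ I → ℂ)} (ha : ∀ i, a i ∈ Hol _) (hb : ∀ i, b i ∈ Hol _)
    {u v : I → (I ⊕ I → ℂ) → ℂ} (hu : ∀ i, HasWt (Sum.inl i) (Sum.inr i) 0 (u i))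
    (hv : ∀ i, HasWt (Sum.inl i) (Sum.inr i) 0 (v i)) (hu0 : ∀ i, u i 0 = l i)
    (hv0 : ∀ i, v i 0 = (l i)⁻¹) (har : ∀ i, Rp (a i) (tauF (Sum.inl i) (Sum.inr i) (u i)))
    (hbr : ∀ i, Rp (b i) (tauF (Sum.inl i) (Sum.inr i) (v i)))
    (haa : ∀ i j, a i * a j = a j * a i) (hbb : ∀ i j, b i * b j = b j * b i)
    (hs : ∀ i j, a i * b i * Rt j = Rt j * (a i * b i)) :
    ∃ U W : I → (I → ℂ) → ℂ, ∀ i, AnalyticAt ℂ (U i) 0 ∧ AnalyticAt ℂ (W i) 0 ∧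
      (∀ᶠ x in 𝓝 0, u i x = U i (hm x)) ∧ ∀ᶠ x in 𝓝 0, v i x = W i (hm x) := by
  have hune : ∀ i, u i 0 ≠ 0 := fun i => by rw [hu0]; exact hl0 i
  have hvne : ∀ i, v i 0 ≠ 0 := fun i => by rw [hv0]; exact inv_ne_zero (hl0 i)
  set m : I → (I ⊕ I → ℂ) → ℂ := fun i x => u i x * (v i x)⁻¹ with hm'
  have hmi : ∀ i, HasWt (Sum.inl i) (Sum.inr i) 0 (m i) := fun i => (hu i).mul ((hv i).inv (hvne i))
  have hm0 : ∀ i, m i 0 = l i ^ 2 := fun i => by simp only [hm', hu0, hv0, inv_inv, sq]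
  have hmne : ∀ i, m i 0 ≠ 0 := fun i => by rw [hm0]; exact pow_ne_zero _ (hl0 i)
  have hsr : ∀ i, Rp (a i * b i) (sF (Sum.inl i) (Sum.inr i) (m i)) := fun i =>
    rp_tau_mul_tau (hpq i) (hu i) (hv i) (hvne i) (har i) (hbr i)
  have hne1 : ∀ {i j : I}, i ≠ j → (Sum.inl i : I ⊕ I) ≠ Sum.inl j := fun h => by simpa using h
  have hne2 : ∀ {i j : I}, i ≠ j → (Sum.inr i : I ⊕ I) ≠ Sum.inr j := fun h => by simpa using h
  -- m_i is the multiplier of a_i b_i, which commutes with every rotation; for j ≠ i the rotation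
  -- fixes ξ_i, η_i.
  have hmj : ∀ i j, HasWt (Sum.inl j) (Sum.inr j) 0 (m i) := by
    intro i j
    rcases eq_or_ne i j with rfl | hij
    · exact hmi i
    · refine ⟨(hmi i).an, ?_⟩
      have h := sF_multiplier_invariant (hmi i).an (hsr i) (rotG_rp (Sum.inl j) (Sum.inr j))
        (rotG_mem _ _) (fun x => by
          rw [rot, Pi.mul_apply, dv_other (hne1 hij) (by simp), one_mul]) (hs i j)
      filter_upwards [h] with x hx
      rw [hx, zpow_zero, one_mul]
  have hvj : ∀ i j, HasWt (Sum.inl j) (Sum.inr j) 0 (v i) := by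
    intro i j
    rcases eq_or_ne i j with rfl | hij
    · exact hv i
    have h1 : ∀ᶠ x in 𝓝 0, u i (tauF (Sum.inl j) (Sum.inr j) (u j) x) = u i x :=
      tau_multiplier_invariant (hu i).an (har i) (har j) (ha j)
        (fun x => tauF_other (hne1 hij) (by simp) _ _)
        (fun x => tauF_other (by simp) (hne2 hij) _ _) (haa i j)
    have h2 : ∀ᶠ x in 𝓝 0, v i (tauF (Sum.inl j) (Sum.inr j) (v j) x) = v i x :=
      tau_multiplier_invariant (hv i).an (hbr i) (hbr j) (hb j)
        (fun x => tauF_other (hne1 hij) (by simp) _ _)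
        (fun x => tauF_other (by simp) (hne2 hij) _ _) (hbb i j)
    have h3 := (hmj i j).comp_tauF (hpq j) (hu j).an.continuousAt (hune j) (har j).tendsto
    -- Commutation of the a's gives only that u_i is invariant under a_j, and of the b's only that
    -- v_i is invariant under b_j. As u_i / v_i = m_i has weight zero for the pair j, v_i is
    -- invariant under a_j too, hence under the hyperbolic composition a_j b_j, and `hasWt_of_comp`
    -- applies.
    have h4 : ∀ᶠ x in 𝓝 0, v i (tauF (Sum.inl j) (Sum.inr j) (u j) x) = v i x := by
      have h5 : ∀ᶠ x in 𝓝 0, u i x = m i x * v i x ∧ m i x ≠ 0 := by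
        filter_upwards [(hv i).an.continuousAt.eventually_ne (hvne i),
          (hmi i).an.continuousAt.eventually_ne (hmne i)] with x h6 h7
        refine ⟨?_, h7⟩
        simp only [hm']
        field_simp
      filter_upwards [h1, h3, h5, (har j).tendsto.eventually h5] with x e1 e2 e3 e4
      rw [e3.1, e4.1, e2] at e1
      exact mul_left_cancel₀ e3.2 e1
    have h5 : ∀ᶠ x in 𝓝 0, v i (sF (Sum.inl j) (Sum.inr j) (m j) x) = 1 * v i x := by
      have h6 := (hsr j).eventuallyEq ((har j).mul (hbr j))
      filter_upwards [h6, h2, (hbr j).tendsto.eventually h4] with x e1 e2 e3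
      rw [e1, e3, e2, one_mul]
    refine hasWt_of_comp (hpq j) (hmne j)
      (zpow_eq_one_of_norm_ne_one ?_) (hv i).an (hasFDerivAt_sF (hmi j).an (hmne j))
      (fun y => rfl) (by simp [sF]) (sF_rot (hmi j)) (c := fun _ => 1) continuousAt_const
      (.of_forall fun _ => rfl) (by simp) h5
    rw [hm0, norm_pow]
    exact fun h => hl1 j ((pow_eq_one_iff_of_nonneg (norm_nonneg _) two_ne_zero).1 h)
  have huj : ∀ i j, HasWt (Sum.inl j) (Sum.inr j) 0 (u i) := by
    intro i j
    have h1 := (hmj i j).mul (hvj i j)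
    refine ⟨(hu i).an, ?_⟩
    have h5 : ∀ᶠ x in 𝓝 0, u i x = m i x * v i x := by
      filter_upwards [(hv i).an.continuousAt.eventually_ne (hvne i)] with x h6
      simp only [hm']
      field_simp
    filter_upwards [h5, tendsto_rot.eventually h5, h1.rot] with x e1 e2 e3
    rw [e2, e3, e1]; rfl
  choose U hU hUe using fun i => exists_eq_comp_hm (huj i) (hu i).an
  choose W hW hWe using fun i => exists_eq_comp_hm (hvj i) (hv i).an
  exact ⟨U, W, fun i => ⟨hU i, hW i, hUe i, hWe i⟩⟩

end NormalForm

section NormalForm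
open PS

/-! ### The normal form of the involutions -/

lemma Rp.conj {V : Type*} [NormedAddCommGroup V] [NormedSpace ℂ V] {A K : GG V} {f k g : V → V}
    (hA : Rp A f) (hK : Rp K k) (hg : Tendsto g (𝓝 0) (𝓝 0)) (h : ∀ᶠ x in 𝓝 0, f (k x) = k (g x)) :
    Rp (K⁻¹ * A * K) g := by
  obtain ⟨k', hk'⟩ := exists_rp K⁻¹
  have h1 := (hk'.mul hK).eventuallyEq (inv_mul_cancel K ▸ Rp.one)
  refine ((hk'.mul hA).mul hK).congr ?_
  filter_upwards [h, hg.eventually h1] with x e1 e2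
  rw [e1, e2]

lemma eventuallyEq_of_tauF {J : Type*} [Fintype J] [DecidableEq J] {p q : J}
    {u v : (J → ℂ) → ℂ} (hu : AnalyticAt ℂ u 0) (hv : AnalyticAt ℂ v 0)
    (h : tauF p q u =ᶠ[𝓝 0] tauF p q v) : u =ᶠ[𝓝 0] v := by
  have h2 := eventually_eq_zero_of_coord_mul (hu.sub hv) q (by
    filter_upwards [h] with x hx
    have h3 := congrFun hx p
    rw [tauF_left, tauF_left] at h3
    simp only [Pi.sub_apply]
    linear_combination h3)
  filter_upwards [h2] with x hx using sub_eq_zero.1 hx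

/-- Conjugation (and inversion) commutes with fourth roots near `1`. -/
lemma cj_cpow (b : Bool) {z : ℂ} (hz : z ∈ Complex.slitPlane) :
    cj b (z ^ (((4 : ℕ) : ℂ)⁻¹)) = cj b z ^ (((4 : ℕ) : ℂ)⁻¹) := by
  have h1 : z.arg ≠ Real.pi := Complex.slitPlane_arg_ne_pi hz
  have h2 : (conj z).arg ≠ Real.pi := Complex.slitPlane_arg_ne_pi (by
    rw [Complex.mem_slitPlane_iff] at hz ⊢
    simpa using hz)
  have h3 : conj (z ^ (((4 : ℕ) : ℂ)⁻¹)) = conj z ^ (((4 : ℕ) : ℂ)⁻¹) := by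
    rw [Complex.conj_cpow _ _ h1, map_inv₀, map_natCast]
  cases b
  · simpa [cj] using h3
  · simp only [cj, if_true, h3]
    rw [Complex.inv_cpow _ _ h2]

lemma analyticAt_cj {I : Type*} [Fintype I] [DecidableEq I] {f : (I → ℂ) → ℂ}
    (hf : AnalyticAt ℂ f 0) (h0 : f 0 ≠ 0) (b : Bool) (π : I → I) :
    AnalyticAt ℂ (fun x => cj b (f (conjR π x))) 0 := by
  have h1 := analyticAt_conj_conjR hf π
  cases b
  · simpa [cj] using h1
  · simp only [cj, if_true]
    refine h1.inv ?_
    rw [conjR_zero]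
    exact fun h => h0 (by simpa using h)

variable {I : Type*} [Fintype I] [DecidableEq I]

lemma hm_conjR (r : RealData I) (x : I ⊕ I → ℂ) : hm (conjR r.perm x) = conjR r.star (hm x) := by
  funext i
  cases h : r.fl i <;> simp [hm, conjR, RealData.perm, h, mul_comm]

/-- `ξ_i ↦ c_i(ξη) ξ_i`, `η_i ↦ c_i(ξη)⁻¹ η_i`. -/
def scl (c : I → (I → ℂ) → ℂ) (x : I ⊕ I → ℂ) : I ⊕ I → ℂ :=
  Sum.elim (fun i => c i (hm x) * x (Sum.inl i)) fun i => (c i (hm x))⁻¹ * x (Sum.inr i)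

lemma hm_scl {c : I → (I → ℂ) → ℂ} {x : I ⊕ I → ℂ} (h : ∀ i, c i (hm x) ≠ 0) :
    hm (scl c x) = hm x := by
  funext i
  have := h i
  simp only [hm, scl, Sum.elim_inl, Sum.elim_inr] at this ⊢
  field_simp

lemma exists_scl {c : I → (I → ℂ) → ℂ} (hc : ∀ i, AnalyticAt ℂ (c i) 0) (h1 : ∀ i, c i 0 = 1) :
    ∃ κ ∈ Hol (I ⊕ I → ℂ), Rp κ (scl c) := by
  set n : I ⊕ I → (I ⊕ I → ℂ) → ℂ :=
    Sum.elim (fun i x => c i (hm x)) fun i x => (c i (hm x))⁻¹ with hn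
  have ha : ∀ i, AnalyticAt ℂ (fun x : I ⊕ I → ℂ => c i (hm x)) 0 := fun i =>
    analyticAt_comp_zero (hc i) (analyticAt_hm 0) hm_zero
  have hna : ∀ j, AnalyticAt ℂ (n j) 0 := by
    rintro (i | i)
    · exact ha i
    · exact (ha i).inv (by rw [hm_zero, h1]; exact one_ne_zero)
  have hn0 : ∀ j, n j 0 = 1 := by
    rintro (i | i) <;> simp [hn, hm_zero, h1]
  have hsc : scl c = fun x j => n j x * x j := by
    funext x j
    rcases j with i | i <;> rfl
  have hp : ∀ j : I ⊕ I, AnalyticAt ℂ (fun x : I ⊕ I → ℂ => x j) 0 := fun j =>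
    (ContinuousLinearMap.proj (R := ℂ) (φ := fun _ : I ⊕ I => ℂ) j).analyticAt 0
  have hd : HasFDerivAt (scl c) (ContinuousLinearMap.id ℂ (I ⊕ I → ℂ)) 0 := by
    rw [hsc]
    refine hasFDerivAt_pi'.2 fun j => ?_
    have h2 := (hna j).differentiableAt.hasFDerivAt.mul
      (ContinuousLinearMap.proj (R := ℂ) (φ := fun _ : I ⊕ I => ℂ) j).hasFDerivAt
    refine h2.congr_fderiv ?_
    ext x
    simp [hn0]
  obtain ⟨κ, hκ, hr, -⟩ := exists_hol_of_hasFDerivAt (f := scl c)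
    (by rw [hsc]; exact analyticAt_pi_iff.2 fun j => (hna j).mul (hp j))
    (by rw [hsc]; funext j; simp) (A := ContinuousLinearMap.id ℂ (I ⊕ I → ℂ))
    ⟨ContinuousLinearEquiv.refl ℂ _, rfl⟩ hd
  exact ⟨κ, hκ, hr⟩

/-- The scaling preserves all products ξ_i η_i, so the multipliers act as constants: the target ξ_i
loses a factor c_i and the source η_i contributes c_i⁻¹, dividing u by c_i². -/
lemma tauF_scl {c : I → (I → ℂ) → ℂ} {u : (I → ℂ) → ℂ} {x : I ⊕ I → ℂ} {i : I}
    (h : ∀ j, c j (hm x) ≠ 0) (hu : u (hm x) ≠ 0) :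
    tauF (Sum.inl i) (Sum.inr i) (fun y => u (hm y)) (scl c x) =
      scl c (tauF (Sum.inl i) (Sum.inr i) (fun y => u (hm y) / c i (hm y) ^ 2) x) := by
  have hi := h i
  have h2 : hm (tauF (Sum.inl i) (Sum.inr i) (fun y => u (hm y) / c i (hm y) ^ 2) x) = hm x :=
    hm_tauF (div_ne_zero hu (pow_ne_zero _ hi))
  funext j
  by_cases hj1 : j = Sum.inl i
  · subst hj1
    rw [tauF_left]
    simp only [scl, Sum.elim_inl, Sum.elim_inr, h2]
    rw [tauF_left, ← scl, hm_scl h]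
    field_simp
  by_cases hj2 : j = Sum.inr i
  · subst hj2
    rw [tauF_right (hpq i)]
    simp only [scl, Sum.elim_inl, Sum.elim_inr, h2]
    rw [tauF_right (hpq i), ← scl, hm_scl h]
    field_simp
  rw [tauF_other hj1 hj2]
  rcases j with k | k <;> simp only [scl, Sum.elim_inl, Sum.elim_inr, h2] <;>
    rw [tauF_other hj1 hj2]

lemma scl_conjR (r : RealData I) {c : I → (I → ℂ) → ℂ} {x : I ⊕ I → ℂ}
    (h : ∀ i, c i (conjR r.star (hm x)) = cj (r.fl i) (c (r.star i) (hm x))) :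
    scl c (conjR r.perm x) = conjR r.perm (scl c x) := by
  funext j
  rcases j with i | i <;> have hi := h i <;> cases hf : r.fl i <;> rw [hf] at hi <;>
    simp [scl, hm_conjR, hi, conjR, RealData.perm, hf, cj]

end NormalForm

/-! ### Rescaling the multipliers and the normal form of the whole family -/

section NormalForm
open PS

variable {I : Type*} [Fintype I] [DecidableEq I]

/-- Multipliers `u`, `v` interchanged by a real structure can be rescaled to inverse multipliers. -/
lemma exists_rescaling (r : RealData I) {l : I → ℂ} (hl0 : ∀ i, l i ≠ 0) {u v : I → (I → ℂ) → ℂ}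
    (hu : ∀ i, AnalyticAt ℂ (u i) 0) (hv : ∀ i, AnalyticAt ℂ (v i) 0) (hu0 : ∀ i, u i 0 = l i)
    (hv0 : ∀ i, v i 0 = (l i)⁻¹)
    (h : ∀ i, ∀ᶠ ζ in 𝓝 0, v i ζ = cj (r.fl i) (u (r.star i) (conjR r.star ζ))) :
    ∃ c : I → (I → ℂ) → ℂ, (∀ i, AnalyticAt ℂ (c i) 0) ∧ (∀ i, c i 0 = 1) ∧
      (∀ᶠ ζ in 𝓝 0, ∀ i, c i (conjR r.star ζ) = cj (r.fl i) (c (r.star i) ζ)) ∧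
      ∀ i, ∀ᶠ ζ in 𝓝 0, u i ζ / c i ζ ^ 2 * (v i ζ / c i ζ ^ 2) = 1 := by
  have huv0 : ∀ i, u i 0 * v i 0 = 1 := fun i => by rw [hu0, hv0, mul_inv_cancel₀ (hl0 i)]
  have hsl : ∀ i, u i 0 * v i 0 ∈ Complex.slitPlane := fun i => by
    rw [huv0]; exact Complex.one_mem_slitPlane
  -- Rescaling divides both multipliers by c², so their product becomes uv / c⁴ = 1. Since uv = 1 at
  -- 0, the principal root is analytic there and compatible with conjugation.
  set c : I → (I → ℂ) → ℂ := fun i ζ => (u i ζ * v i ζ) ^ (((4 : ℕ) : ℂ)⁻¹) with hc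
  have hca : ∀ i, AnalyticAt ℂ (c i) 0 := fun i =>
    ((hu i).mul (hv i)).cpow analyticAt_const (hsl i)
  have hc0 : ∀ i, c i 0 = 1 := fun i => by simp only [hc, huv0, Complex.one_cpow]
  have hslt : ∀ i, ∀ᶠ ζ in 𝓝 0, u i ζ * v i ζ ∈ Complex.slitPlane := fun i =>
    ((hu i).mul (hv i)).continuousAt.eventually (Complex.isOpen_slitPlane.mem_nhds (hsl i))
  have ht : Tendsto (conjR r.star) (𝓝 (0 : I → ℂ)) (𝓝 0) := tendsto_conjR _
  refine ⟨c, hca, hc0, eventually_all.2 fun i => ?_, fun i => ?_⟩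
  · filter_upwards [hslt (r.star i), ht.eventually (h i), h (r.star i)] with ζ h1 h2 h3
    rw [conjR_conjR r.star_star] at h2
    rw [r.star_star, r.fl_star] at h3
    simp only [hc]
    rw [cj_cpow _ h1, h2, h3, cj_mul, cj_cj, mul_comm]
  · filter_upwards [hslt i] with ζ h1
    have h2 : c i ζ ^ 4 = u i ζ * v i ζ := by
      simp only [hc]
      exact Complex.cpow_nat_inv_pow _ (by norm_num)
    have h3 : u i ζ * v i ζ ≠ 0 := Complex.slitPlane_ne_zero h1
    have h4 : c i ζ ≠ 0 := fun h5 => h3 (by rw [← h2, h5]; simp)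
    rw [div_mul_div_comm, ← pow_add, h2, div_self h3]

/-- The simultaneous normal form of a family of involutions and their conjugates. -/
theorem exists_normal_form (r : RealData I) {ρ : GG (I ⊕ I → ℂ)} (hρ : Rp ρ (conjR r.perm))
    (hρρ : ρ * ρ = 1) {l : I → ℂ} (hl0 : ∀ i, l i ≠ 0) (hl1 : ∀ i, ‖l i‖ ≠ 1)
    (hlr : ∀ i, cj (r.fl i) (l (r.star i)) = (l i)⁻¹) {a : I → GG (I ⊕ I → ℂ)}
    (ha : ∀ i, a i ∈ Hol _) (haa : ∀ i j, a i * a j = a j * a i) (ha1 : ∀ i, a i * a i = 1)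
    (hDa : ∀ i, D (a i) = tauL (Sum.inl i) (Sum.inr i) (l i))
    (hcomm : ∀ i j, a i * (ρ * a (r.star i) * ρ) * (a j * (ρ * a (r.star j) * ρ)) =
      a j * (ρ * a (r.star j) * ρ) * (a i * (ρ * a (r.star i) * ρ))) :
    ∃ ψ ∈ Hol (I ⊕ I → ℂ), ψ * ρ = ρ * ψ ∧ ∃ Λ₁ Λ₂ : I → (I → ℂ) → ℂ, ∀ i,
      AnalyticAt ℂ (Λ₁ i) 0 ∧ AnalyticAt ℂ (Λ₂ i) 0 ∧ Λ₁ i 0 = l i ∧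
      (∀ᶠ ζ in 𝓝 0, Λ₁ i ζ * Λ₂ i ζ = 1) ∧
      (∀ᶠ ζ in 𝓝 0, Λ₂ i ζ = cj (r.fl i) (Λ₁ (r.star i) (conjR r.star ζ))) ∧
      Rp (ψ⁻¹ * a i * ψ) (tauF (Sum.inl i) (Sum.inr i) fun x => Λ₁ i (hm x)) ∧
      Rp (ψ⁻¹ * (ρ * a (r.star i) * ρ) * ψ) (tauF (Sum.inl i) (Sum.inr i) fun x => Λ₂ i (hm x)) ∧
      Rp (ψ⁻¹ * (a i * (ρ * a (r.star i) * ρ)) * ψ)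
        (sF (Sum.inl i) (Sum.inr i) fun x => Λ₁ i (hm x) ^ 2) := by
  obtain ⟨χ, hχ, hχρ, hχa⟩ := exists_torus_coordinates r hρ hρρ hl0 hl1 hlr ha ha1 hDa hcomm
  choose u' hu' hu'0 hAu using fun i => (hχa i).1
  choose v' hv' hv'0 hBv using fun i => (hχa i).2.1
  have hR := fun i => (hχa i).2.2
  set b : I → GG (I ⊕ I → ℂ) := fun i => ρ * a (r.star i) * ρ with hb
  have hbH : ∀ i, b i ∈ Hol _ := fun i => conj_mem_Hol hρ hρρ (ha _)
  have hbb : ∀ i j, b i * b j = b j * b i := fun i j => by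
    calc b i * b j = ρ * a (r.star i) * (ρ * ρ) * a (r.star j) * ρ := by rw [hb]; group
      _ = ρ * (a (r.star i) * a (r.star j)) * ρ := by rw [hρρ]; group
      _ = ρ * (a (r.star j) * a (r.star i)) * ρ := by rw [haa]
      _ = ρ * a (r.star j) * (ρ * ρ) * a (r.star i) * ρ := by rw [hρρ]; group
      _ = b j * b i := by rw [hb]; group
  have hcj : ∀ {x y : GG (I ⊕ I → ℂ)}, x * y = y * x →
      χ * x * χ⁻¹ * (χ * y * χ⁻¹) = χ * y * χ⁻¹ * (χ * x * χ⁻¹) := fun {x y} h => by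
    calc χ * x * χ⁻¹ * (χ * y * χ⁻¹) = χ * (x * y) * χ⁻¹ := by group
      _ = χ * (y * x) * χ⁻¹ := by rw [h]
      _ = χ * y * χ⁻¹ * (χ * x * χ⁻¹) := by group
  have hcH : ∀ {x : GG (I ⊕ I → ℂ)}, x ∈ Hol _ → χ * x * χ⁻¹ ∈ Hol _ := fun h =>
    (Hol _).mul_mem ((Hol _).mul_mem hχ h) ((Hol _).inv_mem hχ)
  obtain ⟨u, v, huv⟩ := multipliers_eq_comp_hm hl0 hl1 (fun i => hcH (ha i)) (fun i => hcH (hbH i))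
    hu' hv' hu'0 hv'0 hAu hBv (fun i j => hcj (haa i j)) (fun i j => hcj (hbb i j)) (fun i j => by
      have h1 : χ * a i * χ⁻¹ * (χ * b i * χ⁻¹) = χ * (a i * b i) * χ⁻¹ := by group
      rw [h1]; exact hR i j)
  have hua := fun i => (huv i).1
  have hva := fun i => (huv i).2.1
  have hu0 : ∀ i, u i 0 = l i := fun i => by
    have := (huv i).2.2.1.self_of_nhds
    rw [← hu'0, this, hm_zero]
  have hv0 : ∀ i, v i 0 = (l i)⁻¹ := fun i => by
    have := (huv i).2.2.2.self_of_nhds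
    rw [← hv'0, this, hm_zero]
  have hune : ∀ i, u i 0 ≠ 0 := fun i => by rw [hu0]; exact hl0 i
  have hvne : ∀ i, v i 0 ≠ 0 := fun i => by rw [hv0]; exact inv_ne_zero (hl0 i)
  have tauF_congr : ∀ {i : I} {f g : (I ⊕ I → ℂ) → ℂ}, f =ᶠ[𝓝 0] g →
      tauF (Sum.inl i) (Sum.inr i) f =ᶠ[𝓝 0] tauF (Sum.inl i) (Sum.inr i) g := fun h => by
    filter_upwards [h] with x hx
    simp only [tauF, hx]
  have hA : ∀ i, Rp (χ * a i * χ⁻¹) (tauF (Sum.inl i) (Sum.inr i) fun x => u i (hm x)) := fun i =>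
    (hAu i).congr (tauF_congr (huv i).2.2.1)
  have hB : ∀ i, Rp (χ * b i * χ⁻¹) (tauF (Sum.inl i) (Sum.inr i) fun x => v i (hm x)) := fun i =>
    (hBv i).congr (tauF_congr (huv i).2.2.2)
  -- χ commutes with ρ, so in the new coordinates b_i is still the conjugate of a_{i^*}; comparing
  -- multipliers gives the relation.
  have hrel : ∀ i, ∀ᶠ ζ in 𝓝 0, v i ζ = cj (r.fl i) (u (r.star i) (conjR r.star ζ)) := by
    intro i
    have h1 : ρ * (χ * a (r.star i) * χ⁻¹) * ρ = χ * b i * χ⁻¹ := by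
      have h2 : χ⁻¹ * ρ = ρ * χ⁻¹ := by rw [inv_mul_eq_iff_eq_mul, ← mul_assoc, hχρ, mul_inv_cancel_right]
      calc ρ * (χ * a (r.star i) * χ⁻¹) * ρ = (ρ * χ) * a (r.star i) * (χ⁻¹ * ρ) := by group
        _ = (χ * ρ) * a (r.star i) * (ρ * χ⁻¹) := by rw [h2, hχρ]
        _ = χ * b i * χ⁻¹ := by rw [hb]; group
    have h2 := (hρ.mul (hA (r.star i))).mul hρ
    rw [h1] at h2
    have h3 := (hB i).eventuallyEq h2
    simp only [conjR_tauF] at h3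
    rw [r.star_star, r.fl_star] at h3
    simp only [hm_conjR] at h3
    exact eventually_of_hm (eventuallyEq_of_tauF
      (analyticAt_comp_zero (hva i) (analyticAt_hm 0) hm_zero)
      (analyticAt_comp_zero
        (g := fun ζ => cj (r.fl i) (u (r.star i) (conjR r.star ζ)))
        (analyticAt_cj (hua _) (hune _) _ _) (analyticAt_hm 0) hm_zero) h3)
  obtain ⟨c, hc, hc0, hcr, hcuv⟩ := exists_rescaling r hl0 hua hva hu0 hv0 hrel
  obtain ⟨κ, hκ, hκr⟩ := exists_scl hc hc0
  have hcne : ∀ᶠ ζ in 𝓝 0, ∀ i, c i ζ ≠ 0 := eventually_all.2 fun i =>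
    (hc i).continuousAt.eventually_ne (by rw [hc0]; exact one_ne_zero)
  have hdiv : ∀ {w : (I → ℂ) → ℂ} (i : I), AnalyticAt ℂ w 0 →
      AnalyticAt ℂ (fun ζ => w ζ / c i ζ ^ 2) 0 := fun i hw =>
    hw.div ((hc i).pow 2) (by rw [hc0]; norm_num)
  have hconj : ∀ {w : (I → ℂ) → ℂ} {A : GG (I ⊕ I → ℂ)} (i : I), AnalyticAt ℂ w 0 → w 0 ≠ 0 →
      Rp A (tauF (Sum.inl i) (Sum.inr i) fun x => w (hm x)) →
      Rp (κ⁻¹ * A * κ) (tauF (Sum.inl i) (Sum.inr i) fun x => w (hm x) / c i (hm x) ^ 2) := by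
    intro w A i hw hw0 hA
    obtain ⟨g, -, hg, -⟩ := exists_tau_germ (hpq i)
      (analyticAt_comp_zero (hdiv i hw) (analyticAt_hm 0) hm_zero) (by
        rw [hm_zero, hc0]; simpa using hw0)
    refine hA.conj hκr hg.tendsto ?_
    filter_upwards [tendsto_hm.eventually hcne,
      tendsto_hm.eventually (hw.continuousAt.eventually_ne hw0)] with x h1 h2
    exact tauF_scl h1 h2
  have hκρ : κ * ρ = ρ * κ := by
    refine (hκr.mul hρ).ext (hρ.mul hκr) ?_
    filter_upwards [tendsto_hm.eventually hcr] with x hx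
    exact scl_conjR r hx
  have hψ : ∀ x, (χ⁻¹ * κ)⁻¹ * x * (χ⁻¹ * κ) = κ⁻¹ * (χ * x * χ⁻¹) * κ := fun x => by group
  refine ⟨χ⁻¹ * κ, (Hol _).mul_mem ((Hol _).inv_mem hχ) hκ, ?_, fun i ζ => u i ζ / c i ζ ^ 2,
    fun i ζ => v i ζ / c i ζ ^ 2, fun i => ?_⟩
  · rw [mul_assoc, hκρ, ← mul_assoc, comm_inv hχρ, mul_assoc]
  have hT₁ := hconj i (hua i) (hune i) (hA i)
  have hT₂ := hconj i (hva i) (hvne i) (hB i)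
  have hΛ : ∀ᶠ ζ in 𝓝 0, u i ζ / c i ζ ^ 2 * (v i ζ / c i ζ ^ 2) = 1 := hcuv i
  refine ⟨hdiv i (hua i), hdiv i (hva i), by simp [hc0, hu0], hΛ, ?_, ?_, ?_, ?_⟩
  · have ht : Tendsto (conjR r.star) (𝓝 (0 : I → ℂ)) (𝓝 0) := tendsto_conjR _
    filter_upwards [hrel i, ht.eventually hcr] with ζ h1 h2
    have h3 := h2 i
    rw [conjR_conjR r.star_star] at h3
    rw [h1, h3, div_eq_mul_inv, div_eq_mul_inv, cj_mul, cj_inv, cj_pow]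
  · rw [hψ]; exact hT₁
  · rw [hψ]; exact hT₂
  · have h1 : (χ⁻¹ * κ)⁻¹ * (a i * b i) * (χ⁻¹ * κ) =
        κ⁻¹ * (χ * a i * χ⁻¹) * κ * (κ⁻¹ * (χ * b i * χ⁻¹) * κ) := by group
    rw [h1]
    refine (rp_tau_mul_tau (hpq i) (hasWt_comp_hm (hdiv i (hua i)) i)
      (hasWt_comp_hm (hdiv i (hva i)) i) ?_ hT₁ hT₂).congr ?_
    · rw [hm_zero, hc0]; simpa using hvne i
    -- The multiplier of the composition is Λ₁ / Λ₂ = Λ₁².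
    · filter_upwards [tendsto_hm.eventually hΛ] with x hx
      have h2 : u i (hm x) / c i (hm x) ^ 2 * (v i (hm x) / c i (hm x) ^ 2)⁻¹ =
          (u i (hm x) / c i (hm x) ^ 2) ^ 2 := by
        rw [← eq_inv_of_mul_eq_one_left hx, ← sq]
      simp only [sF, h2]

end NormalForm

section Deck

/-! ### Deck transformations -/

variable {e s : ℕ}

lemma partner_partner (j : Idx e s) : partner (partner j) = j := by
  rcases j with i | k | k <;> rfl

/-- The linear form whose square is the `j`-th component of the quadric. -/
def ell (γe : Fin e → ℝ) (γs : Fin s → ℂ) (j : Idx e s) : Dbl e s →L[ℂ] ℂ :=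
  (ContinuousLinearMap.proj j).comp (ContinuousLinearMap.fst ℂ (Vec e s) (Vec e s)) +
    (2 * coeff γe γs j) •
      (ContinuousLinearMap.proj (partner j)).comp (ContinuousLinearMap.snd ℂ (Vec e s) (Vec e s))

lemma ell_apply (γe : Fin e → ℝ) (γs : Fin s → ℂ) (j : Idx e s) (x : Dbl e s) :
    ell γe γs j x = x.1 j + 2 * coeff γe γs j * x.2 (partner j) := by
  simp [ell]

/-- `quadricT` as a linear map. -/
def quadricTL (γe : Fin e → ℝ) (γs : Fin s → ℂ) (j : Idx e s) : Dbl e s →L[ℂ] Dbl e s :=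
  LinearMap.toContinuousLinearMap
    { toFun := quadricT γe γs j
      map_add' := fun x y => by
        refine Prod.ext rfl (funext fun k => ?_)
        rcases eq_or_ne k j with rfl | h
        · simp [quadricT]; ring
        · simp [quadricT, h]
      map_smul' := fun c x => by
        refine Prod.ext rfl (funext fun k => ?_)
        rcases eq_or_ne k j with rfl | h
        · simp [quadricT]; ring
        · simp [quadricT, h] }

lemma quadricTL_apply (γe : Fin e → ℝ) (γs : Fin s → ℂ) (j : Idx e s) (x : Dbl e s) :
    quadricTL γe γs j x = quadricT γe γs j x := rfl

/-- The variable w_j enters only the form with index `partner j`, and T_{1j} is the reflection that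
reverses its sign. -/
lemma ell_quadricT {γe : Fin e → ℝ} {γs : Fin s → ℂ} (hc : ∀ j, coeff γe γs j ≠ 0) (j k : Idx e s)
    (x : Dbl e s) : ell γe γs k (quadricT γe γs j x) =
      (((if k = partner j then -1 else 1 : ℤˣ) : ℤ) : ℂ) * ell γe γs k x := by
  simp only [ell_apply, quadricT]
  split_ifs with h
  · subst h
    rw [partner_partner, Function.update_self]
    have := hc (partner j)
    push_cast
    field_simp
    ring
  · have h1 : partner k ≠ j := fun h2 => h (by rw [← h2, partner_partner])
    rw [Function.update_of_ne h1]
    simp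

lemma eq_of_ell_eq {γe : Fin e → ℝ} {γs : Fin s → ℂ} (hc : ∀ j, coeff γe γs j ≠ 0) {x y : Dbl e s}
    (h1 : x.1 = y.1) (h2 : ∀ j, ell γe γs j x = ell γe γs j y) : x = y := by
  refine Prod.ext h1 (funext fun k => ?_)
  have h3 := h2 (partner k)
  rw [ell_apply, ell_apply, partner_partner, h1] at h3
  exact mul_left_cancel₀ (mul_ne_zero two_ne_zero (hc _)) (add_left_cancel h3)

/-- Linear forms with the same square agree up to sign. -/
lemma exists_sign {V : Type*} [NormedAddCommGroup V] [NormedSpace ℂ V] (f g : V →L[ℂ] ℂ)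
    (h : ∀ x, f x ^ 2 = g x ^ 2) : ∃ ε : ℤˣ, ∀ x, f x = ((ε : ℤ) : ℂ) * g x := by
  by_cases h1 : ∀ x, f x = g x
  · exact ⟨1, fun x => by simp [h1]⟩
  by_cases h2 : ∀ x, f x = - g x
  · exact ⟨-1, fun x => by simp [h2]⟩
  push Not at h1 h2
  obtain ⟨x, hx⟩ := h1
  obtain ⟨y, hy⟩ := h2
  have ex := h x
  have ey := h y
  have exy := h (x + y)
  rw [map_add, map_add] at exy
  have hx' : f x = - g x := (sq_eq_sq_iff_eq_or_eq_neg.1 ex).resolve_left hx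
  have hy' : f y = g y := (sq_eq_sq_iff_eq_or_eq_neg.1 ey).resolve_right hy
  rw [hx', hy'] at exy
  -- At x the sign is - and at y it is +; the squares at x + y then force a mixed term to vanish.
  have h3 : g x * g y = 0 := by linear_combination (-1 / 4 : ℂ) * exy
  rcases mul_eq_zero.1 h3 with h4 | h4
  · exact absurd (by rw [hx', h4, neg_zero]) hx
  · exact absurd (by rw [hy', h4, neg_zero]) hy

variable (E : Dbl e s → Vec e s)

/-- The group of germs of deck transformations. -/
def deckGroup : Subgroup (GG (Dbl e s)) where
  carrier := {g | g ∈ Hol _ ∧ ∃ f, Rp g f ∧ pi1 E ∘ f =ᶠ[𝓝 0] pi1 E}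
  mul_mem' := by
    rintro g g' ⟨hg, f, hf, h⟩ ⟨hg', f', hf', h'⟩
    refine ⟨mul_mem hg hg', _, hf.mul hf', ?_⟩
    filter_upwards [hf'.tendsto.eventually h, h'] with x e1 e2
    exact e1.trans e2
  one_mem' := ⟨one_mem _, _, Rp.one, EventuallyEq.rfl⟩
  inv_mem' := by
    rintro g ⟨hg, f, hf, h⟩
    obtain ⟨f', hf'⟩ := exists_rp g⁻¹
    refine ⟨inv_mem hg, f', hf', ?_⟩
    have h1 := (hf.mul hf').eventuallyEq (mul_inv_cancel g ▸ Rp.one)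
    filter_upwards [hf'.tendsto.eventually h, h1] with x e1 e2
    have e3 : pi1 E (f (f' x)) = pi1 E (f' x) := e1
    rw [e2] at e3
    exact e3.symm

variable {E}

lemma isDeck_of_rp {g : GG (Dbl e s)} (hg : g ∈ deckGroup E) {F : Dbl e s → Dbl e s} (hF : Rp g F) :
    IsDeck E F := by
  obtain ⟨hg, f, hf, h⟩ := hg
  refine ⟨⟨hF.analyticAt hg, hF.map_zero, ?_⟩, ?_⟩
  · rw [← hF.D_eq]; exact isInvertible_D hg
  · filter_upwards [h, hf.eventuallyEq hF] with x e1 e2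
    rw [Function.comp, ← e2]; exact e1

lemma exists_rp_of_isDeck {F : Dbl e s → Dbl e s} (hF : IsDeck E F) : ∃ g ∈ deckGroup E, Rp g F := by
  obtain ⟨g, hg, hr⟩ := exists_hol_of_invertible hF.1.analytic hF.1.map_zero hF.1.invertible
  exact ⟨g, ⟨hg, F, hr, hF.2⟩, hr⟩

/-- Elements of `GG` and ordinary germs are both functions modulo equality near 0; the bijection
passes through representatives. -/
lemma card_deckGroup : Nat.card (deckGroup E) = (deckGerms E).ncard := by
  choose f hf using fun g : deckGroup E => exists_rp (g : GG (Dbl e s))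
  refine Nat.card_congr (Equiv.ofBijective
    (fun g : deckGroup E => (⟨((f g : Dbl e s → Dbl e s) : Germ (𝓝 (0 : Dbl e s)) (Dbl e s)), f g, isDeck_of_rp g.2 (hf g), rfl⟩ :
      deckGerms E)) ⟨fun g g' h => ?_, ?_⟩)
  · have h1 : ((f g : Dbl e s → Dbl e s) : Germ (𝓝 (0 : Dbl e s)) (Dbl e s)) =
        (f g' : Dbl e s → Dbl e s) := congrArg Subtype.val h
    exact Subtype.ext ((hf g).ext (hf g') (Germ.coe_eq.1 h1))
  · rintro ⟨_, F, hF, rfl⟩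
    obtain ⟨g, hg, hr⟩ := exists_rp_of_isDeck hF
    exact ⟨⟨g, hg⟩, Subtype.ext (Germ.coe_eq.2 ((hf ⟨g, hg⟩).eventuallyEq hr))⟩

/-- In a finite group every element has finite order, so a deck transformation is determined by its
linear part. -/
lemma eq_one_of_D_eq_one [Finite (deckGroup E)] {g : GG (Dbl e s)} (hg : g ∈ deckGroup E)
    (h : D g = 1) : g = 1 := by
  have h1 : (⟨g, hg⟩ : deckGroup E) ^ Nat.card (deckGroup E) = 1 := pow_card_eq_one'
  exact eq_one_of_pow_eq_one hg.1 h Nat.card_pos.ne' (congrArg Subtype.val h1)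

section LinearPart

variable {γe : Fin e → ℝ} {γs : Fin s → ℂ} {M : Set (Dbl e s)}

lemma quadric_smul (c : ℂ) (x : Dbl e s) : quadric γe γs (c • x) = c ^ 2 • quadric γe γs x := by
  funext j; simp [quadric]; ring

lemma continuous_quadric : Continuous (quadric γe γs) := by
  have h : quadric γe γs = fun x j => ell γe γs j x ^ 2 := by
    funext x j; rw [ell_apply]; rfl
  rw [h]
  exact continuous_pi fun j => ((ell γe γs j).continuous).pow 2

lemma D_fst {g : GG (Dbl e s)} (hg : g ∈ deckGroup E) (v : Dbl e s) : (D g v).1 = v.1 := by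
  obtain ⟨hg, f, hf, h⟩ := hg
  have h1 := (hasFDerivAt_fst (𝕜 := ℂ) (p := f 0)).comp (0 : Dbl e s) (hf.hasFDerivAt hg)
  have h2 : (Prod.fst ∘ f : Dbl e s → Vec e s) =ᶠ[𝓝 0] Prod.fst := by
    filter_upwards [h] with x hx
    have h3 : pi1 E (f x) = pi1 E x := hx
    have h4 := congrArg (fun y : Dbl e s => y.1) h3
    exact h4
  have h3 := h1.unique ((hasFDerivAt_fst (𝕜 := ℂ) (p := (0 : Dbl e s))).congr_of_eventuallyEq h2)
  exact DFunLike.congr_fun h3 v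

/-- The quadric is the lowest-order part of `E`, and `E` is invariant. Along a line the cubic error
disappears after division by t², leaving the invariance of the quadric under the derivative. -/
lemma quadric_D (hM : IsPerturbation γe γs M E) {g : GG (Dbl e s)} (hg : g ∈ deckGroup E)
    (v : Dbl e s) : quadric γe γs (D g v) = quadric γe γs v := by
  obtain ⟨hg, f, hf, h⟩ := hg
  have hd := hf.hasFDerivAt hg
  have hfx : f =O[𝓝 0] fun x => x := by
    simpa [hf.map_zero] using hd.isBigO_sub
  have h1 : (fun x => E (f x) - quadric γe γs (f x)) =O[𝓝 0] fun x => ‖x‖ ^ 3 :=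
    (hM.jet.comp_tendsto hf.tendsto).trans (hfx.norm_norm.pow 3)
  have h2 : (fun x => quadric γe γs (f x) - quadric γe γs x) =O[𝓝 0] fun x : Dbl e s => ‖x‖ ^ 3 := by
    refine (hM.jet.sub h1).congr' ?_ EventuallyEq.rfl
    filter_upwards [h] with x hx
    have : E (f x) = E x := congrArg Prod.snd hx
    simp only [this]
    abel
  have hγ : Tendsto (fun t : ℂ => t • v) (𝓝[≠] 0) (𝓝 0) := by
    have : Continuous fun t : ℂ => t • v := by fun_prop
    have h3 := this.tendsto 0
    rw [zero_smul] at h3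
    exact h3.mono_left nhdsWithin_le_nhds
  have h3 : (fun t : ℂ => quadric γe γs (f (t • v)) - quadric γe γs (t • v)) =O[𝓝[≠] 0]
      fun t : ℂ => t ^ 3 := by
    refine (h2.comp_tendsto hγ).trans (IsBigO.of_bound (‖v‖ ^ 3) (.of_forall fun t => ?_))
    simp only [Function.comp, norm_smul, norm_pow, norm_norm, mul_pow, norm_mul]
    rw [mul_comm]
  have h4 : Tendsto (fun t : ℂ => (t ^ 2)⁻¹ • (quadric γe γs (f (t • v)) - quadric γe γs (t • v)))
      (𝓝[≠] 0) (𝓝 0) := by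
    have h5 : (fun t : ℂ => (t ^ 2)⁻¹ • (quadric γe γs (f (t • v)) - quadric γe γs (t • v)))
        =O[𝓝[≠] 0] fun t : ℂ => t := by
      refine ((isBigO_refl (fun t : ℂ => (t ^ 2)⁻¹) _).smul h3).congr' EventuallyEq.rfl ?_
      filter_upwards [self_mem_nhdsWithin] with t ht
      have : t ≠ 0 := ht
      simp only [smul_eq_mul]
      field_simp
    exact h5.trans_tendsto (tendsto_id.mono_left nhdsWithin_le_nhds)
  have h5 : Tendsto (fun t : ℂ => t⁻¹ • f (t • v)) (𝓝[≠] 0) (𝓝 (D g v)) := by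
    have h6 := hd.hasLineDerivAt v
    have h7 := (hasDerivAt_iff_tendsto_slope_zero.1 h6)
    simpa [hf.map_zero] using h7
  have h6 := ((continuous_quadric (γe := γe) (γs := γs)).tendsto _).comp h5
  have h7 : Tendsto (fun t : ℂ => (t ^ 2)⁻¹ • (quadric γe γs (f (t • v)) - quadric γe γs (t • v)))
      (𝓝[≠] 0) (𝓝 (quadric γe γs (D g v) - quadric γe γs v)) := by
    refine (h6.sub_const (quadric γe γs v)).congr' ?_
    filter_upwards [self_mem_nhdsWithin] with t ht
    have : t ≠ 0 := ht
    rw [smul_sub, Function.comp, quadric_smul, quadric_smul, smul_smul, inv_mul_cancel₀ (pow_ne_zero 2 this),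
      one_smul, inv_pow]
  exact sub_eq_zero.1 (tendsto_nhds_unique h7 h4)

variable (γe γs) in
/-- The linear part of `g` multiplies the linear forms `ell` by the signs `ε`. -/
def HasSigns (g : GG (Dbl e s)) (ε : Idx e s → ℤˣ) : Prop :=
  ∀ j x, ell γe γs j (D g x) = ((ε j : ℤ) : ℂ) * ell γe γs j x

lemma exists_hasSigns (hM : IsPerturbation γe γs M E) {g : GG (Dbl e s)} (hg : g ∈ deckGroup E) :
    ∃ ε, HasSigns γe γs g ε := by
  have h : ∀ j, ∃ ε : ℤˣ, ∀ x, ell γe γs j (D g x) = ((ε : ℤ) : ℂ) * ell γe γs j x := fun j =>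
    exists_sign ((ell γe γs j).comp (D g)) (ell γe γs j) fun x => by
      have := congrFun (quadric_D hM hg x) j
      rw [ContinuousLinearMap.comp_apply, ell_apply, ell_apply]
      exact this
  choose ε hε using h
  exact ⟨ε, hε⟩

lemma HasSigns.mul {g g' : GG (Dbl e s)} {ε ε' : Idx e s → ℤˣ} (hg : g ∈ deckGroup E)
    (hg' : g' ∈ deckGroup E) (h : HasSigns γe γs g ε) (h' : HasSigns γe γs g' ε') :
    HasSigns γe γs (g * g') (ε * ε') := fun j x => by
  rw [D_mul hg.1 hg'.1]
  change ell γe γs j (D g (D g' x)) = _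
  rw [h, h', Pi.mul_apply]
  push_cast
  ring

lemma HasSigns.D_eq (hc : ∀ j, coeff γe γs j ≠ 0) {g : GG (Dbl e s)} {ε : Idx e s → ℤˣ}
    (hg : g ∈ deckGroup E) (h : HasSigns γe γs g ε) {A : Dbl e s →L[ℂ] Dbl e s}
    (hA : ∀ x, (A x).1 = x.1) (hA' : ∀ j x, ell γe γs j (A x) = ((ε j : ℤ) : ℂ) * ell γe γs j x) :
    D g = A := by
  refine ContinuousLinearMap.ext fun x => ?_
  exact eq_of_ell_eq hc (by rw [D_fst hg, hA]) fun j => by rw [h, hA']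

/-- The forms `ell` together with z' are coordinates, and deck transformations fix z', so the signs
give the linear part and the linear part gives the germ. -/
lemma HasSigns.eq [Finite (deckGroup E)] (hc : ∀ j, coeff γe γs j ≠ 0) {g g' : GG (Dbl e s)}
    {ε : Idx e s → ℤˣ} (hg : g ∈ deckGroup E) (hg' : g' ∈ deckGroup E) (h : HasSigns γe γs g ε)
    (h' : HasSigns γe γs g' ε) : g = g' := by
  have h1 : D g = D g' := h.D_eq hc hg (fun x => D_fst hg' x) h'
  have h2 : g⁻¹ * g' = 1 := by
    refine eq_one_of_D_eq_one (mul_mem (inv_mem hg) hg') ?_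
    rw [D_mul (inv_mem hg.1) hg'.1, ← h1, D_inv_mul hg.1]
  exact inv_mul_eq_one.1 h2

lemma hasSigns_one : HasSigns γe γs (1 : GG (Dbl e s)) 1 := fun j x => by
  rw [D_one]; simp

/-- The deck transformations commute. -/
lemma deckGroup_comm [Finite (deckGroup E)] (hc : ∀ j, coeff γe γs j ≠ 0)
    (hM : IsPerturbation γe γs M E) {g g' : GG (Dbl e s)} (hg : g ∈ deckGroup E)
    (hg' : g' ∈ deckGroup E) : g * g' = g' * g := by
  obtain ⟨ε, h⟩ := exists_hasSigns hM hg
  obtain ⟨ε', h'⟩ := exists_hasSigns hM hg'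
  exact (h.mul hg hg' h').eq hc (mul_mem hg hg') (mul_mem hg' hg) (mul_comm ε' ε ▸ h'.mul hg' hg h)

/-- If there are `2^p` deck transformations, all signs occur. -/
lemma exists_of_signs (hc : ∀ j, coeff γe γs j ≠ 0) (hM : IsPerturbation γe γs M E)
    (hcard : Nat.card (deckGroup E) = 2 ^ (e + 2 * s)) [Finite (deckGroup E)] (ε : Idx e s → ℤˣ) :
    ∃ g ∈ deckGroup E, HasSigns γe γs g ε := by
  choose S hS using fun g : deckGroup E => exists_hasSigns hM g.2
  have hinj : Function.Injective S := fun g g' h =>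
    Subtype.ext ((hS g).eq hc g.2 g'.2 (h ▸ hS g'))
  -- An injection from 2^p elements into the 2^p sign vectors is onto.
  have hb := hinj.bijective_of_nat_card_le (by
    rw [hcard, Nat.card_eq_fintype_card]
    simp [Fintype.card_units_int, two_mul])
  obtain ⟨g, hg⟩ := hb.2 ε
  exact ⟨g, g.2, hg ▸ hS g⟩

end LinearPart

end Deck

section Deck

/-! ### The Moser-Webster involutions -/

variable {e s : ℕ} {E : Dbl e s → Vec e s} {γe : Fin e → ℝ} {γs : Fin s → ℂ} {M : Set (Dbl e s)}

lemma isBigO_sub_of_hasFDerivAt {V : Type*} [NormedAddCommGroup V] [NormedSpace ℂ V] {f : V → V}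
    {A : V →L[ℂ] V} (hf : AnalyticAt ℂ f 0) (h0 : f 0 = 0) (h : HasFDerivAt f A 0) :
    (fun x => f x - A x) =O[𝓝 0] fun x => ‖x‖ ^ 2 := by
  obtain ⟨p, hp⟩ := hf
  have h1 := hp.isBigO_sub_partialSum_pow 2
  have h2 : ∀ y : V, p.partialSum 2 y = A y := fun y => by
    rw [FormalMultilinearSeries.partialSum, Finset.sum_range_succ, Finset.sum_range_one,
      hp.coeff_zero, h0, zero_add, ← hp.hasFDerivAt.unique h]
    simp only [continuousMultilinearCurryFin1_apply]
    congr 1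
  simpa only [h2, zero_add] using h1

lemma hasFDerivAt_of_isBigO {V : Type*} [NormedAddCommGroup V] [NormedSpace ℂ V] {f : V → V}
    {A : V →L[ℂ] V} (h0 : f 0 = 0) (h : (fun x => f x - A x) =O[𝓝 0] fun x => ‖x‖ ^ 2) :
    HasFDerivAt f A 0 := by
  rw [hasFDerivAt_iff_isLittleO]
  simp only [h0, sub_zero]
  refine h.trans_isLittleO ?_
  have h1 : (fun x : V => ‖x‖ ^ 2) =o[𝓝 0] fun x : V => ‖x‖ ^ 1 :=
    isLittleO_pow_pow one_lt_two |>.comp_tendsto (tendsto_norm_zero (E := V))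
  exact isLittleO_norm_right.1 (by simpa using h1)

lemma rp_foldr {V ι : Type*} [NormedAddCommGroup V] [NormedSpace ℂ V] {g : ι → GG V} {f : ι → V → V}
    (h : ∀ i, Rp (g i) (f i)) (l : List ι) :
    Rp (l.map g).prod ((l.map f).foldr (fun f g => f ∘ g) id) := by
  induction l with
  | nil => exact Rp.one
  | cons i l ih => exact (h i).mul ih

/-- The signs of the linear part of the `j`-th involution. -/
def tauSigns (j : Idx e s) (k : Idx e s) : ℤˣ := if k = partner j then -1 else 1

/-- Induction on the set of reversed signs: multiplying by t_j removes one of them. -/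
lemma exists_list (hc : ∀ j, coeff γe γs j ≠ 0) [Finite (deckGroup E)]
    (hM : IsPerturbation γe γs M E) {t : Idx e s → GG (Dbl e s)} (ht : ∀ j, t j ∈ deckGroup E)
    (htt : ∀ j, t j * t j = 1) (hS : ∀ j, HasSigns γe γs (t j) (tauSigns j))
    {g : GG (Dbl e s)} (hg : g ∈ deckGroup E) : ∃ l : List (Idx e s), g = (l.map t).prod := by
  suffices h : ∀ (S : Finset (Idx e s)) (g : GG (Dbl e s)), g ∈ deckGroup E →
      HasSigns γe γs g (fun k => if partner k ∈ S then -1 else 1) →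
      ∃ l : List (Idx e s), g = (l.map t).prod by
    obtain ⟨ε, hε⟩ := exists_hasSigns hM hg
    refine h (Finset.univ.filter fun j => ε (partner j) = -1) g hg ?_
    convert hε using 1
    funext k
    simp only [Finset.mem_filter, Finset.mem_univ, true_and, partner_partner]
    rcases Int.units_eq_one_or (ε k) with h1 | h1 <;> simp [h1]
  intro S
  induction S using Finset.induction_on with
  | empty =>
    intro g hg h
    refine ⟨[], ?_⟩
    exact h.eq hc hg (one_mem _) (by simpa using! hasSigns_one)
  | insert j S hj ih =>
    intro g hg h
    obtain ⟨l, hl⟩ := ih (t j * g) (mul_mem (ht j) hg) (by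
      have h1 := (hS j).mul (ht j) hg h
      convert h1 using 1
      funext k
      have h2 : k = partner j ↔ partner k = j :=
        ⟨fun h => by rw [h, partner_partner], fun h => by rw [← h, partner_partner]⟩
      simp only [tauSigns, Pi.mul_apply, Finset.mem_insert, h2]
      by_cases h3 : partner k = j
      · simp [h3, hj]
      · simp [h3])
    exact ⟨j :: l, by rw [List.map_cons, List.prod_cons, ← hl, ← mul_assoc, htt, one_mul]⟩

/-- An involution whose linear part is a reflection fixes a hypersurface. -/
lemma fixesHypersurface_of_D_eq (hc : ∀ j, coeff γe γs j ≠ 0) {g : GG (Dbl e s)} (hg : g ∈ Hol _)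
    (hgg : g * g = 1) {j : Idx e s} (hD : D g = quadricTL γe γs j) {F : Dbl e s → Dbl e s}
    (hF : Rp g F) : FixesHypersurface F := by
  have hT : ∀ x, quadricTL γe γs j (quadricTL γe γs j x) = x := fun x => by
    have h := D_mul hg hg
    rw [hgg, D_one, hD] at h
    exact (DFunLike.congr_fun h x).symm
  obtain ⟨A, -, hA, -⟩ := exists_lin (ContinuousLinearEquiv.equivOfInverse _ _ hT hT)
  obtain ⟨φ, hφ, hDφ, hφg⟩ := exists_linearize hg hgg (T := quadricTL γe γs j) hA hD
  obtain ⟨f, hfa, hf, hfd⟩ := exists_analytic_rp hφ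
  obtain ⟨f', hf'⟩ := exists_rp φ⁻¹
  have hinv := (hf'.mul hf).eventuallyEq (inv_mul_cancel φ ▸ Rp.one)
  have hcomm := (hf.mul hF).eventuallyEq (hφg ▸ hA.mul hf)
  have hd : HasFDerivAt (fun x => ell γe γs (partner j) (f x)) (ell γe γs (partner j)) 0 := by
    have h1 := (ell γe γs (partner j)).hasFDerivAt.comp (0 : Dbl e s) hfd
    rw [hDφ] at h1
    exact h1
  -- In linearizing coordinates the fixed set is the mirror of the reflection, the zero set of the
  -- one form that changes sign.
  refine ⟨fun x => ell γe γs (partner j) (f x), ?_, ?_, ?_⟩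
  · exact analyticAt_comp_zero ((ell γe γs (partner j)).analyticAt 0) hfa hf.map_zero
  · rw [hd.fderiv]
    intro h
    have h1 := DFunLike.congr_fun h ((Pi.single (partner j) 1, 0) : Dbl e s)
    rw [ell_apply] at h1
    simp at h1
  · filter_upwards [hinv, hF.tendsto.eventually hinv, hcomm] with x e1 e2 e3
    have e4 : f (F x) = quadricTL γe γs j (f x) := e3
    have h1 : F x = x ↔ quadricTL γe γs j (f x) = f x := by
      rw [← e4]
      exact ⟨fun h => by rw [h], fun h => by rw [← e2, h, e1]⟩
    rw [h1]
    constructor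
    · intro h
      have h2 := ell_quadricT hc j (partner j) (f x)
      rw [← quadricTL_apply, h, if_pos rfl] at h2
      push_cast at h2
      linear_combination (1 / 2 : ℂ) * h2
    · intro h
      refine eq_of_ell_eq hc rfl fun k => ?_
      rw [quadricTL_apply, ell_quadricT hc]
      split_ifs with hk
      · rw [hk, h, mul_zero]
      · simp

/-- The Moser-Webster involutions exist. -/
theorem exists_isMoserWebster (hc : ∀ j, coeff γe γs j ≠ 0) (hM : IsPerturbation γe γs M E)
    (hcard : (deckGerms E).ncard = 2 ^ (e + 2 * s)) : ∃ τ, IsMoserWebster γe γs E τ := by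
  rw [← card_deckGroup] at hcard
  have : Finite (deckGroup E) := Nat.finite_of_card_ne_zero (by rw [hcard]; positivity)
  choose t ht hS using fun j => exists_of_signs hc hM hcard (tauSigns j)
  have hD : ∀ j, D (t j) = quadricTL γe γs j := fun j =>
    (hS j).D_eq hc (ht j) (fun x => rfl) fun k x => by
      rw [quadricTL_apply, ell_quadricT hc]; rfl
  have htt : ∀ j, t j * t j = 1 := fun j =>
    ((hS j).mul (ht j) (ht j) (hS j)).eq hc (mul_mem (ht j) (ht j)) (one_mem _) (by
      have : tauSigns j * tauSigns j = (1 : Idx e s → ℤˣ) := funext fun k => Int.units_mul_self _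
      rw [this]; exact hasSigns_one)
  choose τ hτa hτ hτd using fun j => exists_analytic_rp (ht j).1
  refine ⟨τ, fun j => isDeck_of_rp (ht j) (hτ j), fun j => ?_, fun j => ?_, fun F hF => ?_,
    fun j => ?_⟩
  · exact ((hτ j).mul (hτ j)).eventuallyEq (htt j ▸ Rp.one)
  · exact fixesHypersurface_of_D_eq hc (ht j).1 (htt j) (hD j) (hτ j)
  · obtain ⟨g, hg, hgF⟩ := exists_rp_of_isDeck hF
    obtain ⟨l, hl⟩ := exists_list hc hM ht htt hS hg
    exact ⟨l, (hl ▸ hgF).eventuallyEq (rp_foldr hτ l)⟩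
  · exact isBigO_sub_of_hasFDerivAt (hτa j) (hτ j).map_zero (hD j ▸ hτd j)

/-- The germs of the Moser-Webster involutions. -/
theorem IsMoserWebster.exists_germs (hc : ∀ j, coeff γe γs j ≠ 0) (hM : IsPerturbation γe γs M E)
    (hcard : (deckGerms E).ncard = 2 ^ (e + 2 * s)) {τ : Idx e s → Dbl e s → Dbl e s}
    (hτ : IsMoserWebster γe γs E τ) : ∃ t : Idx e s → GG (Dbl e s), (∀ j, t j ∈ Hol _) ∧
      (∀ j, Rp (t j) (τ j)) ∧ (∀ j, t j * t j = 1) ∧ (∀ i j, t i * t j = t j * t i) ∧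
      ∀ j, D (t j) = quadricTL γe γs j := by
  rw [← card_deckGroup] at hcard
  have : Finite (deckGroup E) := Nat.finite_of_card_ne_zero (by rw [hcard]; positivity)
  choose t ht hr using fun j => exists_rp_of_isDeck (hτ.deck j)
  refine ⟨t, fun j => (ht j).1, hr, fun j => (hr j).mul_eq_one (hr j) (hτ.involution j),
    fun i j => deckGroup_comm hc hM (ht i) (ht j), fun j => ?_⟩
  rw [(hr j).D_eq]
  exact (hasFDerivAt_of_isBigO (hr j).map_zero (hτ.linear_part j)).fderiv

end Deck

section Coordinates

/-! ### Normalizing linear coordinates -/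

variable {e s : ℕ} {γe : Fin e → ℝ} {γs : Fin s → ℂ}

lemma coeff_ne_zero (hγe : ∀ i, 0 < γe i ∧ γe i < 1 / 2)
    (hγs : ∀ k, (γs k).re < 1 / 2 ∧ 0 ≤ (γs k).im ∧ γs k ≠ 0) (j : Idx e s) :
    coeff γe γs j ≠ 0 := by
  rcases j with i | k | k
  · exact Complex.ofReal_ne_zero.2 (hγe i).1.ne'
  · exact (hγs k).2.2
  · intro h
    have h1 := congrArg Complex.re h
    simp only [coeff, Complex.sub_re, Complex.one_re, Complex.conj_re, Complex.zero_re] at h1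
    linarith [(hγs k).1]

/-- `λ_e` as a real number. -/
def lamE (γ : ℝ) : ℝ := (1 + √(1 - 4 * γ ^ 2)) / (2 * γ)

lemma lamE_spec {γ : ℝ} (h : 0 < γ ∧ γ < 1 / 2) :
    1 < lamE γ ∧ γ * (lamE γ ^ 2 + 1) = lamE γ := by
  have h1 : 0 < 1 - 4 * γ ^ 2 := by nlinarith
  have h2 := Real.sq_sqrt h1.le
  have h3 := Real.sqrt_pos.2 h1
  have hγ := h.1.ne'
  refine ⟨?_, ?_⟩
  · rw [lamE, lt_div_iff₀ (by linarith)]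
    linarith
  · rw [lamE]
    generalize √(1 - 4 * γ ^ 2) = r at h2
    field_simp
    linear_combination h2

lemma lam_inl (i : Fin e) : lam γe γs (.inl i) = (lamE (γe i) : ℂ) := rfl

lemma lam_inr_inr (k : Fin s) :
    lam γe γs (.inr (.inr k)) = (conj (lam γe γs (.inr (.inl k))))⁻¹ := rfl

lemma lam_inr_inl_sq (k : Fin s) : lam γe γs (.inr (.inl k)) ^ 2 = (conj (γs k))⁻¹ - 1 := by
  simp only [lam, one_div]
  exact Complex.cpow_nat_inv_pow _ two_ne_zero

/-- |λ|² is the quotient of |1 - conj γ| by |γ|, and it exceeds 1 exactly when γ is closer to 0 than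
to 1. -/
lemma one_lt_norm_lam_inr_inl {k : Fin s} (h1 : (γs k).re < 1 / 2) (h0 : γs k ≠ 0) :
    1 < ‖lam γe γs (.inr (.inl k))‖ := by
  have hc : conj (γs k) ≠ 0 := by simpa using h0
  have h2 : 1 < ‖lam γe γs (.inr (.inl k))‖ ^ 2 := by
    rw [← norm_pow, lam_inr_inl_sq, show (conj (γs k))⁻¹ - 1 = (1 - conj (γs k)) / conj (γs k) by
      field_simp, norm_div, one_lt_div (norm_pos_iff.2 hc)]
    refine lt_of_pow_lt_pow_left₀ 2 (norm_nonneg _) ?_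
    rw [Complex.sq_norm, Complex.sq_norm, Complex.normSq_apply, Complex.normSq_apply]
    simp only [Complex.sub_re, Complex.sub_im, Complex.one_re, Complex.one_im, Complex.conj_re,
      Complex.conj_im]
    nlinarith
  exact (one_lt_pow_iff_of_nonneg (norm_nonneg _) two_ne_zero).1 h2

lemma norm_lam_ne_one (hγe : ∀ i, 0 < γe i ∧ γe i < 1 / 2)
    (hγs : ∀ k, (γs k).re < 1 / 2 ∧ 0 ≤ (γs k).im ∧ γs k ≠ 0) (j : Idx e s) :
    ‖lam γe γs j‖ ≠ 1 := by
  rcases j with i | k | k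
  · have h := (lamE_spec (hγe i)).1
    rw [lam_inl, Complex.norm_real, Real.norm_of_nonneg (by linarith)]
    exact h.ne'
  · exact (one_lt_norm_lam_inr_inl (hγs k).1 (hγs k).2.2).ne'
  · have h := one_lt_norm_lam_inr_inl (γe := γe) (hγs k).1 (hγs k).2.2
    rw [lam_inr_inr, norm_inv, RCLike.norm_conj]
    exact fun h1 => h.ne' (inv_eq_one.1 h1)

lemma lam_ne_zero (hγe : ∀ i, 0 < γe i ∧ γe i < 1 / 2)
    (hγs : ∀ k, (γs k).re < 1 / 2 ∧ 0 ≤ (γs k).im ∧ γs k ≠ 0) (j : Idx e s) :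
    lam γe γs j ≠ 0 := by
  rcases j with i | k | k
  · have h := (lamE_spec (hγe i)).1
    rw [lam_inl]
    exact_mod_cast (by linarith : (0 : ℝ) < _).ne'
  · have h := one_lt_norm_lam_inr_inl (γe := γe) (hγs k).1 (hγs k).2.2
    exact norm_pos_iff.1 (by linarith)
  · have h := one_lt_norm_lam_inr_inl (γe := γe) (hγs k).1 (hγs k).2.2
    rw [lam_inr_inr]
    refine inv_ne_zero ((map_ne_zero _).2 (norm_pos_iff.1 (by linarith)))

/-- The coefficients of `w_j` in the normalizing coordinates. -/
def normCoeff (γe : Fin e → ℝ) (γs : Fin s → ℂ) : Idx e s → ℂ × ℂ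
  | .inl i => (-Complex.I * lam γe γs (.inl i), -Complex.I)
  | .inr k => (-Complex.I, -Complex.I * (lam γe γs (.inr k))⁻¹)

/-- For w_j = aξ_j + bη_j, the sum of w_j and its image under the normalized involution is (a +
bλ⁻¹)(ξ_j + λη_j). It must equal -c⁻¹ times the partner coordinate i(ξ_j + λη_j). -/
lemma normCoeff_add (hγe : ∀ i, 0 < γe i ∧ γe i < 1 / 2)
    (hγs : ∀ k, (γs k).re < 1 / 2 ∧ 0 ≤ (γs k).im ∧ γs k ≠ 0) (j : Idx e s) :
    (normCoeff γe γs j).1 + (normCoeff γe γs j).2 * (lam γe γs j)⁻¹ =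
      -(Complex.I * (coeff γe γs (partner j))⁻¹) := by
  have hl := lam_ne_zero hγe hγs j
  have hc := coeff_ne_zero hγe hγs (partner j)
  rcases j with i | k | k
  · have h : (γe i : ℂ) * (lam γe γs (.inl i) ^ 2 + 1) = lam γe γs (.inl i) := by
      rw [lam_inl]
      exact_mod_cast (lamE_spec (hγe i)).2
    simp only [normCoeff, partner, coeff] at hl hc ⊢
    field_simp
    linear_combination (-1 : ℂ) * h
  · have h := lam_inr_inl_sq (γe := γe) (γs := γs) k
    have h0 : conj (γs k) ≠ 0 := by simpa using (hγs k).2.2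
    simp only [normCoeff, partner, coeff] at hl hc ⊢
    field_simp
    rw [h]
    field_simp
    ring
  · have h := lam_inr_inl_sq (γe := γe) (γs := γs) k
    have hl' := lam_ne_zero hγe hγs (.inr (.inl k))
    have h0 : conj (γs k) ≠ 0 := by simpa using (hγs k).2.2
    have h2 : conj (lam γe γs (.inr (.inl k))) ^ 2 = (γs k)⁻¹ - 1 := by
      rw [← map_pow, h]; simp
    simp only [normCoeff, partner, coeff, lam_inr_inr] at hc ⊢
    rw [inv_inv]
    have h3 : conj (lam γe γs (.inr (.inl k))) * conj (lam γe γs (.inr (.inl k))) =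
      (γs k)⁻¹ - 1 := by rw [← sq, h2]
    linear_combination (-Complex.I) * h3

/-- This is the determinant of the j-th two-by-two block of the coordinate change; it degenerates
only for λ² = 1. -/
lemma normCoeff_sub_ne_zero (hγe : ∀ i, 0 < γe i ∧ γe i < 1 / 2)
    (hγs : ∀ k, (γs k).re < 1 / 2 ∧ 0 ≤ (γs k).im ∧ γs k ≠ 0) (j : Idx e s) :
    (normCoeff γe γs j).2 - (normCoeff γe γs j).1 * lam γe γs j ≠ 0 := by
  have hl := lam_ne_zero hγe hγs j
  have h1 : lam γe γs j ^ 2 ≠ 1 := fun h => norm_lam_ne_one hγe hγs j (by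
    have h2 : ‖lam γe γs j‖ ^ 2 = 1 := by rw [← norm_pow, h, norm_one]
    exact (pow_eq_one_iff_of_nonneg (norm_nonneg _) two_ne_zero).1 h2)
  rcases j with i | k
  · simp only [normCoeff]
    rw [show -Complex.I - -Complex.I * lam γe γs (.inl i) * lam γe γs (.inl i) =
      Complex.I * (lam γe γs (.inl i) ^ 2 - 1) by ring]
    exact mul_ne_zero Complex.I_ne_zero (sub_ne_zero.2 h1)
  · simp only [normCoeff]
    rw [show -Complex.I * (lam γe γs (.inr k))⁻¹ - -Complex.I * lam γe γs (.inr k) =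
      Complex.I * (lam γe γs (.inr k) ^ 2 - 1) * (lam γe γs (.inr k))⁻¹ by field_simp; ring]
    exact mul_ne_zero (mul_ne_zero Complex.I_ne_zero (sub_ne_zero.2 h1)) (inv_ne_zero hl)

/-- The normalizing linear map. -/
def normMap (γe : Fin e → ℝ) (γs : Fin s → ℂ) : Dbl e s →ₗ[ℂ] Dbl e s where
  -- The z-coordinates are the invariants ξ + λη of the first involutions; reality dictates the
  -- w-coordinates. The factor i produces the minus sign in the formula for T_{1j}.
  toFun x := (fun j => Complex.I * (x.1 (partner j) + lam γe γs (partner j) * x.2 (partner j)),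
    fun j => (normCoeff γe γs j).1 * x.1 j + (normCoeff γe γs j).2 * x.2 j)
  map_add' x y := by
    refine Prod.ext (funext fun j => ?_) (funext fun j => ?_) <;> simp <;> ring
  map_smul' c x := by
    refine Prod.ext (funext fun j => ?_) (funext fun j => ?_) <;> simp <;> ring

lemma normMap_injective (hγe : ∀ i, 0 < γe i ∧ γe i < 1 / 2)
    (hγs : ∀ k, (γs k).re < 1 / 2 ∧ 0 ≤ (γs k).im ∧ γs k ≠ 0) :
    Function.Injective (normMap γe γs) := by
  refine (injective_iff_map_eq_zero _).2 fun x hx => ?_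
  have h1 : ∀ j, x.1 j + lam γe γs j * x.2 j = 0 := fun j => by
    have h := congrFun (congrArg Prod.fst hx) (partner j)
    simp only [normMap, LinearMap.coe_mk, AddHom.coe_mk, partner_partner] at h
    exact (mul_eq_zero.1 h).resolve_left Complex.I_ne_zero
  have h2 : ∀ j, (normCoeff γe γs j).1 * x.1 j + (normCoeff γe γs j).2 * x.2 j = 0 := fun j =>
    congrFun (congrArg Prod.snd hx) j
  have h3 : ∀ j, x.2 j = 0 := fun j => by
    refine (mul_eq_zero.1 ?_).resolve_left (normCoeff_sub_ne_zero hγe hγs j)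
    linear_combination h2 j - (normCoeff γe γs j).1 * h1 j
  have h4 : ∀ j, x.1 j = 0 := fun j => by simpa [h3] using h1 j
  exact Prod.ext (funext h4) (funext h3)

/-- Normalizing coordinates exist. -/
theorem exists_isNormalizing (hγe : ∀ i, 0 < γe i ∧ γe i < 1 / 2)
    (hγs : ∀ k, (γs k).re < 1 / 2 ∧ 0 ≤ (γs k).im ∧ γs k ≠ 0) :
    ∃ L, IsNormalizing γe γs L := by
  refine ⟨(LinearEquiv.ofInjectiveEndo _ (normMap_injective hγe hγs)).toContinuousLinearEquiv,
    fun x => ?_, fun j x => ?_⟩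
  · change normMap γe γs (rho x) = rho0 (normMap γe γs x)
    refine Prod.ext (funext fun j => ?_) (funext fun j => ?_)
    · rcases j with i | k | k <;> simp [normMap, rho, rho0, conjV, partner, normCoeff, lam_inl,
        lam_inr_inr] <;> ring
    · rcases j with i | k | k <;> simp [normMap, rho, rho0, conjV, partner, normCoeff, lam_inl,
        lam_inr_inr] <;> ring
  · change normMap γe γs (tauNF (fun _ => lam γe γs j) j x) = quadricT γe γs j (normMap γe γs x)
    have hl := lam_ne_zero hγe hγs j
    refine Prod.ext (funext fun k => ?_) (funext fun k => ?_)
    · simp only [normMap, tauNF, quadricT, LinearMap.coe_mk, AddHom.coe_mk]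
      rcases eq_or_ne (partner k) j with h | h
      · rw [h, Function.update_self, Function.update_self]
        field_simp
        ring
      · rw [Function.update_of_ne h, Function.update_of_ne h]
    · simp only [normMap, tauNF, quadricT, LinearMap.coe_mk, AddHom.coe_mk]
      rcases eq_or_ne k j with rfl | h
      · rw [Function.update_self, Function.update_self, Function.update_self, partner_partner]
        have h1 := normCoeff_add hγe hγs k
        have h2 : lam γe γs k * (lam γe γs k)⁻¹ = 1 := mul_inv_cancel₀ hl
        linear_combination (x.1 k + lam γe γs k * x.2 k) * h1 -
          (normCoeff γe γs k).2 * x.2 k * h2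
      · rw [Function.update_of_ne h, Function.update_of_ne h, Function.update_of_ne h]

/-- The real structure on the coordinates. -/
def realData (e s : ℕ) : RealData (Idx e s) where
  star := partner
  star_star := partner_partner
  fl := Sum.elim (fun _ => true) fun _ => false
  fl_star j := by rcases j with i | k | k <;> rfl

lemma cj_lam (i : Idx e s) :
    cj ((realData e s).fl i) (lam γe γs ((realData e s).star i)) = (lam γe γs i)⁻¹ := by
  rcases i with i | k | k <;> simp [realData, cj, partner, lam_inl, lam_inr_inr]

end Coordinates

section Transfer

/-! ### Transfer to the coordinates `(ξ, η)` -/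

/-- Conjugation of a germ by a linear isomorphism. -/
lemma exists_transfer {V W : Type*} [NormedAddCommGroup V] [NormedSpace ℂ V]
    [NormedAddCommGroup W] [NormedSpace ℂ W] [CompleteSpace W] (N : W ≃L[ℂ] V) {t : GG V}
    (ht : t ∈ Hol V) {f : V → V} (hf : Rp t f) :
    ∃ a ∈ Hol W, Rp a (fun x => N.symm (f (N x))) ∧ ∀ x, D a x = N.symm (D t (N x)) := by
  obtain ⟨B, hB⟩ := isInvertible_D ht
  have h1 : HasFDerivAt (fun x => N.symm (f (N x)))
      (((N.trans B).trans N.symm : W ≃L[ℂ] W) : W →L[ℂ] W) 0 := by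
    have h2 : HasFDerivAt f (D t) (N 0) := by rw [map_zero]; exact hf.hasFDerivAt ht
    have h3 := N.symm.toContinuousLinearMap.hasFDerivAt.comp (0 : W)
      (h2.comp (0 : W) N.toContinuousLinearMap.hasFDerivAt)
    rw [← hB] at h3
    exact h3
  obtain ⟨a, ha, har, hD⟩ := exists_hol_of_hasFDerivAt (f := fun x => N.symm (f (N x)))
    (analyticAt_comp_zero (N.symm.toContinuousLinearMap.analyticAt 0)
      (analyticAt_comp_zero (hf.analyticAt ht) (N.toContinuousLinearMap.analyticAt 0) (map_zero N))
      (by rw [map_zero, hf.map_zero]))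
    (by rw [map_zero, hf.map_zero, map_zero]) ⟨_, rfl⟩ h1
  refine ⟨a, ha, har, fun x => ?_⟩
  rw [hD, ← hB]
  rfl

variable {e s : ℕ}

/-- `(ξ, η)` as a pair of vectors. -/
def pairE (e s : ℕ) : (Idx e s ⊕ Idx e s → ℂ) ≃L[ℂ] Dbl e s :=
  (LinearEquiv.sumArrowLequivProdArrow (Idx e s) (Idx e s) ℂ ℂ).toContinuousLinearEquiv

lemma pairE_apply (x : Idx e s ⊕ Idx e s → ℂ) :
    pairE e s x = (fun i => x (Sum.inl i), fun i => x (Sum.inr i)) := rfl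

lemma pairE_conjR (x : Idx e s ⊕ Idx e s → ℂ) :
    pairE e s (conjR (realData e s).perm x) = rho (pairE e s x) := by
  refine Prod.ext (funext fun i => ?_) (funext fun i => ?_) <;> rcases i with i | k | k <;> rfl

lemma pairE_tauF (l : Vec e s → ℂ) (i : Idx e s) (x : Idx e s ⊕ Idx e s → ℂ) :
    tauNF l i (pairE e s x) =
      pairE e s (tauF (Sum.inl i) (Sum.inr i) (fun x => l (hm x)) x) := by
  refine Prod.ext (funext fun k => ?_) (funext fun k => ?_)
  · simp only [pairE_apply, tauNF]
    rcases eq_or_ne k i with rfl | h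
    · rw [Function.update_self, tauF_left]; rfl
    · rw [Function.update_of_ne h, tauF_other (by simpa using h) (by simp)]
  · simp only [pairE_apply, tauNF]
    rcases eq_or_ne k i with rfl | h
    · rw [Function.update_self, tauF_right (hpq k)]; rfl
    · rw [Function.update_of_ne h, tauF_other (by simp) (by simpa using h)]

lemma pairE_sF (m : Vec e s → ℂ) (i : Idx e s) (x : Idx e s ⊕ Idx e s → ℂ) :
    sigmaNF m i (pairE e s x) =
      pairE e s (sF (Sum.inl i) (Sum.inr i) (fun x => m (hm x)) x) := by
  refine Prod.ext (funext fun k => ?_) (funext fun k => ?_)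
  · simp only [pairE_apply, sigmaNF, sF, Pi.mul_apply]
    rcases eq_or_ne k i with rfl | h
    · rw [Function.update_self, dv_left]; rfl
    · rw [Function.update_of_ne h, dv_other (by simpa using h) (by simp), one_mul]
  · simp only [pairE_apply, sigmaNF, sF, Pi.mul_apply]
    rcases eq_or_ne k i with rfl | h
    · rw [Function.update_self, dv_right (hpq k)]; rfl
    · rw [Function.update_of_ne h, dv_other (by simp) (by simpa using h), one_mul]

/-- An identity of germs in the coordinates `(ξ, η)` as an identity of maps. -/
lemma comp_eventuallyEq (L : Dbl e s ≃L[ℂ] Dbl e s) {A ψ : GG (Idx e s ⊕ Idx e s → ℂ)}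
    {F G : Dbl e s → Dbl e s} {f g : (Idx e s ⊕ Idx e s → ℂ) → Idx e s ⊕ Idx e s → ℂ}
    (hA : Rp A fun x => ((pairE e s).trans L).symm (F ((pairE e s).trans L x))) (hψ : Rp ψ f)
    (hB : Rp (ψ⁻¹ * A * ψ) g) (hG : ∀ x, G (pairE e s x) = pairE e s (g x)) :
    F ∘ (L ∘ fun y => pairE e s (f ((pairE e s).symm y))) =ᶠ[𝓝 0]
      (L ∘ fun y => pairE e s (f ((pairE e s).symm y))) ∘ G := by
  have h1 : A * ψ = ψ * (ψ⁻¹ * A * ψ) := by group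
  have h2 := (hA.mul hψ).eventuallyEq (h1 ▸ hψ.mul hB)
  have h3 : Tendsto (pairE e s).symm (𝓝 0) (𝓝 0) := by
    simpa using (pairE e s).symm.continuous.tendsto 0
  filter_upwards [h3.eventually h2] with y hy
  have h4 := congrArg ((pairE e s).trans L) hy
  rw [ContinuousLinearEquiv.apply_symm_apply] at h4
  have h5 := hG ((pairE e s).symm y)
  rw [ContinuousLinearEquiv.apply_symm_apply] at h5
  simp only [Function.comp]
  rw [h5, ContinuousLinearEquiv.symm_apply_apply]
  exact h4

/-- The normal form of the Moser-Webster involutions. -/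
theorem exists_moserWebster_normal_form {γe : Fin e → ℝ} {γs : Fin s → ℂ}
    (hγe : ∀ i, 0 < γe i ∧ γe i < 1 / 2)
    (hγs : ∀ k, (γs k).re < 1 / 2 ∧ 0 ≤ (γs k).im ∧ γs k ≠ 0)
    {M : Set (Dbl e s)} {E : Dbl e s → Vec e s} (hM : IsPerturbation γe γs M E)
    (hab : IsAbelianCRSingularity γe γs E) {τ : Idx e s → Dbl e s → Dbl e s}
    (hτ : IsMoserWebster γe γs E τ) {L : Dbl e s ≃L[ℂ] Dbl e s} (hL : IsNormalizing γe γs L) :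
    ∃ (ψ : Dbl e s → Dbl e s) (Λ₁ Λ₂ : Idx e s → Vec e s → ℂ),
      IsBiholo ψ ∧ ψ ∘ rho =ᶠ[𝓝 0] rho ∘ ψ ∧ ∀ i,
        AnalyticAt ℂ (Λ₁ i) 0 ∧ AnalyticAt ℂ (Λ₂ i) 0 ∧ Λ₁ i 0 = lam γe γs i ∧
        (∀ᶠ ζ in 𝓝 0, Λ₁ i ζ * Λ₂ i ζ = 1) ∧
        (∀ᶠ ζ in 𝓝 0, Λ₂ i ζ = cj ((realData e s).fl i) (Λ₁ (partner i) (rhoz ζ))) ∧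
        sigma τ i ∘ (L ∘ ψ) =ᶠ[𝓝 0] (L ∘ ψ) ∘ sigmaNF (fun ζ => Λ₁ i ζ ^ 2) i ∧
        τ i ∘ (L ∘ ψ) =ᶠ[𝓝 0] (L ∘ ψ) ∘ tauNF (Λ₁ i) i ∧
        tau2 τ (partner i) ∘ (L ∘ ψ) =ᶠ[𝓝 0] (L ∘ ψ) ∘ tauNF (Λ₂ i) i := by
  obtain ⟨t, ht, htr, htt, htc, hDt⟩ := hτ.exists_germs (coeff_ne_zero hγe hγs) hM hab.1
  set N := (pairE e s).trans L with hN
  set r := realData e s with hr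
  have hNx : ∀ x, N x = L (pairE e s x) := fun x => rfl
  have hN0 : Tendsto N (𝓝 0) (𝓝 0) := by simpa using N.continuous.tendsto 0
  have hNρ : ∀ x, N (conjR r.perm x) = rho0 (N x) := fun x => by
    rw [hNx, pairE_conjR, hL.1, hNx]
  have hNρ' : ∀ y, N.symm (rho0 y) = conjR r.perm (N.symm y) := fun y => by
    rw [N.symm_apply_eq, hNρ, N.apply_symm_apply]
  choose a ha har hDa using fun i => exists_transfer N (ht i) (htr i)
  obtain ⟨ρ, hρ, hρρ⟩ := exists_conjG r.perm_perm
  have haa : ∀ i j, a i * a j = a j * a i := fun i j => by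
    refine ((har i).mul (har j)).ext ((har j).mul (har i)) ?_
    have h1 := ((htr i).mul (htr j)).eventuallyEq (htc i j ▸ (htr j).mul (htr i))
    filter_upwards [hN0.eventually h1] with x hx
    simp only [N.apply_symm_apply, hx]
  have ha1 : ∀ i, a i * a i = 1 := fun i => by
    refine (har i).mul_eq_one (har i) ?_
    filter_upwards [hN0.eventually (hτ.involution i)] with x hx
    have h1 : τ i (τ i (N x)) = N x := hx
    rw [N.apply_symm_apply, h1, N.symm_apply_apply]
  have hDa' : ∀ i, D (a i) = tauL (Sum.inl i) (Sum.inr i) (lam γe γs i) := fun i => by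
    refine ContinuousLinearMap.ext fun x => ?_
    rw [hDa, hDt, quadricTL_apply, N.symm_apply_eq, hNx, hNx, ← hL.2, pairE_tauF]
    rfl
  have hb : ∀ i, Rp (ρ * a (r.star i) * ρ)
      (fun x => N.symm (tau2 τ (partner i) (N x))) := fun i => by
    refine ((hρ.mul (har (r.star i))).mul hρ).congr (.of_forall fun x => ?_)
    simp only [tau2, Function.comp]
    rw [hNρ', hNρ]
    rfl
  have hs : ∀ i, Rp (a i * (ρ * a (r.star i) * ρ)) (fun x => N.symm (sigma τ i (N x))) := fun i => by
    refine ((har i).mul (hb i)).congr (.of_forall fun x => ?_)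
    simp only [N.apply_symm_apply]
    rfl
  have hcomm : ∀ i j, a i * (ρ * a (r.star i) * ρ) * (a j * (ρ * a (r.star j) * ρ)) =
      a j * (ρ * a (r.star j) * ρ) * (a i * (ρ * a (r.star i) * ρ)) := fun i j => by
    -- Here the commutation of the σ's from the abelian hypothesis enters; that of the τ's came from
    -- the deck group.
    refine ((hs i).mul (hs j)).ext ((hs j).mul (hs i)) ?_
    filter_upwards [hN0.eventually (hab.2 τ hτ i j)] with x hx
    have h1 : sigma τ i (sigma τ j (N x)) = sigma τ j (sigma τ i (N x)) := hx
    simp only [N.apply_symm_apply, h1]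
  obtain ⟨ψ, hψ, hψρ, Λ₁, Λ₂, h⟩ := exists_normal_form r hρ hρρ (lam_ne_zero hγe hγs)
    (norm_lam_ne_one hγe hγs) cj_lam ha haa ha1 hDa' hcomm
  obtain ⟨f, hfa, hf, hfd⟩ := exists_analytic_rp hψ
  obtain ⟨Ψ, hΨ, hΨr, -⟩ := exists_transfer (pairE e s).symm hψ hf
  refine ⟨fun y => pairE e s (f ((pairE e s).symm y)), Λ₁, Λ₂,
    ⟨hΨr.analyticAt hΨ, hΨr.map_zero, ?_⟩, ?_, fun i => ?_⟩
  · have h1 := isInvertible_D hΨ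
    rw [hΨr.D_eq] at h1
    exact h1
  · have h1 := (hf.mul hρ).eventuallyEq (hψρ ▸ hρ.mul hf)
    have h3 : Tendsto (pairE e s).symm (𝓝 0) (𝓝 0) := by
      simpa using (pairE e s).symm.continuous.tendsto 0
    filter_upwards [h3.eventually h1] with y hy
    simp only [Function.comp]
    rw [← pairE_conjR, ← hy]
    congr 2
    rw [ContinuousLinearEquiv.symm_apply_eq, pairE_conjR, ContinuousLinearEquiv.apply_symm_apply]
  · obtain ⟨h1, h2, h3, h4, h5, h6, h7, h8⟩ := h i
    refine ⟨h1, h2, h3, h4, h5, ?_, ?_, ?_⟩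
    · exact comp_eventuallyEq L (hs i) hf h8 (pairE_sF _ i)
    · exact comp_eventuallyEq L (har i) hf h6 (pairE_tauF _ i)
    · exact comp_eventuallyEq L (hb i) hf h7 (pairE_tauF _ i)

end Transfer

end AbelianCR
end

/-! ### The main theorem -/

theorem mainTheorem2 (e s : ℕ) (γe : Fin e → ℝ) (γs : Fin s → ℂ)
    (hγe : ∀ i, 0 < γe i ∧ γe i < 1 / 2)
    (hγs : ∀ k, (γs k).re < 1 / 2 ∧ 0 ≤ (γs k).im ∧ γs k ≠ 0)
    (M : Set (Dbl e s)) (E : Dbl e s → Vec e s)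
    (hM : IsPerturbation γe γs M E)
    (hab : IsAbelianCRSingularity γe γs E) :
    (∃ τ, IsMoserWebster γe γs E τ) ∧
    (∃ L, IsNormalizing γe γs L) ∧
    ∀ τ, IsMoserWebster γe γs E τ → ∀ L, IsNormalizing γe γs L →
      ∃ (ψ : Dbl e s → Dbl e s) (m Λ₁ Λ₂ : Idx e s → Vec e s → ℂ),
        IsBiholo ψ ∧
        ψ ∘ rho =ᶠ[𝓝 0] rho ∘ ψ ∧
        (∀ i, AnalyticAt ℂ (m i) 0 ∧ AnalyticAt ℂ (Λ₁ i) 0 ∧ AnalyticAt ℂ (Λ₂ i) 0) ∧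
        (∀ i, m i 0 = lam γe γs i ^ 2 ∧ Λ₁ i 0 = lam γe γs i) ∧
        (∀ i, sigma τ i ∘ (L ∘ ψ) =ᶠ[𝓝 0] (L ∘ ψ) ∘ sigmaNF (m i) i) ∧
        (∀ i, τ i ∘ (L ∘ ψ) =ᶠ[𝓝 0] (L ∘ ψ) ∘ tauNF (Λ₁ i) i) ∧
        (∀ i, tau2 τ (partner i) ∘ (L ∘ ψ) =ᶠ[𝓝 0] (L ∘ ψ) ∘ tauNF (Λ₂ i) i) ∧
        (∀ i, ∀ᶠ ζ in 𝓝 0, Λ₂ i ζ = (Λ₁ i ζ)⁻¹) ∧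
        (∀ i : Fin e, ∀ᶠ ζ in 𝓝 0, Λ₁ (.inl i) ζ = conj (Λ₁ (.inl i) (rhoz ζ))) ∧
        (∀ k : Fin s, ∀ᶠ ζ in 𝓝 0,
          (Λ₁ (.inr (.inl k)) ζ)⁻¹ = conj (Λ₁ (.inr (.inr k)) (rhoz ζ))) := by
  refine ⟨exists_isMoserWebster (coeff_ne_zero hγe hγs) hM hab.1, exists_isNormalizing hγe hγs,
    fun τ hτ L hL => ?_⟩
  obtain ⟨ψ, Λ₁, Λ₂, hψ, hψρ, h⟩ := exists_moserWebster_normal_form hγe hγs hM hab hτ hL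
  have hinv : ∀ i, ∀ᶠ ζ in 𝓝 0, Λ₂ i ζ = (Λ₁ i ζ)⁻¹ := fun i => by
    filter_upwards [(h i).2.2.2.1] with ζ hζ
    exact eq_inv_of_mul_eq_one_right hζ
  refine ⟨ψ, fun i ζ => Λ₁ i ζ ^ 2, Λ₁, Λ₂, hψ, hψρ,
    fun i => ⟨(h i).1.pow 2, (h i).1, (h i).2.1⟩, fun i => ?_, fun i => (h i).2.2.2.2.2.1,
    fun i => (h i).2.2.2.2.2.2.1, fun i => (h i).2.2.2.2.2.2.2, hinv, fun i => ?_, fun k => ?_⟩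
  · have h3 := (h i).2.2.1
    exact ⟨by simp only [h3], h3⟩
  -- For an elliptic index `cj` includes an inversion, since ρ exchanges ξ and η, and both sides are
  -- inverted; for the complex type it is plain conjugation, so the inverse stays on one side.
  · filter_upwards [hinv (.inl i), (h (.inl i)).2.2.2.2.1] with ζ h1 h2
    rw [h1] at h2
    exact inv_injective h2
  · filter_upwards [hinv (.inr (.inl k)), (h (.inr (.inl k))).2.2.2.2.1] with ζ h1 h2
    rw [h1] at h2
    exact h2
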